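/- **Setting.** All vector spaces are $\mathbb Z/2$-graded vector spaces (superspaces) over $\mathbb C$, and the Koszul sign rule is used throughout. For a finite-dimensional superspace $V$ let $\widehat T(V)=\prod_{k\ge 0}V^{\otimes k}$, with the topology given by the powers of the ideal of elements with zero constant term. Let $\widehat\Omega(V)$ be the completed free algebra on the symbols $v, dv$ ($v\in V$, with $dv$ linear in $v$ and of parity opposite to that of $v$), with differential $v\mapsto dv\mapsto 0$, and let $\widehat{DR}^\bullet(V)$ be the quotient of $\widehat\Omega(V)$ by the closure of the span of supercommutators, graded by the number of factors $dv$. A vector field is a continuous superderivation $\xi$ of $\widehat T(V)$; it acts on $\widehat{DR}^\bullet(V)$ by the contraction $i_\xi$ ($v\mapsto 0$, $dv\mapsto \xi(v)$) and the Lie derivative $L_\xi$ ($v\mapsto\xi(v)$, $dv\mapsto(-1)^{|\xi|}d\xi(v)$). An even continuous algebra homomorphism $\phi$ induces a map $\phi^*$ of de Rham complexes. An (even) symplectic form is an even closed 2-form $\omega\in\widehat{DR}^2(V)$ such that $\xi\mapsto i_\xi\omega$ is a bijection from vector fields onto $\widehat{DR}^1(V)$; it has order zero if it is a combination of terms $dv\,dw$,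 $v,w\in V$. A *minimal symplectic $A_\infty$-algebra with even symplectic form* $A=(U,m,\omega)$ consists of a finite-dimensional superspace $U$, an even symplectic form $\omega\in\widehat{DR}^2(\Pi U^*)$ and an odd vector field $m$ on $\widehat T(\Pi U^*)$ such that $m^2=0$, $L_m\omega=0$, and $m(v)$ has zero constant and zero linear term for each $v\in\Pi U^*$. A morphism from $(U,m,\omega)$ to $(W,m',\omega')$ is an even continuous algebra homomorphism $\phi:\widehat T(\Pi W^*)\to\widehat T(\Pi U^*)$ with $\phi m'=m\phi$ and $\phi^*\omega'=\omega$; isomorphisms are the invertible morphisms. The class of these objects is $\mathcal{SA}_\infty$; those with $\omega$ of order zero form $\mathcal{SA}^0_\infty$. The Hamiltonian of $A$ is the 0-form $h\in\widehat{DR}^0(\Pi U^*)$ without constant term such that $dh=i_m\omega$. **The complex.** Let $\mathbb C^{2n|m}$ have even coordinates $p_i,q_i$ $(1\le i\le n)$ and odd coordinates $x_i$ $(1\le i\le m)$, with the form $\langle p_i,q_i\rangle=1=-\langle q_i,p_i\rangle$, $\langle x_i,x_i\rangle=1$ (all other pairs of coordinates being $0$), and the symplectic form $\omega_{\rm std}=\sum_i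 dp_i\,dq_i+\frac12\sum_i dx_i\,dx_i$. Cyclic words ($\mathbb Z/k$-coinvariants of $k$-fold tensors) in these coordinates form a Lie superalgebra under $$\{a_1\cdots a_k,\,b_1\cdots b_l\}=\sum_{i,j}\pm\langle a_i,b_j\rangle\,(a_{i+1}\cdots a_k a_1\cdots a_{i-1})(b_{j+1}\cdots b_l b_1\cdots b_{j-1}),$$ where $\pm$ is the product of the Koszul signs of the rotations $a_1\cdots a_k\mapsto a_i\cdots a_ka_1\cdots a_{i-1}$ and $b_1\cdots b_l\mapsto b_j\cdots b_lb_1\cdots b_{j-1}$ and of the sign $(-1)^{|a_i|\sum_{r\ne i}|a_r|}$ for moving $a_i$ next to $b_j$. The words of length $2$ form $\mathfrak{osp}_{2n|m}$, which acts on the Lie superalgebra $\tilde{\mathfrak g}_{2n|m}$ of the words of length $\ge 3$; let $\mathfrak g_{2n|m}=\mathfrak{osp}_{2n|m}\ltimes\tilde{\mathfrak g}_{2n|m}$. The relative Chevalley–Eilenberg complex $C(\mathfrak g_{2n|m},\mathfrak{osp}_{2n|m})$ is the space of $\mathfrak{osp}_{2n|m}$-coinvariants of the exterior algebra $\Lambda(\tilde{\mathfrak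 g}_{2n|m})$ with the Chevalley–Eilenberg differential $d$, and $C(\mathfrak g,\mathfrak{osp})=\varinjlim_{n,m}C(\mathfrak g_{2n|m},\mathfrak{osp}_{2n|m})$. Let $C_{ij}(\mathfrak g,\mathfrak{osp})$ be spanned by the products of $i$ words of total length $2j$ (products of odd total length are zero), so that $d:C_{i+1,j+1}\to C_{ij}$. Let $\widehat C(\mathfrak g,\mathfrak{osp})=\prod_{i,j\ge0}C_{ij}(\mathfrak g,\mathfrak{osp})$, with the induced differential, and let $H(\mathfrak g,\mathfrak{osp})$ denote its homology. For $A$ in $\mathcal{SA}^0_\infty$ choose an even linear isomorphism $\phi:\Pi U^*\to\mathbb C^{2n|m}$ with $\phi^*\omega=\omega_{\rm std}$, let $h'=\phi^*(h)$ be the image of the Hamiltonian, which has only terms of order $\ge 3$, and put $$c_A=\exp(h')=\sum_{i\ge 0}\frac1{i!}\,\underbrace{h'\wedge\dots\wedge h'}_{i}\in\widehat C(\mathfrak g,\mathfrak{osp}).$$ **Theorem 6.8.** For each $A$ in $\mathcal{SA}^0_\infty$ the chain $c_A$ is well defined (it exists and does not depend on $\phi$), and it is a cycle: $d\,c_A=0$.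 If $A,B$ in $\mathcal{SA}^0_\infty$ are isomorphic, then $c_A$ and $c_B$ are homologous in $\widehat C(\mathfrak g,\mathfrak{osp})$. Moreover there is exactly one map $$c:\mathcal{SA}_\infty/\!\cong\;\longrightarrow\;H(\mathfrak g,\mathfrak{osp})$$ from the isomorphism classes of all minimal symplectic $A_\infty$-algebras with even symplectic form (of any order) such that $c([A])$ is the homology class of $c_A$ for every $A$ in $\mathcal{SA}^0_\infty$. -/

import Mathlib

universe u
noncomputable section
namespace SympAInf

/-- The sign `(-1)^p`. -/
def sg (p : ZMod 2) : ℂ := (-1) ^ p.val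

lemma sg_zero : sg 0 = 1 := by simp [sg]

lemma sg_one : sg 1 = -1 := by simp [sg, ZMod.val_one]

lemma sg_add (p q : ZMod 2) : sg (p + q) = sg p * sg q := by
  have h : ∀ a : ZMod 2, a = 0 ∨ a = 1 := by decide
  rcases h p with rfl | rfl <;> rcases h q with rfl | rfl <;>
    simp [sg_zero, sg_one, CharTwo.add_self_eq_zero]

lemma sg_sq (p : ZMod 2) : sg p * sg p = 1 := by
  rw [← sg_add, CharTwo.add_self_eq_zero, sg_zero]

/-- The free associative algebra on `α`; its basis consists of the words (lists) in `α`. -/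
abbrev FA (α : Type) : Type := MonoidAlgebra ℂ (FreeMonoid α)

section Words

variable {α : Type} {M : Type*} [AddCommGroup M] [Module ℂ M]

/-- The basis element of the free algebra given by a word. -/
def wd (l : List α) : FA α := MonoidAlgebra.single (FreeMonoid.ofList l) 1

/-- The linear map defined on the basis of words. -/
def linExt (f : List α → M) : FA α →ₗ[ℂ] M where
  toFun x := x.coeff.sum fun l c => c • f (FreeMonoid.toList l)
  map_add' x y := by
    rw [MonoidAlgebra.coeff_add, Finsupp.sum_add_index'] <;> simp [add_smul]
  map_smul' c x := by
    rw [MonoidAlgebra.coeff_smul, Finsupp.sum_smul_index'] <;> simp [Finsupp.smul_sum, mul_smul]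

@[simp] lemma linExt_wd (f : List α → M) (l : List α) : linExt f (wd l) = f l := by
  simp [linExt, wd]

lemma wd_nil : (wd [] : FA α) = 1 := rfl

lemma wd_mul (l l' : List α) : wd l * wd l' = wd (l ++ l') := by
  simp [wd]

lemma wd_cons (a : α) (l : List α) : wd (a :: l) = wd [a] * wd l := by
  rw [wd_mul]; rfl

lemma span_wd : Submodule.span ℂ (Set.range (wd : List α → FA α)) = ⊤ := by
  refine top_unique fun x _ => ?_
  induction x using MonoidAlgebra.induction_linear with
  | zero => exact zero_mem _
  | add x y hx hy => exact add_mem (hx trivial) (hy trivial)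
  | single m r =>
    have : MonoidAlgebra.single m r = r • wd (FreeMonoid.toList m) := by simp [wd]
    rw [this]
    exact Submodule.smul_mem _ _ (Submodule.subset_span ⟨_, rfl⟩)

lemma fa_ext {f g : FA α →ₗ[ℂ] M} (h : ∀ l, f (wd l) = g (wd l)) : f = g :=
  LinearMap.ext_on_range span_wd h

lemma fa_induction {P : FA α → Prop} (x : FA α) (h0 : P 0) (hw : ∀ l, P (wd l))
    (ha : ∀ x y, P x → P y → P (x + y)) (hs : ∀ (c : ℂ) x, P x → P (c • x)) : P x := by
  have hx : x ∈ Submodule.span ℂ (Set.range (wd : List α → FA α)) := by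
    rw [span_wd]; trivial
  induction hx using Submodule.span_induction with
  | mem x hx => obtain ⟨l, rfl⟩ := hx; exact hw l
  | zero => exact h0
  | add x y _ _ hx hy => exact ha x y hx hy
  | smul c x _ hx => exact hs c x hx

/-- Parity of a word: the sum of the parities of its letters. -/
def lpar (par : α → ZMod 2) (l : List α) : ZMod 2 := (l.map par).sum

@[simp] lemma lpar_nil (par : α → ZMod 2) : lpar par [] = 0 := rfl
@[simp] lemma lpar_cons (par : α → ZMod 2) (a : α) (l : List α) :
    lpar par (a :: l) = par a + lpar par l := by simp [lpar]
@[simp] lemma lpar_append (par : α → ZMod 2) (l l' : List α) :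
    lpar par (l ++ l') = lpar par l + lpar par l' := by simp [lpar]

/-- The elements of parity `p`. -/
def hom (par : α → ZMod 2) (p : ZMod 2) : Submodule ℂ (FA α) :=
  Submodule.span ℂ (wd '' {l | lpar par l = p})

lemma wd_mem_hom (par : α → ZMod 2) (l : List α) : wd l ∈ hom par (lpar par l) :=
  Submodule.subset_span ⟨l, rfl, rfl⟩

lemma hom_mul {par : α → ZMod 2} {p q : ZMod 2} {x y : FA α} (hx : x ∈ hom par p)
    (hy : y ∈ hom par q) : x * y ∈ hom par (p + q) := by
  induction hx using Submodule.span_induction with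
  | mem x hx =>
    obtain ⟨l, hl, rfl⟩ := hx
    induction hy using Submodule.span_induction with
    | mem y hy =>
      obtain ⟨l', hl', rfl⟩ := hy
      rw [wd_mul, ← show lpar par l = p from hl, ← show lpar par l' = q from hl', ← lpar_append]
      exact wd_mem_hom _ _
    | zero => rw [mul_zero]; exact zero_mem _
    | add x y _ _ hx hy => rw [mul_add]; exact add_mem hx hy
    | smul c x _ hx => rw [mul_smul_comm]; exact Submodule.smul_mem _ _ hx
  | zero => rw [zero_mul]; exact zero_mem _
  | add x y _ _ hx hy => rw [add_mul]; exact add_mem hx hy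
  | smul c x _ hx => rw [smul_mul_assoc]; exact Submodule.smul_mem _ _ hx

/-- Values on words of the superderivation of parity `e` with values `δ a` on the letters. -/
def sder (par : α → ZMod 2) (e : ZMod 2) (δ : α → FA α) : List α → FA α
  | [] => 0
  | a :: l => δ a * wd l + sg (e * par a) • (wd [a] * sder par e δ l)

lemma sder_append (par : α → ZMod 2) (e : ZMod 2) (δ : α → FA α) (l l' : List α) :
    sder par e δ (l ++ l') =
      sder par e δ l * wd l' + sg (e * lpar par l) • (wd l * sder par e δ l') := by
  induction l with
  | nil => simp [sder, sg_zero, wd_nil]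
  | cons a l ih =>
    simp only [List.cons_append, sder, ih, lpar_cons, mul_add, sg_add, add_mul, smul_add,
      mul_smul_comm, smul_mul_assoc, smul_smul, wd_cons a l, ← wd_mul l l', mul_assoc]
    abel

lemma sder_smul (par : α → ZMod 2) (e : ZMod 2) (δ : α → FA α) (c : ℂ) (l : List α) :
    sder par e (fun a => c • δ a) l = c • sder par e δ l := by
  induction l with
  | nil => simp [sder]
  | cons a l ih =>
    simp only [sder, ih, smul_add, smul_mul_assoc, mul_smul_comm, smul_comm c]

/-- The superderivation of parity `e` of the free algebra with values `δ a` on the letters. -/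
def sderL (par : α → ZMod 2) (e : ZMod 2) (δ : α → FA α) : FA α →ₗ[ℂ] FA α :=
  linExt (sder par e δ)

lemma sderL_mul {par : α → ZMod 2} (e : ZMod 2) (δ : α → FA α) {p : ZMod 2} {x : FA α}
    (hx : x ∈ hom par p) (y : FA α) :
    sderL par e δ (x * y) = sderL par e δ x * y + sg (e * p) • (x * sderL par e δ y) := by
  induction hx using Submodule.span_induction with
  | mem x hx =>
    obtain ⟨l, rfl, rfl⟩ := hx
    induction y using fa_induction with
    | h0 => simp
    | hw l' => rw [wd_mul]; simp only [sderL, linExt_wd, sder_append]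
    | ha x y hx hy => simp only [mul_add, map_add, hx, hy, smul_add]; abel
    | hs c x hx => simp only [mul_smul_comm, map_smul, hx, smul_add, smul_comm c]
  | zero => simp
  | add x y _ _ hx hy => simp only [add_mul, map_add, hx, hy, smul_add]; abel
  | smul c x _ hx => simp only [smul_mul_assoc, map_smul, hx, smul_add, smul_comm c]

lemma sderL_single (par : α → ZMod 2) (e : ZMod 2) (δ : α → FA α) (a : α) :
    sderL par e δ (wd [a]) = δ a := by
  simp [sderL, sder, wd_nil]

lemma sderL_hom {par : α → ZMod 2} {e : ZMod 2} {δ : α → FA α}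
    (hδ : ∀ a, δ a ∈ hom par (e + par a)) {p : ZMod 2} {x : FA α} (hx : x ∈ hom par p) :
    sderL par e δ x ∈ hom par (e + p) := by
  induction hx using Submodule.span_induction with
  | mem x hx =>
    obtain ⟨l, rfl, rfl⟩ := hx
    simp only [sderL, linExt_wd]
    induction l with
    | nil => exact zero_mem _
    | cons a l ih =>
      simp only [sder, lpar_cons]
      refine add_mem ?_ (Submodule.smul_mem _ _ ?_)
      · rw [← add_assoc]; exact hom_mul (hδ a) (wd_mem_hom _ _)
      · rw [show e + (par a + lpar par l) = (lpar par [a]) + (e + lpar par l) by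
          rw [lpar_cons, lpar_nil]; ring]
        exact hom_mul (wd_mem_hom _ _) ih
  | zero => rw [map_zero]; exact zero_mem _
  | add x y _ _ hx hy => rw [map_add]; exact add_mem hx hy
  | smul c x _ hx => rw [map_smul]; exact Submodule.smul_mem _ _ hx

/-- The cyclic rotation `a₁a₂…aₖ ↦ ± a₂…aₖa₁` with its Koszul sign: the action of the generator of the
cyclic group on tensors. -/
def rot (par : α → ZMod 2) : List α → FA α
  | [] => 1
  | a :: l => sg (par a * lpar par l) • wd (l ++ [a])

/-- Linear extension of `rot`. -/
def rotL (par : α → ZMod 2) : FA α →ₗ[ℂ] FA α := linExt (rot par)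

lemma rotL_pow (par : α → ZMod 2) (l l' : List α) :
    (rotL par ^ l.length) (wd (l ++ l')) = sg (lpar par l * lpar par l') • wd (l' ++ l) := by
  induction l generalizing l' with
  | nil => simp [sg_zero]
  | cons a l ih =>
    rw [List.length_cons, pow_succ, Module.End.mul_apply]
    simp only [rotL, List.cons_append, linExt_wd, rot, map_smul] at ih ⊢
    rw [List.append_assoc, ih, smul_smul, ← sg_add]
    congr 1
    · congr 1
      simp only [lpar_append, lpar_cons, lpar_nil]
      generalize par a = x; generalize lpar par l = y; generalize lpar par l' = z
      clear * -
      revert x y z; decide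
    · simp

lemma rotL_hom {par : α → ZMod 2} {p : ZMod 2} {x : FA α} (hx : x ∈ hom par p) :
    rotL par x ∈ hom par p := by
  induction hx using Submodule.span_induction with
  | mem x hx =>
    obtain ⟨l, rfl, rfl⟩ := hx
    simp only [rotL, linExt_wd]
    cases l with
    | nil => exact wd_mem_hom par []
    | cons a l =>
      refine Submodule.smul_mem _ _ ?_
      convert wd_mem_hom par (l ++ [a]) using 1
      simp [add_comm]
  | zero => rw [map_zero]; exact zero_mem _
  | add x y _ _ hx hy => rw [map_add]; exact add_mem hx hy
  | smul c x _ hx => rw [map_smul]; exact Submodule.smul_mem _ _ hx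

/-- The norm operator `∑ z^i` of the cyclic group, applied to a word: the sum of all rotations of the
word, with Koszul signs. -/
def cycN (par : α → ZMod 2) (l : List α) : FA α :=
  ∑ i ∈ Finset.range l.length, (rotL par ^ i) (wd l)

/-- Linear extension of `cycN`. -/
def cycNL (par : α → ZMod 2) : FA α →ₗ[ℂ] FA α := linExt (cycN par)

/-- The span of the words of length `k`. -/
def lenSub (k : ℕ) : Submodule ℂ (FA α) := Submodule.span ℂ (wd '' {l | l.length = k})

lemma cycNL_of_len (par : α → ZMod 2) {k : ℕ} {x : FA α} (hx : x ∈ lenSub k) :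
    cycNL par x = ∑ i ∈ Finset.range k, (rotL par ^ i) x := by
  induction hx using Submodule.span_induction with
  | mem x hx =>
    obtain ⟨l, rfl, rfl⟩ := hx
    simp [cycNL, cycN]
  | zero => simp
  | add x y _ _ hx hy => simp only [map_add, hx, hy, Finset.sum_add_distrib]
  | smul c x _ hx => simp only [map_smul, hx, Finset.smul_sum]

lemma rot_len (par : α → ZMod 2) (l : List α) : rot par l ∈ lenSub l.length := by
  cases l with
  | nil => exact Submodule.subset_span ⟨[], rfl, rfl⟩
  | cons a l => exact Submodule.smul_mem _ _ (Submodule.subset_span ⟨l ++ [a], by simp, rfl⟩)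

lemma cycNL_rot (par : α → ZMod 2) (l : List α) : cycNL par (rot par l) = cycN par l := by
  rw [cycNL_of_len par (rot_len par l), cycN]
  have h1 : rot par l = rotL par (wd l) := by simp [rotL]
  have h2 : ∀ i, (rotL par ^ i) (rot par l) = (rotL par ^ (i + 1)) (wd l) := by
    intro i; rw [h1, pow_succ, Module.End.mul_apply]
  simp only [h2]
  have h3 := Finset.sum_range_succ (fun i => (rotL par ^ i) (wd l)) l.length
  have h4 := Finset.sum_range_succ' (fun i => (rotL par ^ i) (wd l)) l.length
  have h5 := rotL_pow par l []
  simp only [List.append_nil, lpar_nil, mul_zero, sg_zero, one_smul, List.nil_append] at h5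
  rw [h3, h5] at h4
  simp only [pow_zero, Module.End.one_apply] at h4
  exact (add_right_cancel h4).symm

lemma cycN_hom (par : α → ZMod 2) (l : List α) : cycN par l ∈ hom par (lpar par l) := by
  refine Submodule.sum_mem _ fun i hi => ?_
  clear hi
  induction i with
  | zero => exact wd_mem_hom _ _
  | succ i ih => rw [pow_succ', Module.End.mul_apply]; exact rotL_hom ih

/-- A superderivation commutes with cyclic rotation -/
lemma sderL_rot {par : α → ZMod 2} {e : ZMod 2} {δ : α → FA α}
    (hδ : ∀ a, δ a ∈ Submodule.span ℂ ((fun b => wd [b]) '' {b | par b = e + par a})) (x : FA α) :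
    sderL par e δ (rotL par x) = rotL par (sderL par e δ x) := by
  suffices h : (sderL par e δ) ∘ₗ (rotL par) = rotL par ∘ₗ sderL par e δ from
    LinearMap.congr_fun h x
  have key : ∀ a, ∀ y ∈ Submodule.span ℂ ((fun b : α => wd [b]) '' {b | par b = e + par a}),
      ∀ l, rotL par (y * wd l) = sg ((e + par a) * lpar par l) • (wd l * y) := by
    intro a y hy l
    induction hy using Submodule.span_induction with
    | mem y hy =>
      obtain ⟨b, hb, rfl⟩ := hy
      rw [wd_mul, wd_mul]
      simp only [rotL, linExt_wd, List.cons_append, List.nil_append, rot]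
      rw [show par b = e + par a from hb]
    | zero => simp
    | add x y _ _ hx hy => simp only [add_mul, mul_add, map_add, hx, hy, smul_add]
    | smul c x _ hx => simp only [smul_mul_assoc, mul_smul_comm, map_smul, hx, smul_comm c]
  have key2 : ∀ a (p : ZMod 2) (y : FA α), y ∈ hom par p →
      rotL par (wd [a] * y) = sg (par a * p) • (y * wd [a]) := by
    intro a p y hy
    induction hy using Submodule.span_induction with
    | mem y hy =>
      obtain ⟨l, rfl, rfl⟩ := hy
      rw [wd_mul, wd_mul]
      simp only [rotL, linExt_wd, List.cons_append, List.nil_append, rot]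
    | zero => simp
    | add x y _ _ hx hy => simp only [add_mul, mul_add, map_add, hx, hy, smul_add]
    | smul c x _ hx => simp only [smul_mul_assoc, mul_smul_comm, map_smul, hx, smul_comm c]
  have hδ' : ∀ a, δ a ∈ hom par (e + par a) := by
    intro a
    refine Submodule.span_mono ?_ (hδ a)
    rintro _ ⟨b, hb, rfl⟩
    exact ⟨[b], by simpa using hb, rfl⟩
  refine fa_ext fun l => ?_
  simp only [LinearMap.comp_apply]
  cases l with
  | nil => simp [rotL, rot, ← wd_nil, sderL, sder]
  | cons a l =>
    have h1 : sder par e δ l ∈ hom par (e + lpar par l) := by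
      simpa [sderL] using sderL_hom hδ' (wd_mem_hom par l)
    have h2 : sderL par e δ (wd (a :: l)) =
        δ a * wd l + sg (e * par a) • (wd [a] * sder par e δ l) := by
      simp [sderL, sder]
    rw [h2, map_add, map_smul, key a _ (hδ a), key2 a _ _ h1]
    have h3 : rotL par (wd (a :: l)) = sg (par a * lpar par l) • wd (l ++ [a]) := by
      simp [rotL, rot]
    rw [h3, map_smul, ← wd_mul, sderL_mul e δ (wd_mem_hom par l), sderL_single]
    simp only [smul_add, smul_smul, sderL, linExt_wd, ← sg_add]
    rw [add_comm]
    congr 2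
    · congr 1; ring
    · congr 1
      generalize par a = x; generalize lpar par l = y
      clear * -
      revert e x y; decide

lemma sderL_cycN {par : α → ZMod 2} {e : ZMod 2} {δ : α → FA α}
    (hδ : ∀ a, δ a ∈ Submodule.span ℂ ((fun b => wd [b]) '' {b | par b = e + par a}))
    (l : List α) :
    sderL par e δ (cycN par l) = cycNL par (sder par e δ l) := by
  have hlen : sder par e δ l ∈ lenSub l.length := by
    have hm : ∀ (j k : ℕ) (x y : FA α), x ∈ lenSub j → y ∈ lenSub k → x * y ∈ lenSub (j + k) := by
      intro j k x y hx hy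
      induction hx using Submodule.span_induction with
      | mem x hx =>
        obtain ⟨l, rfl, rfl⟩ := hx
        induction hy using Submodule.span_induction with
        | mem y hy =>
          obtain ⟨l', rfl, rfl⟩ := hy
          rw [wd_mul]; exact Submodule.subset_span ⟨_, by simp, rfl⟩
        | zero => rw [mul_zero]; exact zero_mem _
        | add x y _ _ hx hy => rw [mul_add]; exact add_mem hx hy
        | smul c x _ hx => rw [mul_smul_comm]; exact Submodule.smul_mem _ _ hx
      | zero => rw [zero_mul]; exact zero_mem _
      | add x y _ _ hx hy => rw [add_mul]; exact add_mem hx hy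
      | smul c x _ hx => rw [smul_mul_assoc]; exact Submodule.smul_mem _ _ hx
    have hw : ∀ l : List α, wd l ∈ lenSub l.length :=
      fun l => Submodule.subset_span ⟨l, rfl, rfl⟩
    induction l with
    | nil => exact zero_mem _
    | cons a l ih =>
      rw [sder, List.length_cons, add_comm l.length]
      refine add_mem (hm _ _ _ _ ?_ (hw l)) (Submodule.smul_mem _ _ (hm _ _ _ _ (hw [a]) ih))
      refine Submodule.span_mono ?_ (hδ a)
      rintro _ ⟨b, hb, rfl⟩
      exact ⟨[b], by simp, rfl⟩
  rw [cycNL_of_len par hlen, cycN, map_sum]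
  refine Finset.sum_congr rfl fun i hi => ?_
  clear hi
  have : ∀ x, sderL par e δ ((rotL par ^ i) x) = (rotL par ^ i) (sderL par e δ x) := by
    induction i with
    | zero => intro x; rfl
    | succ i ih =>
      intro x
      rw [pow_succ', Module.End.mul_apply, Module.End.mul_apply, sderL_rot hδ, ih]
  rw [this]; simp [sderL]

end Words


/-! ### The stable Lie superalgebra of noncommutative Hamiltonians -/

/-- The canonical homogeneous basis `p₁, p₂, …; q₁, q₂, …; x₁, x₂, …` of `ℂ^{2∞|∞}`, the union of
the superspaces `ℂ^{2n|m}`. -/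
inductive Letter : Type
  | p (i : ℕ)
  | q (i : ℕ)
  | x (i : ℕ)

namespace Letter

/-- The `p` and the `q` are even, the `x` are odd. -/
def par : Letter → ZMod 2
  | p _ => 0
  | q _ => 0
  | x _ => 1

/-- The canonical even skew-symmetric (in the super sense) form:
`⟨pᵢ, qᵢ⟩ = 1 = -⟨qᵢ, pᵢ⟩`, `⟨xᵢ, xᵢ⟩ = 1`, all other pairs `0`. -/
def pr : Letter → Letter → ℂ
  | p i, q j => if i = j then 1 else 0
  | q i, p j => if i = j then -1 else 0
  | x i, x j => if i = j then 1 else 0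
  | _, _ => 0

lemma pr_swap (u v : Letter) : pr v u = -(sg (par u * par v) * pr u v) := by
  cases u with
  | p i => cases v <;> simp [pr]; split_ifs <;> simp_all [par, sg_zero]
  | q i => cases v <;> simp [pr]; split_ifs <;> simp_all [par, sg_zero]
  | x i => cases v <;> simp [pr]; split_ifs <;> simp_all [par, sg_one]

lemma pr_ne {u v : Letter} (h : pr u v ≠ 0) : par u = par v := by
  cases u <;> cases v <;> simp_all [pr, par]

end Letter

open Letter

/-- A word in the letters, that is, a basis tensor in the tensor algebra of `ℂ^{2∞|∞}`. Modulo cyclic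
rotation these span the Lie superalgebra of noncommutative Hamiltonians. -/
abbrev Word : Type := List Letter

/-- Parity of a word in the letters. -/
def wpar : Word → ZMod 2 := lpar par

/-- Contraction of the first letters of two words, `ua, vb ↦ ± ⟨u, v⟩ ab`; the sign is the one for
moving `u` past `a`. -/
def ctr : Word → Word → FA Letter
  | u :: a, v :: b => (sg (par u * lpar par a) * pr u v) • wd (a ++ b)
  | _, _ => 0

/-- Bilinear extension of `ctr`. -/
def ctrL : FA Letter →ₗ[ℂ] FA Letter →ₗ[ℂ] FA Letter :=
  linExt fun a => linExt fun b => ctr a b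

lemma ctrL_wd (a b : Word) : ctrL (wd a) (wd b) = ctr a b := by simp [ctrL]

/-- The Hamiltonian (Poisson) bracket of cyclic words
`{a₁…aₖ, b₁…bₗ} = ∑ᵢⱼ ± ⟨aᵢ, bⱼ⟩ (aᵢ₊₁…aₖa₁…aᵢ₋₁)(bⱼ₊₁…bₗb₁…bⱼ₋₁)`:
the letters `aᵢ` and `bⱼ` are brought to the front by cyclic rotations, then contracted. The value is
a representative modulo cyclic rotation. -/
def br : FA Letter →ₗ[ℂ] FA Letter →ₗ[ℂ] FA Letter :=
  ctrL.compl₁₂ (cycNL par) (cycNL par)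

lemma br_apply (x y : FA Letter) : br x y = ctrL (cycNL par x) (cycNL par y) := rfl

lemma ctrL_hom {p q : ZMod 2} {x y : FA Letter} (hx : x ∈ hom par p) (hy : y ∈ hom par q) :
    ctrL x y ∈ hom par (p + q) := by
  induction hx using Submodule.span_induction with
  | mem x hx =>
    obtain ⟨l, rfl, rfl⟩ := hx
    induction hy using Submodule.span_induction with
    | mem y hy =>
      obtain ⟨l', rfl, rfl⟩ := hy
      rw [ctrL_wd]
      rcases l with _ | ⟨u, a⟩
      · simp [ctr]
      rcases l' with _ | ⟨v, b⟩
      · simp [ctr]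
      simp only [ctr]
      by_cases h : pr u v = 0
      · simp [h]
      · refine Submodule.smul_mem _ _ ?_
        have e : lpar par (u :: a) + lpar par (v :: b) = lpar par (a ++ b) := ?_
        · rw [e]; exact wd_mem_hom par (a ++ b)
        have := pr_ne h
        simp only [lpar_cons, lpar_append, this]
        generalize par v = x; generalize lpar par a = y; generalize lpar par b = z
        clear * -
        revert x y z; decide
    | zero => rw [map_zero]; exact zero_mem _
    | add x y _ _ hx hy => rw [map_add]; exact add_mem hx hy
    | smul c x _ hx => rw [map_smul]; exact Submodule.smul_mem _ _ hx
  | zero => rw [map_zero]; exact zero_mem _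
  | add x y _ _ hx hy => rw [map_add]; exact add_mem hx hy
  | smul c x _ hx => rw [map_smul]; exact Submodule.smul_mem _ _ hx

lemma cycNL_wd (w : Word) : cycNL par (wd w) = cycN par w := by simp [cycNL]

lemma cycNL_hom {p : ZMod 2} {x : FA Letter} (hx : x ∈ hom par p) : cycNL par x ∈ hom par p := by
  induction hx using Submodule.span_induction with
  | mem x hx => obtain ⟨l, rfl, rfl⟩ := hx; rw [cycNL_wd]; exact cycN_hom _ _
  | zero => rw [map_zero]; exact zero_mem _
  | add x y _ _ hx hy => rw [map_add]; exact add_mem hx hy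
  | smul c x _ hx => rw [map_smul]; exact Submodule.smul_mem _ _ hx

lemma br_hom {p q : ZMod 2} {x y : FA Letter} (hx : x ∈ hom par p) (hy : y ∈ hom par q) :
    br x y ∈ hom par (p + q) := ctrL_hom (cycNL_hom hx) (cycNL_hom hy)

lemma br_rot_left (w : Word) (y : FA Letter) : br (rot par w) y = br (wd w) y := by
  rw [br_apply, br_apply, cycNL_rot, cycNL_wd]

lemma br_rot_right (w : Word) (y : FA Letter) : br y (rot par w) = br y (wd w) := by
  rw [br_apply, br_apply, cycNL_rot, cycNL_wd]

/-- The cyclic relations on words. -/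
def cyc : Submodule ℂ (FA Letter) :=
  Submodule.span ℂ (Set.range fun w : Word => wd w - rot par w)

lemma cyc_rotL (x : FA Letter) : x - rotL par x ∈ cyc := by
  induction x using fa_induction with
  | h0 => simp
  | hw l => exact Submodule.subset_span ⟨l, by simp [rotL]⟩
  | ha x y hx hy => rw [map_add, add_sub_add_comm]; exact add_mem hx hy
  | hs c x hx => rw [map_smul, ← smul_sub]; exact Submodule.smul_mem _ _ hx

lemma cyc_swap (a b : Word) : wd (a ++ b) - sg (lpar par a * lpar par b) • wd (b ++ a) ∈ cyc := by
  have h : ∀ (n : ℕ) (x : FA Letter), x - (rotL par ^ n) x ∈ cyc := by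
    intro n
    induction n with
    | zero => intro x; simp
    | succ n ih =>
      intro x
      have := add_mem (cyc_rotL x) (ih (rotL par x))
      rwa [sub_add_sub_cancel, ← Module.End.mul_apply, ← pow_succ] at this
  rw [← rotL_pow]; exact h _ _

lemma ctrL_skew {p q : ZMod 2} {x y : FA Letter} (hx : x ∈ hom par p) (hy : y ∈ hom par q) :
    ctrL x y + sg (p * q) • ctrL y x ∈ cyc := by
  induction hx using Submodule.span_induction with
  | mem x hx =>
    obtain ⟨l, rfl, rfl⟩ := hx
    induction hy using Submodule.span_induction with
    | mem y hy =>
      obtain ⟨l', rfl, rfl⟩ := hy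
      rw [ctrL_wd, ctrL_wd]
      rcases l with _ | ⟨u, a⟩
      · rcases l' with _ | ⟨v, b⟩ <;> simp [ctr]
      rcases l' with _ | ⟨v, b⟩
      · simp [ctr]
      simp only [ctr]
      by_cases h : pr u v = 0
      · simp [h, pr_swap u v]
      · have h2 := Submodule.smul_mem cyc (sg (par u * lpar par a) * pr u v) (cyc_swap a b)
        convert h2 using 1
        have h1 := pr_ne h
        rw [smul_sub, sub_eq_add_neg, ← neg_smul, pr_swap u v, smul_smul, smul_smul]
        congr 1
        congr 1
        simp only [lpar_cons, h1]
        have : sg ((par v + lpar par a) * (par v + lpar par b)) * sg (par v * lpar par b) *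
            sg (par v * par v) = sg (par v * lpar par a) * sg (lpar par a * lpar par b) := by
          simp only [← sg_add]
          congr 1
          generalize par v = x; generalize lpar par a = y; generalize lpar par b = z
          clear * -
          revert x y z; decide
        linear_combination (-pr u v) * this
    | zero => simp
    | add x y _ _ hx hy =>
      simp only [map_add, LinearMap.add_apply, smul_add]; rw [add_add_add_comm]
      exact add_mem hx hy
    | smul c x _ hx =>
      simp only [map_smul, LinearMap.smul_apply]; rw [smul_comm, ← smul_add]
      exact Submodule.smul_mem _ _ hx
  | zero => simp
  | add x y _ _ hx hy =>
    simp only [map_add, LinearMap.add_apply, smul_add]; rw [add_add_add_comm]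
    exact add_mem hx hy
  | smul c x _ hx =>
    simp only [map_smul, LinearMap.smul_apply]; rw [smul_comm, ← smul_add]
    exact Submodule.smul_mem _ _ hx

lemma br_skew {p q : ZMod 2} {x y : FA Letter} (hx : x ∈ hom par p) (hy : y ∈ hom par q) :
    br x y + sg (p * q) • br y x ∈ cyc := ctrL_skew (cycNL_hom hx) (cycNL_hom hy)

/-- The linear symplectic vector field (element of `𝔬𝔰𝔭`) `v ↦ {st, v}` of the quadratic
Hamiltonian `st`, on a letter. These span `𝔬𝔰𝔭`. -/
def ospV (s t : Letter) (v : Letter) : FA Letter :=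
  pr t v • wd [s] + (sg (par s * par t) * pr s v) • wd [t]

lemma ospV_mem (s t a : Letter) : ospV s t a ∈
    Submodule.span ℂ ((fun b => wd [b]) '' {b | par b = par s + par t + par a}) := by
  have h2 : ∀ x : ZMod 2, x + x = 0 := by decide
  refine add_mem ?_ ?_
  · by_cases h : pr t a = 0
    · simp [h]
    · refine Submodule.smul_mem _ _ (Submodule.subset_span ⟨s, ?_, rfl⟩)
      simp [pr_ne h, add_assoc, h2]
  · by_cases h : pr s a = 0
    · simp [h]
    · refine Submodule.smul_mem _ _ (Submodule.subset_span ⟨t, ?_, rfl⟩)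
      have := pr_ne h
      change par t = par s + par t + par a
      rw [this]
      rw [add_comm (par a), add_assoc, h2, add_zero]

lemma ospV_hom (s t a : Letter) : ospV s t a ∈ hom par (par s + par t + par a) := by
  refine Submodule.span_mono ?_ (ospV_mem s t a)
  rintro _ ⟨b, hb, rfl⟩
  exact ⟨[b], by simpa using hb, rfl⟩

/-- The action by the Leibniz rule on tensors of the element of `𝔬𝔰𝔭` with Hamiltonian `st`. -/
def ospT (s t : Letter) : FA Letter →ₗ[ℂ] FA Letter := sderL par (par s + par t) (ospV s t)

lemma ospT_hom (s t : Letter) {p : ZMod 2} {x : FA Letter} (hx : x ∈ hom par p) :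
    ospT s t x ∈ hom par (par s + par t + p) := sderL_hom (ospV_hom s t) hx

lemma ospT_cons (s t a : Letter) (l : Word) : ospT s t (wd (a :: l)) =
    ospV s t a * wd l + sg ((par s + par t) * par a) • (wd [a] * ospT s t (wd l)) := by
  simp [ospT, sderL, sder]

lemma ospT_ctr (s t : Letter) {p : ZMod 2} {x : FA Letter} (hx : x ∈ hom par p) (y : FA Letter) :
    ospT s t (ctrL x y) = ctrL (ospT s t x) y +
      sg ((par s + par t) * p) • ctrL x (ospT s t y) := by
  -- the contraction with a letter in front
  have c1 : ∀ (u v : Letter) (q : ZMod 2) (x y : FA Letter), x ∈ hom par q →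
      ctrL (wd [u] * x) (wd [v] * y) = (sg (par u * q) * pr u v) • (x * y) := by
    intro u v q x y hx
    induction hx using Submodule.span_induction with
    | mem x hx =>
      obtain ⟨l, rfl, rfl⟩ := hx
      induction y using fa_induction with
      | h0 => simp
      | hw l' => rw [wd_mul, wd_mul, wd_mul, ctrL_wd]; rfl
      | ha x y hx hy => simp only [mul_add, map_add, hx, hy, smul_add]
      | hs c x hx => simp only [mul_smul_comm, map_smul, hx, smul_comm c]
    | zero => simp
    | add x y _ _ hx hy =>
      simp only [mul_add, add_mul, map_add, LinearMap.add_apply, hx, hy, smul_add]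
    | smul c x _ hx =>
      simp only [mul_smul_comm, smul_mul_assoc, map_smul, LinearMap.smul_apply, hx, smul_comm c]
  have z1 : ∀ y : FA Letter, ctrL 1 y = 0 := by
    intro y
    rw [← wd_nil]
    induction y using fa_induction with
    | h0 => simp
    | hw l => rw [ctrL_wd]; rfl
    | ha x y hx hy => rw [map_add, hx, hy, add_zero]
    | hs c x hx => rw [map_smul, hx, smul_zero]
  have z2 : ∀ y : FA Letter, ctrL y 1 = 0 := by
    intro y
    rw [← wd_nil]
    induction y using fa_induction with
    | h0 => simp
    | hw l => rw [ctrL_wd]; cases l <;> rfl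
    | ha x y hx hy => rw [map_add, LinearMap.add_apply, hx, hy, add_zero]
    | hs c x hx => rw [map_smul, LinearMap.smul_apply, hx, smul_zero]
  have o1 : ospT s t 1 = 0 := by rw [← wd_nil]; simp [ospT, sderL, sder]
  induction hx using Submodule.span_induction with
  | mem x hx =>
    obtain ⟨l, rfl, rfl⟩ := hx
    induction y using fa_induction with
    | h0 => simp
    | hw l' =>
      rcases l with _ | ⟨u, a⟩
      · rw [wd_nil, o1, z1, z1]; simp
      rcases l' with _ | ⟨v, b⟩
      · rw [wd_nil, o1, z2, z2]; simp
      have e0 : ctrL (wd (u :: a)) (wd (v :: b)) =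
          (sg (par u * lpar par a) * pr u v) • (wd a * wd b) := by
        rw [ctrL_wd, wd_mul]; rfl
      have e1 : ctrL (ospT s t (wd (u :: a))) (wd (v :: b)) =
          (pr t u * (sg (par s * lpar par a) * pr s v) +
            sg (par s * par t) * pr s u * (sg (par t * lpar par a) * pr t v)) • (wd a * wd b) +
          (sg ((par s + par t) * par u) * (sg (par u * (par s + par t + lpar par a)) * pr u v)) •
            (ospT s t (wd a) * wd b) := by
        rw [ospT_cons, wd_cons v b]
        simp only [ospV, add_mul, smul_mul_assoc, map_add, map_smul, LinearMap.add_apply,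
          LinearMap.smul_apply]
        rw [c1 s v _ _ _ (wd_mem_hom par a), c1 t v _ _ _ (wd_mem_hom par a),
          c1 u v _ _ _ (ospT_hom s t (wd_mem_hom par a))]
        simp only [smul_smul, add_smul]
      have e2 : ctrL (wd (u :: a)) (ospT s t (wd (v :: b))) =
          (pr t v * (sg (par u * lpar par a) * pr u s) +
            sg (par s * par t) * pr s v * (sg (par u * lpar par a) * pr u t)) • (wd a * wd b) +
          (sg ((par s + par t) * par v) * (sg (par u * lpar par a) * pr u v)) •
            (wd a * ospT s t (wd b)) := by
        rw [ospT_cons, wd_cons u a]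
        simp only [ospV, add_mul, smul_mul_assoc, map_add, map_smul]
        rw [c1 u s _ _ _ (wd_mem_hom par a), c1 u t _ _ _ (wd_mem_hom par a),
          c1 u v _ _ _ (wd_mem_hom par a)]
        simp only [smul_smul, add_smul]
      have e3 : ospT s t (wd a * wd b) = ospT s t (wd a) * wd b +
          sg ((par s + par t) * lpar par a) • (wd a * ospT s t (wd b)) :=
        sderL_mul _ _ (wd_mem_hom par a) _
      rw [e0, e1, e2, map_smul, e3]
      have k1 : sg ((par s + par t) * par u) * (sg (par u * (par s + par t + lpar par a)) * pr u v)
          = sg (par u * lpar par a) * pr u v := by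
        rw [← mul_assoc, ← sg_add]
        congr 2
        generalize par s = x; generalize lpar par a = y; generalize par t = z
        generalize par u = w
        clear * -
        revert x y z w; decide
      have k2 : sg ((par s + par t) * lpar par (u :: a)) *
          (sg ((par s + par t) * par v) * (sg (par u * lpar par a) * pr u v)) =
          sg (par u * lpar par a) * pr u v * sg ((par s + par t) * lpar par a) := by
        by_cases h : pr u v = 0
        · simp [h]
        · rw [lpar_cons, ← pr_ne h]
          have : sg ((par s + par t) * (par u + lpar par a)) * sg ((par s + par t) * par u) =
              sg ((par s + par t) * lpar par a) := by
            rw [← sg_add]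
            congr 1
            generalize par s = x; generalize lpar par a = y; generalize par t = z
            generalize par u = w
            clear * -
            revert x y z w; decide
          linear_combination sg (par u * lpar par a) * pr u v * this
      have k3 : (pr t u * (sg (par s * lpar par a) * pr s v) +
            sg (par s * par t) * pr s u * (sg (par t * lpar par a) * pr t v)) +
          sg ((par s + par t) * lpar par (u :: a)) *
          (pr t v * (sg (par u * lpar par a) * pr u s) +
            sg (par s * par t) * pr s v * (sg (par u * lpar par a) * pr u t)) = 0 := by
        have f1 : pr t u * (sg (par s * lpar par a) * pr s v) +
            sg ((par s + par t) * lpar par (u :: a)) *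
            (sg (par s * par t) * pr s v * (sg (par u * lpar par a) * pr u t)) = 0 := by
          by_cases h : pr t u = 0
          · simp [h, pr_swap t u]
          · rw [pr_swap t u, lpar_cons, ← pr_ne h]
            have : sg ((par s + par t) * (par t + lpar par a)) * sg (par s * par t) *
              sg (par t * lpar par a) * sg (par t * par t) = sg (par s * lpar par a) := by
              simp only [← sg_add]
              congr 1
              generalize par s = x; generalize lpar par a = y; generalize par t = z
              clear * -
              revert x y z; decide
            linear_combination (-pr s v * pr t u) * this
        have f2 : sg (par s * par t) * pr s u * (sg (par t * lpar par a) * pr t v) +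
            sg ((par s + par t) * lpar par (u :: a)) *
            (pr t v * (sg (par u * lpar par a) * pr u s)) = 0 := by
          by_cases h : pr s u = 0
          · simp [h, pr_swap s u]
          · rw [pr_swap s u, lpar_cons, ← pr_ne h]
            have : sg ((par s + par t) * (par s + lpar par a)) * sg (par s * lpar par a) *
              sg (par s * par s) = sg (par s * par t) * sg (par t * lpar par a) := by
              simp only [← sg_add]
              congr 1
              generalize par s = x; generalize lpar par a = y; generalize par t = z
              clear * -
              revert x y z; decide
            linear_combination (-pr t v * pr s u) * this
        linear_combination f1 + f2
      rw [k1]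
      simp only [smul_add, smul_smul]
      rw [k2]
      have k4 := congrArg (fun c : ℂ => c • (wd a * wd b)) k3
      simp only [add_smul, zero_smul, mul_add] at k4 ⊢
      rw [add_add_add_comm, k4, zero_add]
    | ha x y hx hy => simp only [map_add, hx, hy, smul_add]; abel
    | hs c x hx => simp only [map_smul, hx, smul_add, smul_comm c]
  | zero => simp
  | add x y _ _ hx hy => simp only [map_add, LinearMap.add_apply, hx, hy, smul_add]; abel
  | smul c x _ hx => simp only [map_smul, LinearMap.smul_apply, hx, smul_add, smul_comm c]

lemma ospT_cycN (s t : Letter) (x : FA Letter) :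
    ospT s t (cycNL par x) = cycNL par (ospT s t x) := by
  suffices h : ospT s t ∘ₗ cycNL par = cycNL par ∘ₗ ospT s t from LinearMap.congr_fun h x
  refine fa_ext fun l => ?_
  simp only [LinearMap.comp_apply, cycNL_wd]
  rw [ospT, sderL_cycN (ospV_mem s t)]; simp [sderL]

lemma ospT_br (s t : Letter) {p : ZMod 2} {x : FA Letter} (hx : x ∈ hom par p) (y : FA Letter) :
    ospT s t (br x y) = br (ospT s t x) y + sg ((par s + par t) * p) • br x (ospT s t y) := by
  simp only [br_apply, ospT_ctr s t (cycNL_hom hx), ospT_cycN]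


/-! ### Chevalley–Eilenberg chains and coinvariants -/

/-- A combination of words as a chain of exterior degree one. A chain is a combination of lists
`[g₁, …, gᵢ]` of words, which stands for `g₁ ∧ … ∧ gᵢ`; relations are imposed below. -/
def emb : FA Letter →ₗ[ℂ] FA Word := linExt fun w => wd [w]

@[simp] lemma emb_wd (w : Word) : emb (wd w) = wd [w] := by simp [emb]

lemma emb_hom {p : ZMod 2} {x : FA Letter} (hx : x ∈ hom par p) : emb x ∈ hom wpar p := by
  induction hx using Submodule.span_induction with
  | mem x hx =>
    obtain ⟨l, rfl, rfl⟩ := hx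
    rw [emb_wd]
    convert wd_mem_hom wpar [l] using 1
    simp [wpar]
  | zero => rw [map_zero]; exact zero_mem _
  | add x y _ _ hx hy => rw [map_add]; exact add_mem hx hy
  | smul c x _ hx => rw [map_smul]; exact Submodule.smul_mem _ _ hx

/-- The adjoint action of a word `g` on chains. -/
def ad (g : Word) : FA Word →ₗ[ℂ] FA Word :=
  sderL wpar (wpar g) fun h => emb (br (wd g) (wd h))

/-- Linear extension of `ad` in its first argument. -/
def adL : FA Letter →ₗ[ℂ] FA Word →ₗ[ℂ] FA Word := linExt ad

@[simp] lemma adL_wd (g : Word) : adL (wd g) = ad g := by simp [adL]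

/-- The Chevalley–Eilenberg differential, by the recursion `d(g ∧ c) = ad_g c - g ∧ dc`; unfolding it
gives the usual formula `∑_{i<j} ± [gᵢ, gⱼ] ∧ g₁ ∧ … ĝᵢ … ĝⱼ … ∧ gₘ`. -/
def dList : List Word → FA Word
  | [] => 0
  | g :: l => ad g (wd l) - wd [g] * dList l

/-- The Chevalley–Eilenberg differential on chains. -/
def dCE : FA Word →ₗ[ℂ] FA Word := linExt dList

/-- The Leibniz action on chains of the element of `𝔬𝔰𝔭` with Hamiltonian `st`. -/
def ospC (s t : Letter) : FA Word →ₗ[ℂ] FA Word :=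
  sderL wpar (par s + par t) fun w => emb (ospT s t (wd w))

/-- The defining relations: words are taken modulo cyclic rotation, and `a ∧ b = -(-1)^{|a||b|} b ∧ a`. -/
def relS : Set (FA Word) :=
  {r | (∃ w : Word, r = wd [w] - emb (rot par w)) ∨
    ∃ a b : Word, r = wd [a, b] + sg (wpar a * wpar b) • wd [b, a]}

/-- The two-sided ideal generated by the defining relations; chains modulo it form the exterior
algebra on the space of cyclic words. -/
def ceI : Submodule ℂ (FA Word) :=
  Submodule.span ℂ {z | ∃ l l' : List Word, ∃ r ∈ relS, z = wd l * r * wd l'}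

/-- The relations of the `𝔬𝔰𝔭`-coinvariants of the exterior algebra on cyclic words. -/
def ceR : Submodule ℂ (FA Word) :=
  ceI ⊔ Submodule.span ℂ {z | ∃ (s t : Letter) (l : List Word), z = ospC s t (wd l)}

lemma ceI_mul_left (x : FA Word) {z : FA Word} (hz : z ∈ ceI) : x * z ∈ ceI := by
  induction hz using Submodule.span_induction with
  | mem z hz =>
    obtain ⟨l, l', r, hr, rfl⟩ := hz
    induction x using fa_induction with
    | h0 => rw [zero_mul]; exact zero_mem _
    | hw m =>
      refine Submodule.subset_span ⟨m ++ l, l', r, hr, ?_⟩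
      simp only [← wd_mul, mul_assoc]
    | ha x y hx hy => rw [add_mul]; exact add_mem hx hy
    | hs c x hx => rw [smul_mul_assoc]; exact Submodule.smul_mem _ _ hx
  | zero => rw [mul_zero]; exact zero_mem _
  | add x y _ _ hx hy => rw [mul_add]; exact add_mem hx hy
  | smul c x _ hx => rw [mul_smul_comm]; exact Submodule.smul_mem _ _ hx

lemma ceI_mul_right {z : FA Word} (hz : z ∈ ceI) (x : FA Word) : z * x ∈ ceI := by
  induction hz using Submodule.span_induction with
  | mem z hz =>
    obtain ⟨l, l', r, hr, rfl⟩ := hz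
    induction x using fa_induction with
    | h0 => rw [mul_zero]; exact zero_mem _
    | hw m =>
      refine Submodule.subset_span ⟨l, l' ++ m, r, hr, ?_⟩
      simp only [← wd_mul, mul_assoc]
    | ha x y hx hy => rw [mul_add]; exact add_mem hx hy
    | hs c x hx => rw [mul_smul_comm]; exact Submodule.smul_mem _ _ hx
  | zero => rw [zero_mul]; exact zero_mem _
  | add x y _ _ hx hy => rw [add_mul]; exact add_mem hx hy
  | smul c x _ hx => rw [smul_mul_assoc]; exact Submodule.smul_mem _ _ hx

lemma relS_mem {r : FA Word} (hr : r ∈ relS) : r ∈ ceI :=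
  Submodule.subset_span ⟨[], [], r, hr, by simp [wd_nil]⟩

lemma emb_cyc {x : FA Letter} (hx : x ∈ cyc) : emb x ∈ ceI := by
  induction hx using Submodule.span_induction with
  | mem x hx =>
    obtain ⟨w, rfl⟩ := hx
    exact relS_mem (Or.inl ⟨w, by simp⟩)
  | zero => rw [map_zero]; exact zero_mem _
  | add x y _ _ hx hy => rw [map_add]; exact add_mem hx hy
  | smul c x _ hx => rw [map_smul]; exact Submodule.smul_mem _ _ hx

lemma emb_swap {p : ZMod 2} {x : FA Letter} (hx : x ∈ hom par p) (b : Word) :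
    emb x * wd [b] + sg (p * wpar b) • (wd [b] * emb x) ∈ ceI := by
  induction hx using Submodule.span_induction with
  | mem x hx =>
    obtain ⟨l, rfl, rfl⟩ := hx
    refine relS_mem (Or.inr ⟨l, b, ?_⟩)
    rw [emb_wd, wd_mul, wd_mul]; rfl
  | zero => simp
  | add x y _ _ hx hy =>
    rw [map_add, add_mul, mul_add, smul_add, add_add_add_comm]; exact add_mem hx hy
  | smul c x _ hx =>
    rw [map_smul, smul_mul_assoc, mul_smul_comm, smul_comm, ← smul_add]
    exact Submodule.smul_mem _ _ hx

lemma relS_hom {r : FA Word} (hr : r ∈ relS) : ∃ p, r ∈ hom wpar p := by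
  rcases hr with ⟨w, rfl⟩ | ⟨a, b, rfl⟩
  · refine ⟨wpar w, sub_mem ?_ ?_⟩
    · have := emb_hom (wd_mem_hom par w); rwa [emb_wd] at this
    · have := rotL_hom (wd_mem_hom par w)
      simp only [rotL, linExt_wd] at this
      exact emb_hom this
  · refine ⟨lpar wpar [a, b], add_mem (wd_mem_hom _ _) (Submodule.smul_mem _ _ ?_)⟩
    have := wd_mem_hom wpar [b, a]
    rwa [show lpar wpar [b, a] = lpar wpar [a, b] by simp [add_comm]] at this

/-- a superderivation of chains induced by an operator on words that respects cyclic rotation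
preserves the relations -/
lemma sderL_ceI {e : ZMod 2} {η : FA Letter →ₗ[ℂ] FA Letter}
    (h1 : ∀ w, η (wd w) ∈ hom par (e + wpar w)) (h2 : ∀ w, η (wd w - rot par w) ∈ cyc)
    {z : FA Word} (hz : z ∈ ceI) : sderL wpar e (fun w => emb (η (wd w))) z ∈ ceI := by
  set D := sderL wpar e (fun w => emb (η (wd w))) with hD
  have hE : ∀ x, D (emb x) = emb (η x) := by
    intro x
    induction x using fa_induction with
    | h0 => simp
    | hw l => rw [emb_wd, hD, sderL_single]
    | ha x y hx hy => simp only [map_add, hx, hy]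
    | hs c x hx => simp only [map_smul, hx]
  have hr : ∀ r ∈ relS, D r ∈ ceI := by
    intro r hr
    rcases hr with ⟨w, rfl⟩ | ⟨a, b, rfl⟩
    · rw [← emb_wd, ← map_sub, hE]; exact emb_cyc (h2 w)
    · have ea : wd [a] ∈ hom wpar (wpar a) := by
        have := wd_mem_hom wpar [a]; simpa using this
      have eb : wd [b] ∈ hom wpar (wpar b) := by
        have := wd_mem_hom wpar [b]; simpa using this
      have x1 := emb_swap (h1 a) b
      have x2 := Submodule.smul_mem ceI (sg (e * wpar a + (wpar a) * (e + wpar b)))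
        (emb_swap (h1 b) a)
      convert add_mem x1 x2 using 1
      rw [wd_cons a [b], wd_cons b [a], map_add, map_smul, hD, sderL_mul _ _ ea, sderL_mul _ _ eb]
      simp only [sderL_single, smul_add, smul_smul, ← sg_add]
      have s1 : wpar a * wpar b + e * wpar b = (e + wpar a) * wpar b := by ring
      have s2 : e * wpar a + wpar a * (e + wpar b) = wpar a * wpar b := by
        generalize wpar a = x; generalize wpar b = y
        clear * -
        revert e x y; decide
      have s3 : e * wpar a + wpar a * (e + wpar b) + (e + wpar b) * wpar a = e * wpar a := by
        generalize wpar a = x; generalize wpar b = y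
        clear * -
        revert e x y; decide
      rw [s1, s3, s2]
      abel
  induction hz using Submodule.span_induction with
  | mem z hz =>
    obtain ⟨l, l', r, hrr, rfl⟩ := hz
    obtain ⟨p, hp⟩ := relS_hom hrr
    have hrI := relS_mem hrr
    rw [mul_assoc, hD, sderL_mul _ _ (wd_mem_hom wpar l), sderL_mul _ _ hp, ← hD]
    refine add_mem (ceI_mul_left _ (ceI_mul_right hrI _)) (Submodule.smul_mem _ _
      (ceI_mul_left _ (add_mem (ceI_mul_right (hr r hrr) _)
        (Submodule.smul_mem _ _ (ceI_mul_right hrI _)))))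
  | zero => rw [map_zero]; exact zero_mem _
  | add x y _ _ hx hy => rw [map_add]; exact add_mem hx hy
  | smul c x _ hx => rw [map_smul]; exact Submodule.smul_mem _ _ hx

lemma ad_ceI (g : Word) {z : FA Word} (hz : z ∈ ceI) : ad g z ∈ ceI := by
  refine sderL_ceI (η := br (wd g)) (fun w => br_hom (wd_mem_hom _ _) (wd_mem_hom _ _))
    (fun w => ?_) hz
  rw [map_sub, br_rot_right, sub_self]; exact zero_mem _

lemma ospC_ceI (s t : Letter) {z : FA Word} (hz : z ∈ ceI) : ospC s t z ∈ ceI := by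
  refine sderL_ceI (η := ospT s t) (fun w => ospT_hom s t (wd_mem_hom _ _)) (fun w => ?_) hz
  have := sderL_rot (ospV_mem s t) (wd w)
  simp only [rotL, linExt_wd] at this
  rw [map_sub, ospT, this]
  exact cyc_rotL _

lemma dCE_one : dCE 1 = 0 := by rw [← wd_nil]; simp [dCE, dList]

lemma dCE_cons (g : Word) (y : FA Word) : dCE (wd [g] * y) = ad g y - wd [g] * dCE y := by
  induction y using fa_induction with
  | h0 => simp
  | hw l => rw [wd_mul]; simp [dCE, dList]
  | ha x y hx hy => simp only [mul_add, map_add, hx, hy]; abel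
  | hs c x hx => simp only [mul_smul_comm, map_smul, hx, smul_sub]

lemma dCE_emb (x : FA Letter) (y : FA Word) : dCE (emb x * y) = adL x y - emb x * dCE y := by
  induction x using fa_induction with
  | h0 => simp
  | hw l => rw [emb_wd, dCE_cons, adL_wd]
  | ha x z hx hy => simp only [add_mul, map_add, hx, hy, LinearMap.add_apply]; abel
  | hs c x hx => simp only [smul_mul_assoc, map_smul, hx, smul_sub, LinearMap.smul_apply]

lemma adL_mul {p : ZMod 2} {x : FA Letter} (hx : x ∈ hom par p) (h : Word) (y : FA Word) :
    adL x (wd [h] * y) =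
      emb (br x (wd h)) * y + sg (p * wpar h) • (wd [h] * adL x y) := by
  induction hx using Submodule.span_induction with
  | mem x hx =>
    obtain ⟨l, rfl, rfl⟩ := hx
    have : wd [h] ∈ hom wpar (wpar h) := by simpa using wd_mem_hom wpar [h]
    rw [adL_wd, ad, sderL_mul _ _ this, sderL_single]; rfl
  | zero => simp
  | add x z _ _ hx hy =>
    simp only [map_add, LinearMap.add_apply, hx, hy, mul_add, smul_add, add_mul]; abel
  | smul c x _ hx =>
    simp only [map_smul, LinearMap.smul_apply, hx, mul_smul_comm, smul_add, smul_mul_assoc,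
      smul_comm c]

lemma adL_one (x : FA Letter) : adL x 1 = 0 := by
  induction x using fa_induction with
  | h0 => simp
  | hw l => rw [adL_wd, ad, ← wd_nil]; simp [sderL, sder]
  | ha x y hx hy => rw [map_add, LinearMap.add_apply, hx, hy, add_zero]
  | hs c x hx => rw [map_smul, LinearMap.smul_apply, hx, smul_zero]

lemma adL_rot (w : Word) : adL (rot par w) = ad w := by
  rw [← adL_wd]
  have h1 : rot par w ∈ hom par (wpar w) := by
    have := rotL_hom (wd_mem_hom par w)
    simp only [rotL, linExt_wd] at this
    exact this
  refine fa_ext fun l => ?_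
  induction l with
  | nil => rw [wd_nil, adL_one, adL_one]
  | cons h l ih =>
    rw [wd_cons, adL_mul h1, adL_mul (wd_mem_hom par w), br_rot_left, ih]; rfl

/-- The differential descends to the exterior algebra. -/
lemma dCE_ceI {z : FA Word} (hz : z ∈ ceI) : dCE z ∈ ceI := by
  induction hz using Submodule.span_induction with
  | mem z hz =>
    obtain ⟨l, l', r, hr, rfl⟩ := hz
    induction l with
    | cons g l ih =>
      rw [wd_cons, mul_assoc, mul_assoc, dCE_cons, ← mul_assoc]
      exact sub_mem (ad_ceI g (ceI_mul_right (ceI_mul_left _ (relS_mem hr)) _))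
        (ceI_mul_left _ ih)
    | nil =>
      rw [wd_nil, one_mul]
      have hrI := relS_mem hr
      rcases hr with ⟨w, rfl⟩ | ⟨a, b, rfl⟩
      · rw [sub_mul, map_sub, dCE_cons, dCE_emb, adL_rot]
        rw [sub_sub_sub_cancel_left, ← neg_sub, ← sub_mul]
        exact neg_mem (ceI_mul_right hrI _)
      · have ha : wd a ∈ hom par (wpar a) := wd_mem_hom _ _
        have hb : wd b ∈ hom par (wpar b) := wd_mem_hom _ _
        have h1 := ceI_mul_right (emb_cyc (br_skew ha hb)) (wd l')
        have h2 := ceI_mul_right hrI (dCE (wd l'))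
        convert add_mem h1 h2 using 1
        have ea := adL_mul ha b (wd l')
        have eb := adL_mul hb a (wd l')
        rw [adL_wd] at ea eb
        have s : sg (wpar a * wpar b) * sg (wpar b * wpar a) = 1 := by
          rw [mul_comm (wpar b)]; exact sg_sq _
        rw [wd_cons a [b], wd_cons b [a], add_mul, smul_mul_assoc, mul_assoc, mul_assoc, map_add,
          map_smul, dCE_cons, dCE_cons, dCE_cons, dCE_cons, ea, eb]
        simp only [map_add, map_smul, add_mul, mul_sub, smul_add, smul_sub, smul_smul, s, one_smul,
          smul_mul_assoc, mul_assoc]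
        abel
  | zero => rw [map_zero]; exact zero_mem _
  | add x y _ _ hx hy => rw [map_add]; exact add_mem hx hy
  | smul c x _ hx => rw [map_smul]; exact Submodule.smul_mem _ _ hx

lemma ospC_one (s t : Letter) : ospC s t 1 = 0 := by
  rw [← wd_nil]; simp [ospC, sderL, sder]

lemma ospC_emb (s t : Letter) {p : ZMod 2} {x : FA Letter} (hx : x ∈ hom par p) (y : FA Word) :
    ospC s t (emb x * y) =
      emb (ospT s t x) * y + sg ((par s + par t) * p) • (emb x * ospC s t y) := by
  rw [ospC, sderL_mul _ _ (emb_hom hx)]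
  congr 2
  clear hx
  induction x using fa_induction with
  | h0 => simp
  | hw l => rw [emb_wd, sderL_single]
  | ha x y hx hy => simp only [map_add, *]
  | hs c x hx => simp only [map_smul, *]

lemma ospC_ad (s t : Letter) (g : Word) (y : FA Word) :
    ospC s t (ad g y) =
      adL (ospT s t (wd g)) y + sg ((par s + par t) * wpar g) • ad g (ospC s t y) := by
  have hg : wd g ∈ hom par (wpar g) := wd_mem_hom _ _
  have hXg := ospT_hom s t hg
  suffices h : ospC s t ∘ₗ ad g =
      adL (ospT s t (wd g)) + sg ((par s + par t) * wpar g) • (ad g ∘ₗ ospC s t) from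
    LinearMap.congr_fun h y
  refine fa_ext fun l => ?_
  simp only [LinearMap.comp_apply, LinearMap.add_apply, LinearMap.smul_apply]
  induction l with
  | nil => rw [wd_nil, ← adL_wd, adL_one, adL_one, ospC_one]; simp
  | cons h l ih =>
    have hh : wd h ∈ hom par (wpar h) := wd_mem_hom _ _
    have hXh := ospT_hom s t hh
    have a1 := adL_mul hg h (wd l)
    have a2 := adL_mul hXg h (wd l)
    have a3 := ospC_emb s t hh (wd l)
    rw [emb_wd] at a3
    have a4 : ad g (emb (ospT s t (wd h)) * wd l) =
        emb (br (wd g) (ospT s t (wd h))) * wd l +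
          sg (wpar g * (par s + par t + wpar h)) • (emb (ospT s t (wd h)) * ad g (wd l)) := by
      clear * - hXh
      generalize par s + par t + wpar h = p at *
      generalize ospT s t (wd h) = x at *
      induction hXh using Submodule.span_induction with
      | mem x hx =>
        obtain ⟨l', rfl, rfl⟩ := hx
        rw [emb_wd, ← adL_wd, adL_mul (wd_mem_hom par g)]; rfl
      | zero => simp
      | add x y _ _ hx hy => simp only [map_add, add_mul, hx, hy, smul_add]; abel
      | smul c x _ hx => simp only [map_smul, smul_mul_assoc, hx, smul_add, smul_comm c]
    have a5 := adL_mul hg h (ospC s t (wd l))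
    have a6 := ospC_emb s t (br_hom hg hh) (wd l)
    have a7 := ospC_emb s t hh (ad g (wd l))
    rw [emb_wd] at a7
    rw [adL_wd] at a1 a5
    obtain ⟨e, he⟩ : ∃ e, e = par s + par t := ⟨_, rfl⟩
    rw [← he] at hXg ih a2 a3 a4 a6 a7
    rw [wd_cons, a1, a2, a3, map_add, map_smul, a6, a7, ih, map_add, map_smul, a4, a5,
      ospT_br s t hg, ← he]
    simp only [map_add, map_smul, smul_add, add_mul, mul_add, smul_smul, mul_smul_comm,
      smul_mul_assoc, ← sg_add]
    generalize wpar g = x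
    generalize wpar h = z
    have s1 : x * z + e * z = e * z + x * z := by ring
    have s2 : x * z + (e * z + e * x) = e * x + (e * z + x * z) := by ring
    have s3 : e * x + (x * e + x * z) = x * z := by clear * -; revert e x z; decide
    rw [s1, s2, s3]
    abel

lemma dCE_ospC (s t : Letter) (y : FA Word) : dCE (ospC s t y) = ospC s t (dCE y) := by
  suffices h : dCE ∘ₗ ospC s t = ospC s t ∘ₗ dCE from LinearMap.congr_fun h y
  refine fa_ext fun l => ?_
  simp only [LinearMap.comp_apply]
  induction l with
  | nil => rw [wd_nil, ospC_one, dCE_one]; simp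
  | cons g l ih =>
    have hg : wd g ∈ hom par (wpar g) := wd_mem_hom _ _
    have a1 := ospC_emb s t hg (wd l)
    have a2 := ospC_emb s t hg (dCE (wd l))
    rw [emb_wd] at a1 a2
    rw [wd_cons, a1, map_add, map_smul, dCE_emb, dCE_cons, dCE_cons, map_sub, a2, ospC_ad, ih]
    simp only [smul_sub]
    abel

lemma dCE_ceR {z : FA Word} (hz : z ∈ ceR) : dCE z ∈ ceR := by
  obtain ⟨a, ha, b, hb, rfl⟩ := Submodule.mem_sup.1 hz
  clear hz
  rw [map_add]
  refine add_mem (Submodule.mem_sup_left (dCE_ceI ha)) (Submodule.mem_sup_right ?_)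
  have key : ∀ s t (y : FA Word), ospC s t y ∈ Submodule.span ℂ
      {z | ∃ (s t : Letter) (l : List Word), z = ospC s t (wd l)} := by
    intro s t y
    induction y using fa_induction with
    | h0 => simp
    | hw l => exact Submodule.subset_span ⟨s, t, l, rfl⟩
    | ha x y hx hy => rw [map_add]; exact add_mem hx hy
    | hs c x hx => rw [map_smul]; exact Submodule.smul_mem _ _ hx
  induction hb using Submodule.span_induction with
  | mem z hz => obtain ⟨s, t, l, rfl⟩ := hz; rw [dCE_ospC]; exact key _ _ _
  | zero => rw [map_zero]; exact zero_mem _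
  | add x y _ _ hx hy =>
    rw [map_add]
    exact add_mem hx hy
  | smul c x _ hx =>
    rw [map_smul]
    exact Submodule.smul_mem _ _ hx

/-! ### Bigrading and completion -/

/-- The span of the products of `i` words, each of length at least three, of total length `k`. -/
def bigr (i k : ℕ) : Submodule ℂ (FA Word) :=
  Submodule.span ℂ (wd '' {l | l.length = i ∧ (l.map List.length).sum = k ∧ ∀ w ∈ l, 3 ≤ w.length})

lemma bigr_mul {i k i' k' : ℕ} {x y : FA Word} (hx : x ∈ bigr i k) (hy : y ∈ bigr i' k') :
    x * y ∈ bigr (i + i') (k + k') := by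
  induction hx using Submodule.span_induction with
  | mem x hx =>
    obtain ⟨l, ⟨h1, h2, h3⟩, rfl⟩ := hx
    induction hy using Submodule.span_induction with
    | mem y hy =>
      obtain ⟨l', ⟨h1', h2', h3'⟩, rfl⟩ := hy
      rw [wd_mul]
      refine Submodule.subset_span ⟨l ++ l', ⟨by simp [h1, h1'], by simp [h2, h2'], ?_⟩, rfl⟩
      intro w hw
      rcases List.mem_append.1 hw with hw | hw
      · exact h3 w hw
      · exact h3' w hw
    | zero => rw [mul_zero]; exact zero_mem _
    | add x y _ _ hx hy => rw [mul_add]; exact add_mem hx hy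
    | smul c x _ hx => rw [mul_smul_comm]; exact Submodule.smul_mem _ _ hx
  | zero => rw [zero_mul]; exact zero_mem _
  | add x y _ _ hx hy => rw [add_mul]; exact add_mem hx hy
  | smul c x _ hx => rw [smul_mul_assoc]; exact Submodule.smul_mem _ _ hx

lemma emb_bigr {n : ℕ} (hn : 3 ≤ n) {x : FA Letter} (hx : x ∈ lenSub n) : emb x ∈ bigr 1 n := by
  induction hx using Submodule.span_induction with
  | mem x hx =>
    obtain ⟨l, rfl, rfl⟩ := hx
    rw [emb_wd]
    exact Submodule.subset_span ⟨[l], ⟨by simp, by simp, by simpa using hn⟩, rfl⟩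
  | zero => rw [map_zero]; exact zero_mem _
  | add x y _ _ hx hy => rw [map_add]; exact add_mem hx hy
  | smul c x _ hx => rw [map_smul]; exact Submodule.smul_mem _ _ hx

lemma ctrL_len {j k n : ℕ} (h : n + 2 = j + k) {x y : FA Letter} (hx : x ∈ lenSub j)
    (hy : y ∈ lenSub k) : ctrL x y ∈ lenSub n := by
  induction hx using Submodule.span_induction with
  | mem x hx =>
    obtain ⟨l, rfl, rfl⟩ := hx
    induction hy using Submodule.span_induction with
    | mem y hy =>
      obtain ⟨l', rfl, rfl⟩ := hy
      rw [ctrL_wd]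
      rcases l with _ | ⟨u, a⟩
      · exact zero_mem _
      rcases l' with _ | ⟨v, b⟩
      · exact zero_mem _
      refine Submodule.smul_mem _ _ (Submodule.subset_span ⟨a ++ b, ?_, rfl⟩)
      simp only [List.length_cons] at h
      change (a ++ b).length = n
      rw [List.length_append]; omega
    | zero => rw [map_zero]; exact zero_mem _
    | add x y _ _ hx hy => rw [map_add]; exact add_mem hx hy
    | smul c x _ hx => rw [map_smul]; exact Submodule.smul_mem _ _ hx
  | zero => rw [map_zero]; exact zero_mem _
  | add x y _ _ hx hy => rw [map_add]; exact add_mem hx hy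
  | smul c x _ hx => rw [map_smul]; exact Submodule.smul_mem _ _ hx

lemma cycN_len (w : Word) : cycN par w ∈ lenSub w.length := by
  have h : ∀ x ∈ lenSub w.length, rotL par x ∈ lenSub w.length := by
    intro x hx
    induction hx using Submodule.span_induction with
    | mem x hx =>
      obtain ⟨l, hl, rfl⟩ := hx
      rw [rotL, linExt_wd, ← show l.length = w.length from hl]; exact rot_len _ _
    | zero => rw [map_zero]; exact zero_mem _
    | add x y _ _ hx hy => rw [map_add]; exact add_mem hx hy
    | smul c x _ hx => rw [map_smul]; exact Submodule.smul_mem _ _ hx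
  refine Submodule.sum_mem _ fun i hi => ?_
  clear hi
  induction i with
  | zero => exact Submodule.subset_span ⟨w, rfl, rfl⟩
  | succ i ih => rw [pow_succ', Module.End.mul_apply]; exact h _ ih

lemma br_len {g h : Word} {n : ℕ} (hn : n + 2 = g.length + h.length) :
    br (wd g) (wd h) ∈ lenSub n := by
  rw [br_apply, cycNL_wd, cycNL_wd]; exact ctrL_len hn (cycN_len g) (cycN_len h)

lemma ad_bigr (g : Word) (hg : 3 ≤ g.length) (l : List Word) (hl : ∀ w ∈ l, 3 ≤ w.length)
    {k : ℕ} (hk : k + 2 = g.length + (l.map List.length).sum) :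
    ad g (wd l) ∈ bigr l.length k := by
  induction l generalizing k with
  | nil => rw [wd_nil, ← adL_wd, adL_one]; exact zero_mem _
  | cons h l ih =>
    have hh : 3 ≤ h.length := hl h (by simp)
    have hl' : ∀ w ∈ l, 3 ≤ w.length := fun w hw => hl w (by simp [hw])
    simp only [List.map_cons, List.sum_cons] at hk
    rw [wd_cons, ← adL_wd, adL_mul (wd_mem_hom par g), adL_wd]
    refine add_mem ?_ (Submodule.smul_mem _ _ ?_)
    · have h1 := emb_bigr (n := g.length + h.length - 2) (by omega)
        (br_len (g := g) (h := h) (by omega))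
      have h2 : wd l ∈ bigr l.length (l.map List.length).sum :=
        Submodule.subset_span ⟨l, ⟨rfl, rfl, hl'⟩, rfl⟩
      have := bigr_mul h1 h2
      rwa [add_comm 1, show g.length + h.length - 2 + (l.map List.length).sum = k by omega] at this
    · have h1 : wd [h] ∈ bigr 1 h.length :=
        Submodule.subset_span ⟨[h], ⟨by simp, by simp, by simpa using hh⟩, rfl⟩
      have := bigr_mul h1 (ih hl' (k := g.length + (l.map List.length).sum - 2) (by omega))
      rwa [add_comm 1, show h.length + (g.length + (l.map List.length).sum - 2) = k by omega]
        at this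

lemma dCE_bigr {i k : ℕ} {x : FA Word} (hx : x ∈ bigr (i + 1) (k + 2)) : dCE x ∈ bigr i k := by
  have key : ∀ (l : List Word) (i k : ℕ), l.length = i + 1 → (l.map List.length).sum = k + 2 →
      (∀ w ∈ l, 3 ≤ w.length) → dList l ∈ bigr i k := by
    intro l
    induction l with
    | nil => intro i k h; simp at h
    | cons g l ih =>
      intro i k h1 h2 h3
      have hg : 3 ≤ g.length := h3 g (by simp)
      have hl : ∀ w ∈ l, 3 ≤ w.length := fun w hw => h3 w (by simp [hw])
      simp only [List.length_cons, add_left_inj] at h1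
      simp only [List.map_cons, List.sum_cons] at h2
      refine sub_mem ?_ ?_
      · rw [← h1]; exact ad_bigr g hg l hl (by omega)
      · rcases l with _ | ⟨h, l⟩
        · rw [dList, mul_zero]; exact zero_mem _
        · have hh : 3 ≤ h.length := hl h (by simp)
          obtain ⟨i', rfl⟩ : ∃ i', i = 1 + i' := ⟨l.length, by rw [← h1]; simp [add_comm]⟩
          have h4 : wd [g] ∈ bigr 1 g.length :=
            Submodule.subset_span ⟨[g], ⟨by simp, by simp, by simpa using hg⟩, rfl⟩
          obtain ⟨k', hk'⟩ : ∃ k', ((h :: l).map List.length).sum = k' + 2 :=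
            ⟨((h :: l).map List.length).sum - 2, by
              simp only [List.map_cons, List.sum_cons]; omega⟩
          have := bigr_mul h4 (ih i' k' (by omega) hk' hl)
          rwa [show g.length + k' = k by omega] at this
  induction hx using Submodule.span_induction with
  | mem x hx =>
    obtain ⟨l, ⟨h1, h2, h3⟩, rfl⟩ := hx
    simp only [dCE, linExt_wd]
    exact key l i k h1 h2 h3
  | zero => rw [map_zero]; exact zero_mem _
  | add x y _ _ hx hy => rw [map_add]; exact add_mem hx hy
  | smul c x _ hx => rw [map_smul]; exact Submodule.smul_mem _ _ hx

/-- The `𝔬𝔰𝔭`-coinvariants of the Chevalley–Eilenberg chains on all cyclic words in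
`ℂ^{2∞|∞}` (the direct limit over `n, m` of those for `ℂ^{2n|m}`). All relations are homogeneous
in the lengths of the words, so that the words of length at least three span in it the coinvariants of the
Chevalley–Eilenberg chains on the Hamiltonians of order at least three: the relative complex. -/
abbrev RelCE : Type := FA Word ⧸ ceR

/-- The Chevalley–Eilenberg differential on coinvariants. -/
def relD : RelCE →ₗ[ℂ] RelCE := ceR.mapQ ceR dCE fun _ h => dCE_ceR h

/-- The component `C_{ij}(𝔤, 𝔬𝔰𝔭)` of the stable relative complex: `i` exterior factors, each a cyclic
word of length at least three, of total length `2j`. (Coinvariants of odd total length vanish.) -/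
def relC (i j : ℕ) : Submodule ℂ RelCE := (bigr i (2 * j)).map ceR.mkQ

/-- The families of elements of the components `C_{ij}(𝔤, 𝔬𝔰𝔭)`. -/
def cHatSub : Submodule ℂ (ℕ → ℕ → RelCE) where
  carrier := {x | ∀ i j, x i j ∈ relC i j}
  add_mem' hx hy i j := add_mem (hx i j) (hy i j)
  zero_mem' _ _ := zero_mem _
  smul_mem' c _ hx i j := Submodule.smul_mem _ c (hx i j)

/-- The completed complex `Ĉ(𝔤, 𝔬𝔰𝔭) = ∏_{i,j} C_{ij}(𝔤, 𝔬𝔰𝔭)`. -/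
def CHat : Type := cHatSub

instance : AddCommGroup CHat := inferInstanceAs (AddCommGroup cHatSub)

instance : Module ℂ CHat := inferInstanceAs (Module ℂ cHatSub)

lemma relD_relC {i j : ℕ} {x : RelCE} (hx : x ∈ relC (i + 1) (j + 1)) : relD x ∈ relC i j := by
  obtain ⟨y, hy, rfl⟩ := hx
  exact ⟨dCE y, dCE_bigr hy, rfl⟩

/-- The Chevalley–Eilenberg differential on `Ĉ(𝔤, 𝔬𝔰𝔭)`; it maps `C_{i+1,j+1}` to `C_{ij}`. -/
def dHat : CHat →ₗ[ℂ] CHat where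
  toFun x := ⟨fun i j => relD (x.1 (i + 1) (j + 1)), fun _ _ => relD_relC (x.2 _ _)⟩
  map_add' x y := Subtype.ext (funext fun i => funext fun j =>
    relD.map_add (x.1 (i + 1) (j + 1)) (y.1 (i + 1) (j + 1)))
  map_smul' c x := Subtype.ext (funext fun i => funext fun j =>
    relD.map_smul c (x.1 (i + 1) (j + 1)))

/-- The homology of `Ĉ(𝔤, 𝔬𝔰𝔭)`: cycles modulo boundaries. -/
abbrev HHat : Type := LinearMap.ker dHat ⧸ (LinearMap.range dHat).submoduleOf (LinearMap.ker dHat)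

/-- The series `∑_{k ≥ 3} H_k t^k` of chains of exterior degree one. -/
def genSer (H : ℕ → FA Letter) : PowerSeries (FA Word) :=
  PowerSeries.mk fun k => if 3 ≤ k then emb (H k) else 0

lemma genSer_pow {H : ℕ → FA Letter} (hH : ∀ k, H k ∈ lenSub k) (i k : ℕ) :
    PowerSeries.coeff k (genSer H ^ i) ∈ bigr i k := by
  induction i generalizing k with
  | zero =>
    rw [pow_zero, PowerSeries.coeff_one]
    split_ifs with h
    · subst h; exact Submodule.subset_span ⟨[], ⟨rfl, rfl, by simp⟩, rfl⟩
    · exact zero_mem _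
  | succ i ih =>
    rw [pow_succ, PowerSeries.coeff_mul]
    refine Submodule.sum_mem _ fun p hp => ?_
    rw [← Finset.HasAntidiagonal.mem_antidiagonal.1 hp]
    refine bigr_mul (ih _) ?_
    rw [genSer, PowerSeries.coeff_mk]
    split_ifs with h
    · exact emb_bigr h (hH _)
    · exact zero_mem _

/-- `exp(H) = ∑ᵢ (1/i!) H ∧ … ∧ H` for `H = ∑_{k ≥ 3} H_k` with `H_k` a combination of words of
length `k`. -/
def expC (H : ℕ → FA Letter) (hH : ∀ k, H k ∈ lenSub k) : CHat :=
  ⟨fun i j => ceR.mkQ ((i.factorial : ℂ)⁻¹ • PowerSeries.coeff (2 * j) (genSer H ^ i)),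
    fun i j => ⟨_, Submodule.smul_mem _ _ (genSer_pow hH i (2 * j)), rfl⟩⟩

/-! ### Completed tensor algebras -/

open TensorAlgebra

/-- A `ℤ/2`-grading on a complex vector space, given by the parity involution: `inv` is `1` on the even
part and `-1` on the odd part. -/
class SuperSpace (V : Type*) [AddCommGroup V] [Module ℂ V] where
  inv : V →ₗ[ℂ] V
  inv_inv : ∀ v, inv (inv v) = v

/-- The parity involution. -/
abbrev sinv {V : Type*} [AddCommGroup V] [Module ℂ V] [SuperSpace V] : V →ₗ[ℂ] V := SuperSpace.inv

section That

variable (V : Type*) [AddCommGroup V] [Module ℂ V]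

/-- The tensors of degree `n`, i.e. `V^{⊗ n}`, in the tensor algebra. -/
def gr (n : ℕ) : Submodule ℂ (TensorAlgebra ℂ V) := (LinearMap.range (ι ℂ : V →ₗ[ℂ] _)) ^ n

/-- The completed tensor algebra `T̂(V) = ∏ₙ V^{⊗ n}`, as an algebra of formal series whose coefficient
of index `n` is a tensor of degree `n`. -/
def That : Subalgebra ℂ (PowerSeries (TensorAlgebra ℂ V)) where
  carrier := {f | ∀ n, PowerSeries.coeff n f ∈ gr V n}
  mul_mem' {f g} hf hg n := by
    rw [PowerSeries.coeff_mul]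
    refine Submodule.sum_mem _ fun p hp => ?_
    rw [← Finset.HasAntidiagonal.mem_antidiagonal.1 hp, gr, pow_add]
    exact Submodule.mul_mem_mul (hf _) (hg _)
  add_mem' {f g} hf hg n := by rw [map_add]; exact add_mem (hf n) (hg n)
  algebraMap_mem' r n := by
    rw [PowerSeries.algebraMap_apply, PowerSeries.coeff_C]
    split_ifs with h
    · subst h; rw [gr, pow_zero]; exact Submodule.algebraMap_mem r
    · exact zero_mem _

variable {V}

/-- The component of tensor degree `n` of an element of `T̂(V)`. -/
def tc (n : ℕ) : That V →ₗ[ℂ] TensorAlgebra ℂ V where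
  toFun f := PowerSeries.coeff n f.1
  map_add' f g := by simp
  map_smul' c f := by
    change PowerSeries.coeff n (c • f.1) = c • PowerSeries.coeff n f.1
    rw [Algebra.smul_def, PowerSeries.algebraMap_apply, PowerSeries.coeff_C_mul,
      Algebra.smul_def]

lemma tc_mem (n : ℕ) (f : That V) : tc n f ∈ gr V n := f.2 n

lemma That.ext' {f g : That V} (h : ∀ n, tc n f = tc n g) : f = g :=
  Subtype.ext (PowerSeries.ext h)

lemma tc_mul (n : ℕ) (f g : That V) :
    tc n (f * g) = ∑ p ∈ Finset.HasAntidiagonal.antidiagonal n, tc p.1 f * tc p.2 g :=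
  PowerSeries.coeff_mul n f.1 g.1

/-- The linear map to `T̂(V)` with given components. -/
def tmk {M : Type*} [AddCommGroup M] [Module ℂ M] (F : ℕ → M →ₗ[ℂ] TensorAlgebra ℂ V)
    (hF : ∀ n x, F n x ∈ gr V n) : M →ₗ[ℂ] That V where
  toFun x := ⟨PowerSeries.mk fun n => F n x, fun n => by rw [PowerSeries.coeff_mk]; exact hF n x⟩
  map_add' x y := That.ext' fun n => by
    rw [map_add]
    simp [tc]
  map_smul' c x := That.ext' fun n => by
    rw [map_smul]
    simp [tc]

lemma tc_tmk {M : Type*} [AddCommGroup M] [Module ℂ M] (F : ℕ → M →ₗ[ℂ] TensorAlgebra ℂ V)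
    (hF : ∀ n x, F n x ∈ gr V n) (n : ℕ) (x : M) : tc n (tmk F hF x) = F n x :=
  PowerSeries.coeff_mk n fun n => F n x

/-- The inclusion `V → T̂(V)`. -/
def tι : V →ₗ[ℂ] That V :=
  tmk (fun n => if n = 1 then ι ℂ else 0) fun n x => by
    split_ifs with h
    · subst h; rw [gr, pow_one]; exact ⟨x, rfl⟩
    · exact zero_mem _

/-- The inclusion `T(V) → T̂(V)`. -/
def temb : TensorAlgebra ℂ V →ₐ[ℂ] That V := lift ℂ tι

/-- The homomorphism of tensor algebras induced by a linear map. -/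
def tmap {W : Type*} [AddCommGroup W] [Module ℂ W] (φ : V →ₗ[ℂ] W) :
    TensorAlgebra ℂ V →ₐ[ℂ] TensorAlgebra ℂ W := lift ℂ (ι ℂ ∘ₗ φ)

lemma tmap_gr {W : Type*} [AddCommGroup W] [Module ℂ W] (φ : V →ₗ[ℂ] W) {n : ℕ}
    {x : TensorAlgebra ℂ V} (hx : x ∈ gr V n) : tmap φ x ∈ gr W n := by
  have h1 : (gr V n).map (tmap φ).toLinearMap ≤ gr W n := by
    rw [gr, Submodule.map_pow, gr]
    refine pow_le_pow_left' ?_ n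
    rintro _ ⟨_, ⟨v, rfl⟩, rfl⟩
    exact ⟨φ v, by simp [tmap]⟩
  exact h1 ⟨x, hx, rfl⟩

/-- The homomorphism of completed tensor algebras induced by a linear map. -/
def hmap {W : Type*} [AddCommGroup W] [Module ℂ W] (φ : V →ₗ[ℂ] W) : That V →ₐ[ℂ] That W where
  toFun f := ⟨PowerSeries.map (tmap φ).toRingHom f.1, fun n => by
    rw [PowerSeries.coeff_map]; exact tmap_gr φ (f.2 n)⟩
  map_one' := Subtype.ext (map_one _)
  map_mul' f g := Subtype.ext (map_mul _ _ _)
  map_zero' := Subtype.ext (map_zero _)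
  map_add' f g := Subtype.ext (map_add _ _ _)
  commutes' r := Subtype.ext (by
    change PowerSeries.map (tmap φ).toRingHom (algebraMap ℂ _ r) = algebraMap ℂ _ r
    rw [PowerSeries.algebraMap_apply, PowerSeries.algebraMap_apply, PowerSeries.map_C]; simp)

lemma tc_hmap {W : Type*} [AddCommGroup W] [Module ℂ W] (φ : V →ₗ[ℂ] W) (n : ℕ) (f : That V) :
    tc n (hmap φ f) = tmap φ (tc n f) :=
  PowerSeries.coeff_map (tmap φ).toRingHom n f.1

/-- Continuity of a linear map for the `I`-adic topologies, where `I` is the ideal of elements with vanishing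
constant term and `I^k` consists of the elements whose components of degree less than `k` vanish. -/
def IAdicCont {W : Type*} [AddCommGroup W] [Module ℂ W] (F : That V →ₗ[ℂ] That W) : Prop :=
  ∀ k, ∃ l, ∀ f : That V, (∀ i < l, tc i f = 0) → ∀ i < k, tc i (F f) = 0

end That

section SuperThat

variable {V W : Type*} [AddCommGroup V] [Module ℂ V] [SuperSpace V]
  [AddCommGroup W] [Module ℂ W] [SuperSpace W]

/-- The parity involution of `T(V)`. -/
abbrev tsgn : TensorAlgebra ℂ V →ₐ[ℂ] TensorAlgebra ℂ V := tmap sinv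
/-- The parity involution of `T̂(V)`. So `f` has parity `p` when `hsgn f = (-1)^p f`. -/
abbrev hsgn : That V →ₐ[ℂ] That V := hmap sinv

variable (V) in
/-- The span of the supercommutators `xy - (-1)^{|x||y|} yx` in `T(V)`. -/
def sComm : Submodule ℂ (TensorAlgebra ℂ V) :=
  Submodule.span ℂ {z | ∃ (p q : ZMod 2) (x y : TensorAlgebra ℂ V),
    tsgn x = sg p • x ∧ tsgn y = sg q • y ∧ z = x * y - sg (p * q) • (y * x)}

variable (V) in
/-- The closure of the span of the supercommutators in `T̂(V)` (supercommutators are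
homogeneous for the tensor degree). -/
def hComm : Submodule ℂ (That V) := ⨅ n, (sComm V).comap (tc n)

lemma mem_hComm {f : That V} : f ∈ hComm V ↔ ∀ n, tc n f ∈ sComm V := by
  simp [hComm]

lemma tc_hsgn {f : That V} {p : ZMod 2} (h : hsgn f = sg p • f) (n : ℕ) :
    tsgn (tc n f) = sg p • tc n f := by
  rw [← tc_hmap, h, map_smul]

lemma comm_mem_hComm {f g : That V} {p q : ZMod 2} (hf : hsgn f = sg p • f)
    (hg : hsgn g = sg q • g) : f * g - sg (p * q) • (g * f) ∈ hComm V := by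
  rw [mem_hComm]
  intro n
  rw [map_sub, map_smul, tc_mul, tc_mul, ← Finset.Nat.sum_antidiagonal_swap, Finset.smul_sum,
    ← Finset.sum_sub_distrib]
  refine Submodule.sum_mem _ fun i _ => ?_
  exact Submodule.subset_span ⟨p, q, _, _, tc_hsgn hf _, tc_hsgn hg _, rfl⟩

/-! ### Derivations and homomorphisms -/

/-- The `p`-th power of the parity involution of `V`. -/
def spow (p : ZMod 2) : V →ₗ[ℂ] V := if p = 0 then LinearMap.id else sinv

/-- The `p`-th power of the parity involution of `T̂(V)`: multiplies `f` by `(-1)^{p|f|}`. -/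
def hsgnPow (p : ZMod 2) : That V →ₐ[ℂ] That V := hmap (spow p)

/-- An auxiliary homomorphism into upper triangular matrices. Its upper right corner is a
superderivation of parity `p`. -/
def derMat (p : ZMod 2) (δ : V →ₗ[ℂ] That V) :
    TensorAlgebra ℂ V →ₐ[ℂ] Matrix (Fin 2) (Fin 2) (That V) :=
  lift ℂ
    { toFun := fun v => !![tι (spow p v), δ v; 0, tι v]
      map_add' := fun v w => by ext i j; fin_cases i <;> fin_cases j <;> simp
      map_smul' := fun c v => by ext i j; fin_cases i <;> fin_cases j <;> simp }

/-- The superderivation `T(V) → T̂(V)` of parity `p` that extends `δ`. -/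
def derT (p : ZMod 2) (δ : V →ₗ[ℂ] That V) : TensorAlgebra ℂ V →ₗ[ℂ] That V where
  toFun x := derMat p δ x 0 1
  map_add' x y := by simp
  map_smul' c x := by simp

/-- The continuous superderivation of `T̂(V)` of parity `p` that extends `δ : V → T̂(V)`. A derivation
lowers the tensor degree by at most one, so the sum is the whole component of degree `k`. -/
def derHat (p : ZMod 2) (δ : V →ₗ[ℂ] That V) : That V →ₗ[ℂ] That V :=
  tmk (fun k => ∑ n ∈ Finset.range (k + 2), tc k ∘ₗ derT p δ ∘ₗ tc n) fun k f => by
    rw [LinearMap.sum_apply]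
    exact Submodule.sum_mem _ fun n _ => tc_mem _ _

/-- The continuous homomorphism `T̂(V) → T̂(W)` that extends a linear map `η : V → T̂(W)` whose values have no
constant term. -/
def homHat (η : V →ₗ[ℂ] That W) : That V →ₗ[ℂ] That W :=
  tmk (fun k => ∑ n ∈ Finset.range (k + 1), tc k ∘ₗ (lift ℂ η).toLinearMap ∘ₗ tc n) fun k f => by
    rw [LinearMap.sum_apply]
    exact Submodule.sum_mem _ fun n _ => tc_mem _ _

lemma derMat_10 (p : ZMod 2) (δ : V →ₗ[ℂ] That V) (x : TensorAlgebra ℂ V) :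
    derMat p δ x 1 0 = 0 := by
  induction x using TensorAlgebra.induction with
  | algebraMap r => rw [AlgHom.commutes, Matrix.algebraMap_matrix_apply]; simp
  | ι v => simp [derMat]
  | mul a b ha hb => rw [map_mul, Matrix.mul_apply, Fin.sum_univ_two, ha, hb]; simp
  | add a b ha hb => rw [map_add, Matrix.add_apply, ha, hb, add_zero]

lemma derMat_11 (p : ZMod 2) (δ : V →ₗ[ℂ] That V) (x : TensorAlgebra ℂ V) :
    derMat p δ x 1 1 = temb x := by
  induction x using TensorAlgebra.induction with
  | algebraMap r => rw [AlgHom.commutes, Matrix.algebraMap_matrix_apply, AlgHom.commutes]; simp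
  | ι v => simp [derMat, temb]
  | mul a b ha hb =>
    rw [map_mul, Matrix.mul_apply, Fin.sum_univ_two, derMat_10, ha, hb, map_mul]; simp
  | add a b ha hb => rw [map_add, Matrix.add_apply, ha, hb, map_add]

lemma derMat_00 (p : ZMod 2) (δ : V →ₗ[ℂ] That V) (x : TensorAlgebra ℂ V) :
    derMat p δ x 0 0 = temb (tmap (spow p) x) := by
  induction x using TensorAlgebra.induction with
  | algebraMap r =>
    rw [AlgHom.commutes, Matrix.algebraMap_matrix_apply, AlgHom.commutes, AlgHom.commutes]; simp
  | ι v => simp [derMat, temb, tmap]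
  | mul a b ha hb =>
    rw [map_mul, Matrix.mul_apply, Fin.sum_univ_two, derMat_10, ha, hb, map_mul, map_mul]; simp
  | add a b ha hb => rw [map_add, Matrix.add_apply, ha, hb, map_add, map_add]

lemma derT_mul (p : ZMod 2) (δ : V →ₗ[ℂ] That V) (x y : TensorAlgebra ℂ V) :
    derT p δ (x * y) = derT p δ x * temb y + temb (tmap (spow p) x) * derT p δ y := by
  simp only [derT, LinearMap.coe_mk, AddHom.coe_mk]
  rw [map_mul, Matrix.mul_apply, Fin.sum_univ_two, derMat_00, derMat_11, add_comm]

lemma derT_ι (p : ZMod 2) (δ : V →ₗ[ℂ] That V) (v : V) : derT p δ (ι ℂ v) = δ v := by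
  simp [derT, derMat]

lemma derT_algebraMap (p : ZMod 2) (δ : V →ₗ[ℂ] That V) (r : ℂ) :
    derT p δ (algebraMap ℂ _ r) = 0 := by
  simp only [derT, LinearMap.coe_mk, AddHom.coe_mk]
  rw [AlgHom.commutes, Matrix.algebraMap_matrix_apply]; simp

lemma tmap_spow {p q : ZMod 2} {x : TensorAlgebra ℂ V} (hx : tsgn x = sg q • x) :
    tmap (spow p) x = sg (p * q) • x := by
  have h : p = 0 ∨ p = 1 := by clear * -; revert p; decide
  rcases h with rfl | rfl
  · have : tmap (spow 0 : V →ₗ[ℂ] V) = AlgHom.id ℂ _ := by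
      ext v; simp [tmap, spow]
    rw [this]; simp [sg_zero]
  · rw [one_mul, ← hx]; simp [spow]

lemma hsgn_tι (v : V) : hsgn (tι v) = tι (sinv v) := by
  refine That.ext' fun n => ?_
  rw [tc_hmap, tι, tc_tmk, tc_tmk]
  split_ifs
  · simp [tmap]
  · simp

lemma hsgn_temb (x : TensorAlgebra ℂ V) : hsgn (temb x) = temb (tsgn x) := by
  have : (hsgn : That V →ₐ[ℂ] That V).comp temb = temb.comp tsgn := by
    ext v
    simp [temb, tmap, hsgn_tι]
  exact DFunLike.congr_fun this x

lemma tsgn_tsgn (x : TensorAlgebra ℂ V) : tsgn (tsgn x) = x := by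
  have : (tsgn : TensorAlgebra ℂ V →ₐ[ℂ] _).comp tsgn = AlgHom.id ℂ _ := by
    ext v; simp [tmap, SuperSpace.inv_inv]
  exact DFunLike.congr_fun this x

lemma tmap_spow_tsgn (p : ZMod 2) (x : TensorAlgebra ℂ V) :
    tmap (spow p) (tsgn x) = tsgn (tmap (spow p) x) := by
  have : (tmap (spow p : V →ₗ[ℂ] V)).comp tsgn = (tsgn).comp (tmap (spow p)) := by
    ext v
    simp only [spow]
    split_ifs <;> simp [tmap]
  exact DFunLike.congr_fun this x

/-- homogeneity of the derivation -/
lemma derT_sgn {p : ZMod 2} {δ : V →ₗ[ℂ] That V} (hδ : ∀ v, hsgn (δ v) = sg p • δ (sinv v))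
    (x : TensorAlgebra ℂ V) : hsgn (derT p δ x) = sg p • derT p δ (tsgn x) := by
  induction x using TensorAlgebra.induction with
  | algebraMap r => rw [derT_algebraMap, AlgHom.commutes, derT_algebraMap]; simp
  | ι v => rw [derT_ι, hδ, show tsgn (ι ℂ v) = ι ℂ (sinv v) by simp [tmap], derT_ι]
  | mul a b ha hb =>
    rw [derT_mul, map_add, map_mul, map_mul, ha, hb, map_mul, derT_mul, hsgn_temb, hsgn_temb,
      tmap_spow_tsgn, smul_add, smul_mul_assoc, mul_smul_comm]
  | add a b ha hb => rw [map_add, map_add, ha, hb, map_add, map_add, smul_add]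

lemma derHat_sgn {p : ZMod 2} {δ : V →ₗ[ℂ] That V} (hδ : ∀ v, hsgn (δ v) = sg p • δ (sinv v))
    (f : That V) : hsgn (derHat p δ f) = sg p • derHat p δ (hsgn f) := by
  refine That.ext' fun k => ?_
  rw [tc_hmap, map_smul, derHat, tc_tmk, tc_tmk]
  simp only [LinearMap.sum_apply, LinearMap.comp_apply, map_sum, Finset.smul_sum]
  refine Finset.sum_congr rfl fun n _ => ?_
  rw [← tc_hmap, derT_sgn hδ, map_smul, tc_hmap]

lemma derHat_comm {p : ZMod 2} {δ : V →ₗ[ℂ] That V} (hδ : ∀ v, hsgn (δ v) = sg p • δ (sinv v))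
    {f : That V} (hf : f ∈ hComm V) : derHat p δ f ∈ hComm V := by
  have key : ∀ z ∈ sComm V, derT p δ z ∈ hComm V := by
    intro z hz
    induction hz using Submodule.span_induction with
    | mem z hz =>
      obtain ⟨a, b, x, y, hx, hy, rfl⟩ := hz
      have ex : hsgn (temb x) = sg a • temb x := by rw [hsgn_temb, hx, map_smul]
      have ey : hsgn (temb y) = sg b • temb y := by rw [hsgn_temb, hy, map_smul]
      have dx : hsgn (derT p δ x) = sg (p + a) • derT p δ x := by
        rw [derT_sgn hδ, hx, map_smul, smul_smul, sg_add]
      have dy : hsgn (derT p δ y) = sg (p + b) • derT p δ y := by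
        rw [derT_sgn hδ, hy, map_smul, smul_smul, sg_add]
      have h1 := comm_mem_hComm dx ey
      have h2 := Submodule.smul_mem _ (sg (p * a)) (comm_mem_hComm ex dy)
      convert add_mem h1 h2 using 1
      rw [map_sub, map_smul, derT_mul, derT_mul, tmap_spow hx, tmap_spow hy]
      simp only [map_smul, smul_mul_assoc, smul_add, smul_sub, smul_smul, ← sg_add]
      have s1 : a * b + p * b = (p + a) * b := by ring
      have s2 : p * a + a * (p + b) = a * b := by clear * -; revert a b p; decide
      rw [s1, s2]
      abel
    | zero => rw [map_zero]; exact zero_mem _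
    | add x y _ _ hx hy => rw [map_add]; exact add_mem hx hy
    | smul c x _ hx => rw [map_smul]; exact Submodule.smul_mem _ _ hx
  rw [mem_hComm] at hf ⊢
  intro k
  rw [derHat, tc_tmk]
  simp only [LinearMap.sum_apply, LinearMap.comp_apply]
  exact Submodule.sum_mem _ fun n _ => mem_hComm.1 (key _ (hf n)) k

lemma homHat_comm {η : V →ₗ[ℂ] That W} (hη : ∀ v, hsgn (η v) = η (sinv v))
    {f : That V} (hf : f ∈ hComm V) : homHat η f ∈ hComm W := by
  have e : ∀ x, hsgn (lift ℂ η x) = lift ℂ η (tsgn x) := by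
    intro x
    have : (hsgn : That W →ₐ[ℂ] That W).comp (lift ℂ η) = (lift ℂ η).comp tsgn := by
      ext v
      simp [tmap, hη]
    exact DFunLike.congr_fun this x
  have key : ∀ z ∈ sComm V, lift ℂ η z ∈ hComm W := by
    intro z hz
    induction hz using Submodule.span_induction with
    | mem z hz =>
      obtain ⟨a, b, x, y, hx, hy, rfl⟩ := hz
      have ex : hsgn (lift ℂ η x) = sg a • lift ℂ η x := by rw [e, hx, map_smul]
      have ey : hsgn (lift ℂ η y) = sg b • lift ℂ η y := by rw [e, hy, map_smul]
      have := comm_mem_hComm ex ey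
      rwa [← map_mul, ← map_mul, ← map_smul, ← map_sub] at this
    | zero => rw [map_zero]; exact zero_mem _
    | add x y _ _ hx hy => rw [map_add]; exact add_mem hx hy
    | smul c x _ hx => rw [map_smul]; exact Submodule.smul_mem _ _ hx
  rw [mem_hComm] at hf ⊢
  intro k
  rw [homHat, tc_tmk]
  simp only [LinearMap.sum_apply, LinearMap.comp_apply]
  exact Submodule.sum_mem _ fun n _ => mem_hComm.1 (key _ (hf n)) k

lemma hmap_comm {φ : V →ₗ[ℂ] W} (hφ : ∀ v, φ (sinv v) = sinv (φ v)) {f : That V}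
    (hf : f ∈ hComm V) : hmap φ f ∈ hComm W := by
  have e : ∀ x, tsgn (tmap φ x) = tmap φ (tsgn x) := by
    intro x
    have : (tsgn : TensorAlgebra ℂ W →ₐ[ℂ] _).comp (tmap φ) = (tmap φ).comp tsgn := by
      ext v
      simp [tmap, hφ]
    exact DFunLike.congr_fun this x
  rw [mem_hComm] at hf ⊢
  intro k
  rw [tc_hmap]
  have hz := hf k
  generalize tc k f = z at hz
  induction hz using Submodule.span_induction with
  | mem z hz =>
    obtain ⟨a, b, x, y, hx, hy, rfl⟩ := hz
    refine Submodule.subset_span ⟨a, b, tmap φ x, tmap φ y, ?_, ?_, ?_⟩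
    · rw [e, hx, map_smul]
    · rw [e, hy, map_smul]
    · rw [map_sub, map_smul, map_mul, map_mul]
  | zero => rw [map_zero]; exact zero_mem _
  | add x y _ _ hx hy => rw [map_add]; exact add_mem hx hy
  | smul c x _ hx => rw [map_smul]; exact Submodule.smul_mem _ _ hx

end SuperThat


/-! ### Formal noncommutative symplectic geometry -/

section Forms

/-- The space of generators `V ⊕ ΠV` of the algebra of noncommutative forms: a pair `(v, w)` stands for
`v + dw`. -/
def FormGen (V : Type*) : Type _ := V × V

variable (V : Type*) {W : Type*} [AddCommGroup V] [Module ℂ V] [SuperSpace V]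
  [AddCommGroup W] [Module ℂ W] [SuperSpace W]

instance : AddCommGroup (FormGen V) := inferInstanceAs (AddCommGroup (V × V))
instance : Module ℂ (FormGen V) := inferInstanceAs (Module ℂ (V × V))

instance : SuperSpace (FormGen V) where
  inv :=
    { toFun := fun x => (sinv x.1, -sinv x.2)
      map_add' := fun x y => Prod.ext (map_add _ _ _)
        ((congrArg Neg.neg (map_add _ _ _)).trans (neg_add _ _))
      map_smul' := fun c x => Prod.ext (map_smul _ _ _)
        ((congrArg Neg.neg (map_smul _ _ _)).trans (smul_neg _ _).symm) }
  inv_inv x := Prod.ext (SuperSpace.inv_inv _)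
    (show -sinv (-sinv x.2) = x.2 by rw [map_neg, neg_neg]; exact SuperSpace.inv_inv _)

variable {V}

/-- The generator `v`. -/
def gen : V →ₗ[ℂ] FormGen V := LinearMap.inl ℂ V V

/-- The generator `dv`, of parity opposite to that of `v`. -/
def dgen : V →ₗ[ℂ] FormGen V := LinearMap.inr ℂ V V

/-- The linear map `v + dw ↦ v`. -/
def fstL : FormGen V →ₗ[ℂ] V := LinearMap.fst ℂ V V
/-- The linear map `v + dw ↦ w`. -/
def sndL : FormGen V →ₗ[ℂ] V := LinearMap.snd ℂ V V

lemma sinv_gen (v : V) : sinv (gen v) = gen (sinv v) :=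
  Prod.ext rfl (show -sinv (0 : V) = 0 by simp)

lemma sinv_dgen (v : V) : sinv (dgen v) = -dgen (sinv v) :=
  Prod.ext (show sinv (0 : V) = -0 by simp) rfl

lemma fstL_sinv (x : FormGen V) : fstL (sinv x) = sinv (fstL x) := rfl

lemma sndL_sinv (x : FormGen V) : sndL (sinv x) = -sinv (sndL x) := rfl

variable (V) in
/-- The completed algebra of noncommutative differential forms on `V`: freely generated by the symbols `v` and
`dv`, for `v` in `V`. -/
abbrev OmegaHat : Type _ := That (FormGen V)

/-- The de Rham differential `v ↦ dv`, `dv ↦ 0`, on noncommutative forms. -/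
def omD : OmegaHat V →ₗ[ℂ] OmegaHat V := derHat 1 (tι ∘ₗ dgen ∘ₗ fstL)

lemma omD_par (x : FormGen V) : hsgn ((tι ∘ₗ dgen ∘ₗ fstL : FormGen V →ₗ[ℂ] OmegaHat V) x) =
    sg 1 • (tι ∘ₗ dgen ∘ₗ fstL : FormGen V →ₗ[ℂ] OmegaHat V) (sinv x) := by
  simp only [LinearMap.comp_apply, hsgn_tι, sinv_dgen, fstL_sinv, map_neg, sg_one, neg_smul,
    one_smul]

lemma hsgn_omD (f : OmegaHat V) : hsgn (omD f) = -omD (hsgn f) := by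
  rw [omD, derHat_sgn omD_par, sg_one, neg_smul, one_smul]

variable (V) in
/-- The completed noncommutative de Rham complex: forms modulo (the closure of) supercommutators. -/
abbrev DR : Type _ := OmegaHat V ⧸ hComm (FormGen V)

variable (V) in
/-- The noncommutative `0`-forms (functions) `T̂(V)/[T̂(V), T̂(V)]`. -/
abbrev DR0 : Type _ := That V ⧸ hComm V

/-- The de Rham differential. -/
def drD : DR V →ₗ[ℂ] DR V :=
  (hComm (FormGen V)).mapQ _ omD fun _ h => derHat_comm omD_par h

/-- Elements of `T̂(V)` as noncommutative forms. -/
def fn : That V →ₗ[ℂ] OmegaHat V := (hmap gen).toLinearMap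

lemma hsgn_fn (f : That V) : hsgn (fn f) = fn (hsgn f) := by
  refine That.ext' fun n => ?_
  change tc n (hsgn (hmap gen f)) = tc n (hmap gen (hsgn f))
  rw [tc_hmap, tc_hmap, tc_hmap, tc_hmap]
  have : (tsgn : TensorAlgebra ℂ (FormGen V) →ₐ[ℂ] _).comp (tmap gen) = (tmap gen).comp tsgn := by
    ext v
    simp [tmap, sinv_gen]
  exact DFunLike.congr_fun this _

/-- The map from the `0`-forms to the de Rham complex. -/
def drFn : DR0 V →ₗ[ℂ] DR V :=
  (hComm V).mapQ _ fn fun _ h => hmap_comm (fun v => (sinv_gen v).symm) h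

variable (V) in
/-- A formal vector field of parity `p`: a continuous superderivation of parity `p` of `T̂(V)`. -/
@[ext] structure VField (p : ZMod 2) where
  toFun : That V →ₗ[ℂ] That V
  leibniz : ∀ f g, toFun (f * g) = toFun f * g + hsgnPow p f * toFun g
  parity : ∀ f, hsgn (toFun f) = sg p • toFun (hsgn f)
  cont : IAdicCont toFun

variable {p : ZMod 2}

/-- The values `i_ξ(v) = 0`, `i_ξ(dv) = ξ(v)` on generators. -/
def VField.iGen (ξ : VField V p) : FormGen V →ₗ[ℂ] OmegaHat V := fn ∘ₗ ξ.toFun ∘ₗ tι ∘ₗ sndL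

lemma VField.iGen_par (ξ : VField V p) (x : FormGen V) :
    hsgn (ξ.iGen x) = sg (p + 1) • ξ.iGen (sinv x) := by
  simp only [VField.iGen, LinearMap.comp_apply, hsgn_fn, ξ.parity, hsgn_tι, sndL_sinv, map_neg,
    map_smul, sg_add, sg_one, mul_neg, mul_one, neg_smul, smul_neg, neg_neg]

/-- The contraction operator `i_ξ` on the de Rham complex. -/
def VField.contract (ξ : VField V p) : DR V →ₗ[ℂ] DR V :=
  (hComm (FormGen V)).mapQ _ (derHat (p + 1) ξ.iGen) fun _ h => derHat_comm ξ.iGen_par h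

/-- The values `L_ξ(v) = ξ(v)`, `L_ξ(dv) = (-1)^{|ξ|} d(ξ(v))` on generators. -/
def VField.lGen (ξ : VField V p) : FormGen V →ₗ[ℂ] OmegaHat V :=
  fn ∘ₗ ξ.toFun ∘ₗ tι ∘ₗ fstL + sg p • (omD ∘ₗ fn ∘ₗ ξ.toFun ∘ₗ tι ∘ₗ sndL)

lemma VField.lGen_par (ξ : VField V p) (x : FormGen V) :
    hsgn (ξ.lGen x) = sg p • ξ.lGen (sinv x) := by
  simp only [VField.lGen, LinearMap.add_apply, LinearMap.smul_apply, LinearMap.comp_apply, map_add,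
    map_smul, hsgn_fn, hsgn_omD, ξ.parity, hsgn_tι, fstL_sinv, sndL_sinv, map_neg, smul_add,
    smul_neg]

/-- The Lie derivative `L_ξ` on the de Rham complex. -/
def VField.lie (ξ : VField V p) : DR V →ₗ[ℂ] DR V :=
  (hComm (FormGen V)).mapQ _ (derHat p ξ.lGen) fun _ h => derHat_comm ξ.lGen_par h

variable (V W) in
/-- An even continuous algebra homomorphism `T̂(V) → T̂(W)`. -/
structure FMorph where
  toAlgHom : That V →ₐ[ℂ] That W
  even : ∀ f, hsgn (toAlgHom f) = toAlgHom (hsgn f)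
  cont : IAdicCont toAlgHom.toLinearMap

/-- The values `φ^*(v) = φ(v)`, `φ^*(dv) = d(φ(v))` on generators. They have no constant term, since a
continuous homomorphism maps the ideal `I` (topologically nilpotent elements) into `I`. -/
def FMorph.pGen (φ : FMorph V W) : FormGen V →ₗ[ℂ] OmegaHat W :=
  fn ∘ₗ φ.toAlgHom.toLinearMap ∘ₗ tι ∘ₗ fstL + omD ∘ₗ fn ∘ₗ φ.toAlgHom.toLinearMap ∘ₗ tι ∘ₗ sndL

lemma FMorph.pGen_par (φ : FMorph V W) (x : FormGen V) :
    hsgn (φ.pGen x) = φ.pGen (sinv x) := by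
  simp only [FMorph.pGen, LinearMap.add_apply, LinearMap.comp_apply, map_add, hsgn_fn, hsgn_omD,
    AlgHom.toLinearMap_apply, φ.even, hsgn_tι, fstL_sinv, sndL_sinv, map_neg]

/-- The induced map `φ^*` of de Rham complexes. -/
def FMorph.pull (φ : FMorph V W) : DR V →ₗ[ℂ] DR W :=
  (hComm (FormGen V)).mapQ _ (homHat φ.pGen) fun _ h => homHat_comm φ.pGen_par h

/-- The homomorphism induced by an even linear map. -/
def FMorph.ofLinear (φ : V →ₗ[ℂ] W) (hφ : ∀ v, φ (sinv v) = sinv (φ v)) : FMorph V W where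
  toAlgHom := hmap φ
  even f := by
    refine That.ext' fun n => ?_
    rw [tc_hmap, tc_hmap, tc_hmap, tc_hmap]
    have : (tsgn : TensorAlgebra ℂ W →ₐ[ℂ] _).comp (tmap φ) = (tmap φ).comp tsgn := by
      ext v
      simp [tmap, hφ]
    exact DFunLike.congr_fun this _
  cont k := ⟨k, fun f hf i hi => by
    rw [AlgHom.toLinearMap_apply, tc_hmap, hf i hi, map_zero]⟩

/-- The map on `0`-forms induced by an even linear map. -/
def pull0 (φ : V →ₗ[ℂ] W) (hφ : ∀ v, φ (sinv v) = sinv (φ v)) : DR0 V →ₗ[ℂ] DR0 W :=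
  (hComm V).mapQ _ (hmap φ).toLinearMap fun _ h => hmap_comm hφ h

variable (V) in
/-- The span of the products of generators with exactly `r` factors of the form `dv`. -/
def tForm (r : ℕ) : Submodule ℂ (TensorAlgebra ℂ (FormGen V)) :=
  Submodule.span ℂ {z | ∃ l : List (V ⊕ V), l.countP Sum.isRight = r ∧
    z = (l.map (Sum.elim (fun v => ι ℂ (gen v)) (fun v => ι ℂ (dgen v)))).prod}

variable (V) in
/-- The noncommutative forms of form degree `r`. -/
def omForm (r : ℕ) : Submodule ℂ (OmegaHat V) := ⨅ n, (tForm V r).comap (tc n)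

variable (V) in
/-- The `r`-forms in the de Rham complex. -/
def drForm (r : ℕ) : Submodule ℂ (DR V) := (omForm V r).map (hComm (FormGen V)).mkQ

variable (V) in
/-- The `r`-forms of order `k`: the coefficients, apart from the `r` factors `dv`, have total degree `k`.
In particular a `2`-form of order zero is a combination of terms `dv dw`. -/
def drOrd (r k : ℕ) : Submodule ℂ (DR V) :=
  (omForm V r ⊓ ⨅ n, ⨅ _ : n ≠ r + k, LinearMap.ker (tc n)).map (hComm (FormGen V)).mkQ

variable (V) in
/-- The forms of (total) parity `p`. -/
def drPar (p : ZMod 2) : Submodule ℂ (DR V) :=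
  (LinearMap.ker ((hsgn : OmegaHat V →ₐ[ℂ] OmegaHat V).toLinearMap - sg p • LinearMap.id)).map
    (hComm (FormGen V)).mkQ

/-- Even symplectic forms: even closed `2`-forms such that `ξ ↦ i_ξ ω` is a bijection from the vector fields
onto the `1`-forms. As `ω` is even, the map takes vector fields of parity `p` to `1`-forms of parity
`p + 1`, and bijectivity is stated on each parity. -/
structure IsEvenSymplectic (ω : DR V) : Prop where
  form : ω ∈ drForm V 2
  even : ω ∈ drPar V 0
  closed : drD ω = 0
  nondeg : ∀ (p : ZMod 2), ∀ α ∈ drForm V 1 ⊓ drPar V (p + 1),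
    ∃! ξ : VField V p, ξ.contract ω = α

end Forms

section Std

/-- The superspace `ℂ^{2n|m}` with its coordinates `pᵢ, qᵢ` (even) and `xᵢ` (odd). -/
def Std (n m : ℕ) : Type := Fin n ⊕ Fin n ⊕ Fin m → ℂ

instance (n m : ℕ) : AddCommGroup (Std n m) := inferInstanceAs (AddCommGroup (_ → ℂ))
instance (n m : ℕ) : Module ℂ (Std n m) := inferInstanceAs (Module ℂ (_ → ℂ))

/-- The canonical basis of `ℂ^{2n|m}` inside that of `ℂ^{2∞|∞}`. -/
def stdLetter (n m : ℕ) : Fin n ⊕ Fin n ⊕ Fin m → Letter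
  | .inl i => .p i
  | .inr (.inl i) => .q i
  | .inr (.inr i) => .x i

instance (n m : ℕ) : SuperSpace (Std n m) where
  inv :=
    { toFun := fun v i => sg (par (stdLetter n m i)) * v i
      map_add' := fun v w => funext fun i => mul_add _ (v i) (w i)
      map_smul' := fun c v => funext fun i => mul_left_comm _ c (v i) }
  inv_inv v := funext fun i => by
    change sg _ * (sg _ * v i) = v i
    rw [← mul_assoc, sg_sq, one_mul]

/-- The canonical basis vectors. -/
def stdB {n m : ℕ} (i : Fin n ⊕ Fin n ⊕ Fin m) : Std n m := Pi.single i 1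

/-- The canonical symplectic form `∑ dpᵢ dqᵢ + ½ ∑ dxᵢ dxᵢ`. -/
def stdOmega (n m : ℕ) : DR (Std n m) :=
  (hComm (FormGen (Std n m))).mkQ
    (∑ i : Fin n, tι (dgen (stdB (.inl i))) * tι (dgen (stdB (.inr (.inl i)))) +
      (1 / 2 : ℂ) • ∑ i : Fin m,
        tι (dgen (stdB (.inr (.inr i)))) * tι (dgen (stdB (.inr (.inr i)))))

/-- Expansion of tensors on `ℂ^{2n|m}` in words in the canonical basis. -/
def coordT (n m : ℕ) : TensorAlgebra ℂ (Std n m) →ₐ[ℂ] FA Letter :=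
  lift ℂ
    { toFun := fun v => ∑ i, v i • wd [stdLetter n m i]
      map_add' := fun v w => by
        rw [← Finset.sum_add_distrib]
        exact Finset.sum_congr rfl fun i _ => add_smul (v i) (w i) _
      map_smul' := fun c v => by
        rw [Finset.smul_sum]
        exact Finset.sum_congr rfl fun i _ => mul_smul c (v i) _ }

lemma lenSub_mul {α : Type} {j k : ℕ} {x y : FA α} (hx : x ∈ lenSub j) (hy : y ∈ lenSub k) :
    x * y ∈ lenSub (j + k) := by
  induction hx using Submodule.span_induction with
  | mem x hx =>
    obtain ⟨l, rfl, rfl⟩ := hx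
    induction hy using Submodule.span_induction with
    | mem y hy =>
      obtain ⟨l', rfl, rfl⟩ := hy
      rw [wd_mul]; exact Submodule.subset_span ⟨_, by simp, rfl⟩
    | zero => rw [mul_zero]; exact zero_mem _
    | add x y _ _ hx hy => rw [mul_add]; exact add_mem hx hy
    | smul c x _ hx => rw [mul_smul_comm]; exact Submodule.smul_mem _ _ hx
  | zero => rw [zero_mul]; exact zero_mem _
  | add x y _ _ hx hy => rw [add_mul]; exact add_mem hx hy
  | smul c x _ hx => rw [smul_mul_assoc]; exact Submodule.smul_mem _ _ hx

lemma coordT_len (n m : ℕ) {k : ℕ} {x : TensorAlgebra ℂ (Std n m)} (hx : x ∈ gr (Std n m) k) :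
    coordT n m x ∈ lenSub k := by
  rw [gr] at hx
  induction hx using Submodule.pow_induction_on_left' with
  | algebraMap r =>
    rw [AlgHom.commutes, Algebra.algebraMap_eq_smul_one]
    exact Submodule.smul_mem _ _ (Submodule.subset_span ⟨[], rfl, rfl⟩)
  | add x y i hx hy ihx ihy => rw [map_add]; exact add_mem ihx ihy
  | mem_mul v hv i x hx ih =>
    obtain ⟨v, rfl⟩ := hv
    rw [map_mul, Nat.succ_eq_one_add]
    refine lenSub_mul ?_ ih
    rw [coordT, lift_ι_apply]
    change (∑ i, v i • wd [stdLetter n m i]) ∈ lenSub 1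
    exact Submodule.sum_mem _ fun i _ =>
      Submodule.smul_mem _ _ (Submodule.subset_span ⟨[_], rfl, rfl⟩)

/-- `exp(f)` in `Ĉ(𝔤, 𝔬𝔰𝔭)`, for a representative `f` of a Hamiltonian on `ℂ^{2n|m}` without terms of order
less than three (such terms would be discarded). -/
def expHam {n m : ℕ} (f : That (Std n m)) : CHat :=
  expC (fun k => coordT n m (tc k f)) fun k => coordT_len n m (tc_mem k f)

end Std

section AInf

/-- The superspace `ΠU^*`: the dual space with reversed parity. -/
def PiDual (U : Type u) [AddCommGroup U] [Module ℂ U] : Type u := Module.Dual ℂ U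

variable (U : Type u) [AddCommGroup U] [Module ℂ U]

instance : AddCommGroup (PiDual U) := inferInstanceAs (AddCommGroup (Module.Dual ℂ U))
instance : Module ℂ (PiDual U) := inferInstanceAs (Module ℂ (Module.Dual ℂ U))

instance [SuperSpace U] : SuperSpace (PiDual U) where
  inv := -(LinearMap.lcomp ℂ ℂ (sinv : U →ₗ[ℂ] U) : Module.Dual ℂ U →ₗ[ℂ] Module.Dual ℂ U)
  inv_inv f := by
    have h : ∀ g : Module.Dual ℂ U, -((-(g ∘ₗ sinv)) ∘ₗ sinv) = g := fun g =>
      LinearMap.ext fun u => by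
        rw [LinearMap.neg_apply, LinearMap.comp_apply, LinearMap.neg_apply, LinearMap.comp_apply,
          neg_neg]
        exact congrArg g (SuperSpace.inv_inv u)
    exact h f

/-- Minimal symplectic `A_∞`-algebras with even symplectic form: a finite-dimensional superspace
`U`, an even symplectic form `ω` on `ΠU^*`, and an odd symplectic vector field `m` on
`T̂(ΠU^*)` that vanishes at zero, has no linear part (minimality) and satisfies `m² = 0`. -/
structure MinSympAInf where
  U : Type u
  [grp : AddCommGroup U]
  [mod : Module ℂ U]
  [fin : FiniteDimensional ℂ U]
  [sup : SuperSpace U]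
  ω : DR (PiDual U)
  symp : IsEvenSymplectic ω
  m : VField (PiDual U) 1
  m_zero : ∀ v, tc 0 (m.toFun (tι v)) = 0
  m_min : ∀ v, tc 1 (m.toFun (tι v)) = 0
  m_sq : ∀ f, m.toFun (m.toFun f) = 0
  m_symp : m.lie ω = 0

attribute [instance] MinSympAInf.grp MinSympAInf.mod MinSympAInf.fin MinSympAInf.sup

namespace MinSympAInf

/-- The superspace `ΠU^*`. -/
abbrev V (A : MinSympAInf.{u}) : Type u := PiDual A.U

/-- The symplectic form has order zero. -/
def OrderZero (A : MinSympAInf.{u}) : Prop := A.ω ∈ drOrd A.V 2 0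

/-- Symplectic `A_∞`-morphisms from `A` to `B`. -/
structure Hom (A B : MinSympAInf.{u}) where
  φ : FMorph B.V A.V
  comm : ∀ f, φ.toAlgHom (B.m.toFun f) = A.m.toFun (φ.toAlgHom f)
  symp : φ.pull B.ω = A.ω

/-- Isomorphism of minimal symplectic `A_∞`-algebras: a symplectic `A_∞`-morphism with an inverse. -/
def Iso (A B : MinSympAInf.{u}) : Prop :=
  ∃ (f : Hom A B) (g : Hom B A), (∀ x, f.φ.toAlgHom (g.φ.toAlgHom x) = x) ∧
    ∀ x, g.φ.toAlgHom (f.φ.toAlgHom x) = x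

/-- `h` is the Hamiltonian: `dh = i_m ω`, and `h` has vanishing constant term. -/
def IsHamiltonian (A : MinSympAInf.{u}) (h : DR0 A.V) : Prop :=
  drD (drFn h) = A.m.contract A.ω ∧ ∃ f : That A.V, tc 0 f = 0 ∧ (hComm A.V).mkQ f = h

/-- A linear symplectomorphism from `ΠU^*` to the canonical symplectic superspace `ℂ^{2n|m}`. -/
structure Frame (A : MinSympAInf.{u}) (n m : ℕ) where
  φ : A.V ≃ₗ[ℂ] Std n m
  even : ∀ v, φ (sinv v) = sinv (φ v)
  symp : (FMorph.ofLinear φ.toLinearMap even).pull A.ω = stdOmega n m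

/-- `c = exp(h′)`, where `h′` is the image of the Hamiltonian under some linear symplectomorphism onto
`ℂ^{2n|m}`. (By minimality `h′` has only terms of order at least three.) -/
def IsCharClass (A : MinSympAInf.{u}) (c : CHat) : Prop :=
  ∃ (h : DR0 A.V) (n m : ℕ) (F : Frame A n m) (f : That (Std n m)), A.IsHamiltonian h ∧
    (hComm (Std n m)).mkQ f = pull0 F.φ.toLinearMap F.even h ∧ c = expHam f

end MinSympAInf

end AInf

end SympAInf

end

open SympAInf SympAInf.MinSympAInf

noncomputable section
namespace SympAInf
open TensorAlgebra Letter
open scoped TensorProduct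
open Finset.HasAntidiagonal (antidiagonal)

set_option linter.unusedSectionVars false

section Filtration

variable {V W X : Type*} [AddCommGroup V] [Module ℂ V] [AddCommGroup W] [Module ℂ W]
  [AddCommGroup X] [Module ℂ X]

variable (V) in
/-- The `k`-th power of the augmentation ideal: series without components of degree `< k`. -/
def ordSub (k : ℕ) : Submodule ℂ (That V) := ⨅ i, ⨅ _ : i < k, LinearMap.ker (tc i)

lemma mem_ordSub {k : ℕ} {f : That V} : f ∈ ordSub V k ↔ ∀ i < k, tc i f = 0 := by
  simp [ordSub]

lemma ordSub_anti {j k : ℕ} (h : j ≤ k) : ordSub V k ≤ ordSub V j := fun _ hf =>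
  mem_ordSub.2 fun i hi => mem_ordSub.1 hf i (hi.trans_le h)

lemma ordSub_zero : ordSub V 0 = ⊤ := top_unique fun _ _ => mem_ordSub.2 fun _ h => absurd h (by simp)

lemma mem_ordSub_zero (f : That V) : f ∈ ordSub V 0 := by rw [ordSub_zero]; trivial

lemma mul_mem_ordSub {j k : ℕ} {f g : That V} (hf : f ∈ ordSub V j) (hg : g ∈ ordSub V k) :
    f * g ∈ ordSub V (j + k) := by
  rw [mem_ordSub] at *
  intro i hi
  rw [tc_mul]
  refine Finset.sum_eq_zero fun p hp => ?_
  have hp' := Finset.HasAntidiagonal.mem_antidiagonal.1 hp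
  by_cases h : p.1 < j
  · rw [hf _ h, zero_mul]
  · rw [hg p.2 (by omega), mul_zero]

lemma eq_of_sub_mem_ordSub {f g : That V} (h : ∀ k, f - g ∈ ordSub V k) : f = g :=
  That.ext' fun n => sub_eq_zero.1 (by
    rw [← map_sub]; exact mem_ordSub.1 (h (n + 1)) n n.lt_succ_self)

lemma eq_zero_of_mem_ordSub {f : That V} (h : ∀ k, f ∈ ordSub V k) : f = 0 :=
  eq_of_sub_mem_ordSub fun k => by rw [sub_zero]; exact h k

lemma tc_one (n : ℕ) : tc n (1 : That V) = if n = 0 then 1 else 0 := PowerSeries.coeff_one n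

lemma tc_algebraMap (n : ℕ) (r : ℂ) :
    tc n (algebraMap ℂ (That V) r) = if n = 0 then algebraMap ℂ _ r else 0 := by
  rw [Algebra.algebraMap_eq_smul_one, map_smul, tc_one]
  split_ifs <;> simp [Algebra.algebraMap_eq_smul_one]

lemma tc_tι (n : ℕ) (v : V) : tc n (tι v) = if n = 1 then ι ℂ v else 0 := by
  rw [tι, tc_tmk]; split_ifs <;> simp

lemma temb_ι (v : V) : temb (ι ℂ v) = tι v := by simp [temb]

lemma ι_mem_gr (v : V) : ι ℂ v ∈ gr V 1 := by rw [gr, pow_one]; exact ⟨v, rfl⟩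

lemma gr_mul {j k : ℕ} {x y : TensorAlgebra ℂ V} (hx : x ∈ gr V j) (hy : y ∈ gr V k) :
    x * y ∈ gr V (j + k) := by
  rw [gr, pow_add]; exact Submodule.mul_mem_mul hx hy

lemma algebraMap_mem_gr (r : ℂ) : algebraMap ℂ (TensorAlgebra ℂ V) r ∈ gr V 0 := by
  rw [gr, pow_zero]; exact Submodule.algebraMap_mem r

lemma gr_zero_eq {x : TensorAlgebra ℂ V} (hx : x ∈ gr V 0) :
    ∃ r : ℂ, x = algebraMap ℂ _ r := by
  rw [gr, pow_zero] at hx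
  obtain ⟨r, hr⟩ := Submodule.mem_one.1 hx
  exact ⟨r, hr.symm⟩

lemma gr_one_eq {x : TensorAlgebra ℂ V} (hx : x ∈ gr V 1) : ∃ v : V, x = ι ℂ v := by
  rw [gr, pow_one] at hx
  obtain ⟨r, hr⟩ := hx
  exact ⟨r, hr.symm⟩

lemma gr_induct {P : (n : ℕ) → TensorAlgebra ℂ V → Prop}
    (hr : ∀ r : ℂ, P 0 (algebraMap ℂ _ r)) (ha : ∀ n x y, P n x → P n y → P n (x + y))
    (hm : ∀ n (v : V) x, x ∈ gr V n → P n x → P (n + 1) (ι ℂ v * x))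
    {n : ℕ} {x : TensorAlgebra ℂ V} (hx : x ∈ gr V n) : P n x := by
  rw [gr] at hx
  induction hx using Submodule.pow_induction_on_left' with
  | algebraMap r => exact hr r
  | add x y i hx hy ihx ihy => exact ha _ _ _ ihx ihy
  | mem_mul v hv i x hx ih => obtain ⟨v, rfl⟩ := hv; exact hm _ _ _ hx ih

lemma gr_cases {P : TensorAlgebra ℂ V → Prop} (h : ∀ n, ∀ x ∈ gr V n, P x)
    (ha : ∀ x y, P x → P y → P (x + y)) (x : TensorAlgebra ℂ V) : P x := by
  classical
  induction x using DirectSum.Decomposition.inductionOn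
    (ℳ := fun n => (LinearMap.range (ι ℂ : V →ₗ[ℂ] TensorAlgebra ℂ V) ^ n)) with
  | zero => exact h 0 0 (zero_mem _)
  | homogeneous x => exact h _ _ x.2
  | add x y hx hy => exact ha _ _ hx hy

lemma tc_temb {k : ℕ} {x : TensorAlgebra ℂ V} (hx : x ∈ gr V k) (n : ℕ) :
    tc n (temb x) = if n = k then x else 0 := by
  revert n
  refine gr_induct (P := fun k x => ∀ n, tc n (temb x) = if n = k then x else 0)
    (fun r n => ?_) (fun k x y hx hy n => ?_) (fun k v x _ h n => ?_) hx
  · rw [AlgHom.commutes, tc_algebraMap]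
  · rw [map_add, map_add, hx, hy]; split_ifs <;> simp
  · rw [map_mul, temb_ι, tc_mul]
    split_ifs with hn
    · subst hn
      rw [Finset.sum_eq_single (1, k)]
      · simp [tc_tι, h]
      · rintro ⟨a, b⟩ hab hne
        rw [Finset.HasAntidiagonal.mem_antidiagonal] at hab
        simp only at hab ⊢
        rw [tc_tι, h]
        split_ifs with h1 h2 <;> simp
        subst h1 h2; exact absurd rfl hne
      · intro hh; exact absurd (Finset.HasAntidiagonal.mem_antidiagonal.2 (add_comm 1 k)) hh
    · refine Finset.sum_eq_zero fun p hp => ?_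
      rw [Finset.HasAntidiagonal.mem_antidiagonal] at hp
      rw [tc_tι, h]
      split_ifs with h1 h2 <;> simp
      omega

/-- The part of a series of degree less than `l`. -/
def trunc (l : ℕ) (f : That V) : TensorAlgebra ℂ V := ∑ n ∈ Finset.range l, tc n f

lemma tc_trunc (l : ℕ) (f : That V) (n : ℕ) :
    tc n (temb (trunc l f)) = if n < l then tc n f else 0 := by
  rw [trunc, map_sum, map_sum]
  simp_rw [tc_temb (tc_mem _ f)]
  simp

lemma sub_trunc_mem (l : ℕ) (f : That V) : f - temb (trunc l f) ∈ ordSub V l :=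
  mem_ordSub.2 fun i hi => by rw [map_sub, tc_trunc, if_pos hi, sub_self]

lemma IAdicCont.iff {F : That V →ₗ[ℂ] That W} :
    IAdicCont F ↔ ∀ k, ∃ l, ∀ f ∈ ordSub V l, F f ∈ ordSub W k := by
  simp only [IAdicCont, mem_ordSub]

lemma IAdicCont.smul {F : That V →ₗ[ℂ] That W} (hF : IAdicCont F) (c : ℂ) :
    IAdicCont (c • F) := by
  rw [IAdicCont.iff] at *
  intro k
  obtain ⟨l, hl⟩ := hF k
  exact ⟨l, fun f hf => Submodule.smul_mem _ _ (hl f hf)⟩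

lemma IAdicCont.sub {F G : That V →ₗ[ℂ] That W} (hF : IAdicCont F) (hG : IAdicCont G) :
    IAdicCont (F - G) := by
  rw [IAdicCont.iff] at *
  intro k
  obtain ⟨l, hl⟩ := hF k
  obtain ⟨m, hm⟩ := hG k
  exact ⟨max l m, fun f hf => sub_mem (hl f (ordSub_anti (le_max_left _ _) hf))
    (hm f (ordSub_anti (le_max_right _ _) hf))⟩

lemma IAdicCont.comp {F : That W →ₗ[ℂ] That X} {G : That V →ₗ[ℂ] That W} (hF : IAdicCont F)
    (hG : IAdicCont G) : IAdicCont (F ∘ₗ G) := by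
  rw [IAdicCont.iff] at *
  intro k
  obtain ⟨l, hl⟩ := hF k
  obtain ⟨m, hm⟩ := hG l
  exact ⟨m, fun f hf => hl _ (hm f hf)⟩

lemma IAdicCont.of_shift {F : That V →ₗ[ℂ] That W} (j : ℕ)
    (h : ∀ k, ∀ f ∈ ordSub V (k + j), F f ∈ ordSub W k) : IAdicCont F :=
  IAdicCont.iff.2 fun k => ⟨k + j, h k⟩

lemma cont_id : IAdicCont (LinearMap.id : That V →ₗ[ℂ] That V) :=
  IAdicCont.of_shift 0 fun _ _ h => h

lemma mulLeft_cont (a : That V) : IAdicCont (LinearMap.mulLeft ℂ a) :=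
  IAdicCont.of_shift 0 fun k f hf => by
    have := mul_mem_ordSub (mem_ordSub_zero a) hf
    rwa [zero_add] at this

lemma mulRight_cont (a : That V) : IAdicCont (LinearMap.mulRight ℂ a) :=
  IAdicCont.of_shift 0 fun k f hf => by
    have := mul_mem_ordSub hf (mem_ordSub_zero a)
    rw [add_zero] at this
    exact this

lemma hmap_ord (φ : V →ₗ[ℂ] W) {k : ℕ} {f : That V} (hf : f ∈ ordSub V k) :
    hmap φ f ∈ ordSub W k := mem_ordSub.2 fun i hi => by
  rw [tc_hmap, mem_ordSub.1 hf i hi, map_zero]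

lemma hmap_cont (φ : V →ₗ[ℂ] W) : IAdicCont (hmap φ).toLinearMap :=
  IAdicCont.of_shift 0 fun _ _ h => hmap_ord φ h

lemma hmap_tι (φ : V →ₗ[ℂ] W) (v : V) : hmap φ (tι v) = tι (φ v) :=
  That.ext' fun n => by rw [tc_hmap, tc_tι, tc_tι]; split_ifs <;> simp [tmap]

lemma hmap_comp (ψ : W →ₗ[ℂ] X) (φ : V →ₗ[ℂ] W) (f : That V) :
    hmap ψ (hmap φ f) = hmap (ψ ∘ₗ φ) f := That.ext' fun n => by
  rw [tc_hmap, tc_hmap, tc_hmap]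
  have : (tmap ψ).comp (tmap φ) = tmap (ψ ∘ₗ φ) := by ext v; simp [tmap]
  exact DFunLike.congr_fun this _

lemma hmap_id (f : That V) : hmap (LinearMap.id : V →ₗ[ℂ] V) f = f := That.ext' fun n => by
  rw [tc_hmap]
  have : tmap (LinearMap.id : V →ₗ[ℂ] V) = AlgHom.id ℂ _ := by ext v; simp [tmap]
  rw [this]; rfl

lemma cont_eq_zero {D : That V →ₗ[ℂ] That W} (hc : IAdicCont D) (h : ∀ x, D (temb x) = 0) :
    D = 0 := by
  refine LinearMap.ext fun f => eq_zero_of_mem_ordSub fun k => ?_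
  obtain ⟨l, hl⟩ := IAdicCont.iff.1 hc k
  have := hl _ (sub_trunc_mem l f)
  rwa [map_sub, h, sub_zero] at this

/-- A continuous twisted derivation that vanishes on the generators is zero. -/
lemma twisted_eq_zero {D : That V →ₗ[ℂ] That W} (σ τ : That V → That W)
    (hD : ∀ f g, D (f * g) = D f * τ g + σ f * D g) (hc : IAdicCont D)
    (h1 : τ 1 = 1) (h1' : σ 1 = 1)
    (h : ∀ v, D (tι v) = 0) : D = 0 := by
  have d1 : D 1 = 0 := by
    have := hD 1 1
    rw [mul_one, h1, h1', mul_one, one_mul] at this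
    simpa using this
  refine cont_eq_zero hc fun x => ?_
  induction x using TensorAlgebra.induction with
  | algebraMap r => rw [AlgHom.commutes, Algebra.algebraMap_eq_smul_one, map_smul, d1, smul_zero]
  | ι v => rw [temb_ι, h]
  | mul a b ha hb => rw [map_mul, hD, ha, hb]; simp
  | add a b ha hb => rw [map_add, map_add, ha, hb, add_zero]

/-- Continuous homomorphisms that agree on the generators are equal. -/
lemma hom_unique {F G : That V →ₐ[ℂ] That W} (hF : IAdicCont F.toLinearMap)
    (hG : IAdicCont G.toLinearMap) (h : ∀ v, F (tι v) = G (tι v)) (f : That V) : F f = G f := by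
  have := twisted_eq_zero (D := F.toLinearMap - G.toLinearMap) F G (fun f g => by
      simp only [LinearMap.sub_apply, AlgHom.toLinearMap_apply, map_mul, sub_mul, mul_sub]
      abel) (hF.sub hG) (map_one G) (map_one F)
    (fun v => by simp [h])
  exact sub_eq_zero.1 (LinearMap.congr_fun this f)

/-- The derivation that multiplies the component of degree `n` by `n`. -/
def eul : That V →ₗ[ℂ] That V :=
  tmk (fun n => (n : ℂ) • tc n) fun n f => Submodule.smul_mem _ _ (tc_mem n f)

@[simp] lemma tc_eul (n : ℕ) (f : That V) : tc n (eul f) = (n : ℂ) • tc n f := tc_tmk _ _ _ _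

lemma eul_mul (f g : That V) : eul (f * g) = eul f * g + f * eul g := That.ext' fun n => by
  rw [map_add, tc_eul, tc_mul, tc_mul, tc_mul, Finset.smul_sum, ← Finset.sum_add_distrib]
  refine Finset.sum_congr rfl fun p hp => ?_
  rw [← Finset.HasAntidiagonal.mem_antidiagonal.1 hp, tc_eul, tc_eul, smul_mul_assoc, mul_smul_comm,
    ← add_smul, Nat.cast_add]

lemma eul_cont : IAdicCont (eul : That V →ₗ[ℂ] That V) :=
  IAdicCont.of_shift 0 fun k f hf => mem_ordSub.2 fun i hi => by
    rw [tc_eul, mem_ordSub.1 hf i hi, smul_zero]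

lemma eul_tι (v : V) : eul (tι v) = tι v := That.ext' fun n => by
  rw [tc_eul, tc_tι]; split_ifs with h <;> simp [h]

end Filtration

section Ext

variable {V W X : Type*} [AddCommGroup V] [Module ℂ V] [SuperSpace V]
  [AddCommGroup W] [Module ℂ W] [SuperSpace W] [AddCommGroup X] [Module ℂ X] [SuperSpace X]

lemma hsgnPow_tι (p : ZMod 2) (v : V) : hsgnPow p (tι v) = tι (spow p v) := hmap_tι _ v

lemma hsgnPow_cont (p : ZMod 2) : IAdicCont (hsgnPow p : That V →ₐ[ℂ] That V).toLinearMap :=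
  hmap_cont _

lemma hsgnPow_temb (p : ZMod 2) (x : TensorAlgebra ℂ V) :
    hsgnPow p (temb x) = temb (tmap (spow p) x) := by
  have : (hsgnPow p : That V →ₐ[ℂ] That V).comp temb = temb.comp (tmap (spow p)) := by
    ext v
    simp [temb, tmap, hsgnPow_tι]
  exact DFunLike.congr_fun this x

lemma temb_ord {k : ℕ} {x : TensorAlgebra ℂ V} (hx : x ∈ gr V k) : temb x ∈ ordSub V k :=
  mem_ordSub.2 fun i hi => by rw [tc_temb hx, if_neg hi.ne]

lemma tι_ord (v : V) : tι v ∈ ordSub V 1 := by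
  rw [← temb_ι]; exact temb_ord (ι_mem_gr v)

lemma derT_ord (p : ZMod 2) (δ : V →ₗ[ℂ] That V) {n : ℕ} {x : TensorAlgebra ℂ V}
    (hx : x ∈ gr V n) : derT p δ x ∈ ordSub V (n - 1) := by
  refine gr_induct (P := fun n x => derT p δ x ∈ ordSub V (n - 1)) (fun r => ?_)
    (fun n x y hx hy => ?_) (fun n v x hx ih => ?_) hx
  · rw [derT_algebraMap]; exact zero_mem _
  · rw [map_add]; exact add_mem hx hy
  · rw [derT_mul, derT_ι, Nat.add_sub_cancel]
    refine add_mem ?_ ?_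
    · have := mul_mem_ordSub (mem_ordSub_zero (δ v)) (temb_ord hx)
      rwa [zero_add] at this
    · have h1 := temb_ord (tmap_gr (spow p) (ι_mem_gr v))
      exact ordSub_anti (by omega) (mul_mem_ordSub h1 ih)

lemma derHat_temb (p : ZMod 2) (δ : V →ₗ[ℂ] That V) (x : TensorAlgebra ℂ V) :
    derHat p δ (temb x) = derT p δ x := by
  refine gr_cases (P := fun x => derHat p δ (temb x) = derT p δ x) (fun n x hx => ?_)
    (fun x y hx hy => by rw [map_add, map_add, map_add, hx, hy]) x
  refine That.ext' fun k => ?_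
  rw [derHat, tc_tmk, LinearMap.sum_apply]
  simp only [LinearMap.comp_apply, tc_temb hx]
  by_cases h : n < k + 2
  · rw [Finset.sum_eq_single n]
    · simp
    · intro b _ hb; simp [hb]
    · intro hh; exact absurd (Finset.mem_range.2 h) hh
  · rw [Finset.sum_eq_zero, mem_ordSub.1 (derT_ord p δ hx) k (by omega)]
    intro b hb
    rw [if_neg (by have := Finset.mem_range.1 hb; omega), map_zero, map_zero]

lemma derHat_ord (p : ZMod 2) (δ : V →ₗ[ℂ] That V) {k : ℕ} {f : That V}
    (hf : f ∈ ordSub V (k + 1)) : derHat p δ f ∈ ordSub V k := mem_ordSub.2 fun i hi => by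
  rw [derHat, tc_tmk, LinearMap.sum_apply]
  refine Finset.sum_eq_zero fun n hn => ?_
  have := Finset.mem_range.1 hn
  rw [LinearMap.comp_apply, LinearMap.comp_apply, mem_ordSub.1 hf n (by omega), map_zero, map_zero]

lemma derHat_cont (p : ZMod 2) (δ : V →ₗ[ℂ] That V) : IAdicCont (derHat p δ) :=
  IAdicCont.of_shift 1 fun _ _ h => derHat_ord p δ h

lemma derHat_tι (p : ZMod 2) (δ : V →ₗ[ℂ] That V) (v : V) : derHat p δ (tι v) = δ v := by
  rw [← temb_ι, derHat_temb, derT_ι]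

lemma derHat_mul (p : ZMod 2) (δ : V →ₗ[ℂ] That V) (f g : That V) :
    derHat p δ (f * g) = derHat p δ f * g + hsgnPow p f * derHat p δ g := by
  have key : ∀ x, ∀ g : That V, derHat p δ (temb x * g) =
      derHat p δ (temb x) * g + hsgnPow p (temb x) * derHat p δ g := by
    intro x g
    have := cont_eq_zero (D := derHat p δ ∘ₗ LinearMap.mulLeft ℂ (temb x) -
      LinearMap.mulLeft ℂ (derHat p δ (temb x)) -
      LinearMap.mulLeft ℂ (hsgnPow p (temb x)) ∘ₗ derHat p δ)
      ((((derHat_cont p δ).comp (mulLeft_cont _)).sub (mulLeft_cont _)).sub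
        ((mulLeft_cont _).comp (derHat_cont p δ))) fun y => by
        simp only [LinearMap.sub_apply, LinearMap.comp_apply, LinearMap.mulLeft_apply]
        rw [← map_mul, derHat_temb, derHat_temb, derHat_temb, derT_mul, hsgnPow_temb]
        abel
    have h := LinearMap.congr_fun this g
    simp only [LinearMap.sub_apply, LinearMap.comp_apply, LinearMap.mulLeft_apply,
      LinearMap.zero_apply] at h
    rw [sub_sub, sub_eq_zero] at h
    exact h
  have := cont_eq_zero (D := derHat p δ ∘ₗ LinearMap.mulRight ℂ g -
      LinearMap.mulRight ℂ g ∘ₗ derHat p δ -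
      LinearMap.mulRight ℂ (derHat p δ g) ∘ₗ (hsgnPow p : That V →ₐ[ℂ] That V).toLinearMap)
      ((((derHat_cont p δ).comp (mulRight_cont _)).sub ((mulRight_cont _).comp (derHat_cont p δ))).sub
        ((mulRight_cont _).comp (hsgnPow_cont p))) fun x => by
        simp only [LinearMap.sub_apply, LinearMap.comp_apply, LinearMap.mulRight_apply,
          AlgHom.toLinearMap_apply, key]
        abel
  have h := LinearMap.congr_fun this f
  simp only [LinearMap.sub_apply, LinearMap.comp_apply, LinearMap.mulRight_apply,
      LinearMap.zero_apply, AlgHom.toLinearMap_apply] at h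
  rw [sub_sub, sub_eq_zero] at h
  exact h

lemma lift_ord {η : V →ₗ[ℂ] That W} (hη : ∀ v, tc 0 (η v) = 0) {n : ℕ} {x : TensorAlgebra ℂ V}
    (hx : x ∈ gr V n) : lift ℂ η x ∈ ordSub W n := by
  refine gr_induct (P := fun n x => lift ℂ η x ∈ ordSub W n) (fun r => mem_ordSub_zero _)
    (fun n x y hx hy => ?_) (fun n v x hx ih => ?_) hx
  · rw [map_add]; exact add_mem hx hy
  · rw [map_mul, lift_ι_apply, add_comm]
    refine mul_mem_ordSub (mem_ordSub.2 fun i hi => ?_) ih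
    obtain rfl : i = 0 := by omega
    exact hη v

lemma homHat_temb {η : V →ₗ[ℂ] That W} (hη : ∀ v, tc 0 (η v) = 0) (x : TensorAlgebra ℂ V) :
    homHat η (temb x) = lift ℂ η x := by
  refine gr_cases (P := fun x => homHat η (temb x) = lift ℂ η x) (fun n x hx => ?_)
    (fun x y hx hy => by rw [map_add, map_add, map_add, hx, hy]) x
  refine That.ext' fun k => ?_
  rw [homHat, tc_tmk, LinearMap.sum_apply]
  simp only [LinearMap.comp_apply, tc_temb hx, AlgHom.toLinearMap_apply]
  by_cases h : n < k + 1
  · rw [Finset.sum_eq_single n]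
    · simp
    · intro b _ hb; simp [hb]
    · intro hh; exact absurd (Finset.mem_range.2 h) hh
  · rw [Finset.sum_eq_zero, mem_ordSub.1 (lift_ord hη hx) k (by omega)]
    intro b hb
    rw [if_neg (by have := Finset.mem_range.1 hb; omega), map_zero, map_zero]

lemma homHat_ord (η : V →ₗ[ℂ] That W) {k : ℕ} {f : That V}
    (hf : f ∈ ordSub V k) : homHat η f ∈ ordSub W k := mem_ordSub.2 fun i hi => by
  rw [homHat, tc_tmk, LinearMap.sum_apply]
  refine Finset.sum_eq_zero fun n hn => ?_
  have := Finset.mem_range.1 hn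
  rw [LinearMap.comp_apply, LinearMap.comp_apply, mem_ordSub.1 hf n (by omega), map_zero, map_zero]

lemma homHat_cont (η : V →ₗ[ℂ] That W) : IAdicCont (homHat η) :=
  IAdicCont.of_shift 0 fun _ _ h => homHat_ord η h

lemma homHat_tι {η : V →ₗ[ℂ] That W} (hη : ∀ v, tc 0 (η v) = 0) (v : V) :
    homHat η (tι v) = η v := by
  rw [← temb_ι, homHat_temb hη, lift_ι_apply]

lemma homHat_mul {η : V →ₗ[ℂ] That W} (hη : ∀ v, tc 0 (η v) = 0) (f g : That V) :
    homHat η (f * g) = homHat η f * homHat η g := by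
  have key : ∀ x, ∀ g : That V, homHat η (temb x * g) = homHat η (temb x) * homHat η g := by
    intro x g
    have := cont_eq_zero (D := homHat η ∘ₗ LinearMap.mulLeft ℂ (temb x) -
      LinearMap.mulLeft ℂ (homHat η (temb x)) ∘ₗ homHat η)
      (((homHat_cont η).comp (mulLeft_cont _)).sub
        ((mulLeft_cont _).comp (homHat_cont η))) fun y => by
        simp only [LinearMap.sub_apply, LinearMap.comp_apply, LinearMap.mulLeft_apply]
        rw [← map_mul, homHat_temb hη, homHat_temb hη, homHat_temb hη, map_mul, sub_self]
    have h := LinearMap.congr_fun this g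
    simp only [LinearMap.sub_apply, LinearMap.comp_apply, LinearMap.mulLeft_apply,
      LinearMap.zero_apply] at h
    exact sub_eq_zero.1 h
  have := cont_eq_zero (D := homHat η ∘ₗ LinearMap.mulRight ℂ g -
      LinearMap.mulRight ℂ (homHat η g) ∘ₗ homHat η)
      (((homHat_cont η).comp (mulRight_cont _)).sub ((mulRight_cont _).comp (homHat_cont η)))
      fun x => by
        simp only [LinearMap.sub_apply, LinearMap.comp_apply, LinearMap.mulRight_apply, key,
          sub_self]
  have h := LinearMap.congr_fun this f
  simp only [LinearMap.sub_apply, LinearMap.comp_apply, LinearMap.mulRight_apply,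
      LinearMap.zero_apply] at h
  exact sub_eq_zero.1 h

lemma homHat_one {η : V →ₗ[ℂ] That W} (hη : ∀ v, tc 0 (η v) = 0) : homHat η 1 = 1 := by
  have h := homHat_temb hη 1
  have e : (temb (1 : TensorAlgebra ℂ V)) = 1 := map_one _
  rw [e] at h
  rw [h]
  exact map_one _

/-- `homHat` as a homomorphism of algebras. -/
def homAlg (η : V →ₗ[ℂ] That W) (hη : ∀ v, tc 0 (η v) = 0) : That V →ₐ[ℂ] That W :=
  AlgHom.ofLinearMap (homHat η) (homHat_one hη) (homHat_mul hη)

/-- A continuous homomorphism preserves the augmentation ideal. -/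
lemma FMorph.tc_zero (φ : FMorph V W) (v : V) : tc 0 (φ.toAlgHom (tι v)) = 0 := by
  obtain ⟨l, hl⟩ := IAdicCont.iff.1 φ.cont 1
  have h1 : ∀ n, tι v ^ n ∈ ordSub V n := by
    intro n
    induction n with
    | zero => exact mem_ordSub_zero _
    | succ n ih => rw [pow_succ]; exact mul_mem_ordSub ih (tι_ord v)
  have h2 := mem_ordSub.1 (hl _ (h1 l)) 0 Nat.one_pos
  rw [AlgHom.toLinearMap_apply, map_pow] at h2
  obtain ⟨r, hr⟩ := gr_zero_eq (tc_mem 0 (φ.toAlgHom (tι v)))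
  have h3 : ∀ n, tc 0 (φ.toAlgHom (tι v) ^ n) = algebraMap ℂ _ (r ^ n) := by
    intro n
    induction n with
    | zero => rw [pow_zero, tc_one]; simp
    | succ n ih => rw [pow_succ, tc_mul]; simp [ih, hr, pow_succ]
  rw [h3] at h2
  have h4 : r ^ l = 0 := by
    have := congrArg TensorAlgebra.algebraMapInv h2
    simpa [TensorAlgebra.algebraMap_leftInverse _] using this
  rw [hr, eq_zero_of_pow_eq_zero h4, map_zero]

lemma FMorph.eq_homHat (φ : FMorph V W) (f : That V) :
    φ.toAlgHom f = homHat (φ.toAlgHom.toLinearMap ∘ₗ tι) f := by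
  have h0 : ∀ v, tc 0 ((φ.toAlgHom.toLinearMap ∘ₗ tι) v) = 0 := φ.tc_zero
  exact hom_unique (G := homAlg _ h0) φ.cont (homHat_cont _)
    (fun v => (homHat_tι h0 v).symm) f

lemma FMorph.ord (φ : FMorph V W) {k : ℕ} {f : That V} (hf : f ∈ ordSub V k) :
    φ.toAlgHom f ∈ ordSub W k := by
  rw [φ.eq_homHat]; exact homHat_ord _ hf

variable {p : ZMod 2}

lemma VField.eq_derHat (ξ : VField V p) (f : That V) : ξ.toFun f = derHat p (ξ.toFun ∘ₗ tι) f := by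
  have := twisted_eq_zero (D := ξ.toFun - derHat p (ξ.toFun ∘ₗ tι)) (hsgnPow p) id
    (fun f g => by
      simp only [LinearMap.sub_apply, ξ.leibniz, derHat_mul, id, sub_mul, mul_sub]
      abel) (ξ.cont.sub (derHat_cont _ _)) rfl (map_one _)
    (fun v => by rw [LinearMap.sub_apply, derHat_tι]; simp)
  exact sub_eq_zero.1 (LinearMap.congr_fun this f)

lemma VField.ord (ξ : VField V p) {k : ℕ} {f : That V} (hf : f ∈ ordSub V (k + 1)) :
    ξ.toFun f ∈ ordSub V k := by
  rw [ξ.eq_derHat]; exact derHat_ord _ _ hf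

lemma VField.ext_tι {ξ η : VField V p} (h : ∀ v, ξ.toFun (tι v) = η.toFun (tι v)) : ξ = η := by
  have : ξ.toFun ∘ₗ tι = η.toFun ∘ₗ tι := LinearMap.ext h
  exact VField.ext (LinearMap.ext fun f => by rw [ξ.eq_derHat, η.eq_derHat, this])

/-- The vector field with given values on the generators. -/
def VField.mk' (δ : V →ₗ[ℂ] That V) (hδ : ∀ v, hsgn (δ v) = sg p • δ (sinv v)) : VField V p where
  toFun := derHat p δ
  leibniz := derHat_mul p δ
  parity := derHat_sgn hδ
  cont := derHat_cont p δ

lemma homHat_sgn {η : V →ₗ[ℂ] That W} (hη : ∀ v, hsgn (η v) = η (sinv v)) (f : That V) :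
    hsgn (homHat η f) = homHat η (hsgn f) := by
  have e : ∀ x, hsgn (lift ℂ η x) = lift ℂ η (tsgn x) := by
    intro x
    have : (hsgn : That W →ₐ[ℂ] That W).comp (lift ℂ η) = (lift ℂ η).comp tsgn := by
      ext v
      simp [tmap, hη]
    exact DFunLike.congr_fun this x
  refine That.ext' fun k => ?_
  rw [tc_hmap, homHat, tc_tmk, tc_tmk]
  simp only [LinearMap.sum_apply, LinearMap.comp_apply, map_sum]
  refine Finset.sum_congr rfl fun n _ => ?_
  have h := congrArg (tc k) (e (tc n f))
  rw [tc_hmap] at h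
  have h' : tc n (hsgn f) = tsgn (tc n f) := tc_hmap _ _ _
  rw [h']
  exact h

/-- The morphism with given values on the generators. -/
def FMorph.mk' (η : V →ₗ[ℂ] That W) (h0 : ∀ v, tc 0 (η v) = 0)
    (hη : ∀ v, hsgn (η v) = η (sinv v)) : FMorph V W where
  toAlgHom := homAlg η h0
  even := homHat_sgn hη
  cont := homHat_cont η

lemma FMorph.mk'_tι (η : V →ₗ[ℂ] That W) (h0 : ∀ v, tc 0 (η v) = 0)
    (hη : ∀ v, hsgn (η v) = η (sinv v)) (v : V) : (FMorph.mk' η h0 hη).toAlgHom (tι v) = η v :=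
  homHat_tι h0 v

/-- Composition of morphisms. -/
def FMorph.comp (ψ : FMorph W X) (φ : FMorph V W) : FMorph V X where
  toAlgHom := ψ.toAlgHom.comp φ.toAlgHom
  even f := by simp only [AlgHom.comp_apply, ψ.even, φ.even]
  cont := IAdicCont.comp (F := ψ.toAlgHom.toLinearMap) (G := φ.toAlgHom.toLinearMap) ψ.cont φ.cont

@[simp] lemma FMorph.comp_apply (ψ : FMorph W X) (φ : FMorph V W) (f : That V) :
    (ψ.comp φ).toAlgHom f = ψ.toAlgHom (φ.toAlgHom f) := rfl

variable (V) in
/-- The identity morphism. -/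
def FMorph.id : FMorph V V where
  toAlgHom := AlgHom.id ℂ _
  even _ := rfl
  cont := cont_id

@[simp] lemma FMorph.id_apply (f : That V) : (FMorph.id V).toAlgHom f = f := rfl

lemma FMorph.ext_fun {φ ψ : FMorph V W} (h : ∀ f, φ.toAlgHom f = ψ.toAlgHom f) : φ = ψ := by
  cases φ; cases ψ
  congr
  exact AlgHom.ext h

end Ext

section Calculus

variable {V W X : Type*} [AddCommGroup V] [Module ℂ V] [SuperSpace V]
  [AddCommGroup W] [Module ℂ W] [SuperSpace W] [AddCommGroup X] [Module ℂ X] [SuperSpace X]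
  {p q r : ZMod 2}

lemma zmod2_cases (p : ZMod 2) : p = 0 ∨ p = 1 := by revert p; decide

lemma spow_zero_eq : (spow 0 : V →ₗ[ℂ] V) = LinearMap.id := if_pos rfl

lemma spow_one_eq : (spow 1 : V →ₗ[ℂ] V) = sinv := if_neg one_ne_zero

lemma hsgnPow_zero_apply (f : That V) : hsgnPow 0 f = f := by
  rw [hsgnPow, spow_zero_eq, hmap_id]

lemma hsgnPow_one_apply (f : That V) : hsgnPow 1 f = hsgn f := by rw [hsgnPow, spow_one_eq]

lemma hsgn_hsgn (f : That V) : hsgn (hsgn f) = f := by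
  have : (sinv ∘ₗ sinv : V →ₗ[ℂ] V) = LinearMap.id := LinearMap.ext SuperSpace.inv_inv
  rw [hmap_comp, this, hmap_id]

lemma hsgnPow_add (p q : ZMod 2) (f : That V) : hsgnPow (p + q) f = hsgnPow p (hsgnPow q f) := by
  rcases zmod2_cases p with rfl | rfl <;> rcases zmod2_cases q with rfl | rfl
  · simp [hsgnPow_zero_apply]
  · simp [hsgnPow_zero_apply]
  · simp [hsgnPow_zero_apply]
  · rw [CharTwo.add_self_eq_zero, hsgnPow_zero_apply, hsgnPow_one_apply, hsgnPow_one_apply,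
      hsgn_hsgn]

lemma hsgnPow_of_hsgn {p q : ZMod 2} {f : That V} (h : hsgn f = sg q • f) :
    hsgnPow p f = sg (p * q) • f := by
  rcases zmod2_cases p with rfl | rfl
  · rw [hsgnPow_zero_apply, zero_mul, sg_zero, one_smul]
  · rw [hsgnPow_one_apply, h, one_mul]

lemma VField.hsgnPow (ξ : VField V p) (q : ZMod 2) (f : That V) :
    hsgnPow q (ξ.toFun f) = sg (p * q) • ξ.toFun (SympAInf.hsgnPow q f) := by
  rcases zmod2_cases q with rfl | rfl
  · rw [hsgnPow_zero_apply, hsgnPow_zero_apply, mul_zero, sg_zero, one_smul]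
  · rw [hsgnPow_one_apply, hsgnPow_one_apply, mul_one, ξ.parity]

/-- Two superderivations with a prescribed supercommutator on the generators. -/
lemma VField.supercomm_eq (ξ : VField V p) (η : VField V q) (ζ : VField V r) (hr : r = p + q)
    (h : ∀ v, ξ.toFun (η.toFun (tι v)) - sg (p * q) • η.toFun (ξ.toFun (tι v)) = ζ.toFun (tι v))
    (f : That V) : ξ.toFun (η.toFun f) - sg (p * q) • η.toFun (ξ.toFun f) = ζ.toFun f := by
  subst hr
  have := twisted_eq_zero (D := ξ.toFun ∘ₗ η.toFun - sg (p * q) • (η.toFun ∘ₗ ξ.toFun) - ζ.toFun)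
    (SympAInf.hsgnPow (p + q)) id (fun f g => by
      simp only [LinearMap.sub_apply, LinearMap.smul_apply, LinearMap.comp_apply, id]
      rw [ξ.leibniz f g, η.leibniz f g, ζ.leibniz f g, map_add, map_add, ξ.leibniz, ξ.leibniz,
        η.leibniz, η.leibniz, VField.hsgnPow, VField.hsgnPow, hsgnPow_add]
      have e1 : SympAInf.hsgnPow q (SympAInf.hsgnPow p f) = SympAInf.hsgnPow p (SympAInf.hsgnPow q f) := by
        rw [← hsgnPow_add, ← hsgnPow_add, add_comm]
      rw [e1, mul_comm q p]
      have e2 : sg (p * q) * sg (p * q) = 1 := sg_sq _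
      simp only [smul_add, sub_mul, mul_sub, smul_mul_assoc, mul_smul_comm, smul_smul, e2, one_smul]
      abel)
    (((ξ.cont.comp η.cont).sub ((η.cont.comp ξ.cont).smul _)).sub ζ.cont) rfl (map_one _)
    (fun v => by
      rw [LinearMap.sub_apply, sub_eq_zero]
      exact h v)
  exact sub_eq_zero.1 (LinearMap.congr_fun this f)

lemma FMorph.hsgnPow (φ : FMorph V W) (q : ZMod 2) (f : That V) :
    hsgnPow q (φ.toAlgHom f) = φ.toAlgHom (SympAInf.hsgnPow q f) := by
  rcases zmod2_cases q with rfl | rfl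
  · rw [hsgnPow_zero_apply, hsgnPow_zero_apply]
  · rw [hsgnPow_one_apply, hsgnPow_one_apply, φ.even]

lemma FMorph.intertwine (φ : FMorph V W) (ξ : VField V p) (η : VField W p)
    (h : ∀ v, φ.toAlgHom (ξ.toFun (tι v)) = η.toFun (φ.toAlgHom (tι v))) (f : That V) :
    φ.toAlgHom (ξ.toFun f) = η.toFun (φ.toAlgHom f) := by
  have := twisted_eq_zero (D := φ.toAlgHom.toLinearMap ∘ₗ ξ.toFun - η.toFun ∘ₗ φ.toAlgHom.toLinearMap)
    (fun f => SympAInf.hsgnPow p (φ.toAlgHom f)) φ.toAlgHom (fun f g => by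
      simp only [LinearMap.sub_apply, LinearMap.comp_apply, AlgHom.toLinearMap_apply]
      rw [ξ.leibniz, map_mul, η.leibniz, map_add, map_mul, map_mul, FMorph.hsgnPow, sub_mul, mul_sub]
      abel) ((IAdicCont.comp φ.cont ξ.cont).sub (IAdicCont.comp η.cont φ.cont)) (map_one _)
    (by rw [map_one, map_one])
    (fun v => by
      rw [LinearMap.sub_apply, sub_eq_zero]
      exact h v)
  exact sub_eq_zero.1 (LinearMap.congr_fun this f)

/-- The zero vector field. -/
instance : Zero (VField V p) := ⟨VField.mk' 0 fun v => by simp⟩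

@[simp] lemma VField.zero_apply (f : That V) : (0 : VField V p).toFun f = 0 := by
  have : derHat p (0 : V →ₗ[ℂ] That V) = 0 :=
    twisted_eq_zero _ id (derHat_mul p 0) (derHat_cont p 0) rfl (map_one _) (fun v => by
      rw [derHat_tι]; rfl)
  exact LinearMap.congr_fun this f

lemma hsgn_eul (f : That V) : hsgn (eul f) = eul (hsgn f) := That.ext' fun n => by
  rw [tc_hmap, tc_eul, tc_eul, tc_hmap, map_smul]

variable (V) in
/-- The Euler vector field. -/
def eulV : VField V 0 where
  toFun := eul
  leibniz f g := by rw [hsgnPow_zero_apply]; exact eul_mul f g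
  parity f := by rw [sg_zero, one_smul]; exact hsgn_eul f
  cont := eul_cont

@[simp] lemma eulV_apply (f : That V) : (eulV V).toFun f = eul f := rfl

variable (V) in
/-- The de Rham differential as a derivation. -/
def omDV : VField (FormGen V) 1 := VField.mk' _ omD_par

@[simp] lemma omDV_apply (f : OmegaHat V) : (omDV V).toFun f = omD f := rfl

/-- The contraction as a derivation of the algebra of forms. -/
def VField.iV (ξ : VField V p) : VField (FormGen V) (p + 1) := VField.mk' _ ξ.iGen_par

/-- The Lie derivative as a derivation of the algebra of forms. -/
def VField.lV (ξ : VField V p) : VField (FormGen V) p := VField.mk' _ ξ.lGen_par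

lemma VField.contract_mkQ (ξ : VField V p) (f : OmegaHat V) :
    ξ.contract ((hComm (FormGen V)).mkQ f) = (hComm (FormGen V)).mkQ (ξ.iV.toFun f) := rfl

lemma VField.lie_mkQ (ξ : VField V p) (f : OmegaHat V) :
    ξ.lie ((hComm (FormGen V)).mkQ f) = (hComm (FormGen V)).mkQ (ξ.lV.toFun f) := rfl

lemma drD_mkQ (f : OmegaHat V) :
    drD ((hComm (FormGen V)).mkQ f) = (hComm (FormGen V)).mkQ (omD f) := rfl

lemma drFn_mkQ (f : That V) :
    drFn ((hComm V).mkQ f) = (hComm (FormGen V)).mkQ (fn f) := rfl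

lemma formGen_eq (x : FormGen V) : x = gen (fstL x) + dgen (sndL x) :=
  Prod.ext (show x.1 = x.1 + 0 by rw [add_zero]) (show x.2 = 0 + x.2 by rw [zero_add])

@[simp] lemma fstL_gen (v : V) : fstL (gen v) = v := rfl
@[simp] lemma sndL_gen (v : V) : sndL (gen v) = 0 := rfl
@[simp] lemma fstL_dgen (v : V) : fstL (dgen v) = 0 := rfl
@[simp] lemma sndL_dgen (v : V) : sndL (dgen v) = v := rfl

lemma omD_tι (x : FormGen V) : omD (tι x) = tι (dgen (fstL x)) := derHat_tι _ _ _

lemma omD_mul (f g : OmegaHat V) : omD (f * g) = omD f * g + hsgn f * omD g := by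
  have := derHat_mul 1 (tι ∘ₗ dgen ∘ₗ fstL : FormGen V →ₗ[ℂ] OmegaHat V) f g
  rw [hsgnPow_one_apply] at this
  exact this

lemma VField.iV_tι (ξ : VField V p) (x : FormGen V) :
    ξ.iV.toFun (tι x) = fn (ξ.toFun (tι (sndL x))) := derHat_tι _ _ _

lemma VField.lV_tι (ξ : VField V p) (x : FormGen V) :
    ξ.lV.toFun (tι x) = fn (ξ.toFun (tι (fstL x))) + sg p • omD (fn (ξ.toFun (tι (sndL x)))) :=
  derHat_tι _ _ _

lemma fn_apply (f : That V) : fn f = hmap gen f := rfl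

lemma fn_mul (f g : That V) : fn (f * g) = fn f * fn g := map_mul (hmap gen) f g

lemma fn_one : fn (1 : That V) = 1 := map_one (hmap gen)

lemma fn_tι (v : V) : fn (tι v) = tι (gen v) := hmap_tι _ _

lemma fn_cont : IAdicCont (fn : That V →ₗ[ℂ] OmegaHat V) := hmap_cont gen

lemma hsgnPow_fn (p : ZMod 2) (f : That V) : hsgnPow p (fn f) = fn (hsgnPow p f) := by
  rcases zmod2_cases p with rfl | rfl
  · rw [hsgnPow_zero_apply, hsgnPow_zero_apply]
  · rw [hsgnPow_one_apply, hsgnPow_one_apply, hsgn_fn]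

lemma omD_omD (f : OmegaHat V) : omD (omD f) = 0 := by
  have := (omDV V).supercomm_eq (omDV V) (0 : VField (FormGen V) 0) rfl (fun x => by
    simp [omD_tι]) f
  rw [omDV_apply, omDV_apply, VField.zero_apply, one_mul, sg_one, neg_one_smul, sub_neg_eq_add,
    ← two_smul ℂ] at this
  exact (smul_eq_zero.1 this).resolve_left two_ne_zero

/-- A derivation of forms that agrees with a derivation of functions on generators does so on
functions. -/
lemma VField.fn_intertwine (ξ : VField V p) (Ξ : VField (FormGen V) p)
    (h : ∀ v, Ξ.toFun (tι (gen v)) = fn (ξ.toFun (tι v))) (f : That V) :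
    Ξ.toFun (fn f) = fn (ξ.toFun f) := by
  have := twisted_eq_zero (D := Ξ.toFun ∘ₗ fn - fn ∘ₗ ξ.toFun)
    (fun f => SympAInf.hsgnPow p (fn f)) fn (fun f g => by
      simp only [LinearMap.sub_apply, LinearMap.comp_apply]
      rw [fn_mul, Ξ.leibniz, ξ.leibniz, map_add, fn_mul, fn_mul, hsgnPow_fn, sub_mul, mul_sub]
      abel) ((Ξ.cont.comp fn_cont).sub (fn_cont.comp ξ.cont)) fn_one
    (by rw [fn_one, map_one])
    (fun v => by
      rw [LinearMap.sub_apply, sub_eq_zero, LinearMap.comp_apply, LinearMap.comp_apply, fn_tι]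
      exact h v)
  exact sub_eq_zero.1 (LinearMap.congr_fun this f)

lemma VField.iV_fn (ξ : VField V p) (f : That V) : ξ.iV.toFun (fn f) = 0 := by
  rw [VField.fn_intertwine (0 : VField V (p + 1)) ξ.iV (fun v => ?_) f]
  · simp
  · rw [VField.iV_tι]; simp

lemma VField.lV_fn (ξ : VField V p) (f : That V) : ξ.lV.toFun (fn f) = fn (ξ.toFun f) := by
  refine VField.fn_intertwine ξ ξ.lV (fun v => ?_) f
  rw [VField.lV_tι]; simp

/-- Cartan's formula. -/
lemma VField.cartan (ξ : VField V p) (f : OmegaHat V) :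
    ξ.lV.toFun f = ξ.iV.toFun (omD f) + sg p • omD (ξ.iV.toFun f) := by
  have := ξ.iV.supercomm_eq (omDV V) ξ.lV (by rw [add_assoc, CharTwo.add_self_eq_zero, add_zero])
    (fun x => by
      rw [omDV_apply, omDV_apply, omD_tι, VField.iV_tι, VField.iV_tι, VField.lV_tι, mul_one,
        sg_add, sg_one, mul_neg_one, neg_smul, sub_neg_eq_add]
      rfl) f
  rw [← this, omDV_apply, omDV_apply, mul_one, sg_add, sg_one, mul_neg_one, neg_smul,
    sub_neg_eq_add]

lemma VField.lie_eq (ξ : VField V p) (a : DR V) :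
    ξ.lie a = ξ.contract (drD a) + sg p • drD (ξ.contract a) := by
  obtain ⟨f, rfl⟩ := Submodule.mkQ_surjective _ a
  rw [drD_mkQ, VField.contract_mkQ, VField.contract_mkQ, VField.lie_mkQ, VField.cartan, drD_mkQ,
    map_add, map_smul]

lemma VField.iV_omD_fn (ξ : VField V p) (f : That V) :
    ξ.iV.toFun (omD (fn f)) = fn (ξ.toFun f) := by
  rw [← VField.lV_fn, VField.cartan, VField.iV_fn, map_zero, smul_zero, add_zero]

/-- The homotopy formula for the Euler vector field. -/
lemma euler_homotopy (f : OmegaHat V) :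
    (eulV V).iV.toFun (omD f) + omD ((eulV V).iV.toFun f) = eul f := by
  have h : (eulV V).lV = eulV (FormGen V) := VField.ext_tι fun x => by
    rw [VField.lV_tι, eulV_apply, eulV_apply, eulV_apply, eul_tι, eul_tι, eul_tι, fn_tι, fn_tι,
      omD_tι, fstL_gen, sg_zero, one_smul, ← map_add, ← formGen_eq]
  have := (eulV V).cartan f
  rw [h, eulV_apply, sg_zero, one_smul] at this
  exact this.symm

lemma eul_omD (f : OmegaHat V) : eul (omD f) = omD (eul f) := by
  rw [← euler_homotopy, ← euler_homotopy, omD_omD, map_zero, zero_add, map_add, omD_omD, add_zero]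

lemma homogeneous_of_eul {n : ℕ} {f : That V} (h : eul f = (n : ℂ) • f) :
    f = temb (tc n f) := That.ext' fun k => by
  rw [tc_temb (tc_mem n f)]
  split_ifs with hk
  · rw [hk]
  · have := congrArg (tc k) h
    rw [tc_eul, map_smul, ← sub_eq_zero, ← sub_smul] at this
    refine (smul_eq_zero.1 this).resolve_left ?_
    exact sub_ne_zero.2 (by exact_mod_cast hk)

lemma eul_temb {n : ℕ} {x : TensorAlgebra ℂ V} (hx : x ∈ gr V n) :
    eul (temb x) = (n : ℂ) • temb x := That.ext' fun k => by
  rw [tc_eul, map_smul, tc_temb hx]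
  split_ifs with h
  · rw [h]
  · simp

/-- The de Rham differential preserves the total degree. -/
lemma tc_omD (n : ℕ) (f : OmegaHat V) : tc n (omD f) = tc n (omD (temb (tc n f))) := by
  have h : ∀ k, ∀ x ∈ gr (FormGen V) k, ∀ i, i ≠ k → tc i (omD (temb x)) = 0 := by
    intro k x hx i hi
    have h1 : eul (omD (temb x)) = (k : ℂ) • omD (temb x) := by
      rw [eul_omD, eul_temb hx, map_smul]
    rw [homogeneous_of_eul h1, tc_temb (tc_mem _ _), if_neg hi]
  have h2 := mem_ordSub.1 (derHat_ord 1 (tι ∘ₗ dgen ∘ₗ fstL : FormGen V →ₗ[ℂ] OmegaHat V)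
    (sub_trunc_mem (n + 2) f)) n (by omega)
  have h3 : tc n (omD f) = tc n (omD (temb (trunc (n + 2) f))) := by
    rw [← sub_eq_zero, ← map_sub, omD, ← map_sub]; exact h2
  rw [h3, trunc, map_sum, map_sum, map_sum, Finset.sum_eq_single n]
  · intro b _ hb; exact h b _ (tc_mem _ _) n (Ne.symm hb)
  · intro hh; exact absurd (Finset.mem_range.2 (by omega)) hh

lemma omD_ord {k : ℕ} {f : OmegaHat V} (hf : f ∈ ordSub _ k) : omD f ∈ ordSub _ k :=
  mem_ordSub.2 fun i hi => by rw [tc_omD, mem_ordSub.1 hf i hi]; simp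

/-- Division of the component of degree `n` by `n`. -/
def ideg : That V →ₗ[ℂ] That V :=
  tmk (fun n => (n : ℂ)⁻¹ • tc n) fun n f => Submodule.smul_mem _ _ (tc_mem n f)

lemma tc_ideg (n : ℕ) (f : That V) : tc n (ideg f) = (n : ℂ)⁻¹ • tc n f := tc_tmk _ _ _ _

lemma omD_ideg (f : OmegaHat V) : omD (ideg f) = ideg (omD f) := That.ext' fun n => by
  rw [tc_ideg, tc_omD, tc_omD n f, tc_ideg, map_smul, map_smul, map_smul]

/-- Poincaré lemma. -/
lemma poincare {f : OmegaHat V} (hf : omD f ∈ hComm (FormGen V)) (h0 : tc 0 f = 0) :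
    f - omD (ideg ((eulV V).iV.toFun f)) ∈ hComm (FormGen V) := by
  have h1 : (eulV V).iV.toFun (omD f) ∈ hComm (FormGen V) := derHat_comm (eulV V).iGen_par hf
  have h2 := euler_homotopy f
  rw [mem_hComm] at *
  intro n
  rw [omD_ideg, map_sub, tc_ideg]
  rcases eq_or_ne n 0 with rfl | hn
  · rw [h0]; simp
  · have h3 := congrArg (tc n) h2
    rw [map_add, tc_eul] at h3
    have hn' : (n : ℂ) ≠ 0 := by exact_mod_cast hn
    have h4 : tc n f - (n : ℂ)⁻¹ • tc n (omD ((eulV V).iV.toFun f)) =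
        (n : ℂ)⁻¹ • tc n ((eulV V).iV.toFun (omD f)) := by
      rw [eq_sub_of_add_eq h3, smul_sub, smul_smul, inv_mul_cancel₀ hn', one_smul]
    rw [h4]
    exact Submodule.smul_mem _ _ (h1 n)

/-! ### Naturality -/

lemma FMorph.pGen_zero (φ : FMorph V W) (x : FormGen V) : tc 0 (φ.pGen x) = 0 := by
  have h : ∀ v, fn (φ.toAlgHom (tι v)) ∈ ordSub (FormGen W) 1 := fun v =>
    hmap_ord _ (φ.ord (tι_ord v))
  exact mem_ordSub.1 (add_mem (h (fstL x)) (omD_ord (h (sndL x)))) 0 Nat.one_pos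

/-- The homomorphism of algebras of forms induced by a morphism. -/
def FMorph.pO (φ : FMorph V W) : FMorph (FormGen V) (FormGen W) :=
  FMorph.mk' φ.pGen φ.pGen_zero φ.pGen_par

lemma FMorph.pull_mkQ (φ : FMorph V W) (f : OmegaHat V) :
    φ.pull ((hComm (FormGen V)).mkQ f) = (hComm (FormGen W)).mkQ (φ.pO.toAlgHom f) := rfl

lemma FMorph.pO_tι (φ : FMorph V W) (x : FormGen V) : φ.pO.toAlgHom (tι x) =
    fn (φ.toAlgHom (tι (fstL x))) + omD (fn (φ.toAlgHom (tι (sndL x)))) :=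
  FMorph.mk'_tι _ φ.pGen_zero φ.pGen_par x

lemma FMorph.pO_fn (φ : FMorph V W) (f : That V) : φ.pO.toAlgHom (fn f) = fn (φ.toAlgHom f) :=
  hom_unique (F := φ.pO.toAlgHom.comp (hmap gen)) (G := (hmap gen).comp φ.toAlgHom)
    (IAdicCont.comp φ.pO.cont (hmap_cont gen)) (IAdicCont.comp (hmap_cont gen) φ.cont)
    (fun v => by
      rw [AlgHom.comp_apply, AlgHom.comp_apply, hmap_tι, FMorph.pO_tι]
      simp [fn_apply]) f

lemma FMorph.pO_omD (φ : FMorph V W) (f : OmegaHat V) :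
    φ.pO.toAlgHom (omD f) = omD (φ.pO.toAlgHom f) := by
  refine φ.pO.intertwine (omDV V) (omDV W) (fun x => ?_) f
  rw [omDV_apply, omDV_apply, omD_tι, FMorph.pO_tι, FMorph.pO_tι, map_add, omD_omD]
  simp

lemma FMorph.pull_drD (φ : FMorph V W) (a : DR V) : φ.pull (drD a) = drD (φ.pull a) := by
  obtain ⟨f, rfl⟩ := Submodule.mkQ_surjective _ a
  rw [drD_mkQ, FMorph.pull_mkQ, FMorph.pull_mkQ, FMorph.pO_omD, drD_mkQ]

lemma FMorph.pO_iV (φ : FMorph V W) (ξ : VField V p) (η : VField W p)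
    (h : ∀ f, φ.toAlgHom (ξ.toFun f) = η.toFun (φ.toAlgHom f)) (f : OmegaHat V) :
    φ.pO.toAlgHom (ξ.iV.toFun f) = η.iV.toFun (φ.pO.toAlgHom f) := by
  refine φ.pO.intertwine ξ.iV η.iV (fun x => ?_) f
  rw [VField.iV_tι, FMorph.pO_fn, FMorph.pO_tι, map_add, VField.iV_fn, VField.iV_omD_fn, zero_add, h]

lemma FMorph.pull_contract (φ : FMorph V W) (ξ : VField V p) (η : VField W p)
    (h : ∀ f, φ.toAlgHom (ξ.toFun f) = η.toFun (φ.toAlgHom f)) (a : DR V) :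
    φ.pull (ξ.contract a) = η.contract (φ.pull a) := by
  obtain ⟨f, rfl⟩ := Submodule.mkQ_surjective _ a
  rw [VField.contract_mkQ, FMorph.pull_mkQ, FMorph.pull_mkQ, VField.contract_mkQ, φ.pO_iV ξ η h]

lemma FMorph.pull_lie (φ : FMorph V W) (ξ : VField V p) (η : VField W p)
    (h : ∀ f, φ.toAlgHom (ξ.toFun f) = η.toFun (φ.toAlgHom f)) (a : DR V) :
    φ.pull (ξ.lie a) = η.lie (φ.pull a) := by
  rw [VField.lie_eq, VField.lie_eq, map_add, map_smul, φ.pull_contract ξ η h, φ.pull_drD,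
    φ.pull_drD, φ.pull_contract ξ η h]

lemma FMorph.pO_comp (ψ : FMorph W X) (φ : FMorph V W) (f : OmegaHat V) :
    (ψ.comp φ).pO.toAlgHom f = ψ.pO.toAlgHom (φ.pO.toAlgHom f) :=
  hom_unique (G := ψ.pO.toAlgHom.comp φ.pO.toAlgHom) (ψ.comp φ).pO.cont
    (IAdicCont.comp ψ.pO.cont φ.pO.cont) (fun x => by
      rw [AlgHom.comp_apply, FMorph.pO_tι, FMorph.pO_tι, map_add, FMorph.pO_omD, FMorph.pO_fn,
        FMorph.pO_fn]
      rfl) f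

lemma FMorph.pull_comp (ψ : FMorph W X) (φ : FMorph V W) (a : DR V) :
    (ψ.comp φ).pull a = ψ.pull (φ.pull a) := by
  obtain ⟨f, rfl⟩ := Submodule.mkQ_surjective _ a
  rw [FMorph.pull_mkQ, FMorph.pull_mkQ, FMorph.pull_mkQ, FMorph.pO_comp]

lemma FMorph.pull_id (a : DR V) : (FMorph.id V).pull a = a := by
  obtain ⟨f, rfl⟩ := Submodule.mkQ_surjective _ a
  rw [FMorph.pull_mkQ]
  congr 1
  refine hom_unique (G := AlgHom.id ℂ _) (FMorph.id V).pO.cont cont_id (fun x => ?_) f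
  rw [FMorph.pO_tι, FMorph.id_apply, FMorph.id_apply, fn_tι, fn_tι, omD_tι, fstL_gen, ← map_add,
    ← formGen_eq]
  rfl

lemma pull0_mkQ (φ : V →ₗ[ℂ] W) (hφ : ∀ v, φ (sinv v) = sinv (φ v)) (f : That V) :
    pull0 φ hφ ((hComm V).mkQ f) = (hComm W).mkQ (hmap φ f) := rfl

/-! ### Form degree -/

variable (V) in
/-- The dilation `v + dw ↦ v + 2 dw`. -/
def dilL : FormGen V →ₗ[ℂ] FormGen V := gen ∘ₗ fstL + (2 : ℂ) • (dgen ∘ₗ sndL)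

lemma dilL_apply (x : FormGen V) : dilL V x = gen (fstL x) + (2 : ℂ) • dgen (sndL x) := rfl

/-- The dilation of the algebra of forms; the forms of degree `r` are the eigenvectors for `2 ^ r`. -/
abbrev dil : OmegaHat V →ₐ[ℂ] OmegaHat V := hmap (dilL V)

lemma dil_tι (x : FormGen V) : dil (tι x) = tι (gen (fstL x)) + (2 : ℂ) • tι (dgen (sndL x)) := by
  rw [hmap_tι, dilL_apply, map_add, map_smul]

lemma dil_fn (f : That V) : dil (fn f) = fn f := by
  rw [fn_apply, hmap_comp]
  have : (dilL V ∘ₗ gen : V →ₗ[ℂ] FormGen V) = gen := LinearMap.ext fun v => by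
    rw [LinearMap.comp_apply, dilL_apply]; simp
  rw [this]

lemma hsgnPow_dil (p : ZMod 2) (f : OmegaHat V) : hsgnPow p (dil f) = dil (hsgnPow p f) := by
  rcases zmod2_cases p with rfl | rfl
  · rw [hsgnPow_zero_apply, hsgnPow_zero_apply]
  · rw [hsgnPow_one_apply, hsgnPow_one_apply, hmap_comp, hmap_comp]
    congr 2
    refine LinearMap.ext fun x => ?_
    rw [LinearMap.comp_apply, LinearMap.comp_apply, dilL_apply, dilL_apply, map_add, map_smul,
      sinv_gen, sinv_dgen, fstL_sinv, sndL_sinv, map_neg]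

lemma dil_omD (f : OmegaHat V) : dil (omD f) = (2 : ℂ) • omD (dil f) := by
  let dL : OmegaHat V →ₗ[ℂ] OmegaHat V := (dil (V := V)).toLinearMap
  have := twisted_eq_zero (D := dL ∘ₗ omD - (2 : ℂ) • (omD ∘ₗ dL))
    (fun f : OmegaHat V => hsgn (dil f)) dil (fun f g => by
      simp only [LinearMap.sub_apply, LinearMap.smul_apply, LinearMap.comp_apply, dL,
        AlgHom.toLinearMap_apply]
      have e := hsgnPow_dil 1 f
      rw [hsgnPow_one_apply, hsgnPow_one_apply] at e
      rw [omD_mul, map_mul, omD_mul, map_add, map_mul, map_mul, ← e, sub_mul, mul_sub]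
      simp only [smul_add, smul_mul_assoc, mul_smul_comm]
      abel) (((hmap_cont _).comp (derHat_cont _ _)).sub (((derHat_cont _ _).comp (hmap_cont _)).smul _))
      (map_one _) (by rw [map_one, map_one]) (fun x => by
      simp only [LinearMap.sub_apply, LinearMap.smul_apply, LinearMap.comp_apply, dL,
        AlgHom.toLinearMap_apply]
      rw [omD_tι, dil_tι, dil_tι, map_add, map_smul, omD_tι, omD_tι]
      simp)
  exact sub_eq_zero.1 (LinearMap.congr_fun this f)

lemma VField.iV_dil (ξ : VField V p) (f : OmegaHat V) :
    ξ.iV.toFun (dil f) = (2 : ℂ) • dil (ξ.iV.toFun f) := by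
  let dL : OmegaHat V →ₗ[ℂ] OmegaHat V := (dil (V := V)).toLinearMap
  have := twisted_eq_zero (D := ξ.iV.toFun ∘ₗ dL - (2 : ℂ) • (dL ∘ₗ ξ.iV.toFun))
    (fun f : OmegaHat V => SympAInf.hsgnPow (p + 1) (dil f)) dil (fun f g => by
      simp only [LinearMap.sub_apply, LinearMap.smul_apply, LinearMap.comp_apply, dL,
        AlgHom.toLinearMap_apply]
      rw [ξ.iV.leibniz, map_mul, ξ.iV.leibniz, map_add, map_mul, map_mul, hsgnPow_dil, sub_mul, mul_sub]
      simp only [smul_add, smul_mul_assoc, mul_smul_comm]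
      abel) ((ξ.iV.cont.comp (hmap_cont _)).sub (((hmap_cont _).comp ξ.iV.cont).smul _))
      (map_one _) (by rw [map_one, map_one]) (fun x => by
      simp only [LinearMap.sub_apply, LinearMap.smul_apply, LinearMap.comp_apply, dL,
        AlgHom.toLinearMap_apply]
      rw [dil_tι, map_add, map_smul, VField.iV_tι, VField.iV_tι, VField.iV_tι, dil_fn]
      simp)
  exact sub_eq_zero.1 (LinearMap.congr_fun this f)

lemma FMorph.pO_dil (φ : FMorph V W) (f : OmegaHat V) :
    φ.pO.toAlgHom (dil f) = dil (φ.pO.toAlgHom f) :=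
  by
  have c1 : IAdicCont (φ.pO.toAlgHom.comp (dil (V := V))).toLinearMap :=
    IAdicCont.comp (F := φ.pO.toAlgHom.toLinearMap) (G := (dil (V := V)).toLinearMap) φ.pO.cont
      (hmap_cont _)
  have c2 : IAdicCont ((dil (V := W)).comp φ.pO.toAlgHom).toLinearMap :=
    IAdicCont.comp (F := (dil (V := W)).toLinearMap) (G := φ.pO.toAlgHom.toLinearMap) (hmap_cont _)
      φ.pO.cont
  refine hom_unique c1 c2 (fun x => ?_) f
  rw [AlgHom.comp_apply, AlgHom.comp_apply, dil_tι, map_add, map_smul, FMorph.pO_tι,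
    FMorph.pO_tι, FMorph.pO_tι, map_add, dil_omD, dil_fn, dil_fn]
  simp

lemma tmap_dil_of_mem {r : ℕ} {z : TensorAlgebra ℂ (FormGen V)} (hz : z ∈ tForm V r) :
    tmap (dilL V) z = (2 : ℂ) ^ r • z := by
  induction hz using Submodule.span_induction with
  | mem z hz =>
    obtain ⟨l, rfl, rfl⟩ := hz
    induction l with
    | nil => simp
    | cons a l ih =>
      rw [List.map_cons, List.prod_cons, map_mul, ih, List.countP_cons]
      rcases a with v | v
      · have : tmap (dilL V) (ι ℂ (gen v)) = ι ℂ (gen v) := by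
          simp [tmap, dilL_apply]
        simp [this]
      · have : tmap (dilL V) (ι ℂ (dgen v)) = (2 : ℂ) • ι ℂ (dgen v) := by
          simp [tmap, dilL_apply]
        simp [this, pow_succ, smul_smul]
  | zero => simp
  | add x y _ _ hx hy => rw [map_add, hx, hy, smul_add]
  | smul c x _ hx => rw [map_smul, hx, smul_comm]

lemma iSup_tForm (z : TensorAlgebra ℂ (FormGen V)) : z ∈ ⨆ r, tForm V r := by
  have key : ∀ z : TensorAlgebra ℂ (FormGen V), z ∈ Submodule.span ℂ
      {z | ∃ l : List (V ⊕ V), z =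
        (l.map (Sum.elim (fun v => ι ℂ (gen v)) (fun v => ι ℂ (dgen v)))).prod} := by
    intro z
    induction z using TensorAlgebra.induction with
    | algebraMap r =>
      rw [Algebra.algebraMap_eq_smul_one]
      exact Submodule.smul_mem _ _ (Submodule.subset_span ⟨[], by simp⟩)
    | ι x =>
      rw [formGen_eq x, map_add]
      exact add_mem (Submodule.subset_span ⟨[Sum.inl (fstL x)], by simp⟩)
        (Submodule.subset_span ⟨[Sum.inr (sndL x)], by simp⟩)
    | mul a b ha hb =>
      have := Submodule.mul_mem_mul ha hb
      rw [Submodule.span_mul_span] at this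
      refine Submodule.span_mono ?_ this
      rintro _ ⟨_, ⟨l, rfl⟩, _, ⟨l', rfl⟩, rfl⟩
      exact ⟨l ++ l', by simp⟩
    | add a b ha hb => exact add_mem ha hb
  refine Submodule.span_le.2 ?_ (key z)
  rintro _ ⟨l, rfl⟩
  exact Submodule.mem_iSup_of_mem (l.countP Sum.isRight) (Submodule.subset_span ⟨l, rfl, rfl⟩)

lemma mem_tForm_iff {r : ℕ} {z : TensorAlgebra ℂ (FormGen V)} :
    z ∈ tForm V r ↔ tmap (dilL V) z = (2 : ℂ) ^ r • z := by
  refine ⟨tmap_dil_of_mem, fun h => ?_⟩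
  set T := (tmap (dilL V)).toLinearMap
  obtain ⟨f, hf⟩ := (Submodule.mem_iSup_iff_exists_finsupp _ _).1 (iSup_tForm z)
  obtain ⟨hf, hz⟩ := hf
  have hle : ∀ s : ℕ, tForm V s ≤ Module.End.eigenspace T ((2 : ℂ) ^ s) := fun s x hx =>
    Module.End.mem_eigenspace_iff.2 (tmap_dil_of_mem hx)
  have hind : iSupIndep fun s : ℕ => Module.End.eigenspace T ((2 : ℂ) ^ s) :=
    (Module.End.eigenspaces_iSupIndep T).comp fun a b hab => by
      have h1 : ((2 ^ a : ℕ) : ℂ) = ((2 ^ b : ℕ) : ℂ) := by push_cast; exact hab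
      exact Nat.pow_right_injective le_rfl (Nat.cast_injective h1)
  have h1 : z - f r ∈ Module.End.eigenspace T ((2 : ℂ) ^ r) :=
    sub_mem (Module.End.mem_eigenspace_iff.2 h) (hle r (hf r))
  have h2 : z - f r ∈ ⨆ s, ⨆ _ : s ≠ r, Module.End.eigenspace T ((2 : ℂ) ^ s) := by
    have : z - f r = ∑ s ∈ f.support.erase r, f s := by
      rw [← hz, Finsupp.sum]
      by_cases hr : r ∈ f.support
      · rw [← Finset.add_sum_erase _ _ hr]; simp
      · rw [Finset.erase_eq_of_notMem hr, Finsupp.notMem_support_iff.1 hr, sub_zero]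
    rw [this]
    refine Submodule.sum_mem _ fun s hs => ?_
    exact Submodule.mem_iSup_of_mem s (Submodule.mem_iSup_of_mem (Finset.ne_of_mem_erase hs)
      (hle s (hf s)))
  have h3 := (Submodule.disjoint_def.1 (hind r)) _ h1 h2
  rw [sub_eq_zero.1 h3]
  exact hf r

lemma mem_omForm_iff {r : ℕ} {f : OmegaHat V} : f ∈ omForm V r ↔ dil f = (2 : ℂ) ^ r • f := by
  simp only [omForm, Submodule.mem_iInf, Submodule.mem_comap, mem_tForm_iff]
  constructor
  · intro h; exact That.ext' fun n => by rw [tc_hmap, h, map_smul]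
  · intro h n; rw [← tc_hmap, h, map_smul]

lemma fn_mem_omForm (f : That V) : fn f ∈ omForm V 0 :=
  mem_omForm_iff.2 (by rw [dil_fn, pow_zero, one_smul])

lemma mul_mem_omForm {r s : ℕ} {f g : OmegaHat V} (hf : f ∈ omForm V r) (hg : g ∈ omForm V s) :
    f * g ∈ omForm V (r + s) := by
  rw [mem_omForm_iff] at *
  rw [map_mul, hf, hg, smul_mul_assoc, mul_smul_comm, smul_smul, pow_add]

lemma omD_mem_omForm {r : ℕ} {f : OmegaHat V} (hf : f ∈ omForm V r) : omD f ∈ omForm V (r + 1) := by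
  rw [mem_omForm_iff] at *
  rw [dil_omD, hf, map_smul, smul_smul, pow_succ']

lemma VField.iV_mem_omForm (ξ : VField V p) {r : ℕ} {f : OmegaHat V} (hf : f ∈ omForm V (r + 1)) :
    ξ.iV.toFun f ∈ omForm V r := by
  rw [mem_omForm_iff] at *
  have := ξ.iV_dil f
  rw [hf, map_smul, pow_succ', ← smul_smul] at this
  exact (smul_right_injective _ (two_ne_zero (α := ℂ)) this).symm

lemma FMorph.pO_mem_omForm (φ : FMorph V W) {r : ℕ} {f : OmegaHat V} (hf : f ∈ omForm V r) :
    φ.pO.toAlgHom f ∈ omForm W r := by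
  rw [mem_omForm_iff] at *
  rw [← FMorph.pO_dil, hf, map_smul]

lemma ideg_mem_omForm {r : ℕ} {f : OmegaHat V} (hf : f ∈ omForm V r) : ideg f ∈ omForm V r := by
  simp only [omForm, Submodule.mem_iInf, Submodule.mem_comap, tc_ideg] at *
  exact fun n => Submodule.smul_mem _ _ (hf n)

lemma tι_dgen_mem (v : V) : tι (dgen v) ∈ omForm V 1 := by
  rw [mem_omForm_iff, dil_tι]; simp

lemma eq_fn_of_mem {f : OmegaHat V} (hf : f ∈ omForm V 0) : fn (hmap fstL f) = f := by
  simp only [omForm, Submodule.mem_iInf, Submodule.mem_comap] at hf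
  refine That.ext' fun n => ?_
  rw [fn_apply, tc_hmap, tc_hmap]
  have h := hf n
  generalize tc n f = z at h
  induction h using Submodule.span_induction with
  | mem z hz =>
    obtain ⟨l, hl, rfl⟩ := hz
    rw [List.countP_eq_zero] at hl
    induction l with
    | nil => simp
    | cons a l ih =>
      rw [List.map_cons, List.prod_cons, map_mul, map_mul, ih fun b hb => hl b (by simp [hb])]
      rcases a with v | v
      · simp [tmap]
      · exact absurd rfl (hl (Sum.inr v) (by simp))
  | zero => simp
  | add x y _ _ hx hy => rw [map_add, map_add, hx, hy]
  | smul c x _ hx => rw [map_smul, map_smul, hx]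

lemma FMorph.pull_mem_drForm (φ : FMorph V W) {r : ℕ} {a : DR V} (ha : a ∈ drForm V r) :
    φ.pull a ∈ drForm W r := by
  obtain ⟨f, hf, rfl⟩ := ha
  exact ⟨_, φ.pO_mem_omForm hf, rfl⟩

lemma mem_drPar {q : ZMod 2} {a : DR V} : a ∈ drPar V q ↔
    ∃ f : OmegaHat V, hsgn f = sg q • f ∧ (hComm (FormGen V)).mkQ f = a := by
  constructor
  · rintro ⟨f, hf, rfl⟩; exact ⟨f, sub_eq_zero.1 hf, rfl⟩
  · rintro ⟨f, hf, rfl⟩; exact ⟨f, sub_eq_zero.2 hf, rfl⟩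

lemma FMorph.pull_mem_drPar (φ : FMorph V W) {q : ZMod 2} {a : DR V} (ha : a ∈ drPar V q) :
    φ.pull a ∈ drPar W q := by
  obtain ⟨f, hf, rfl⟩ := mem_drPar.1 ha
  exact mem_drPar.2 ⟨φ.pO.toAlgHom f, by rw [φ.pO.even, hf, map_smul], rfl⟩

/-- Parity components of a form. -/
lemma hsgn_mem_hComm {f : That V} (hf : f ∈ hComm V) : hsgn f ∈ hComm V :=
  hmap_comm (fun _ => rfl) hf

end Calculus

section WordsMore

variable {α β : Type} {M : Type*} [AddCommGroup M] [Module ℂ M]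

/-- The parity involution on combinations of words. -/
def sgnW (par : α → ZMod 2) : FA α →ₗ[ℂ] FA α := linExt fun l => sg (lpar par l) • wd l

@[simp] lemma sgnW_wd (par : α → ZMod 2) (l : List α) :
    sgnW par (wd l) = sg (lpar par l) • wd l := by simp [sgnW]

lemma fa_induction₂ {P : FA α → FA β → Prop} (x : FA α) (y : FA β) (h0 : ∀ y, P 0 y)
    (h0' : ∀ x, P x 0) (hw : ∀ l l', P (wd l) (wd l'))
    (ha : ∀ x x' y, P x y → P x' y → P (x + x') y) (hs : ∀ (c : ℂ) x y, P x y → P (c • x) y)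
    (ha' : ∀ x y y', P x y → P x y' → P x (y + y')) (hs' : ∀ (c : ℂ) x y, P x y → P x (c • y)) :
    P x y := by
  induction x using fa_induction with
  | h0 => exact h0 y
  | hw l =>
    induction y using fa_induction with
    | h0 => exact h0' _
    | hw l' => exact hw l l'
    | ha y y' h h' => exact ha' _ _ _ h h'
    | hs c y h => exact hs' _ _ _ h
  | ha x x' h h' => exact ha _ _ _ h h'
  | hs c x h => exact hs _ _ _ h

lemma hom_induction {par : α → ZMod 2} {p : ZMod 2} {P : FA α → Prop} {x : FA α}
    (hx : x ∈ hom par p) (h0 : P 0) (hw : ∀ l, lpar par l = p → P (wd l))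
    (ha : ∀ x y, P x → P y → P (x + y)) (hs : ∀ (c : ℂ) x, P x → P (c • x)) : P x := by
  induction hx using Submodule.span_induction with
  | mem x hx => obtain ⟨l, hl, rfl⟩ := hx; exact hw l hl
  | zero => exact h0
  | add x y _ _ hx hy => exact ha x y hx hy
  | smul c x _ hx => exact hs c x hx

lemma lenSub_induction {k : ℕ} {P : FA α → Prop} {x : FA α}
    (hx : x ∈ lenSub k) (h0 : P 0) (hw : ∀ l, l.length = k → P (wd l))
    (ha : ∀ x y, P x → P y → P (x + y)) (hs : ∀ (c : ℂ) x, P x → P (c • x)) : P x := by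
  induction hx using Submodule.span_induction with
  | mem x hx => obtain ⟨l, hl, rfl⟩ := hx; exact hw l hl
  | zero => exact h0
  | add x y _ _ hx hy => exact ha x y hx hy
  | smul c x _ hx => exact hs c x hx

lemma sgnW_mul (par : α → ZMod 2) (x y : FA α) : sgnW par (x * y) = sgnW par x * sgnW par y := by
  refine fa_induction₂ (P := fun x y => sgnW par (x * y) = sgnW par x * sgnW par y) x y
    (by simp) (by simp) (fun l l' => ?_) (fun x x' y h h' => ?_) (fun c x y h => ?_)
    (fun x y y' h h' => ?_) (fun c x y h => ?_)
  · rw [wd_mul, sgnW_wd, sgnW_wd, sgnW_wd, lpar_append, sg_add, smul_mul_smul_comm, wd_mul]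
  · simp only [add_mul, map_add, h, h']
  · simp only [smul_mul_assoc, map_smul, h]
  · simp only [mul_add, map_add, h, h']
  · simp only [mul_smul_comm, map_smul, h]

lemma sgnW_of_hom {par : α → ZMod 2} {p : ZMod 2} {x : FA α} (hx : x ∈ hom par p) :
    sgnW par x = sg p • x := by
  refine hom_induction
    (P := fun x => sgnW par x = sg p • x) hx (by simp) (fun l hl => by rw [sgnW_wd, hl]) (fun x y h h' => ?_)
    (fun c x h => ?_)
  · rw [map_add, h, h', smul_add]
  · rw [map_smul, h, smul_comm]

lemma half_add_sgnW_mem (par : α → ZMod 2) (p : ZMod 2) (x : FA α) :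
    x + sg p • sgnW par x ∈ hom par p := by
  induction x using fa_induction with
  | h0 => simp
  | hw l =>
    rw [sgnW_wd, smul_smul]
    by_cases h : lpar par l = p
    · have := wd_mem_hom par l
      rw [h] at this ⊢
      rw [sg_sq, one_smul]; exact add_mem this this
    · have h2 : lpar par l = p + 1 := by
        revert h; generalize lpar par l = a; revert a p; decide
      rw [h2, sg_add, ← mul_assoc, sg_sq, sg_one]
      simp
  | ha x y hx hy => rw [map_add, smul_add, add_add_add_comm]; exact add_mem hx hy
  | hs c x hx => rw [map_smul, smul_comm, ← smul_add]; exact Submodule.smul_mem _ _ hx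

lemma hom_of_sgnW {par : α → ZMod 2} {p : ZMod 2} {x : FA α} (h : sgnW par x = sg p • x) :
    x ∈ hom par p := by
  have := half_add_sgnW_mem par p x
  rw [h, smul_smul, sg_sq, one_smul, ← two_smul ℂ] at this
  exact (Submodule.smul_mem_iff _ two_ne_zero).1 this

lemma cycNL_word (par : α → ZMod 2) (l : List α) : cycNL par (wd l) = cycN par l := by simp [cycNL]

lemma cycNL_rotL (par : α → ZMod 2) (x : FA α) : cycNL par (rotL par x) = cycNL par x := by
  induction x using fa_induction with
  | h0 => simp
  | hw l => rw [cycNL_word, rotL, linExt_wd, cycNL_rot]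
  | ha x y hx hy => simp only [map_add, hx, hy]
  | hs c x hx => simp only [map_smul, hx]

lemma cycNL_rotL_pow (par : α → ZMod 2) (i : ℕ) (x : FA α) :
    cycNL par ((rotL par ^ i) x) = cycNL par x := by
  induction i generalizing x with
  | zero => rfl
  | succ i ih => rw [pow_succ, Module.End.mul_apply, ih, cycNL_rotL]

lemma cycNL_swap (par : α → ZMod 2) (l l' : List α) :
    cycNL par (wd (l ++ l')) = sg (lpar par l * lpar par l') • cycNL par (wd (l' ++ l)) := by
  rw [← cycNL_rotL_pow par l.length, rotL_pow, map_smul]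

lemma cycNL_comm (par : α → ZMod 2) {p q : ZMod 2} {x y : FA α} (hx : x ∈ hom par p)
    (hy : y ∈ hom par q) : cycNL par (x * y - sg (p * q) • (y * x)) = 0 := by
  refine hom_induction (P := fun x => cycNL par (x * y - sg (p * q) • (y * x)) = 0) hx (by simp) (fun l hl => ?_) (fun x x' h h' => ?_) (fun c x h => ?_)
  · refine hom_induction (P := fun y => cycNL par (wd l * y - sg (p * q) • (y * wd l)) = 0) hy (by simp) (fun l' hl' => ?_) (fun x x' h h' => ?_) (fun c x h => ?_)
    · rw [map_sub, map_smul, wd_mul, wd_mul, cycNL_swap, hl, hl', sub_self]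
    · rw [mul_add, add_mul, smul_add, add_sub_add_comm, map_add, h, h', add_zero]
    · rw [mul_smul_comm, smul_mul_assoc, smul_comm, ← smul_sub, map_smul, h, smul_zero]
  · rw [mul_add, add_mul, smul_add, add_sub_add_comm, map_add, h, h', add_zero]
  · rw [mul_smul_comm, smul_mul_assoc, smul_comm, ← smul_sub, map_smul, h, smul_zero]

lemma comm_mem_cyc {p q : ZMod 2} {x y : FA Letter} (hx : x ∈ hom par p)
    (hy : y ∈ hom par q) : x * y - sg (p * q) • (y * x) ∈ cyc := by
  refine hom_induction (P := fun x => x * y - sg (p * q) • (y * x) ∈ cyc) hx (by simp) (fun l hl => ?_) (fun x x' h h' => ?_) (fun c x h => ?_)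
  · refine hom_induction (P := fun y => wd l * y - sg (p * q) • (y * wd l) ∈ cyc) hy (by simp) (fun l' hl' => ?_) (fun x x' h h' => ?_) (fun c x h => ?_)
    · rw [wd_mul, wd_mul, ← hl, ← hl']; exact cyc_swap l l'
    · rw [mul_add, add_mul, smul_add, add_sub_add_comm]; exact add_mem h h'
    · rw [mul_smul_comm, smul_mul_assoc, smul_comm, ← smul_sub]; exact Submodule.smul_mem _ _ h
  · rw [mul_add, add_mul, smul_add, add_sub_add_comm]; exact add_mem h h'
  · rw [mul_smul_comm, smul_mul_assoc, smul_comm, ← smul_sub]; exact Submodule.smul_mem _ _ h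

/-- Words as words in the left half of a doubled alphabet. -/
def inlW : FA α →ₗ[ℂ] FA (α ⊕ β) := linExt fun l => wd (l.map Sum.inl)

@[simp] lemma inlW_wd (l : List α) : (inlW (wd l) : FA (α ⊕ β)) = wd (l.map Sum.inl) := by
  simp [inlW]

lemma inlW_mul (x y : FA α) : (inlW (x * y) : FA (α ⊕ β)) = inlW x * inlW y := by
  refine fa_induction₂ (P := fun x y => (inlW (x * y) : FA (α ⊕ β)) = inlW x * inlW y) x y
    (by simp) (by simp) (fun l l' => ?_) (fun x x' y h h' => ?_) (fun c x y h => ?_)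
    (fun x y y' h h' => ?_) (fun c x y h => ?_)
  · rw [wd_mul, inlW_wd, inlW_wd, inlW_wd, wd_mul, List.map_append]
  · simp only [add_mul, map_add, h, h']
  · simp only [smul_mul_assoc, map_smul, h]
  · simp only [mul_add, map_add, h, h']
  · simp only [mul_smul_comm, map_smul, h]

lemma inlW_one : (inlW (1 : FA α) : FA (α ⊕ β)) = 1 := by rw [← wd_nil, inlW_wd]; rfl

end WordsMore

section Detector

/-- Parity of the letters `a` and `da`. -/
def parO : Letter ⊕ Letter → ZMod 2 := Sum.elim par fun a => par a + 1

@[simp] lemma parO_inl (a : Letter) : parO (.inl a) = par a := rfl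
@[simp] lemma parO_inr (a : Letter) : parO (.inr a) = par a + 1 := rfl

@[simp] lemma lpar_map_inl (l : Word) : lpar parO (l.map Sum.inl) = lpar par l := by
  induction l with
  | nil => rfl
  | cons a l ih => simp [ih]

/-- Words without letters `da`. -/
def strip : List (Letter ⊕ Letter) → FA Letter
  | [] => 1
  | .inl a :: l => wd [a] * strip l
  | .inr _ :: _ => 0

/-- Words of the form `da₁ a₂ … aₖ`. -/
def pick : List (Letter ⊕ Letter) → FA Letter
  | .inr a :: l => wd [a] * strip l
  | _ => 0

lemma strip_map (l : Word) : strip (l.map Sum.inl) = wd l := by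
  induction l with
  | nil => rfl
  | cons a l ih => rw [List.map_cons, strip, ih, wd_mul]; rfl

/-- The coefficient of a `1`-form: cyclic words with one factor `da` are written in the form
`da₁ a₂ … aₖ`, which is mapped to `a₁ a₂ … aₖ`. -/
def kapW : FA (Letter ⊕ Letter) →ₗ[ℂ] FA Letter := linExt pick ∘ₗ cycNL parO

lemma kapW_comm {p q : ZMod 2} {x y : FA (Letter ⊕ Letter)} (hx : x ∈ hom parO p)
    (hy : y ∈ hom parO q) : kapW (x * y - sg (p * q) • (y * x)) = 0 := by
  rw [kapW, LinearMap.comp_apply, cycNL_comm parO hx hy, map_zero]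

lemma kapW_front (b : Letter) (l : Word) :
    kapW (wd (.inr b :: l.map Sum.inl)) = wd (b :: l) := by
  rw [kapW, LinearMap.comp_apply, cycNL_word, cycN, map_sum, Finset.sum_eq_single 0]
  · rw [pow_zero, Module.End.one_apply, linExt_wd, pick, strip_map, wd_mul]; rfl
  · intro i hi hi0
    have hi' := Finset.mem_range.1 hi
    obtain ⟨j, rfl⟩ := Nat.exists_eq_succ_of_ne_zero hi0
    rw [List.length_cons, List.length_map] at hi'
    have e : (Sum.inr b :: l.map Sum.inl : List (Letter ⊕ Letter)) =
        (Sum.inr b :: (l.take j).map Sum.inl) ++ (l.drop j).map Sum.inl := by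
      rw [List.cons_append, ← List.map_append, List.take_append_drop]
    have hl : (Sum.inr b :: (l.take j).map Sum.inl : List (Letter ⊕ Letter)).length = j + 1 := by
      simp; omega
    rw [e, Nat.succ_eq_add_one, ← hl, rotL_pow, map_smul, linExt_wd]
    obtain ⟨c, l', hd⟩ : ∃ c l', l.drop j = c :: l' := by
      rcases h : l.drop j with _ | ⟨c, l'⟩
      · have := congrArg List.length h; simp at this; omega
      · exact ⟨c, l', rfl⟩
    rw [hd]
    simp [pick]
  · intro h; simp at h

lemma kapW_mid (u : Word) (b : Letter) (l : Word) :
    kapW (wd (u.map Sum.inl ++ .inr b :: l.map Sum.inl)) =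
      sg (lpar par u * (par b + 1 + lpar par l)) • wd (b :: (l ++ u)) := by
  have h : kapW (wd (u.map Sum.inl ++ .inr b :: l.map Sum.inl)) =
      sg (lpar par u * (par b + 1 + lpar par l)) • kapW (wd (.inr b :: (l ++ u).map Sum.inl)) := by
    rw [kapW, LinearMap.comp_apply, LinearMap.comp_apply, cycNL_swap, map_smul, lpar_cons, lpar_map_inl,
      lpar_map_inl, parO_inr, List.cons_append, List.map_append]
  rw [h, kapW_front]

/-- The values of the de Rham differential on the letters. -/
def dlet : Letter ⊕ Letter → FA (Letter ⊕ Letter) := Sum.elim (fun a => wd [.inr a]) fun _ => 0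

/-- The de Rham differential on words. -/
def dW : FA (Letter ⊕ Letter) →ₗ[ℂ] FA (Letter ⊕ Letter) := sderL parO 1 dlet

lemma dlet_mem (a : Letter ⊕ Letter) : dlet a ∈
    Submodule.span ℂ ((fun b => wd [b]) '' {b | parO b = 1 + parO a}) := by
  rcases a with a | a
  · exact Submodule.subset_span ⟨.inr a, by simp [add_comm], rfl⟩
  · exact zero_mem _

lemma dW_cons (a : Letter) (l : Word) : dW (wd ((a :: l).map Sum.inl)) =
    wd (.inr a :: l.map Sum.inl) + sg (par a) • (wd [.inl a] * dW (wd (l.map Sum.inl))) := by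
  rw [dW, sderL, linExt_wd, linExt_wd, List.map_cons, sder, one_mul, parO_inl, dlet, Sum.elim_inl,
    wd_mul]
  rfl

lemma inlW_rotL (x : FA Letter) : (inlW (rotL par x)) = rotL parO (inlW x) := by
  induction x using fa_induction with
  | h0 => simp
  | hw l =>
    rcases l with _ | ⟨a, l⟩
    · simp [rotL, rot, inlW_one]
    · simp [rotL, rot]
  | ha x y hx hy => simp only [map_add, hx, hy]
  | hs c x hx => simp only [map_smul, hx]

lemma inlW_cycN (l : Word) : inlW (cycN par l) = cycN parO (l.map Sum.inl) := by
  rw [cycN, cycN, map_sum, List.length_map]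
  refine Finset.sum_congr rfl fun i _ => ?_
  have : ∀ x, inlW ((rotL par ^ i) x) = (rotL parO ^ i) (inlW x) := by
    clear * -
    induction i with
    | zero => intro x; rfl
    | succ i ih => intro x; rw [pow_succ, Module.End.mul_apply, ih, inlW_rotL, pow_succ]; rfl
  rw [this, inlW_wd]

/-- The detector of `1`-forms on exact forms. -/
lemma kapW_dW (x : FA Letter) : kapW (dW (inlW x)) = cycNL par x := by
  induction x using fa_induction with
  | h0 => simp
  | hw l =>
    rw [inlW_wd, kapW, LinearMap.comp_apply, cycNL_word]
    have h1 : cycNL parO (dW (wd (l.map Sum.inl))) = dW (inlW (cycN par l)) := by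
      rw [inlW_cycN, dW, sderL_cycN dlet_mem, sderL, linExt_wd]
    rw [h1]
    rcases l with _ | ⟨a, l⟩
    · simp [cycN]
    refine lenSub_induction (P := fun y => linExt pick (dW (inlW y)) = y)
      (cycN_len (a :: l)) (by simp) (fun l' hl' => ?_) (fun x y hx hy => ?_) (fun c x hx => ?_)
    · rcases l' with _ | ⟨b, l'⟩
      · simp at hl'
      rw [inlW_wd, dW_cons, map_add, map_smul, linExt_wd, pick, strip_map, wd_mul]
      have : ∀ y, linExt pick (wd [Sum.inl b] * y) = 0 := by
        intro y
        induction y using fa_induction with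
        | h0 => simp
        | hw l => rw [wd_mul, linExt_wd]; rfl
        | ha x y hx hy => rw [mul_add, map_add, hx, hy, add_zero]
        | hs c x hx => rw [mul_smul_comm, map_smul, hx, smul_zero]
      rw [this, smul_zero, add_zero]; rfl
    · simp only [map_add, hx, hy]
    · simp only [map_smul, hx]
  | ha x y hx hy => simp only [map_add, hx, hy]
  | hs c x hx => simp only [map_smul, hx]

lemma kapW_mul_dW_word (u g : Word) :
    kapW (wd (u.map Sum.inl) * dW (wd (g.map Sum.inl))) -
      rotL par (kapW (wd (u.map Sum.inl) * dW (wd (g.map Sum.inl)))) =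
    -sg (lpar par u) • (wd u * wd g - sg (lpar par u * lpar par g) • (wd g * wd u)) := by
  induction g generalizing u with
  | nil =>
    have : dW (wd (([] : Word).map Sum.inl)) = 0 := by simp [dW, sderL, sder]
    rw [this]
    simp [sg_zero, wd_nil]
  | cons b g ih =>
    have e1 : wd (u.map Sum.inl) * dW (wd ((b :: g).map Sum.inl)) =
        wd (u.map Sum.inl ++ Sum.inr b :: g.map Sum.inl) +
          sg (par b) • (wd ((u ++ [b]).map Sum.inl) * dW (wd (g.map Sum.inl))) := by
      rw [dW_cons, mul_add, wd_mul, mul_smul_comm, ← mul_assoc, wd_mul, List.map_append]; rfl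
    rw [e1, map_add, map_smul, kapW_mid, map_add, map_smul (rotL par), map_smul (rotL par),
      add_sub_add_comm, ← smul_sub, ← smul_sub, ih]
    have e2 : rotL par (wd (b :: (g ++ u))) =
        sg (par b * (lpar par g + lpar par u)) • wd (g ++ u ++ [b]) := by
      rw [rotL, linExt_wd, rot, lpar_append]
    rw [e2]
    simp only [wd_mul, lpar_append, lpar_cons, lpar_nil, add_zero, smul_sub, smul_smul, neg_mul,
      ← sg_add, neg_smul, smul_neg]
    generalize lpar par u = x
    generalize lpar par g = y
    generalize par b = z
    have s1 : z + (x + z) = x := by clear * -; revert x z; decide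
    have s2 : x * (z + 1 + y) = x + x * (z + y) := by ring
    have s3 : x + x * (z + y) + z * (y + x) = x + (x + z) * y := by
      clear * -; revert x y z; decide
    have s4 : z + (x + z + (x + z) * y) = x + (x + z) * y := by
      clear * -; revert x y z; decide
    have l1 : u ++ [b] ++ g = u ++ b :: g := by simp
    have l2 : g ++ (u ++ [b]) = g ++ u ++ [b] := by simp
    have l3 : b :: (g ++ u) = b :: g ++ u := rfl
    rw [s2, s3, s1, s4, l1, l2, l3]
    abel

lemma kapW_mul_dW {p q : ZMod 2} {x y : FA Letter} (hx : x ∈ hom par p) (hy : y ∈ hom par q) :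
    kapW (inlW x * dW (inlW y)) - rotL par (kapW (inlW x * dW (inlW y))) =
    -sg p • (x * y - sg (p * q) • (y * x)) := by
  refine hom_induction (P := fun x => kapW (inlW x * dW (inlW y)) - rotL par (kapW (inlW x * dW (inlW y))) = -sg p • (x * y - sg (p * q) • (y * x))) hx (by simp) (fun l hl => ?_) (fun x x' h h' => ?_) (fun c x h => ?_)
  · refine hom_induction (P := fun y => kapW (inlW (wd l) * dW (inlW y)) - rotL par (kapW (inlW (wd l) * dW (inlW y))) = -sg p • ((wd l) * y - sg (p * q) • (y * (wd l)))) hy (by simp) (fun l' hl' => ?_) (fun x x' h h' => ?_) (fun c x h => ?_)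
    · rw [inlW_wd, inlW_wd, kapW_mul_dW_word, hl, hl']
    · simp only [map_add, mul_add, add_mul]
      rw [add_sub_add_comm, h, h', ← smul_add]
      congr 1
      simp only [smul_add]
      abel
    · simp only [map_smul, mul_smul_comm, smul_mul_assoc]
      rw [← smul_sub, h, smul_comm, smul_sub, smul_comm c (sg (p * q))]
  · simp only [map_add, mul_add, add_mul]
    rw [add_sub_add_comm, h, h', ← smul_add]
    congr 1
    simp only [smul_add]
    abel
  · simp only [map_smul, mul_smul_comm, smul_mul_assoc]
    rw [← smul_sub, h, smul_comm, smul_sub, smul_comm c (sg (p * q))]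

end Detector

section TcMul

variable {V : Type*} [AddCommGroup V] [Module ℂ V]

lemma tc_tι_mul (n : ℕ) (v : V) (f : That V) : tc (n + 1) (tι v * f) = ι ℂ v * tc n f := by
  rw [tc_mul, Finset.sum_eq_single (1, n)]
  · rw [tc_tι, if_pos rfl]
  · rintro ⟨a, b⟩ hab hne
    rw [Finset.HasAntidiagonal.mem_antidiagonal] at hab
    rw [tc_tι, if_neg, zero_mul]
    rintro rfl
    exact hne (by ext <;> simp at * ; omega)
  · intro h; exact absurd (Finset.HasAntidiagonal.mem_antidiagonal.2 (add_comm 1 n)) h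

lemma tc_mul_tι (n : ℕ) (v : V) (f : That V) : tc (n + 1) (f * tι v) = tc n f * ι ℂ v := by
  rw [tc_mul, Finset.sum_eq_single (n, 1)]
  · rw [tc_tι, if_pos rfl]
  · rintro ⟨a, b⟩ hab hne
    rw [Finset.HasAntidiagonal.mem_antidiagonal] at hab
    rw [tc_tι, if_neg, mul_zero]
    rintro rfl
    exact hne (by ext <;> simp at * ; omega)
  · intro h; exact absurd (Finset.HasAntidiagonal.mem_antidiagonal.2 (show (n, 1).1 + (n, 1).2 = n + 1 from rfl)) h

lemma tc_zero_tι_mul (v : V) (f : That V) : tc 0 (tι v * f) = 0 := by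
  rw [tc_mul]; simp [tc_tι]

end TcMul

/-- The index set of the canonical basis of `ℂ^{2n|m}`. -/
abbrev SI (n m : ℕ) : Type := Fin n ⊕ Fin n ⊕ Fin m

section Coord

variable {n m : ℕ}

@[simp] lemma stdB_apply (i j : SI n m) : (stdB i : Std n m) j = if j = i then 1 else 0 := by
  simp [stdB, Pi.single_apply]

lemma std_sum (v : Std n m) : v = ∑ i, v i • stdB i := by
  refine funext fun j => ?_
  have : (∑ i, v i • stdB i : Std n m) j = ∑ i, (v i • stdB i : Std n m) j :=
    Finset.sum_apply j _ _
  rw [this]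
  have h : ∀ i, (v i • stdB i : Std n m) j = v i * (if j = i then 1 else 0) := fun i => by
    rw [← stdB_apply]; rfl
  simp only [h]
  rw [Finset.sum_eq_single j]
  · rw [if_pos rfl, mul_one]
  · intro i _ hi; rw [if_neg fun e => hi e.symm, mul_zero]
  · intro hj; exact absurd (Finset.mem_univ j) hj

/-- The parity of a basis vector. -/
abbrev spar (i : SI n m) : ZMod 2 := par (stdLetter n m i)

lemma sinv_stdB (i : SI n m) : sinv (stdB i) = sg (spar i) • stdB i := by
  refine funext fun j => ?_
  change sg (par (stdLetter n m j)) * (stdB i : Std n m) j = sg (spar i) * (stdB i : Std n m) j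
  rw [stdB_apply]
  split_ifs with h
  · rw [h]
  · simp

/-- The dual basis vectors `p♯ = q`, `q♯ = -p`, `x♯ = -x`. -/
def shp : SI n m → Std n m
  | .inl i => stdB (.inr (.inl i))
  | .inr (.inl i) => -stdB (.inl i)
  | .inr (.inr i) => -stdB (.inr (.inr i))

lemma sinv_shp (i : SI n m) : sinv (shp i) = sg (spar i) • shp i := by
  rcases i with i | i | i
  · exact sinv_stdB _
  · simp only [shp, map_neg, sinv_stdB, smul_neg]; rfl
  · simp only [shp, map_neg, sinv_stdB, smul_neg]

lemma swap_sum {E : Type*} [AddCommGroup E] [Module ℂ E] (c : ZMod 2 → ℂ)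
    (B : Std n m →ₗ[ℂ] Std n m →ₗ[ℂ] E) :
    ∑ a, (c (spar a) * sg (spar a)) • B (shp a) (stdB a) =
      -∑ a, c (spar a) • B (stdB a) (shp a) := by
  simp only [Fintype.sum_sum_type, shp, spar, stdLetter, par, sg_zero, sg_one, map_neg,
    LinearMap.neg_apply, smul_neg, mul_one, mul_neg, neg_smul, neg_neg, Finset.sum_neg_distrib]
  abel

lemma stdLetter_injective : Function.Injective (stdLetter n m) := by
  rintro (i | i | i) (j | j | j) h <;> simp_all [stdLetter, Fin.ext_iff]

open Classical in
variable (n m) in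
/-- The basis vector of a letter (zero for the letters that do not occur in `ℂ^{2n|m}`). -/
def letV (a : Letter) : Std n m := ∑ i, (if stdLetter n m i = a then (1 : ℂ) else 0) • stdB i

lemma letV_stdLetter (i : SI n m) : letV n m (stdLetter n m i) = stdB i := by
  rw [letV, Finset.sum_eq_single i]
  · simp
  · intro j _ hj; rw [if_neg fun h => hj (stdLetter_injective h), zero_smul]
  · simp

variable (n m) in
/-- The homomorphism from words to tensors. -/
def ev : FA Letter →ₐ[ℂ] TensorAlgebra ℂ (Std n m) :=
  MonoidAlgebra.lift ℂ _ _ (FreeMonoid.lift fun a => ι ℂ (letV n m a))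

lemma ev_wd (l : Word) : ev n m (wd l) = (l.map fun a => ι ℂ (letV n m a)).prod := by
  rw [ev, wd, MonoidAlgebra.lift_single, one_smul, FreeMonoid.lift_apply]; rfl

lemma coordT_ι (v : Std n m) : coordT n m (ι ℂ v) = ∑ i, v i • wd [stdLetter n m i] := by
  rw [coordT, lift_ι_apply]; rfl

lemma coordT_stdB (i : SI n m) : coordT n m (ι ℂ (stdB i)) = wd [stdLetter n m i] := by
  rw [coordT_ι, Finset.sum_eq_single i]
  · simp
  · intro j _ hj; rw [stdB_apply, if_neg hj, zero_smul]
  · simp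

lemma ev_coordT (x : TensorAlgebra ℂ (Std n m)) : ev n m (coordT n m x) = x := by
  have : (ev n m).comp (coordT n m) = AlgHom.id ℂ _ := by
    ext v
    change ev n m (coordT n m (ι ℂ v)) = ι ℂ v
    rw [coordT_ι, map_sum]
    conv_rhs => rw [std_sum v, map_sum]
    refine Finset.sum_congr rfl fun i _ => ?_
    rw [map_smul, map_smul, ev_wd]
    simp [letV_stdLetter]
  exact DFunLike.congr_fun this x

lemma coordT_injective : Function.Injective (coordT n m) :=
  Function.LeftInverse.injective ev_coordT

/-- The tensor of a word in the indices. -/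
def tw (l : List (SI n m)) : TensorAlgebra ℂ (Std n m) := (l.map fun i => ι ℂ (stdB i)).prod

lemma tw_cons (i : SI n m) (l : List (SI n m)) : tw (i :: l) = ι ℂ (stdB i) * tw l := by
  simp [tw]

lemma tw_mem (l : List (SI n m)) : tw l ∈ gr (Std n m) l.length := by
  induction l with
  | nil => simpa [tw] using algebraMap_mem_gr (V := Std n m) 1
  | cons i l ih => rw [tw_cons, List.length_cons, add_comm]; exact gr_mul (ι_mem_gr _) ih

lemma coordT_tw (l : List (SI n m)) : coordT n m (tw l) = wd (l.map (stdLetter n m)) := by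
  induction l with
  | nil => simp [tw, wd_nil]
  | cons i l ih => rw [tw_cons, map_mul, ih, coordT_stdB, wd_mul]; rfl

lemma ev_map (l : List (SI n m)) : ev n m (wd (l.map (stdLetter n m))) = tw l := by
  rw [← coordT_tw, ev_coordT]

lemma span_tw : Submodule.span ℂ (Set.range (tw : List (SI n m) → _)) = ⊤ := by
  refine top_unique fun x _ => ?_
  induction x using TensorAlgebra.induction with
  | algebraMap r =>
    rw [Algebra.algebraMap_eq_smul_one]
    exact Submodule.smul_mem _ _ (Submodule.subset_span ⟨[], rfl⟩)
  | ι v =>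
    rw [std_sum v, map_sum]
    refine Submodule.sum_mem _ fun i _ => ?_
    rw [map_smul]
    exact Submodule.smul_mem _ _ (Submodule.subset_span ⟨[i], by simp [tw]⟩)
  | mul a b ha hb =>
    have := Submodule.mul_mem_mul (ha trivial) (hb trivial)
    rw [Submodule.span_mul_span] at this
    refine Submodule.span_mono ?_ this
    rintro _ ⟨_, ⟨l, rfl⟩, _, ⟨l', rfl⟩, rfl⟩
    exact ⟨l ++ l', by simp [tw]⟩
  | add a b ha hb => exact add_mem (ha trivial) (hb trivial)

lemma tw_induction {P : TensorAlgebra ℂ (Std n m) → Prop} (x : TensorAlgebra ℂ (Std n m))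
    (h0 : P 0) (hw : ∀ l, P (tw l)) (ha : ∀ x y, P x → P y → P (x + y))
    (hs : ∀ (c : ℂ) x, P x → P (c • x)) : P x := by
  have hx : x ∈ Submodule.span ℂ (Set.range (tw : List (SI n m) → _)) := by
    rw [span_tw]; trivial
  induction hx using Submodule.span_induction with
  | mem x hx => obtain ⟨l, rfl⟩ := hx; exact hw l
  | zero => exact h0
  | add x y _ _ hx hy => exact ha x y hx hy
  | smul c x _ hx => exact hs c x hx

lemma coordT_tsgn (x : TensorAlgebra ℂ (Std n m)) :
    coordT n m (tsgn x) = sgnW par (coordT n m x) := by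
  induction x using TensorAlgebra.induction with
  | algebraMap r =>
    rw [AlgHom.commutes, AlgHom.commutes, Algebra.algebraMap_eq_smul_one, map_smul, ← wd_nil,
      sgnW_wd]
    simp [sg_zero]
  | ι v =>
    have : tsgn (ι ℂ v) = ι ℂ (sinv v) := by simp [tmap]
    rw [this, coordT_ι, coordT_ι, map_sum]
    refine Finset.sum_congr rfl fun i _ => ?_
    rw [map_smul, sgnW_wd, smul_smul, lpar_cons, lpar_nil, add_zero, mul_comm]
    rfl
  | mul a b ha hb => rw [map_mul, map_mul, ha, hb, map_mul, sgnW_mul]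
  | add a b ha hb => simp only [map_add, ha, hb]

lemma coordT_hom {p : ZMod 2} {x : TensorAlgebra ℂ (Std n m)} (hx : tsgn x = sg p • x) :
    coordT n m x ∈ hom par p := hom_of_sgnW (by rw [← coordT_tsgn, hx, map_smul])

lemma coordT_tc_hom {p : ZMod 2} {f : That (Std n m)} (hf : hsgn f = sg p • f) (k : ℕ) :
    coordT n m (tc k f) ∈ hom par p := coordT_hom (tc_hsgn hf k)

variable (n m) in
/-- Expansion of noncommutative forms on `ℂ^{2n|m}` in words in the letters `a` and `da`. -/
def coordO : TensorAlgebra ℂ (FormGen (Std n m)) →ₐ[ℂ] FA (Letter ⊕ Letter) :=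
  lift ℂ
    { toFun := fun x : FormGen (Std n m) =>
        (∑ i, (fstL x : Std n m) i • wd [Sum.inl (stdLetter n m i)] +
        ∑ i, (sndL x : Std n m) i • wd [Sum.inr (stdLetter n m i)] : FA (Letter ⊕ Letter))
      map_add' := fun v w => by
        rw [add_add_add_comm]
        exact congrArg₂ (fun x y : FA (Letter ⊕ Letter) => x + y)
          ((Finset.sum_congr rfl fun i _ => add_smul ((fstL v : Std n m) i)
            ((fstL w : Std n m) i) _).trans Finset.sum_add_distrib)
          ((Finset.sum_congr rfl fun i _ => add_smul ((sndL v : Std n m) i)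
            ((sndL w : Std n m) i) _).trans Finset.sum_add_distrib)
      map_smul' := fun c v => by
        rw [smul_add, Finset.smul_sum, Finset.smul_sum]
        exact congrArg₂ (fun x y : FA (Letter ⊕ Letter) => x + y)
          (Finset.sum_congr rfl fun i _ => mul_smul c ((fstL v : Std n m) i) _)
          (Finset.sum_congr rfl fun i _ => mul_smul c ((sndL v : Std n m) i) _) }

lemma coordO_ι (x : FormGen (Std n m)) : coordO n m (ι ℂ x) =
    ∑ i, fstL x i • wd [.inl (stdLetter n m i)] + ∑ i, sndL x i • wd [.inr (stdLetter n m i)] := by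
  rw [coordO, lift_ι_apply]; rfl

lemma coordO_gen (v : Std n m) : coordO n m (ι ℂ (gen v)) = inlW (coordT n m (ι ℂ v)) := by
  rw [coordO_ι, coordT_ι, map_sum]
  have h : ∀ i, sndL (gen v) i = 0 := fun _ => rfl
  simp [h]

lemma coordO_dgen (v : Std n m) : coordO n m (ι ℂ (dgen v)) =
    ∑ i, v i • wd [.inr (stdLetter n m i)] := by
  rw [coordO_ι]
  have h : ∀ i, fstL (dgen v) i = 0 := fun _ => rfl
  simp [h]

lemma coordO_dgen_eq (v : Std n m) : coordO n m (ι ℂ (dgen v)) = dW (inlW (coordT n m (ι ℂ v))) := by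
  rw [coordO_dgen, coordT_ι, map_sum, map_sum]
  refine Finset.sum_congr rfl fun i _ => ?_
  rw [map_smul, map_smul, inlW_wd, dW_cons]
  simp [dW, sderL, sder]

lemma coordO_tmap_gen (x : TensorAlgebra ℂ (Std n m)) :
    coordO n m (tmap gen x) = inlW (coordT n m x) := by
  induction x using TensorAlgebra.induction with
  | algebraMap r =>
    rw [AlgHom.commutes, AlgHom.commutes, AlgHom.commutes, Algebra.algebraMap_eq_smul_one,
      Algebra.algebraMap_eq_smul_one, map_smul, inlW_one]
  | ι v => rw [← coordO_gen]; simp [tmap]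
  | mul a b ha hb => rw [map_mul, map_mul, ha, hb, map_mul, inlW_mul]
  | add a b ha hb => simp only [map_add, ha, hb]

lemma coordO_fn (k : ℕ) (f : That (Std n m)) :
    coordO n m (tc k (fn f)) = inlW (coordT n m (tc k f)) := by
  rw [fn_apply, tc_hmap, coordO_tmap_gen]

lemma coordO_tsgn (x : TensorAlgebra ℂ (FormGen (Std n m))) :
    coordO n m (tsgn x) = sgnW parO (coordO n m x) := by
  induction x using TensorAlgebra.induction with
  | algebraMap r =>
    rw [AlgHom.commutes, AlgHom.commutes, Algebra.algebraMap_eq_smul_one, map_smul, ← wd_nil,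
      sgnW_wd]
    simp [sg_zero]
  | ι x =>
    have : tsgn (ι ℂ x) = ι ℂ (sinv x) := by simp [tmap]
    rw [this, coordO_ι, coordO_ι, map_add, map_sum, map_sum]
    congr 1
    · refine Finset.sum_congr rfl fun i _ => ?_
      rw [map_smul, sgnW_wd, smul_smul, lpar_cons, lpar_nil, add_zero, mul_comm]
      rfl
    · refine Finset.sum_congr rfl fun i _ => ?_
      rw [map_smul, sgnW_wd, smul_smul, lpar_cons, lpar_nil, add_zero, mul_comm, parO_inr, sg_add,
        sg_one, mul_neg_one, neg_mul]
      rfl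
  | mul a b ha hb => rw [map_mul, map_mul, ha, hb, map_mul, sgnW_mul]
  | add a b ha hb => simp only [map_add, ha, hb]

lemma coordO_hom {p : ZMod 2} {x : TensorAlgebra ℂ (FormGen (Std n m))} (hx : tsgn x = sg p • x) :
    coordO n m x ∈ hom parO p := hom_of_sgnW (by rw [← coordO_tsgn, hx, map_smul])

lemma kapW_sComm {x : TensorAlgebra ℂ (FormGen (Std n m))} (hx : x ∈ sComm (FormGen (Std n m))) :
    kapW (coordO n m x) = 0 := by
  induction hx using Submodule.span_induction with
  | mem z hz =>
    obtain ⟨p, q, x, y, hx, hy, rfl⟩ := hz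
    rw [map_sub, map_smul, map_mul, map_mul]
    exact kapW_comm (coordO_hom hx) (coordO_hom hy)
  | zero => rw [map_zero, map_zero]
  | add x y _ _ hx hy => rw [map_add, map_add, hx, hy, add_zero]
  | smul c x _ hx => rw [map_smul, map_smul, hx, smul_zero]

/-- The coefficients of the `1`-form part of a form. -/
def kap (k : ℕ) : OmegaHat (Std n m) →ₗ[ℂ] FA Letter :=
  kapW ∘ₗ (coordO n m).toLinearMap ∘ₗ tc k

lemma kap_apply (k : ℕ) (f : OmegaHat (Std n m)) : kap k f = kapW (coordO n m (tc k f)) := rfl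

lemma kap_hComm {f : OmegaHat (Std n m)} (hf : f ∈ hComm (FormGen (Std n m))) (k : ℕ) :
    kap k f = 0 := kapW_sComm (mem_hComm.1 hf k)

lemma coordO_omD_fn (k : ℕ) (f : That (Std n m)) :
    coordO n m (tc k (omD (fn f))) = dW (inlW (coordT n m (tc k f))) := by
  have key : ∀ (k : ℕ) (x : TensorAlgebra ℂ (Std n m)), x ∈ gr (Std n m) k →
      coordO n m (tc k (omD (fn (temb x)))) = dW (inlW (coordT n m x)) := by
    intro k x hx
    refine gr_induct (P := fun k x => coordO n m (tc k (omD (fn (temb x)))) =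
      dW (inlW (coordT n m x))) (fun r => ?_) (fun k x y hx hy => ?_) (fun k v x hx ih => ?_) hx
    · have h1 : omD (1 : OmegaHat (Std n m)) = 0 := by
        have := omD_mul (1 : OmegaHat (Std n m)) 1
        have h1' : hsgn (1 : OmegaHat (Std n m)) = 1 := map_one _
        rw [mul_one, h1', one_mul, mul_one] at this
        simpa using this
      have h2 : dW (inlW (1 : FA Letter)) = 0 := by
        rw [inlW_one, ← wd_nil]; simp [dW, sderL, sder]
      have h3 : temb (1 : TensorAlgebra ℂ (Std n m)) = 1 := map_one _
      have h4 : coordT n m 1 = 1 := map_one _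
      rw [Algebra.algebraMap_eq_smul_one, map_smul, h3, map_smul, map_smul, fn_one, h1, map_smul (coordT n m),
        h4, map_smul inlW, map_smul dW, h2]
      simp
    · simp only [map_add, hx, hy]
    · rw [map_mul, temb_ι, fn_mul, fn_tι, omD_mul, map_add, omD_tι, fstL_gen, tc_tι_mul,
        hsgn_tι, tc_tι_mul, sinv_gen, map_add, map_mul, map_mul, ih, coordO_gen, coordO_dgen_eq]
      have h3 : tc k (fn (temb x)) = tmap gen x := by
        rw [fn_apply, tc_hmap, tc_temb hx, if_pos rfl]
      rw [h3, coordO_tmap_gen, map_mul, inlW_mul]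
      have h4 : coordT n m (ι ℂ (sinv v)) = sgnW par (coordT n m (ι ℂ v)) := by
        rw [← coordT_tsgn]; congr 1; simp [tmap]
      rw [h4, coordT_ι]
      generalize inlW (coordT n m x) = y
      simp only [map_sum, Finset.sum_mul, ← Finset.sum_add_distrib]
      refine Finset.sum_congr rfl fun i _ => ?_
      simp only [map_smul, smul_mul_assoc, ← smul_add]
      congr 1
      rw [inlW_wd, dW, sderL_mul _ _ (wd_mem_hom parO _), sgnW_wd, map_smul, inlW_wd]
      simp
  rw [tc_omD, ← key k _ (tc_mem k f)]
  congr 2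
  have : temb (tc k (fn f)) = fn (temb (tc k f)) := That.ext' fun j => by
    rw [tc_temb (tc_mem _ _), fn_apply, fn_apply, tc_hmap, tc_hmap, tc_temb (tc_mem _ _)]
    split_ifs <;> simp
  rw [this]

/-- The detector of `1`-forms on exact forms. -/
lemma kap_omD_fn (k : ℕ) (f : That (Std n m)) :
    kap k (omD (fn f)) = cycNL par (coordT n m (tc k f)) := by
  rw [kap_apply, coordO_omD_fn, kapW_dW]

lemma kap_fn_mul_omD {p q : ZMod 2} {f g : That (Std n m)} (hf : hsgn f = sg p • f)
    (hg : hsgn g = sg q • g) (k : ℕ) :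
    kap k (fn f * omD (fn g)) - rotL par (kap k (fn f * omD (fn g))) =
      -sg p • coordT n m (tc k (f * g - sg (p * q) • (g * f))) := by
  rw [kap_apply, map_sub, map_smul, tc_mul, tc_mul, tc_mul, ← Finset.Nat.sum_antidiagonal_swap (n := k)
    (f := fun p => tc p.1 g * tc p.2 f), Finset.smul_sum, ← Finset.sum_sub_distrib]
  simp only [map_sum, ← Finset.sum_sub_distrib, Finset.smul_sum]
  refine Finset.sum_congr rfl fun i _ => ?_
  rw [map_mul, coordO_fn, coordO_omD_fn, kapW_mul_dW (coordT_tc_hom hf _) (coordT_tc_hom hg _),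
    map_sub, map_smul, map_mul, map_mul]
  rfl

/-- Left inverse of the detector modulo supercommutators. -/
def oneForm : FA Letter →ₗ[ℂ] TensorAlgebra ℂ (FormGen (Std n m)) :=
  linExt fun l => match l with
    | [] => 0
    | a :: l => ι ℂ (dgen (letV n m a)) * tmap gen (ev n m (wd l))

lemma tsgn_tmap_gen (x : TensorAlgebra ℂ (Std n m)) : tsgn (tmap gen x) = tmap gen (tsgn x) := by
  have : (tsgn : TensorAlgebra ℂ (FormGen (Std n m)) →ₐ[ℂ] _).comp (tmap gen) =
      (tmap gen).comp tsgn := by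
    ext v
    change tsgn (tmap gen (ι ℂ v)) = tmap gen (tsgn (ι ℂ v))
    simp [tmap, sinv_gen]
  exact DFunLike.congr_fun this _

lemma tsgn_tw (l : List (SI n m)) : tsgn (tw l) = sg (lpar par (l.map (stdLetter n m))) • tw l := by
  apply coordT_injective
  rw [coordT_tsgn, map_smul, coordT_tw, sgnW_wd]

lemma tForm_zero_eq {V : Type*} [AddCommGroup V] [Module ℂ V] (l : List (V ⊕ V))
    (h : l.countP Sum.isRight = 0) : ∃ x : TensorAlgebra ℂ V,
    (l.map (Sum.elim (fun v => ι ℂ (gen v)) (fun v => ι ℂ (dgen v)))).prod = tmap gen x := by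
  induction l with
  | nil => exact ⟨1, by simp⟩
  | cons a l ih =>
    rcases a with v | v
    · obtain ⟨x, hx⟩ := ih (by simpa using h)
      exact ⟨ι ℂ v * x, by rw [List.map_cons, List.prod_cons, hx, map_mul]; simp [tmap]⟩
    · simp at h

lemma tForm_one_eq {V : Type*} [AddCommGroup V] [Module ℂ V] (l : List (V ⊕ V))
    (h : l.countP Sum.isRight = 1) : ∃ (x y : TensorAlgebra ℂ V) (v : V),
    (l.map (Sum.elim (fun v => ι ℂ (gen v)) (fun v => ι ℂ (dgen v)))).prod =
      tmap gen x * ι ℂ (dgen v) * tmap gen y := by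
  induction l with
  | nil => simp at h
  | cons a l ih =>
    rcases a with v | v
    · obtain ⟨x, y, w, hx⟩ := ih (by simpa using h)
      exact ⟨ι ℂ v * x, y, w, by
        rw [List.map_cons, List.prod_cons, hx, map_mul]; simp [tmap, mul_assoc]⟩
    · obtain ⟨x, hx⟩ := tForm_zero_eq l (by rw [List.countP_cons] at h; simpa using h)
      exact ⟨1, x, v, by rw [List.map_cons, List.prod_cons, hx]; simp⟩

lemma sub_oneForm_mem {z : TensorAlgebra ℂ (FormGen (Std n m))} (hz : z ∈ tForm (Std n m) 1) :
    z - oneForm (kapW (coordO n m z)) ∈ sComm (FormGen (Std n m)) := by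
  set T : TensorAlgebra ℂ (FormGen (Std n m)) →ₗ[ℂ] TensorAlgebra ℂ (FormGen (Std n m)) :=
    LinearMap.id - oneForm ∘ₗ kapW ∘ₗ (coordO n m).toLinearMap with hT
  change T z ∈ _
  have key : ∀ (x y : TensorAlgebra ℂ (Std n m)) (v : Std n m),
      T (tmap gen x * ι ℂ (dgen v) * tmap gen y) ∈ sComm (FormGen (Std n m)) := by
    intro x y v
    induction x using tw_induction with
    | h0 => simp
    | ha x x' h h' => rw [map_add, add_mul, add_mul, map_add]; exact add_mem h h'
    | hs c x h =>
      rw [map_smul, smul_mul_assoc, smul_mul_assoc, map_smul]; exact Submodule.smul_mem _ _ h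
    | hw l =>
    induction y using tw_induction with
    | h0 => simp
    | ha x x' h h' => rw [map_add, mul_add, map_add]; exact add_mem h h'
    | hs c x h => rw [map_smul, mul_smul_comm, map_smul]; exact Submodule.smul_mem _ _ h
    | hw l' =>
    rw [std_sum v, map_sum, map_sum, Finset.mul_sum, Finset.sum_mul, map_sum]
    refine Submodule.sum_mem _ fun i _ => ?_
    rw [map_smul, map_smul, mul_smul_comm, smul_mul_assoc, map_smul]
    refine Submodule.smul_mem _ _ ?_
    have e1 : coordO n m (tmap gen (tw l) * ι ℂ (dgen (stdB i)) * tmap gen (tw l')) =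
        wd ((l.map (stdLetter n m)).map Sum.inl ++ Sum.inr (stdLetter n m i) ::
          (l'.map (stdLetter n m)).map Sum.inl) := by
      rw [map_mul, map_mul, coordO_tmap_gen, coordO_tmap_gen, coordT_tw, coordT_tw, inlW_wd, inlW_wd,
        coordO_dgen, Finset.sum_eq_single i]
      · rw [stdB_apply, if_pos rfl, one_smul, wd_mul, wd_mul, List.append_assoc]; rfl
      · intro j _ hj; rw [stdB_apply, if_neg hj, zero_smul]
      · simp
    rw [hT, LinearMap.sub_apply, LinearMap.comp_apply, LinearMap.comp_apply,
      AlgHom.toLinearMap_apply, e1, kapW_mid, map_smul, LinearMap.id_apply, oneForm, linExt_wd]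
    simp only []
    rw [letV_stdLetter, ← wd_mul, map_mul, ev_map, ev_map, map_mul, mul_assoc, ← mul_assoc (ι ℂ _)]
    refine Submodule.subset_span ⟨lpar par (l.map (stdLetter n m)),
      spar i + 1 + lpar par (l'.map (stdLetter n m)), _, _, ?_, ?_, rfl⟩
    · rw [tsgn_tmap_gen, tsgn_tw, map_smul]
    · rw [map_mul, tsgn_tmap_gen, tsgn_tw, map_smul, mul_smul_comm]
      have : tsgn (ι ℂ (dgen (stdB i : Std n m))) = sg (spar i + 1) • ι ℂ (dgen (stdB i)) := by
        have : tsgn (ι ℂ (dgen (stdB i : Std n m))) = ι ℂ (sinv (dgen (stdB i))) := by simp [tmap]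
        rw [this, sinv_dgen, sinv_stdB, map_neg, map_smul, map_smul, sg_add, sg_one]
        simp
      rw [this, smul_mul_assoc, smul_smul, sg_add (spar i + 1), mul_comm]
  induction hz using Submodule.span_induction with
  | mem z hz =>
    obtain ⟨l, hl, rfl⟩ := hz
    obtain ⟨x, y, v, h⟩ := tForm_one_eq l hl
    rw [h]; exact key x y v
  | zero => rw [map_zero]; exact zero_mem _
  | add x y _ _ hx hy => rw [map_add]; exact add_mem hx hy
  | smul c x _ hx => rw [map_smul]; exact Submodule.smul_mem _ _ hx

/-- The detector is injective on `1`-forms. -/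
lemma mem_hComm_of_kap {f : OmegaHat (Std n m)} (hf : f ∈ omForm (Std n m) 1)
    (h : ∀ k, kap k f = 0) : f ∈ hComm (FormGen (Std n m)) := by
  rw [mem_hComm]
  intro k
  simp only [omForm, Submodule.mem_iInf, Submodule.mem_comap] at hf
  have := sub_oneForm_mem (hf k)
  rw [← kap_apply, h, map_zero, sub_zero] at this
  exact this

end Coord

section CyclicWords

lemma rotL_cycNL {α : Type} (par : α → ZMod 2) (x : FA α) :
    rotL par (cycNL par x) = cycNL par x := by
  suffices h : rotL par ∘ₗ cycNL par = cycNL par from LinearMap.congr_fun h x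
  refine fa_ext fun l => ?_
  rw [LinearMap.comp_apply, cycNL_word, cycN, map_sum]
  have h2 : ∀ i, rotL par ((rotL par ^ i) (wd l)) = (rotL par ^ (i + 1)) (wd l) := by
    intro i; rw [pow_succ', Module.End.mul_apply]
  simp only [h2]
  have h3 := Finset.sum_range_succ (fun i => (rotL par ^ i) (wd l)) l.length
  have h4 := Finset.sum_range_succ' (fun i => (rotL par ^ i) (wd l)) l.length
  have h5 := rotL_pow par l []
  simp only [List.append_nil, lpar_nil, mul_zero, sg_zero, one_smul, List.nil_append] at h5
  rw [h3, h5] at h4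
  simp only [pow_zero, Module.End.one_apply] at h4
  exact (add_right_cancel h4).symm

lemma rotL_pow_len {α : Type} (par : α → ZMod 2) {k : ℕ} {x : FA α} (hx : x ∈ lenSub k) :
    (rotL par ^ k) x = x :=
  lenSub_induction (P := fun x => (rotL par ^ k) x = x) hx (map_zero _)
    (fun l hl => by
      have h5 := rotL_pow par l []
      simp only [List.append_nil, lpar_nil, mul_zero, sg_zero, one_smul, List.nil_append] at h5
      rw [← hl, h5])
    (fun x y hx hy => by rw [map_add, hx, hy]) (fun c x hx => by rw [map_smul, hx])

lemma cycNL_of_rot {α : Type} (par : α → ZMod 2) {k : ℕ} {x : FA α} (hx : x ∈ lenSub k)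
    (h : rotL par x = x) : cycNL par x = (k : ℂ) • x := by
  have h' : ∀ i, (rotL par ^ i) x = x := by
    intro i
    induction i with
    | zero => rfl
    | succ i ih => rw [pow_succ, Module.End.mul_apply, h, ih]
  rw [cycNL_of_len par hx, Finset.sum_congr rfl fun i _ => h' i, Finset.sum_const,
    Finset.card_range, Nat.cast_smul_eq_nsmul]

lemma cyc_rotL_pow (i : ℕ) (x : FA Letter) : x - (rotL par ^ i) x ∈ cyc := by
  induction i generalizing x with
  | zero => simp
  | succ i ih =>
    have := add_mem (cyc_rotL x) (ih (rotL par x))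
    rwa [sub_add_sub_cancel, ← Module.End.mul_apply, ← pow_succ] at this

lemma smul_sub_cycNL_mem {k : ℕ} {x : FA Letter} (hx : x ∈ lenSub k) :
    (k : ℂ) • x - cycNL par x ∈ cyc := by
  have : (k : ℂ) • x = ∑ i ∈ Finset.range k, x := by
    rw [Finset.sum_const, Finset.card_range, Nat.cast_smul_eq_nsmul]
  rw [cycNL_of_len par hx, this, ← Finset.sum_sub_distrib]
  exact Submodule.sum_mem _ fun i _ => cyc_rotL_pow i x

lemma cycNL_cyc {x : FA Letter} (hx : x ∈ cyc) : cycNL par x = 0 := by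
  induction hx using Submodule.span_induction with
  | mem x hx =>
    obtain ⟨w, rfl⟩ := hx
    rw [map_sub, cycNL_rot, cycNL_word, sub_self]
  | zero => rw [map_zero]
  | add x y _ _ hx hy => rw [map_add, hx, hy, add_zero]
  | smul c x _ hx => rw [map_smul, hx, smul_zero]

lemma mem_cyc_of_cycNL {k : ℕ} (hk : k ≠ 0) {x : FA Letter} (hx : x ∈ lenSub k)
    (h : cycNL par x = 0) : x ∈ cyc := by
  have := smul_sub_cycNL_mem hx
  rw [h, sub_zero] at this
  have h2 := Submodule.smul_mem cyc (k : ℂ)⁻¹ this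
  rwa [smul_smul, inv_mul_cancel₀ (Nat.cast_ne_zero.2 hk), one_smul] at h2

lemma br_cyc_left {x : FA Letter} (hx : x ∈ cyc) (y : FA Letter) : br x y = 0 := by
  rw [br_apply, cycNL_cyc hx, map_zero, LinearMap.zero_apply]

lemma br_cyc_right (x : FA Letter) {y : FA Letter} (hy : y ∈ cyc) : br x y = 0 := by
  rw [br_apply, cycNL_cyc hy, map_zero]

lemma ctrL_cons_single (u v : Letter) {q : ZMod 2} {y : FA Letter} (hy : y ∈ hom par q) :
    ctrL (wd [u] * y) (wd [v]) = (sg (par u * q) * pr u v) • y :=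
  hom_induction (P := fun y => ctrL (wd [u] * y) (wd [v]) = (sg (par u * q) * pr u v) • y) hy
    (by simp) (fun l hl => by
      rw [wd_mul, ctrL_wd]
      simp only [ctr, List.cons_append, List.nil_append, List.append_nil, hl])
    (fun x y hx hy => by rw [mul_add, map_add, LinearMap.add_apply, hx, hy, smul_add])
    (fun c x hx => by
      rw [mul_smul_comm, map_smul, LinearMap.smul_apply, hx, smul_comm])

lemma ctrL_mul_right (G : FA Letter) (v : Letter) (y : FA Letter) :
    ctrL G (wd [v] * y) = ctrL G (wd [v]) * y := by
  refine fa_induction₂ (P := fun G y => ctrL G (wd [v] * y) = ctrL G (wd [v]) * y) G y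
    (fun y => by simp) (fun x => by simp) (fun l l' => ?_) (fun x x' y h h' => ?_)
    (fun c x y h => ?_) (fun x y y' h h' => ?_) (fun c x y h => ?_)
  · rw [wd_mul, ctrL_wd, ctrL_wd]
    rcases l with _ | ⟨u, a⟩
    · simp [ctr]
    · simp only [ctr, List.cons_append, List.nil_append, List.append_nil, smul_mul_assoc, wd_mul]
  · rw [map_add, LinearMap.add_apply, LinearMap.add_apply, h, h', add_mul]
  · rw [map_smul, LinearMap.smul_apply, LinearMap.smul_apply, h, smul_mul_assoc]
  · rw [mul_add, map_add, h, h', mul_add]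
  · rw [mul_smul_comm, map_smul, h, mul_smul_comm]

/-- Modulo cyclic rotation, a superderivation may be applied to the first letters of all the
rotations of a word. -/
lemma sderL_sub_ctrL_mem {p : ZMod 2} {G : FA Letter} (hG : G ∈ hom par p) (x : FA Letter) :
    sderL par p (fun v => ctrL G (wd [v])) x - ctrL G (cycNL par x) ∈ cyc := by
  set δ := fun v => ctrL G (wd [v]) with hδ
  have hδ' : ∀ a, δ a ∈ hom par (p + par a) := fun a => by
    have := ctrL_hom hG (wd_mem_hom par [a])
    rwa [lpar_cons, lpar_nil, add_zero] at this
  have key : ∀ (t s : Word), sg (p * lpar par s) • (wd s * sder par p δ t) -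
      ∑ i ∈ Finset.range t.length, ctrL G ((rotL par ^ (s.length + i)) (wd (s ++ t))) ∈ cyc := by
    intro t
    induction t with
    | nil => intro s; simp [sder]
    | cons a t ih =>
      intro s
      have h1 := ih (s ++ [a])
      rw [List.length_cons, Finset.sum_range_succ', add_zero, rotL_pow, map_smul, List.cons_append,
        wd_cons a (t ++ s), ctrL_mul_right, sder, mul_add, smul_add, mul_smul_comm, smul_smul]
      have e1 : sg (p * lpar par s) * sg (p * par a) = sg (p * lpar par (s ++ [a])) := by
        rw [← sg_add, lpar_append, lpar_cons, lpar_nil, add_zero, mul_add]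
      have e2 : ∀ i, s.length + (i + 1) = (s ++ [a]).length + i := fun i => by
        rw [List.length_append, List.length_singleton]; omega
      have e3 : s ++ a :: t = (s ++ [a]) ++ t := by simp
      have h2 := Submodule.smul_mem cyc (sg (p * lpar par s))
        (comm_mem_cyc (wd_mem_hom par s) (hom_mul (hδ' a) (wd_mem_hom par t)))
      have e4 : sg (p * lpar par s) * sg (lpar par s * (p + par a + lpar par t)) =
          sg (lpar par s * lpar par (a :: t)) := by
        rw [← sg_add, lpar_cons]
        generalize lpar par s = x; generalize par a = y; generalize lpar par t = z
        congr 1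
        clear * -; revert p x y z; decide
      rw [smul_sub, smul_smul, e4, mul_assoc (δ a), wd_mul] at h2
      simp only [e1, e2, e3]
      rw [← mul_assoc (wd s) (wd [a]), wd_mul]
      convert add_mem h1 h2 using 1
      abel
  refine fa_induction (P := fun x => sderL par p δ x - ctrL G (cycNL par x) ∈ cyc) x (by simp)
    (fun l => ?_) (fun x y hx hy => ?_) (fun c x hx => ?_)
  · have := key l []
    simp only [lpar_nil, mul_zero, sg_zero, one_smul, wd_nil, one_mul, List.length_nil, zero_add,
      List.nil_append, ← map_sum] at this
    rw [cycNL_word, sderL, linExt_wd]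
    exact this
  · rw [map_add, map_add, map_add, add_sub_add_comm]; exact add_mem hx hy
  · rw [map_smul, map_smul, map_smul, ← smul_sub]; exact Submodule.smul_mem _ _ hx

end CyclicWords

section VectorFields

variable {n m : ℕ} {p : ZMod 2}

lemma shp_dual (i : SI n m) : ∑ a, (sg (spar a) * pr (stdLetter n m a) (stdLetter n m i)) • shp a =
    stdB i := by
  rcases i with i | i | i
  · simp only [Fintype.sum_sum_type, stdLetter, spar, par, pr, sg_zero, shp]
    rw [Finset.sum_eq_single (f := fun x : Fin n => _ • -stdB (Sum.inl x)) i]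
    · simp
    · intro j _ hj; simp [Fin.val_inj, hj]
    · simp
  · simp only [Fintype.sum_sum_type, stdLetter, spar, par, pr, sg_zero, shp]
    rw [Finset.sum_eq_single (f := fun x : Fin n => _ • stdB (Sum.inr (Sum.inl x))) i]
    · simp
    · intro j _ hj; simp [Fin.val_inj, hj]
    · simp
  · simp only [Fintype.sum_sum_type, stdLetter, spar, par, pr, sg_one, shp]
    rw [Finset.sum_eq_single (f := fun x : Fin m => _ • -stdB (Sum.inr (Sum.inr x))) i]
    · simp
    · intro j _ hj; simp [Fin.val_inj, hj]
    · simp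

/-- The component of degree `N` of the value of a vector field on a linear function, in coordinates. -/
def vfC (ξ : VField (Std n m) p) (N : ℕ) : Std n m →ₗ[ℂ] FA Letter :=
  (coordT n m).toLinearMap ∘ₗ tc N ∘ₗ ξ.toFun ∘ₗ tι

lemma vfC_apply (ξ : VField (Std n m) p) (N : ℕ) (v : Std n m) :
    vfC ξ N v = coordT n m (tc N (ξ.toFun (tι v))) := rfl

lemma vfC_hom (ξ : VField (Std n m) p) (N : ℕ) {q : ZMod 2} {v : Std n m}
    (hv : sinv v = sg q • v) : vfC ξ N v ∈ hom par (p + q) := by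
  refine coordT_tc_hom ?_ N
  change hsgn (ξ.toFun (tι v)) = sg (p + q) • ξ.toFun (tι v)
  rw [ξ.parity, hsgn_tι, hv, map_smul, map_smul, smul_smul, sg_add]

lemma vfC_len (ξ : VField (Std n m) p) (N : ℕ) (v : Std n m) : vfC ξ N v ∈ lenSub N :=
  coordT_len n m (tc_mem _ _)

/-- The coefficients of the `1`-form dual to a vector field. -/
def FH (ξ : VField (Std n m) p) (N : ℕ) : FA Letter :=
  ∑ a, sg (p * spar a) • (wd [stdLetter n m a] * vfC ξ N (shp a))

lemma FH_hom (ξ : VField (Std n m) p) (N : ℕ) : FH ξ N ∈ hom par p := by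
  refine Submodule.sum_mem _ fun a _ => Submodule.smul_mem _ _ ?_
  have := hom_mul (wd_mem_hom par [stdLetter n m a]) (vfC_hom ξ N (sinv_shp a))
  rw [lpar_cons, lpar_nil, add_zero] at this
  convert this using 2
  change p = spar a + (p + spar a)
  generalize spar a = x
  clear * -; revert p x; decide

lemma FH_len (ξ : VField (Std n m) p) (N : ℕ) : FH ξ N ∈ lenSub (N + 1) := by
  refine Submodule.sum_mem _ fun a _ => Submodule.smul_mem _ _ ?_
  rw [add_comm]
  exact lenSub_mul (Submodule.subset_span ⟨[_], rfl, rfl⟩) (vfC_len ξ N _)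

lemma ctrL_FH (ξ : VField (Std n m) p) (N : ℕ) (i : SI n m) :
    ctrL (FH ξ N) (wd [stdLetter n m i]) = vfC ξ N (stdB i) := by
  rw [← shp_dual i, map_sum, FH, map_sum, LinearMap.sum_apply]
  refine Finset.sum_congr rfl fun a _ => ?_
  rw [map_smul, LinearMap.smul_apply, ctrL_cons_single _ _ (vfC_hom ξ N (sinv_shp a)), map_smul,
    smul_smul, ← mul_assoc, ← sg_add]
  congr 3
  change p * spar a + spar a * (p + spar a) = _
  generalize spar a = x
  clear * -; revert p x; decide

lemma mem_span_tw {k : ℕ} {x : TensorAlgebra ℂ (Std n m)} (hx : x ∈ gr (Std n m) k) :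
    x ∈ Submodule.span ℂ (tw '' {l : List (SI n m) | l.length = k}) := by
  refine gr_induct (P := fun k x => x ∈ Submodule.span ℂ (tw '' {l : List (SI n m) | l.length = k}))
    (fun r => ?_) (fun k x y hx hy => add_mem hx hy) (fun k v x hg hx => ?_) hx
  · rw [Algebra.algebraMap_eq_smul_one]
    exact Submodule.smul_mem _ _ (Submodule.subset_span ⟨[], rfl, rfl⟩)
  · rw [std_sum v, map_sum, Finset.sum_mul]
    refine Submodule.sum_mem _ fun i _ => ?_
    rw [map_smul, smul_mul_assoc]
    refine Submodule.smul_mem _ _ ?_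
    clear hg
    induction hx using Submodule.span_induction with
    | mem x hx =>
      obtain ⟨l, hl, rfl⟩ := hx
      rw [← tw_cons]
      exact Submodule.subset_span ⟨i :: l, by simpa using hl, rfl⟩
    | zero => rw [mul_zero]; exact zero_mem _
    | add x y _ _ hx hy => rw [mul_add]; exact add_mem hx hy
    | smul c x _ hx => rw [mul_smul_comm]; exact Submodule.smul_mem _ _ hx

lemma spow_stdB (i : SI n m) : spow p (stdB i) = sg (p * spar i) • stdB i := by
  rcases zmod2_cases p with rfl | rfl
  · rw [spow_zero_eq, zero_mul, sg_zero, one_smul]; rfl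
  · rw [spow_one_eq, one_mul, sinv_stdB]

lemma tc_mul_temb {V : Type*} [AddCommGroup V] [Module ℂ V] {k : ℕ} {x : TensorAlgebra ℂ V}
    (hx : x ∈ gr V k) (f : That V) (N : ℕ) : tc (N + k) (f * temb x) = tc N f * x := by
  rw [tc_mul, Finset.sum_eq_single (N, k)]
  · rw [tc_temb hx, if_pos rfl]
  · rintro ⟨a, b⟩ hab hne
    rw [Finset.HasAntidiagonal.mem_antidiagonal] at hab
    rw [tc_temb hx, if_neg, mul_zero]
    rintro rfl
    exact hne (by ext <;> simp at * ; omega)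
  · intro h
    exact absurd (Finset.HasAntidiagonal.mem_antidiagonal.2 (show (N, k).1 + (N, k).2 = N + k from rfl)) h

lemma coordT_derT_tw (ξ : VField (Std n m) p) (l : List (SI n m)) (N : ℕ)
    (h : l.length ≤ N + 1) :
    coordT n m (tc N (derT p (ξ.toFun ∘ₗ tι) (tw l))) =
      sderL par p (fun v => ctrL (FH ξ (N + 1 - l.length)) (wd [v])) (coordT n m (tw l)) := by
  induction l generalizing N with
  | nil =>
    have : derT p (ξ.toFun ∘ₗ tι) (tw ([] : List (SI n m))) = 0 := by
      have := derT_algebraMap p (ξ.toFun ∘ₗ tι) 1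
      rwa [map_one] at this
    rw [this, coordT_tw]; simp [sderL, sder]
  | cons i l ih =>
    rw [coordT_tw, List.map_cons, sderL, linExt_wd, sder, ctrL_FH, vfC_apply, tw_cons, derT_mul,
      derT_ι, map_add, map_add]
    rw [List.length_cons] at h ⊢
    congr 1
    · obtain ⟨K, rfl⟩ : ∃ K, N = K + l.length := ⟨N - l.length, by omega⟩
      rw [tc_mul_temb (tw_mem l), map_mul, coordT_tw, LinearMap.comp_apply,
        show K + l.length + 1 - (l.length + 1) = K by omega]
    · have e1 : temb (tmap (spow p) (ι ℂ (stdB i))) = sg (p * spar i) • tι (stdB i : Std n m) := by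
        rw [tmap, lift_ι_apply, LinearMap.comp_apply, temb_ι, spow_stdB, map_smul]
      rw [e1, smul_mul_assoc, map_smul, map_smul]
      congr 1
      rcases N with _ | N
      · have : l = [] := List.eq_nil_of_length_eq_zero (by omega)
        subst this
        rw [tc_zero_tι_mul]; simp [sder]
      · rw [tc_tι_mul, map_mul, coordT_stdB, ih N (by omega), coordT_tw, sderL, linExt_wd,
          show N + 1 + 1 - (l.length + 1) = N + 1 - l.length by omega]

lemma coordT_vf (ξ : VField (Std n m) p) (f : That (Std n m)) (N : ℕ) :
    coordT n m (tc N (ξ.toFun f)) = ∑ k ∈ Finset.range (N + 2),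
      sderL par p (fun v => ctrL (FH ξ (N + 1 - k)) (wd [v])) (coordT n m (tc k f)) := by
  rw [ξ.eq_derHat, derHat, tc_tmk, LinearMap.sum_apply, map_sum]
  refine Finset.sum_congr rfl fun k hk => ?_
  rw [LinearMap.comp_apply, LinearMap.comp_apply]
  have h := mem_span_tw (tc_mem k f)
  rw [Finset.mem_range] at hk
  generalize tc k f = x at h ⊢
  induction h using Submodule.span_induction with
  | mem x hx =>
    obtain ⟨l, rfl, rfl⟩ := hx
    exact coordT_derT_tw ξ l N (by omega)
  | zero => simp
  | add x y _ _ hx hy => simp only [map_add, hx, hy]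
  | smul c x _ hx => simp only [map_smul, hx]

/-- `FH`, indexed by the length of the words. -/
def FF (ξ : VField (Std n m) p) : ℕ → FA Letter
  | 0 => 0
  | k + 1 => FH ξ k

lemma FF_hom (ξ : VField (Std n m) p) (k : ℕ) : FF ξ k ∈ hom par p := by
  cases k with
  | zero => exact zero_mem _
  | succ k => exact FH_hom ξ k

lemma FF_len (ξ : VField (Std n m) p) (k : ℕ) : FF ξ k ∈ lenSub k := by
  cases k with
  | zero => exact zero_mem _
  | succ k => exact FH_len ξ k

open Finset.HasAntidiagonal in
lemma coordT_vf_sub_mem (ξ : VField (Std n m) p) (f : That (Std n m)) (N : ℕ) :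
    coordT n m (tc N (ξ.toFun f)) - ∑ k ∈ antidiagonal (N + 2),
      ctrL (FF ξ k.1) (cycNL par (coordT n m (tc k.2 f))) ∈ cyc := by
  have h : ∑ k ∈ antidiagonal (N + 2), ctrL (FF ξ k.1) (cycNL par (coordT n m (tc k.2 f))) =
      ∑ k ∈ Finset.range (N + 2), ctrL (FH ξ (N + 1 - k)) (cycNL par (coordT n m (tc k f))) := by
    rw [← Finset.Nat.sum_antidiagonal_swap, Finset.Nat.sum_antidiagonal_eq_sum_range_succ_mk,
      Finset.sum_range_succ]
    simp only [Prod.swap]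
    rw [Nat.sub_self]
    simp only [FF, map_zero, LinearMap.zero_apply, add_zero]
    refine Finset.sum_congr rfl fun k hk => ?_
    rw [Finset.mem_range] at hk
    rw [show N + 2 - k = (N + 1 - k) + 1 by omega]
  rw [h, coordT_vf, ← Finset.sum_sub_distrib]
  exact Submodule.sum_mem _ fun k _ => sderL_sub_ctrL_mem (FH_hom ξ _) _

/-- Symplectic vector fields: their dual `1`-forms are closed. -/
def IsSymp (ξ : VField (Std n m) p) : Prop := ∀ N, rotL par (FH ξ N) = FH ξ N

/-- The Hamiltonian of a symplectic vector field. -/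
def ham (ξ : VField (Std n m) p) (k : ℕ) : FA Letter := (k : ℂ)⁻¹ • FF ξ k

lemma ham_hom (ξ : VField (Std n m) p) (k : ℕ) : ham ξ k ∈ hom par p :=
  Submodule.smul_mem _ _ (FF_hom ξ k)

lemma ham_len (ξ : VField (Std n m) p) (k : ℕ) : ham ξ k ∈ lenSub k :=
  Submodule.smul_mem _ _ (FF_len ξ k)

lemma IsSymp.cycNL_FF {ξ : VField (Std n m) p} (h : IsSymp ξ) (k : ℕ) :
    cycNL par (FF ξ k) = (k : ℂ) • FF ξ k := by
  cases k with
  | zero => simp [FF]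
  | succ k => exact cycNL_of_rot par (FH_len ξ k) (h k)

lemma IsSymp.cycNL_ham {ξ : VField (Std n m) p} (h : IsSymp ξ) (k : ℕ) :
    cycNL par (ham ξ k) = FF ξ k := by
  rw [ham, map_smul, h.cycNL_FF]
  cases k with
  | zero => simp [FF]
  | succ k => rw [smul_smul, inv_mul_cancel₀ (Nat.cast_ne_zero.2 k.succ_ne_zero), one_smul]

open Finset.HasAntidiagonal in
/-- A symplectic vector field acts by the bracket with its Hamiltonian. -/
lemma IsSymp.coordT_sub_br_mem {ξ : VField (Std n m) p} (h : IsSymp ξ) (f : That (Std n m)) (N : ℕ) :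
    coordT n m (tc N (ξ.toFun f)) - ∑ k ∈ antidiagonal (N + 2),
      br (ham ξ k.1) (coordT n m (tc k.2 f)) ∈ cyc := by
  have := coordT_vf_sub_mem ξ f N
  simp only [br_apply, h.cycNL_ham]
  exact this

/-- The Poisson bivector `∑ a ⊗ a♯`. -/
def Mhat (n m : ℕ) : That (Std n m) := ∑ a, tι (stdB a) * tι (shp a)

lemma FH_sub_rotL (ξ : VField (Std n m) p) (N : ℕ) :
    FH ξ N - rotL par (FH ξ N) = coordT n m (tc (N + 1) (ξ.toFun (Mhat n m))) := by
  have e1 : rotL par (FH ξ N) = ∑ a, sg (spar a) • (vfC ξ N (shp a) * wd [stdLetter n m a]) := by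
    rw [FH, map_sum]
    refine Finset.sum_congr rfl fun a _ => ?_
    have key : ∀ y ∈ hom par (p + spar a), rotL par (wd [stdLetter n m a] * y) =
        sg (spar a * (p + spar a)) • (y * wd [stdLetter n m a]) := fun y hy =>
      hom_induction (P := fun y => rotL par (wd [stdLetter n m a] * y) =
        sg (spar a * (p + spar a)) • (y * wd [stdLetter n m a])) hy (by simp)
        (fun l hl => by
          rw [wd_mul, wd_mul, rotL, linExt_wd, List.cons_append, List.nil_append, rot, hl])
        (fun x y hx hy => by rw [mul_add, map_add, hx, hy, add_mul, smul_add])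
        (fun c x hx => by rw [mul_smul_comm, map_smul, hx, smul_mul_assoc, smul_comm])
    rw [map_smul, key _ (vfC_hom ξ N (sinv_shp a)), smul_smul, ← sg_add]
    congr 2
    generalize spar a = x
    clear * -; revert p x; decide
  have e2 := swap_sum (n := n) (m := m) (fun _ => 1)
    ((LinearMap.mul ℂ (FA Letter)).compl₁₂ (vfC ξ N) ((coordT n m).toLinearMap ∘ₗ ι ℂ))
  simp only [one_mul, LinearMap.compl₁₂_apply, LinearMap.mul_apply', LinearMap.comp_apply,
    AlgHom.toLinearMap_apply, coordT_stdB, one_smul] at e2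
  rw [e1, e2, sub_neg_eq_add, FH, ← Finset.sum_add_distrib, Mhat, map_sum, map_sum, map_sum]
  refine Finset.sum_congr rfl fun a _ => ?_
  rw [ξ.leibniz, hsgnPow_tι, spow_stdB, map_smul, smul_mul_assoc, map_add, map_smul, tc_tι_mul,
    tc_mul_tι, map_add, map_smul, map_mul, map_mul, coordT_stdB, add_comm]
  rfl

lemma isSymp_of_Mhat {ξ : VField (Std n m) p} (h : ξ.toFun (Mhat n m) = 0) : IsSymp ξ := fun N => by
  have := FH_sub_rotL ξ N
  rw [h, map_zero, map_zero, sub_eq_zero] at this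
  exact this.symm

section MaurerCartan

variable {μ : VField (Std n m) 1}

lemma ctrL_FH_FH (N K : ℕ) : ctrL (FH μ N) (FH μ K) =
    ∑ a, sg (spar a) • (vfC μ N (stdB a) * vfC μ K (shp a)) := by
  conv_lhs => rw [FH.eq_def μ K, map_sum]
  refine Finset.sum_congr rfl fun a _ => ?_
  rw [map_smul, ctrL_mul_right, ctrL_FH, one_mul]

open Finset.HasAntidiagonal in
lemma sum_antidiagonal_FF (N : ℕ) : ∑ k ∈ antidiagonal (N + 2), ctrL (FF μ k.1) (FF μ k.2) =
    ∑ k ∈ antidiagonal N, ctrL (FH μ k.1) (FH μ k.2) := by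
  rw [Finset.Nat.antidiagonal_succ_succ', Finset.sum_cons, Finset.sum_cons, Finset.sum_map]
  simp [FF]

open Finset.HasAntidiagonal in
/-- The Maurer–Cartan equation for the Hamiltonian of an odd symplectic vector field of square zero. -/
theorem maurerCartan (hs : IsSymp μ) (hsq : ∀ v, μ.toFun (μ.toFun (tι v)) = 0)
    (h0 : ∀ v, tc 0 (μ.toFun (tι v)) = 0) (K : ℕ) :
    ∑ k ∈ antidiagonal K, br (ham μ k.1) (ham μ k.2) ∈ cyc := by
  simp only [br_apply, hs.cycNL_ham]
  have hF1 : FF μ 1 = 0 := by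
    change FH μ 0 = 0
    rw [FH]
    refine Finset.sum_eq_zero fun a _ => ?_
    rw [vfC_apply, h0]; simp
  rcases K with _ | _ | N
  · simp [FF]
  · simp [FF, Finset.Nat.antidiagonal_succ]
  set B : ℕ × ℕ → FA Letter := fun k => ctrL (FF μ k.1) (FF μ k.2) with hB
  change ∑ k ∈ antidiagonal (N + 2), B k ∈ cyc
  rcases Nat.eq_zero_or_pos N with rfl | hN
  · have : ∑ k ∈ antidiagonal (0 + 2), B k = 0 := by
      rw [hB, sum_antidiagonal_FF, Finset.Nat.antidiagonal_zero, Finset.sum_singleton]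
      change ctrL (FF μ 1) (FF μ 1) = 0
      rw [hF1, map_zero]
    rw [this]; exact zero_mem _
  set F : That (Std n m) := ∑ a, sg (spar a) • (tι (stdB a) * μ.toFun (tι (shp a))) with hF
  have cF : ∀ k, coordT n m (tc k F) = FF μ k := by
    intro k
    rw [hF, map_sum, map_sum]
    rcases k with _ | k
    · refine Finset.sum_eq_zero fun a _ => ?_
      rw [map_smul, tc_zero_tι_mul, smul_zero, map_zero]
    · rw [FF, FH]
      refine Finset.sum_congr rfl fun a _ => ?_
      rw [map_smul, map_smul, tc_tι_mul, map_mul, coordT_stdB, one_mul, vfC_apply]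
  have mF : μ.toFun F = ∑ a, sg (spar a) • (μ.toFun (tι (stdB a)) * μ.toFun (tι (shp a))) := by
    rw [hF, map_sum]
    refine Finset.sum_congr rfl fun a _ => ?_
    rw [map_smul, μ.leibniz, hsq, mul_zero, add_zero]
  have hQ : coordT n m (tc N (μ.toFun F)) = ∑ k ∈ antidiagonal (N + 2), B k := by
    rw [hB, sum_antidiagonal_FF, mF, map_sum, map_sum]
    simp only [ctrL_FH_FH]
    rw [Finset.sum_comm]
    refine Finset.sum_congr rfl fun a _ => ?_
    rw [map_smul, map_smul, tc_mul, map_sum, Finset.smul_sum]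
    refine Finset.sum_congr rfl fun k _ => ?_
    rw [map_mul]; rfl
  have h1 := coordT_vf_sub_mem μ F N
  rw [hQ] at h1
  have hT : ∑ k ∈ antidiagonal (N + 2), ctrL (FF μ k.1) (cycNL par (coordT n m (tc k.2 F))) =
      ∑ k ∈ antidiagonal (N + 2), (k.2 : ℂ) • B k := Finset.sum_congr rfl fun k _ => by
    rw [cF, hs.cycNL_FF, map_smul]
  rw [hT] at h1
  have h2 : ∑ k ∈ antidiagonal (N + 2), (k.1 : ℂ) • (B k.swap - B k) ∈ cyc := by
    refine Submodule.sum_mem _ fun k _ => Submodule.smul_mem _ _ ?_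
    have := ctrL_skew (FF_hom μ k.2) (FF_hom μ k.1)
    rw [one_mul, sg_one, neg_one_smul, ← sub_eq_add_neg] at this
    exact this
  have h3 : ∑ k ∈ antidiagonal (N + 2), (k.1 : ℂ) • B k.swap =
      ∑ k ∈ antidiagonal (N + 2), (k.2 : ℂ) • B k := by
    rw [← Finset.Nat.sum_antidiagonal_swap]; rfl
  have h4 : ∑ k ∈ antidiagonal (N + 2), (k.1 : ℂ) • B k + ∑ k ∈ antidiagonal (N + 2), (k.2 : ℂ) • B k
      = ((N : ℂ) + 2) • ∑ k ∈ antidiagonal (N + 2), B k := by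
    rw [← Finset.sum_add_distrib, Finset.smul_sum]
    refine Finset.sum_congr rfl fun k hk => ?_
    rw [← add_smul]
    congr 1
    rw [Finset.HasAntidiagonal.mem_antidiagonal] at hk
    exact_mod_cast hk
  simp only [smul_sub, Finset.sum_sub_distrib] at h2
  rw [h3] at h2
  have h5 := add_mem h2 (add_mem h1 h1)
  have h6 : (-(N : ℂ)) • ∑ k ∈ antidiagonal (N + 2), B k ∈ cyc := by
    convert h5 using 1
    have := eq_sub_of_add_eq h4
    rw [this]
    module
  have h7 := Submodule.smul_mem cyc (-(N : ℂ))⁻¹ h6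
  rwa [smul_smul, inv_mul_cancel₀ (neg_ne_zero.2 (Nat.cast_ne_zero.2 hN.ne')), one_smul] at h7

end MaurerCartan

end VectorFields

section ImageWords

variable {α β : Type}

/-- The span of the words of length `k` in the letters in the image of `f`. -/
def imW (f : β → α) (k : ℕ) : Submodule ℂ (FA α) :=
  Submodule.span ℂ ((fun l : List β => wd (l.map f)) '' {l | l.length = k})

lemma wd_mem_imW (f : β → α) (l : List β) : wd (l.map f) ∈ imW f l.length :=
  Submodule.subset_span ⟨l, rfl, rfl⟩

lemma imW_induction {f : β → α} {k : ℕ} {P : FA α → Prop} {x : FA α} (hx : x ∈ imW f k)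
    (h0 : P 0) (hw : ∀ l : List β, l.length = k → P (wd (l.map f)))
    (ha : ∀ x y, P x → P y → P (x + y)) (hs : ∀ (c : ℂ) x, P x → P (c • x)) : P x := by
  induction hx using Submodule.span_induction with
  | mem x hx => obtain ⟨l, hl, rfl⟩ := hx; exact hw l hl
  | zero => exact h0
  | add x y _ _ hx hy => exact ha x y hx hy
  | smul c x _ hx => exact hs c x hx

lemma imW_le_lenSub (f : β → α) (k : ℕ) : imW f k ≤ lenSub k := by
  refine Submodule.span_mono ?_
  rintro _ ⟨l, hl, rfl⟩
  exact ⟨l.map f, by simpa using hl, rfl⟩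

lemma imW_mul {f : β → α} {j k : ℕ} {x y : FA α} (hx : x ∈ imW f j) (hy : y ∈ imW f k) :
    x * y ∈ imW f (j + k) :=
  imW_induction (P := fun x => x * y ∈ imW f (j + k)) hx (by simp)
    (fun l hl => imW_induction (P := fun y => wd (l.map f) * y ∈ imW f (j + k)) hy (by simp)
      (fun l' hl' => by
        rw [wd_mul, ← List.map_append, ← hl, ← hl', ← List.length_append]; exact wd_mem_imW f _)
      (fun x y hx hy => by rw [mul_add]; exact add_mem hx hy)
      (fun c x hx => by rw [mul_smul_comm]; exact Submodule.smul_mem _ _ hx))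
    (fun x y hx hy => by rw [add_mul]; exact add_mem hx hy)
    (fun c x hx => by rw [smul_mul_assoc]; exact Submodule.smul_mem _ _ hx)

lemma rotL_imW (par : α → ZMod 2) {f : β → α} {k : ℕ} {x : FA α} (hx : x ∈ imW f k) :
    rotL par x ∈ imW f k :=
  imW_induction (P := fun x => rotL par x ∈ imW f k) hx (by simp)
    (fun l hl => by
      rw [rotL, linExt_wd]
      cases l with
      | nil => rw [← hl]; exact wd_mem_imW f []
      | cons a l =>
        rw [List.map_cons, rot, ← hl]
        have := wd_mem_imW f (l ++ [a])
        rw [List.map_append, List.length_append] at this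
        exact Submodule.smul_mem _ _ this)
    (fun x y hx hy => by rw [map_add]; exact add_mem hx hy)
    (fun c x hx => by rw [map_smul]; exact Submodule.smul_mem _ _ hx)

lemma rotL_pow_imW (par : α → ZMod 2) (i : ℕ) {f : β → α} {k : ℕ} {x : FA α} (hx : x ∈ imW f k) :
    (rotL par ^ i) x ∈ imW f k := by
  induction i with
  | zero => exact hx
  | succ i ih => rw [pow_succ', Module.End.mul_apply]; exact rotL_imW par ih

lemma cycNL_imW (par : α → ZMod 2) {f : β → α} {k : ℕ} {x : FA α} (hx : x ∈ imW f k) :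
    cycNL par x ∈ imW f k := by
  rw [cycNL_of_len par (imW_le_lenSub f k hx)]
  exact Submodule.sum_mem _ fun i _ => rotL_pow_imW par i hx

lemma strip_imW {σ : β → Letter} (l : List (β ⊕ β)) :
    strip (l.map (Sum.map σ σ)) ∈ imW σ l.length := by
  induction l with
  | nil => exact wd_mem_imW σ []
  | cons a l ih =>
    rcases a with a | a
    · rw [List.map_cons, Sum.map_inl, strip, List.length_cons, add_comm]
      exact imW_mul (wd_mem_imW σ [a]) ih
    · exact zero_mem _

lemma pick_imW {σ : β → Letter} (l : List (β ⊕ β)) :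
    pick (l.map (Sum.map σ σ)) ∈ imW σ l.length := by
  rcases l with _ | ⟨a | a, l⟩
  · exact zero_mem _
  · exact zero_mem _
  · rw [List.map_cons, Sum.map_inr, pick, List.length_cons, add_comm]
    exact imW_mul (wd_mem_imW σ [a]) (strip_imW l)

lemma kapW_imW {σ : β → Letter} {k : ℕ} {x : FA (Letter ⊕ Letter)} (hx : x ∈ imW (Sum.map σ σ) k) :
    kapW x ∈ imW σ k := by
  rw [kapW, LinearMap.comp_apply]
  exact imW_induction (P := fun x => linExt pick x ∈ imW σ k) (cycNL_imW parO hx) (by simp)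
    (fun l hl => by rw [linExt_wd, ← hl]; exact pick_imW l)
    (fun x y hx hy => by rw [map_add]; exact add_mem hx hy)
    (fun c x hx => by rw [map_smul]; exact Submodule.smul_mem _ _ hx)

end ImageWords

section Primitive

variable {n m n' m' : ℕ} {p : ZMod 2}

lemma coordT_imW {k : ℕ} {x : TensorAlgebra ℂ (Std n m)} (hx : x ∈ gr (Std n m) k) :
    coordT n m x ∈ imW (stdLetter n m) k := by
  have h := mem_span_tw hx
  clear hx
  induction h using Submodule.span_induction with
  | mem x hx' => obtain ⟨l, rfl, rfl⟩ := hx'; rw [coordT_tw]; exact wd_mem_imW _ l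
  | zero => rw [map_zero]; exact zero_mem _
  | add x y _ _ hx hy => rw [map_add]; exact add_mem hx hy
  | smul c x _ hx => rw [map_smul]; exact Submodule.smul_mem _ _ hx

lemma coordO_imW {k : ℕ} {x : TensorAlgebra ℂ (FormGen (Std n m))} (hx : x ∈ gr _ k) :
    coordO n m x ∈ imW (Sum.map (stdLetter n m) (stdLetter n m)) k := by
  refine gr_induct (P := fun k x => coordO n m x ∈ imW (Sum.map (stdLetter n m) (stdLetter n m)) k)
    (fun r => ?_) (fun k x y hx hy => by rw [map_add]; exact add_mem hx hy) (fun k v x _ hx => ?_) hx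
  · rw [AlgHom.commutes, Algebra.algebraMap_eq_smul_one]
    exact Submodule.smul_mem _ _ (wd_mem_imW _ [])
  · rw [map_mul, add_comm]
    refine imW_mul ?_ hx
    rw [coordO_ι]
    exact add_mem (Submodule.sum_mem _ fun i _ => Submodule.smul_mem _ _ (wd_mem_imW _ [Sum.inl i]))
      (Submodule.sum_mem _ fun i _ => Submodule.smul_mem _ _ (wd_mem_imW _ [Sum.inr i]))

lemma kap_imW (k : ℕ) (f : OmegaHat (Std n m)) : kap k f ∈ imW (stdLetter n m) k :=
  kapW_imW (coordO_imW (tc_mem k f))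

lemma coordT_ev {k : ℕ} {x : FA Letter} (hx : x ∈ imW (stdLetter n m) k) :
    coordT n m (ev n m x) = x :=
  imW_induction (P := fun x => coordT n m (ev n m x) = x) hx (by simp)
    (fun l _ => by rw [ev_map, coordT_tw]) (fun x y hx hy => by rw [map_add, map_add, hx, hy])
    (fun c x hx => by rw [map_smul, map_smul, hx])

lemma ev_gr {k : ℕ} {x : FA Letter} (hx : x ∈ imW (stdLetter n m) k) :
    ev n m x ∈ gr (Std n m) k :=
  imW_induction (P := fun x => ev n m x ∈ gr (Std n m) k) hx (by simp)
    (fun l hl => by rw [ev_map, ← hl]; exact tw_mem l)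
    (fun x y hx hy => by rw [map_add]; exact add_mem hx hy)
    (fun c x hx => by rw [map_smul]; exact Submodule.smul_mem _ _ hx)

/-- The series with given components in coordinates. -/
def ofCoord (K : ℕ → FA Letter) (hK : ∀ k, K k ∈ imW (stdLetter n m) k) : That (Std n m) :=
  ⟨PowerSeries.mk fun k => ev n m (K k), fun k => by rw [PowerSeries.coeff_mk]; exact ev_gr (hK k)⟩

lemma coordT_ofCoord (K : ℕ → FA Letter) (hK : ∀ k, K k ∈ imW (stdLetter n m) k) (k : ℕ) :
    coordT n m (tc k (ofCoord K hK)) = K k := by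
  have : tc k (ofCoord K hK) = ev n m (K k) := PowerSeries.coeff_mk k fun k => ev n m (K k)
  rw [this, coordT_ev (hK k)]

lemma That.ext_coord {f g : That (Std n m)}
    (h : ∀ k, coordT n m (tc k f) = coordT n m (tc k g)) : f = g :=
  That.ext' fun k => coordT_injective (h k)

lemma omD_mul_omD {V : Type*} [AddCommGroup V] [Module ℂ V] [SuperSpace V] (f g : OmegaHat V) :
    omD (f * omD g) = omD f * omD g := by
  rw [omD_mul, omD_omD, mul_zero, add_zero]

lemma omD_mem_hComm {V : Type*} [AddCommGroup V] [Module ℂ V] [SuperSpace V] {f : OmegaHat V}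
    (hf : f ∈ hComm (FormGen V)) : omD f ∈ hComm (FormGen V) := derHat_comm omD_par hf

lemma omD_fn_tι {V : Type*} [AddCommGroup V] [Module ℂ V] [SuperSpace V] (v : V) :
    omD (fn (tι v)) = tι (dgen v) := by rw [fn_tι, omD_tι]; rfl

variable (n m) in
/-- The canonical primitive `½ ∑ (p dq - q dp) + ½ ∑ x dx` of the canonical symplectic form. -/
def stdAlpha : OmegaHat (Std n m) :=
  (1 / 2 : ℂ) • ∑ a, sg (spar a) • (fn (tι (stdB a)) * omD (fn (tι (shp a))))

lemma omD_stdAlpha : omD (stdAlpha n m) =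
    (1 / 2 : ℂ) • ∑ a, sg (spar a) • (tι (dgen (stdB a)) * tι (dgen (shp a))) := by
  rw [stdAlpha, map_smul, map_sum]
  congr 1
  refine Finset.sum_congr rfl fun a _ => ?_
  rw [map_smul, omD_mul_omD, omD_fn_tι, omD_fn_tι]

lemma hsgn_tι_dgen (i : SI n m) : hsgn (tι (dgen (stdB i : Std n m))) =
    sg (spar i + 1) • tι (dgen (stdB i)) := by
  rw [hsgn_tι, sinv_dgen, sinv_stdB, sg_add, sg_one]
  simp

lemma mkQ_omD_stdAlpha : (hComm (FormGen (Std n m))).mkQ (omD (stdAlpha n m)) = stdOmega n m := by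
  rw [stdOmega, Submodule.mkQ_apply, Submodule.mkQ_apply, Submodule.Quotient.eq, omD_stdAlpha]
  have h : ∀ i : Fin n, (-(1 / 2) : ℂ) • (tι (dgen (stdB (.inl i) : Std n m)) *
      tι (dgen (stdB (.inr (.inl i)))) - sg (1 * 1) • (tι (dgen (stdB (.inr (.inl i)))) *
        tι (dgen (stdB (.inl i))))) ∈ hComm (FormGen (Std n m)) := fun i =>
    Submodule.smul_mem _ _ (comm_mem_hComm (by rw [hsgn_tι_dgen]; rfl) (by rw [hsgn_tι_dgen]; rfl))
  have h' := Submodule.sum_mem _ fun i (_ : i ∈ Finset.univ) => h i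
  convert h' using 1
  have hneg : ∀ x y : OmegaHat (Std n m), x * -y = -(x * y) := fun x y => mul_neg x y
  simp only [Fintype.sum_sum_type, spar, stdLetter, par, sg_zero, sg_one, shp, map_neg, one_smul,
    neg_smul, mul_one, smul_neg, hneg, sub_neg_eq_add, Finset.sum_neg_distrib, smul_add, neg_neg,
    Finset.sum_add_distrib, ← Finset.smul_sum]
  module

lemma kap_dgen_mul_fn (N : ℕ) (i : SI n m) (f : That (Std n m)) :
    kap (N + 1) (tι (dgen (stdB i)) * fn f) = wd [stdLetter n m i] * coordT n m (tc N f) := by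
  rw [kap_apply, tc_tι_mul, map_mul, coordO_fn, coordO_dgen, Finset.sum_eq_single i]
  · rw [stdB_apply, if_pos rfl, one_smul]
    generalize coordT n m (tc N f) = y
    refine fa_induction (P := fun y => kapW (wd [Sum.inr (stdLetter n m i)] * inlW y) =
      wd [stdLetter n m i] * y) y (by simp) (fun l => ?_) (fun x y hx hy => ?_) (fun c x hx => ?_)
    · rw [inlW_wd, wd_mul, wd_mul]; exact kapW_front _ _
    · simp only [map_add, mul_add, hx, hy]
    · simp only [map_smul, mul_smul_comm, hx]
  · intro j _ hj; rw [stdB_apply, if_neg hj, zero_smul]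
  · simp

lemma kap_fn_mul_dgen (N : ℕ) (i : SI n m) {q : ZMod 2} {f : That (Std n m)}
    (hf : hsgn f = sg q • f) : kap (N + 1) (fn f * tι (dgen (stdB i))) =
      sg (q * (spar i + 1)) • (wd [stdLetter n m i] * coordT n m (tc N f)) := by
  have h := kap_hComm (comm_mem_hComm (f := fn f) (g := tι (dgen (stdB i))) (p := q)
    (by rw [hsgn_fn, hf, map_smul]) (hsgn_tι_dgen i)) (N + 1)
  rw [map_sub, map_smul, kap_dgen_mul_fn, sub_eq_zero] at h
  exact h

/-- The `1`-form dual to a vector field under the canonical symplectic form. -/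
lemma kap_contract (ξ : VField (Std n m) p) (N : ℕ) :
    kap (N + 1) (ξ.iV.toFun (omD (stdAlpha n m))) = -sg p • FH ξ N := by
  have h1 := swap_sum (n := n) (m := m) (fun _ => 1) (((LinearMap.mul ℂ (OmegaHat (Std n m))).flip).compl₁₂
    (tι ∘ₗ dgen) (fn ∘ₗ ξ.toFun ∘ₗ tι))
  simp only [one_mul, LinearMap.compl₁₂_apply, LinearMap.flip_apply, LinearMap.mul_apply',
    LinearMap.comp_apply, one_smul] at h1
  have h2 : ξ.iV.toFun (omD (stdAlpha n m)) = (1 / 2 : ℂ) •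
      (-∑ a, fn (ξ.toFun (tι (shp a))) * tι (dgen (stdB a)) + ∑ a, sg (spar a + (p + 1) * (spar a + 1)) •
        (tι (dgen (stdB a)) * fn (ξ.toFun (tι (shp a))))) := by
    rw [← h1, omD_stdAlpha, map_smul, map_sum, ← Finset.sum_add_distrib]
    congr 1
    refine Finset.sum_congr rfl fun a _ => ?_
    rw [map_smul, ξ.iV.leibniz, ξ.iV_tι, ξ.iV_tι, hsgnPow_of_hsgn (hsgn_tι_dgen a), smul_add,
      smul_mul_assoc, smul_smul, ← sg_add]
    rfl
  have h3 : ∀ a : SI n m, hsgn (ξ.toFun (tι (shp a))) = sg (p + spar a) • ξ.toFun (tι (shp a)) :=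
    fun a => by rw [ξ.parity, hsgn_tι, sinv_shp, map_smul, map_smul, smul_smul, sg_add]
  rw [h2, map_smul, map_add, map_neg, map_sum, map_sum, FH]
  simp only [map_smul, kap_dgen_mul_fn, kap_fn_mul_dgen _ _ (h3 _)]
  rw [← Finset.sum_neg_distrib, ← Finset.sum_add_distrib, Finset.smul_sum, Finset.smul_sum]
  refine Finset.sum_congr rfl fun a _ => ?_
  rw [← neg_smul, ← add_smul, smul_smul, smul_smul]
  congr 1
  generalize spar a = x
  have s1 : (p + x) * (x + 1) = p + p * x := by clear * -; revert p x; decide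
  have s2 : x + (p + 1) * (x + 1) = p + p * x + 1 := by clear * -; revert p x; decide
  rw [s1, s2, sg_add (p + p * x), sg_add, sg_one]
  ring

/-- The obstruction for a `1`-form to be exact. -/
def lam (k : ℕ) : OmegaHat (Std n m) →ₗ[ℂ] FA Letter := kap k - rotL par ∘ₗ kap k

lemma lam_apply (k : ℕ) (f : OmegaHat (Std n m)) : lam k f = kap k f - rotL par (kap k f) := rfl

lemma lam_hComm {f : OmegaHat (Std n m)} (hf : f ∈ hComm (FormGen (Std n m))) (k : ℕ) :
    lam k f = 0 := by rw [lam_apply, kap_hComm hf, map_zero, sub_zero]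

lemma lam_omD_fn (k : ℕ) (f : That (Std n m)) : lam k (omD (fn f)) = 0 := by
  rw [lam_apply, kap_omD_fn, rotL_cycNL, sub_self]

lemma lam_pO_stdAlpha (θ : FMorph (Std n m) (Std n' m')) (k : ℕ) :
    lam k (θ.pO.toAlgHom (stdAlpha n m)) = -coordT n' m' (tc k (θ.toAlgHom (Mhat n m))) := by
  have h1 := swap_sum (n := n) (m := m) (fun _ => 1) ((LinearMap.mul ℂ (That (Std n' m'))).compl₁₂
    (θ.toAlgHom.toLinearMap ∘ₗ tι) (θ.toAlgHom.toLinearMap ∘ₗ tι))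
  simp only [one_mul, LinearMap.compl₁₂_apply, LinearMap.mul_apply',
    LinearMap.comp_apply, one_smul, AlgHom.toLinearMap_apply] at h1
  have e1 : ∀ a : SI n m, hsgn (θ.toAlgHom (tι (stdB a))) = sg (spar a) • θ.toAlgHom (tι (stdB a)) :=
    fun a => by rw [θ.even, hsgn_tι, sinv_stdB, map_smul, map_smul]
  have e2 : ∀ a : SI n m, hsgn (θ.toAlgHom (tι (shp a))) = sg (spar a) • θ.toAlgHom (tι (shp a)) :=
    fun a => by rw [θ.even, hsgn_tι, sinv_shp, map_smul, map_smul]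
  have h2 : θ.toAlgHom (Mhat n m) = (1 / 2 : ℂ) • ∑ a, (θ.toAlgHom (tι (stdB a)) *
      θ.toAlgHom (tι (shp a)) - sg (spar a * spar a) • (θ.toAlgHom (tι (shp a)) *
        θ.toAlgHom (tι (stdB a)))) := by
    have : ∀ x : ZMod 2, x * x = x := by decide
    simp only [this]
    rw [Finset.sum_sub_distrib, h1, sub_neg_eq_add, ← two_smul ℂ, smul_smul, Mhat, map_sum]
    norm_num
  rw [h2, stdAlpha, map_smul, map_sum, map_smul, map_smul, map_smul, map_sum, map_sum, map_sum,
    ← smul_neg, ← Finset.sum_neg_distrib]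
  congr 1
  refine Finset.sum_congr rfl fun a _ => ?_
  have h3 := kap_fn_mul_omD (e1 a) (e2 a) k
  rw [map_smul, map_smul, map_mul, θ.pO_fn, θ.pO_omD, θ.pO_fn, lam_apply, h3, smul_smul,
    mul_neg, sg_sq, neg_one_smul]

lemma stdAlpha_mem : stdAlpha n m ∈ omForm (Std n m) 1 := by
  refine Submodule.smul_mem _ _ (Submodule.sum_mem _ fun a _ => Submodule.smul_mem _ _ ?_)
  have := mul_mem_omForm (fn_mem_omForm (tι (stdB a : Std n m)))
    (omD_mem_omForm (fn_mem_omForm (tι (shp a))))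
  simpa using this

lemma tc_zero_of_mem_omForm {V : Type*} [AddCommGroup V] [Module ℂ V] [SuperSpace V] {r : ℕ}
    (hr : r ≠ 0) {f : OmegaHat V} (hf : f ∈ omForm V r) : tc 0 f = 0 := by
  have h1 := mem_omForm_iff.1 hf
  obtain ⟨c, hc⟩ := gr_zero_eq (tc_mem 0 f)
  have h2 := congrArg (tc 0) h1
  rw [tc_hmap, map_smul, hc, AlgHom.commutes, eq_comm, ← sub_eq_zero] at h2
  nth_rewrite 2 [← one_smul ℂ (algebraMap ℂ (TensorAlgebra ℂ (FormGen V)) c)] at h2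
  rw [← sub_smul] at h2
  rw [hc]
  refine (smul_eq_zero.1 h2).resolve_left ?_
  refine sub_ne_zero.2 ?_
  exact_mod_cast (Nat.one_lt_two_pow hr).ne'

lemma exact_of_closed {V : Type*} [AddCommGroup V] [Module ℂ V] [SuperSpace V] {f : OmegaHat V}
    (hf : f ∈ omForm V 1) (h : omD f ∈ hComm (FormGen V)) :
    ∃ g : That V, tc 0 g = 0 ∧ f - omD (fn g) ∈ hComm (FormGen V) := by
  have h0 := ideg_mem_omForm ((eulV V).iV_mem_omForm hf)
  refine ⟨hmap fstL (ideg ((eulV V).iV.toFun f)), ?_, ?_⟩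
  · rw [tc_hmap, tc_ideg]; simp
  · rw [eq_fn_of_mem h0]; exact poincare h (tc_zero_of_mem_omForm one_ne_zero hf)

lemma lam_of_omD {f g : OmegaHat (Std n m)} (hf : f ∈ omForm (Std n m) 1)
    (hg : g ∈ omForm (Std n m) 1) (h : omD f - omD g ∈ hComm (FormGen (Std n m))) (k : ℕ) :
    lam k f = lam k g := by
  rw [← map_sub] at h
  obtain ⟨u, -, hu⟩ := exact_of_closed (sub_mem hf hg) h
  have := lam_hComm hu k
  rw [map_sub, lam_omD_fn, sub_zero, map_sub, sub_eq_zero] at this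
  exact this

lemma exact_of_lam {f : OmegaHat (Std n m)} (hf : f ∈ omForm (Std n m) 1) (h : ∀ k, lam k f = 0) :
    ∃ g, f - omD (fn g) ∈ hComm (FormGen (Std n m)) := by
  refine ⟨ofCoord (fun k => (k : ℂ)⁻¹ • kap k f) fun k => Submodule.smul_mem _ _ (kap_imW k f), ?_⟩
  refine mem_hComm_of_kap (sub_mem hf (by
    have := omD_mem_omForm (fn_mem_omForm (V := Std n m) (ofCoord (fun k => (k : ℂ)⁻¹ • kap k f) fun k => Submodule.smul_mem _ _ (kap_imW k f)))
    simpa using this)) fun k => ?_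
  have hk := h k
  rw [lam_apply, sub_eq_zero] at hk
  rw [map_sub, kap_omD_fn, coordT_ofCoord, map_smul,
    cycNL_of_rot par (imW_le_lenSub _ _ (kap_imW k f)) hk.symm]
  rcases k with _ | k
  · have : tc 0 f = 0 := tc_zero_of_mem_omForm one_ne_zero hf
    simp [kap_apply, this]
  · rw [smul_smul, inv_mul_cancel₀ (Nat.cast_ne_zero.2 k.succ_ne_zero), one_smul, sub_self]

/-- A homomorphism pulls the canonical symplectic form back to `dα` if and only if it maps the Poisson bivector
to the obstruction of `-α`. -/
lemma pull_stdOmega_iff (θ : FMorph (Std n m) (Std n' m')) {α : OmegaHat (Std n' m')}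
    (hα : α ∈ omForm (Std n' m') 1) :
    θ.pull (stdOmega n m) = (hComm (FormGen (Std n' m'))).mkQ (omD α) ↔
      ∀ k, coordT n' m' (tc k (θ.toAlgHom (Mhat n m))) = -lam k α := by
  have hm := θ.pO_mem_omForm (stdAlpha_mem (n := n) (m := m))
  rw [← mkQ_omD_stdAlpha, FMorph.pull_mkQ, Submodule.mkQ_apply, Submodule.mkQ_apply,
    Submodule.Quotient.eq, FMorph.pO_omD]
  constructor
  · intro h k
    rw [← lam_of_omD hm hα h k, lam_pO_stdAlpha, neg_neg]
  · intro h
    have h' : ∀ k, lam k (θ.pO.toAlgHom (stdAlpha n m) - α) = 0 := fun k => by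
      rw [map_sub, lam_pO_stdAlpha, h, neg_neg, sub_self]
    obtain ⟨g, hg⟩ := exact_of_lam (sub_mem hm hα) h'
    have := omD_mem_hComm hg
    rwa [map_sub, omD_omD, sub_zero, map_sub] at this

lemma lam_stdAlpha (k : ℕ) : lam k (stdAlpha n m) = -coordT n m (tc k (Mhat n m)) := by
  have := lam_pO_stdAlpha (FMorph.id (Std n m)) k
  have h : (FMorph.id (Std n m)).pO.toAlgHom (stdAlpha n m) = stdAlpha n m := by
    have : (FMorph.id (Std n m)).pO = FMorph.id _ := by
      refine FMorph.ext_fun fun f => ?_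
      refine hom_unique (FMorph.cont _) (FMorph.cont _) (fun x => ?_) f
      rw [FMorph.pO_tι, FMorph.id_apply, FMorph.id_apply, FMorph.id_apply, omD_fn_tι, fn_tι, ← map_add,
        ← formGen_eq]
    rw [this, FMorph.id_apply]
  rw [h, FMorph.id_apply] at this
  exact this

/-- A homomorphism is symplectic if and only if it preserves the Poisson bivector. -/
lemma pull_stdOmega_eq_iff (θ : FMorph (Std n m) (Std n' m')) :
    θ.pull (stdOmega n m) = stdOmega n' m' ↔ θ.toAlgHom (Mhat n m) = Mhat n' m' := by
  rw [← mkQ_omD_stdAlpha (n := n'), pull_stdOmega_iff θ stdAlpha_mem]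
  simp only [lam_stdAlpha, neg_neg]
  exact ⟨fun h => That.ext_coord h, fun h k => by rw [h]⟩

end Primitive

section Differentiation

variable {M M' : Type*} [AddCommGroup M] [Module ℂ M] [AddCommGroup M'] [Module ℂ M']

variable (M) in
/-- The pairs of a function with values in a finite-dimensional subspace and its derivative. -/
def derSub : Submodule ℂ ((ℝ → M) × (ℝ → M)) :=
  Submodule.span ℂ {x | ∃ (c c' : ℝ → ℂ) (e : M), (∀ t, HasDerivAt c (c' t) t) ∧
    x = (fun t => c t • e, fun t => c' t • e)}

/-- Differentiability of functions with values in a finite-dimensional subspace of a vector space. -/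
def IsDer (u u' : ℝ → M) : Prop := (u, u') ∈ derSub M

lemma IsDer.smul_const {c c' : ℝ → ℂ} (h : ∀ t, HasDerivAt c (c' t) t) (e : M) :
    IsDer (fun t => c t • e) (fun t => c' t • e) := Submodule.subset_span ⟨c, c', e, h, rfl⟩

lemma IsDer.const (e : M) : IsDer (fun _ : ℝ => e) (fun _ => 0) := by
  have := IsDer.smul_const (c := fun _ => 1) (c' := fun _ => 0) (fun t => hasDerivAt_const _ _) e
  simpa using this

lemma IsDer.add {u u' v v' : ℝ → M} (hu : IsDer u u') (hv : IsDer v v') :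
    IsDer (fun t => u t + v t) (fun t => u' t + v' t) := add_mem hu hv

lemma IsDer.sum {ι : Type*} (s : Finset ι) {u u' : ι → ℝ → M} (h : ∀ i ∈ s, IsDer (u i) (u' i)) :
    IsDer (fun t => ∑ i ∈ s, u i t) (fun t => ∑ i ∈ s, u' i t) := by
  classical
  induction s using Finset.induction_on with
  | empty => simpa using IsDer.const (0 : M)
  | insert i s hi ih =>
    simp only [Finset.sum_insert hi]
    exact (h i (Finset.mem_insert_self _ _)).add
      (ih fun j hj => h j (Finset.mem_insert_of_mem hj))

lemma IsDer.map (L : M →ₗ[ℂ] M') {u u' : ℝ → M} (h : IsDer u u') :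
    IsDer (fun t => L (u t)) (fun t => L (u' t)) := by
  have key : ∀ x ∈ derSub M, ((fun t => L (x.1 t), fun t => L (x.2 t)) : (ℝ → M') × (ℝ → M')) ∈
      derSub M' := by
    intro x hx
    induction hx using Submodule.span_induction with
    | mem x hx =>
      obtain ⟨c, c', e, hc, rfl⟩ := hx
      simp only [map_smul]
      exact IsDer.smul_const hc (L e)
    | zero =>
      simp only [Prod.fst_zero, Prod.snd_zero, Pi.zero_apply, map_zero]
      exact zero_mem (derSub M')
    | add x y _ _ hx hy =>
      simp only [Prod.fst_add, Prod.snd_add, Pi.add_apply, map_add]; exact add_mem hx hy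
    | smul c x _ hx =>
      simp only [Prod.smul_fst, Prod.smul_snd, Pi.smul_apply, map_smul]
      exact Submodule.smul_mem _ c hx
  exact key _ h

lemma IsDer.hasDerivAt {u u' : ℝ → ℂ} (h : IsDer u u') (t : ℝ) : HasDerivAt u (u' t) t := by
  have key : ∀ x ∈ derSub ℂ, HasDerivAt x.1 (x.2 t) t := by
    intro x hx
    induction hx using Submodule.span_induction with
    | mem x hx =>
      obtain ⟨c, c', e, hc, rfl⟩ := hx
      exact (hc t).mul_const e
    | zero => exact hasDerivAt_const t 0
    | add x y _ _ hx hy => exact hx.add hy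
    | smul c x _ hx => exact hx.const_mul c
  exact key _ h

lemma IsDer.mul {A : Type*} [Ring A] [Algebra ℂ A] {u u' v v' : ℝ → A} (hu : IsDer u u')
    (hv : IsDer v v') : IsDer (fun t => u t * v t) (fun t => u' t * v t + u t * v' t) := by
  have key : ∀ x ∈ derSub A, ∀ y ∈ derSub A,
      ((fun t => x.1 t * y.1 t, fun t => x.2 t * y.1 t + x.1 t * y.2 t) : (ℝ → A) × (ℝ → A)) ∈
        derSub A := by
    intro x hx y hy
    induction hx using Submodule.span_induction with
    | mem x hx =>
      obtain ⟨c, c', e, hc, rfl⟩ := hx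
      induction hy using Submodule.span_induction with
      | mem y hy =>
        obtain ⟨d, d', f, hd, rfl⟩ := hy
        simp only [smul_mul_smul_comm, ← add_smul]
        exact IsDer.smul_const (fun t => (hc t).mul (hd t)) _
      | zero =>
        simp only [Prod.fst_zero, Prod.snd_zero, Pi.zero_apply, mul_zero, add_zero]
        exact zero_mem (derSub A)
      | add x y _ _ hx hy =>
        convert add_mem hx hy using 1
        ext t
        · simp [mul_add]
        · simp [mul_add]; abel
      | smul c x _ hx =>
        convert Submodule.smul_mem _ c hx using 1
        ext t
        · simp
        · simp
    | zero =>
      simp only [Prod.fst_zero, Prod.snd_zero, Pi.zero_apply, zero_mul, add_zero]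
      exact zero_mem (derSub A)
    | add x y _ _ hx hy =>
      convert add_mem hx hy using 1
      ext t
      · simp [add_mul]
      · simp [add_mul]; abel
    | smul c x _ hx =>
      convert Submodule.smul_mem _ c hx using 1
      ext t
      · simp
      · simp
  exact key _ hu _ hv

/-- A function whose derivative takes values in a subspace is constant modulo the subspace. -/
lemma IsDer.sub_mem {u u' : ℝ → M} (h : IsDer u u') (B : Submodule ℂ M) {T : ℝ} (hT : 0 < T)
    (hB : ∀ t, 0 < t → t ≤ T → u' t ∈ B) : u T - u 0 ∈ B := by
  by_contra hn
  obtain ⟨L, hL, hLB⟩ := Submodule.exists_le_ker_of_notMem hn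
  have hd := (h.map L).hasDerivAt
  refine hL ?_
  have hg : ∀ s, HasDerivAt (fun s => L (u (T - s))) (-(L (u' (T - s)))) s := fun s => by
    have h1 : HasDerivAt (fun s : ℝ => T - s) (-1) s := by
      simpa using (hasDerivAt_id s).const_sub T
    have := (hd (T - s)).scomp s h1
    simpa [Function.comp_def] using this
  have := constant_of_has_deriv_right_zero (f := fun s => L (u (T - s))) (a := 0) (b := T)
    (fun s _ => (hg s).continuousAt.continuousWithinAt) (fun s hs => by
      have h0 : L (u' (T - s)) = 0 := hLB (hB _ (by linarith [hs.2]) (by linarith [hs.1]))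
      have := (hg s).hasDerivWithinAt (s := Set.Ici s)
      rwa [h0, neg_zero] at this) T ⟨hT.le, le_rfl⟩
  simp only [sub_self, sub_zero] at this
  rw [map_sub, this, sub_self]

/-- The derivative of a power. -/
def powDer {A : Type*} [Ring A] (U U' : A) : ℕ → A
  | 0 => 0
  | i + 1 => powDer U U' i * U + U ^ i * U'

lemma powDer_comm {A : Type*} [Ring A] {U U' a x : A} (hx : ∀ y, y * x = x * y)
    (h : a * U = x * U' + U * a) (i : ℕ) : a * U ^ i = x * powDer U U' i + U ^ i * a := by
  induction i with
  | zero => simp [powDer]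
  | succ i ih =>
    rw [pow_succ, ← mul_assoc, ih, add_mul, mul_assoc _ a U, h, mul_add, ← mul_assoc _ x, hx, powDer,
      mul_add]
    simp only [mul_assoc]
    abel

open Finset.HasAntidiagonal in
lemma IsDer.coeff_pow {A : Type*} [Ring A] [Algebra ℂ A] {U U' : ℝ → PowerSeries A}
    (h : ∀ k, IsDer (fun t => PowerSeries.coeff k (U t)) fun t => PowerSeries.coeff k (U' t))
    (i k : ℕ) : IsDer (fun t => PowerSeries.coeff k (U t ^ i))
      fun t => PowerSeries.coeff k (powDer (U t) (U' t) i) := by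
  induction i generalizing k with
  | zero => simpa [powDer] using IsDer.const (PowerSeries.coeff k (1 : PowerSeries A))
  | succ i ih =>
    simp only [pow_succ, powDer, map_add, PowerSeries.coeff_mul, ← Finset.sum_add_distrib]
    exact IsDer.sum _ fun x _ => (ih x.1).mul (h x.2)

end Differentiation

section Chains

/-- The exterior algebra on cyclic words. -/
abbrev CE : Type := FA Word ⧸ ceI

/-- Left multiplication on the exterior algebra. -/
def lmCE : FA Word →ₐ[ℂ] Module.End ℂ CE :=
  AlgHom.ofLinearMap
    { toFun := fun x => ceI.mapQ ceI (LinearMap.mulLeft ℂ x) fun _ h => ceI_mul_left x h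
      map_add' := fun x y => Submodule.linearMap_qext _ (LinearMap.ext fun z =>
        congrArg ceI.mkQ (add_mul x y z))
      map_smul' := fun c x => Submodule.linearMap_qext _ (LinearMap.ext fun z =>
        congrArg ceI.mkQ (smul_mul_assoc c x z)) }
    (Submodule.linearMap_qext _ (LinearMap.ext fun z => congrArg ceI.mkQ (one_mul z)))
    (fun x y => Submodule.linearMap_qext _ (LinearMap.ext fun z =>
        congrArg ceI.mkQ (mul_assoc x y z)))

lemma lmCE_mkQ (x z : FA Word) : lmCE x (ceI.mkQ z) = ceI.mkQ (x * z) := rfl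

lemma adL_ceI (x : FA Letter) {z : FA Word} (hz : z ∈ ceI) : adL x z ∈ ceI :=
  fa_induction (P := fun x => adL x z ∈ ceI) x (by simp) (fun l => by rw [adL_wd]; exact ad_ceI l hz)
    (fun x y hx hy => by rw [map_add]; exact add_mem hx hy)
    (fun c x hx => by rw [map_smul]; exact Submodule.smul_mem _ _ hx)

/-- The adjoint action on the exterior algebra. -/
def adCE (x : FA Letter) : Module.End ℂ CE := ceI.mapQ ceI (adL x) fun _ h => adL_ceI x h

lemma adCE_mkQ (x : FA Letter) (z : FA Word) : adCE x (ceI.mkQ z) = ceI.mkQ (adL x z) := rfl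

/-- The Chevalley–Eilenberg differential on the exterior algebra. -/
def dQ : Module.End ℂ CE := ceI.mapQ ceI dCE fun _ h => dCE_ceI h

lemma dQ_mkQ (z : FA Word) : dQ (ceI.mkQ z) = ceI.mkQ (dCE z) := rfl

lemma dQ_mul_emb (x : FA Letter) : dQ * lmCE (emb x) = adCE x - lmCE (emb x) * dQ :=
  Submodule.linearMap_qext _ (LinearMap.ext fun z => congrArg ceI.mkQ (dCE_emb x z))

lemma adL_emb_mul {p q : ZMod 2} {x z : FA Letter} (hx : x ∈ hom par p) (hz : z ∈ hom par q)
    (y : FA Word) :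
    adL x (emb z * y) = emb (br x z) * y + sg (p * q) • (emb z * adL x y) :=
  hom_induction (P := fun z => adL x (emb z * y) = emb (br x z) * y + sg (p * q) • (emb z * adL x y))
    hz (by simp) (fun l hl => by rw [emb_wd, adL_mul hx, ← hl]; rfl)
    (fun a b ha hb => by simp only [map_add, add_mul, ha, hb, smul_add]; abel)
    (fun c a ha => by simp only [map_smul, smul_mul_assoc, ha, smul_add, smul_comm c])

lemma adCE_mul_emb {p q : ZMod 2} {x z : FA Letter} (hx : x ∈ hom par p) (hz : z ∈ hom par q) :
    adCE x * lmCE (emb z) = lmCE (emb (br x z)) + sg (p * q) • (lmCE (emb z) * adCE x) :=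
  Submodule.linearMap_qext _ (LinearMap.ext fun y => congrArg ceI.mkQ (adL_emb_mul hx hz y))

lemma lmCE_emb_cyc {x : FA Letter} (hx : x ∈ cyc) : lmCE (emb x) = 0 :=
  Submodule.linearMap_qext _ (LinearMap.ext fun y =>
    (Submodule.Quotient.mk_eq_zero _).2 (ceI_mul_right (emb_cyc hx) y))

/-- Multiplication by a Hamiltonian, as a series of operators. -/
def serE (H : ℕ → FA Letter) : PowerSeries (Module.End ℂ CE) :=
  PowerSeries.mk fun k => lmCE (emb (H k))

/-- The adjoint action of a Hamiltonian, as a series of operators. -/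
def serA (H : ℕ → FA Letter) : PowerSeries (Module.End ℂ CE) :=
  PowerSeries.mk fun k => adCE (H k)

lemma coeff_serE (H : ℕ → FA Letter) (k : ℕ) :
    PowerSeries.coeff k (serE H) = lmCE (emb (H k)) := PowerSeries.coeff_mk _ _

lemma coeff_serA (H : ℕ → FA Letter) (k : ℕ) :
    PowerSeries.coeff k (serA H) = adCE (H k) := PowerSeries.coeff_mk _ _

lemma dQ_mul_serE (H : ℕ → FA Letter) :
    PowerSeries.C dQ * serE H = serA H - serE H * PowerSeries.C dQ := by
  ext1 k
  rw [PowerSeries.coeff_C_mul, map_sub, PowerSeries.coeff_mul_C, coeff_serE, coeff_serA, dQ_mul_emb]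

open Finset.HasAntidiagonal in
lemma coeff_serA_mul_serE {p q : ZMod 2} {G H : ℕ → FA Letter} (hG : ∀ k, G k ∈ hom par p)
    (hH : ∀ k, H k ∈ hom par q) (N : ℕ) :
    PowerSeries.coeff N (serA G * serE H) =
      lmCE (emb (∑ k ∈ antidiagonal N, br (G k.1) (H k.2))) +
        sg (p * q) • PowerSeries.coeff N (serE H * serA G) := by
  rw [PowerSeries.coeff_mul, PowerSeries.coeff_mul,
    ← Finset.Nat.sum_antidiagonal_swap (n := N) (f := fun x => PowerSeries.coeff x.1 (serE H) * _),
    map_sum, map_sum, Finset.smul_sum, ← Finset.sum_add_distrib]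
  refine Finset.sum_congr rfl fun x _ => ?_
  simp only [coeff_serE, coeff_serA, Prod.fst_swap, Prod.snd_swap]
  exact adCE_mul_emb (hG _) (hH _)

lemma adCE_one (x : FA Letter) : adCE x (ceI.mkQ 1) = 0 := by rw [adCE_mkQ, adL_one, map_zero]

lemma dQ_one : dQ (ceI.mkQ 1) = 0 := by rw [dQ_mkQ, dCE_one, map_zero]

/-- Application of a series of operators to the unit chain. -/
def apOne (k : ℕ) : PowerSeries (Module.End ℂ CE) →+ CE where
  toFun T := PowerSeries.coeff k T (ceI.mkQ 1)
  map_zero' := by simp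
  map_add' S T := by simp

lemma apOne_apply (k : ℕ) (T : PowerSeries (Module.End ℂ CE)) :
    apOne k T = PowerSeries.coeff k T (ceI.mkQ 1) := rfl

lemma apOne_mul_serA (T : PowerSeries (Module.End ℂ CE)) (H : ℕ → FA Letter) (k : ℕ) :
    apOne k (T * serA H) = 0 := by
  rw [apOne_apply, PowerSeries.coeff_mul, LinearMap.sum_apply]
  refine Finset.sum_eq_zero fun x _ => ?_
  rw [Module.End.mul_apply, coeff_serA, adCE_one, map_zero]

lemma apOne_mul_dQ (T : PowerSeries (Module.End ℂ CE)) (k : ℕ) :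
    apOne k (T * PowerSeries.C dQ) = 0 := by
  rw [apOne_apply, PowerSeries.coeff_mul_C, Module.End.mul_apply, dQ_one, map_zero]

lemma apOne_dQ_mul (T : PowerSeries (Module.End ℂ CE)) (k : ℕ) :
    apOne k (PowerSeries.C dQ * T) = dQ (apOne k T) := by
  rw [apOne_apply, PowerSeries.coeff_C_mul]; rfl

lemma genSer_eq {H : ℕ → FA Letter} (h3 : ∀ k < 3, H k = 0) :
    genSer H = PowerSeries.mk fun k => emb (H k) := by
  rw [genSer]
  congr 1
  funext k
  split_ifs with h
  · rfl
  · rw [h3 k (by omega), map_zero]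

lemma serE_eq {H : ℕ → FA Letter} (h3 : ∀ k < 3, H k = 0) :
    PowerSeries.map (lmCE : FA Word →+* Module.End ℂ CE) (genSer H) = serE H := by
  ext1 k
  rw [PowerSeries.coeff_map, genSer_eq h3, PowerSeries.coeff_mk, coeff_serE]; rfl

lemma apOne_map (T : PowerSeries (FA Word)) (k : ℕ) :
    apOne k (PowerSeries.map (lmCE : FA Word →+* Module.End ℂ CE) T) =
      ceI.mkQ (PowerSeries.coeff k T) := by
  rw [apOne_apply, PowerSeries.coeff_map]
  change lmCE _ (ceI.mkQ 1) = _
  rw [lmCE_mkQ, mul_one]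

lemma mkQ_genSer_pow {H : ℕ → FA Letter} (h3 : ∀ k < 3, H k = 0) (i k : ℕ) :
    ceI.mkQ (PowerSeries.coeff k (genSer H ^ i)) = apOne k (serE H ^ i) := by
  rw [← apOne_map, map_pow, serE_eq h3]

/-- Solutions of the Maurer–Cartan equation. -/
structure IsMC (H : ℕ → FA Letter) : Prop where
  odd : ∀ k, H k ∈ hom par 1
  ord : ∀ k < 3, H k = 0
  mc : ∀ N, ∑ k ∈ Finset.HasAntidiagonal.antidiagonal N, br (H k.1) (H k.2) ∈ cyc

lemma IsMC.serA_serE {H : ℕ → FA Letter} (h : IsMC H) : serA H * serE H = -(serE H * serA H) := by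
  ext1 N
  rw [coeff_serA_mul_serE h.odd h.odd, lmCE_emb_cyc (h.mc N), one_mul, sg_one, zero_add, map_neg]
  exact neg_one_smul ℂ (PowerSeries.coeff N (serE H * serA H))

lemma IsMC.dQ_pow {H : ℕ → FA Letter} (h : IsMC H) (i k : ℕ) : dQ (apOne k (serE H ^ i)) = 0 := by
  have hA : ∀ i, ∃ T, serA H * serE H ^ i = T * serA H := by
    intro i
    induction i with
    | zero => exact ⟨1, by simp⟩
    | succ i ih =>
      obtain ⟨T, hT⟩ := ih
      exact ⟨-(T * serE H), by
        rw [pow_succ, ← mul_assoc, hT, mul_assoc, h.serA_serE]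
        exact (mul_neg T _).trans ((congrArg Neg.neg (mul_assoc T _ _).symm).trans
          (neg_mul (T * serE H) _).symm)⟩
  rw [← apOne_dQ_mul]
  induction i generalizing k with
  | zero => rw [pow_zero, mul_one, ← one_mul (PowerSeries.C dQ), apOne_mul_dQ]
  | succ i ih =>
    obtain ⟨T, hT⟩ := hA i
    rw [pow_succ', ← mul_assoc, dQ_mul_serE, sub_mul, hT, map_sub, apOne_mul_serA, mul_assoc, zero_sub,
      neg_eq_zero, apOne_apply, PowerSeries.coeff_mul, LinearMap.sum_apply]
    refine Finset.sum_eq_zero fun x _ => ?_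
    rw [Module.End.mul_apply, ← apOne_apply, ih, map_zero]

/-- The exponential of a solution of the Maurer–Cartan equation is a cycle. -/
theorem IsMC.dCE_mem {H : ℕ → FA Letter} (h : IsMC H) (i k : ℕ) :
    dCE (PowerSeries.coeff k (genSer H ^ i)) ∈ ceI := by
  rw [← Submodule.Quotient.mk_eq_zero]
  change ceI.mkQ _ = 0
  rw [← dQ_mkQ, mkQ_genSer_pow h.ord, h.dQ_pow]

open Finset.HasAntidiagonal in
/-- The exponentials of the end points of a path of gauge equivalent solutions of the Maurer–Cartan
equation differ by a boundary. -/
theorem genSer_pow_sub_mem {H H' : ℝ → ℕ → FA Letter} (hd : ∀ k, IsDer (fun t => H t k) fun t => H' t k)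
    (hlow : ∀ t, ∀ k < 3, H t k = 0) (hlen : ∀ t k, H t k ∈ lenSub k)
    (hmc : ∀ t, 0 < t → t ≤ 1 → IsMC (H t))
    (hg : ∀ t, 0 < t → t ≤ 1 → ∃ g : ℕ → FA Letter, (∀ k, g k ∈ hom par 0) ∧
      (∀ k, g k ∈ lenSub k) ∧ (∀ k < 3, g k = 0) ∧
      ∀ N, H' t N - ∑ k ∈ antidiagonal (N + 2), br (g k.1) (H t k.2) ∈ cyc) (i N : ℕ) :
    PowerSeries.coeff N (genSer (H 1) ^ i) - PowerSeries.coeff N (genSer (H 0) ^ i) ∈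
      ceI ⊔ (bigr (i + 1) (N + 2)).map dCE := by
  have hE : ∀ k, IsDer (fun t => PowerSeries.coeff k (serE (H t)))
      fun t => PowerSeries.coeff k (serE (H' t)) := fun k => by
    simp only [coeff_serE]
    exact (hd k).map (lmCE.toLinearMap ∘ₗ emb)
  have hu := (IsDer.coeff_pow hE i N).map (LinearMap.applyₗ (ceI.mkQ 1) : Module.End ℂ CE →ₗ[ℂ] CE)
  simp only [LinearMap.applyₗ_apply_apply, ← apOne_apply] at hu
  have := hu.sub_mem (((bigr (i + 1) (N + 2)).map dCE).map ceI.mkQ) one_pos fun t h0 h1 => by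
    obtain ⟨g, g0, gl, g3, gd⟩ := hg t h0 h1
    have hc : serA g * serE (H t) = PowerSeries.X ^ 2 * serE (H' t) + serE (H t) * serA g := by
      ext1 K
      rw [coeff_serA_mul_serE g0 (hmc t h0 h1).odd, zero_mul, sg_zero, one_smul, map_add,
        PowerSeries.coeff_X_pow_mul']
      congr 1
      split_ifs with hK
      · obtain ⟨K, rfl⟩ : ∃ L, K = L + 2 := ⟨K - 2, by omega⟩
        rw [Nat.add_sub_cancel, coeff_serE, ← sub_eq_zero, ← map_sub, ← map_sub, ← neg_sub, map_neg,
          map_neg, lmCE_emb_cyc (gd K), neg_zero]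
      · rw [Finset.sum_eq_zero fun x hx => ?_, map_zero, map_zero]
        rw [Finset.HasAntidiagonal.mem_antidiagonal] at hx
        rw [g3 _ (by omega), map_zero, LinearMap.zero_apply]
    have hp := powDer_comm (fun y => (PowerSeries.X_pow_mul).symm) hc i
    refine ⟨dCE (PowerSeries.coeff (N + 2) (genSer g * genSer (H t) ^ i)), ⟨_, ?_, rfl⟩, ?_⟩
    · rw [add_comm i 1, PowerSeries.coeff_mul]
      refine Submodule.sum_mem _ fun x hx => ?_
      rw [← Finset.HasAntidiagonal.mem_antidiagonal.1 hx]
      refine bigr_mul ?_ (genSer_pow (hlen t) _ _)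
      have := genSer_pow gl 1 x.1
      rwa [pow_one] at this
    · rw [← dQ_mkQ, ← apOne_map, map_mul, map_pow, serE_eq g3, serE_eq (hlow t), ← apOne_dQ_mul,
        ← mul_assoc, dQ_mul_serE, sub_mul, hp, map_sub, map_add, apOne_mul_serA, add_zero, mul_assoc,
        apOne_apply, PowerSeries.coeff_X_pow_mul, ← apOne_apply, sub_eq_self, apOne_apply,
        PowerSeries.coeff_mul, LinearMap.sum_apply]
      refine Finset.sum_eq_zero fun x _ => ?_
      rw [Module.End.mul_apply, ← apOne_apply, apOne_dQ_mul, (hmc t h0 h1).dQ_pow, map_zero]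
  rw [← mkQ_genSer_pow (hlow 1), ← mkQ_genSer_pow (hlow 0), ← map_sub] at this
  obtain ⟨y, hy, hyx⟩ := this
  have h2 : PowerSeries.coeff N (genSer (H 1) ^ i) - PowerSeries.coeff N (genSer (H 0) ^ i) - y ∈ ceI := by
    rw [← Submodule.Quotient.mk_eq_zero]
    change ceI.mkQ _ = 0
    rw [map_sub, hyx, sub_self]
  rw [← sub_add_cancel (PowerSeries.coeff N (genSer (H 1) ^ i) - _) y]
  exact Submodule.add_mem_sup h2 hy

/-- Exponentials depend only on cyclic words. -/
lemma genSer_pow_congr {H K : ℕ → FA Letter} (hH : ∀ k < 3, H k = 0) (hK : ∀ k < 3, K k = 0)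
    (h : ∀ k, H k - K k ∈ cyc) (i N : ℕ) :
    PowerSeries.coeff N (genSer H ^ i) - PowerSeries.coeff N (genSer K ^ i) ∈ ceI := by
  have hE : serE H = serE K := by
    ext1 k
    rw [coeff_serE, coeff_serE, ← sub_eq_zero, ← map_sub, ← map_sub, lmCE_emb_cyc (h k)]
  rw [← Submodule.Quotient.mk_eq_zero]
  change ceI.mkQ _ = 0
  rw [map_sub, mkQ_genSer_pow hH, mkQ_genSer_pow hK, hE, sub_self]

end Chains

section LinearSymplectic

variable {n m n' m' : ℕ}

lemma std_add_apply (v w : Std n m) (i : SI n m) : (v + w) i = v i + w i := rfl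

lemma std_smul_apply (c : ℂ) (v : Std n m) (i : SI n m) : (c • v) i = c * v i := rfl

/-- The canonical bilinear form. -/
def prV : Std n m →ₗ[ℂ] Std n m →ₗ[ℂ] ℂ :=
  LinearMap.mk₂ ℂ (fun v w => ∑ i, ∑ j, v i * w j * pr (stdLetter n m i) (stdLetter n m j))
    (fun v v' w => by simp only [std_add_apply, add_mul, Finset.sum_add_distrib])
    (fun c v w => by simp only [std_smul_apply, smul_eq_mul, Finset.mul_sum, mul_assoc])
    (fun v w w' => by simp only [std_add_apply, mul_add, add_mul, Finset.sum_add_distrib])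
    (fun c v w => by
      simp only [std_smul_apply, smul_eq_mul, Finset.mul_sum, mul_assoc, mul_left_comm c])

lemma prV_apply (v w : Std n m) :
    prV v w = ∑ i, ∑ j, v i * w j * pr (stdLetter n m i) (stdLetter n m j) := rfl

lemma prV_stdB (i j : SI n m) : prV (stdB i : Std n m) (stdB j) =
    pr (stdLetter n m i) (stdLetter n m j) := by
  rw [prV_apply, Finset.sum_eq_single i, Finset.sum_eq_single j]
  · simp
  · intro k _ hk; rw [stdB_apply, stdB_apply, if_neg hk]; simp
  · simp
  · intro k _ hk; refine Finset.sum_eq_zero fun j _ => ?_; rw [stdB_apply, if_neg hk]; simp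
  · simp

lemma shp_dual' (w : Std n m) : ∑ a, (sg (spar a) * prV (stdB a) w) • shp a = w := by
  have h : (∑ a : SI n m, ((sg (spar a)) • (prV (stdB a)).smulRight (shp a))) = LinearMap.id := by
    refine LinearMap.ext fun v => ?_
    conv_lhs => rw [std_sum v, map_sum]
    conv_rhs => rw [std_sum v, map_sum]
    refine Finset.sum_congr rfl fun i _ => ?_
    rw [map_smul, map_smul, LinearMap.sum_apply, LinearMap.id_apply]
    congr 1
    conv_rhs => rw [← shp_dual i]
    refine Finset.sum_congr rfl fun a _ => ?_
    rw [LinearMap.smul_apply, LinearMap.smulRight_apply, prV_stdB, smul_smul]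
  conv_rhs => rw [← LinearMap.id_apply (R := ℂ) w, ← h]
  rw [LinearMap.sum_apply]
  refine Finset.sum_congr rfl fun a _ => ?_
  rw [LinearMap.smul_apply, LinearMap.smulRight_apply, smul_smul]

lemma prV_shp (a i : SI n m) : prV (shp a) (stdB i) = if a = i then -1 else 0 := by
  rcases a with a | a | a <;> rcases i with i | i | i <;>
    simp only [shp, map_neg, LinearMap.neg_apply, prV_stdB, stdLetter, pr] <;>
    simp [Fin.val_inj]
  all_goals split_ifs <;> simp

/-- Evaluation of a bilinear map on words of length two. -/
def bil {E : Type*} [AddCommGroup E] [Module ℂ E] (B : Std n m →ₗ[ℂ] Std n m →ₗ[ℂ] E) :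
    FA Letter →ₗ[ℂ] E :=
  linExt fun l => match l with
    | [a, b] => B (letV n m a) (letV n m b)
    | _ => 0

lemma bil_coordT {E : Type*} [AddCommGroup E] [Module ℂ E] (B : Std n m →ₗ[ℂ] Std n m →ₗ[ℂ] E)
    (v w : Std n m) : bil B (coordT n m (ι ℂ v * ι ℂ w)) = B v w := by
  have h : ((LinearMap.mul ℂ (TensorAlgebra ℂ (Std n m))).compl₁₂ (ι ℂ) (ι ℂ)).compr₂
      (bil B ∘ₗ (coordT n m).toLinearMap) = B := by
    refine LinearMap.ext fun v => LinearMap.ext fun w => ?_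
    rw [std_sum v, std_sum w]
    simp only [map_sum, map_smul, LinearMap.sum_apply, LinearMap.smul_apply]
    refine Finset.sum_congr rfl fun i _ => ?_
    congr 1
    refine Finset.sum_congr rfl fun j _ => ?_
    congr 1
    rw [LinearMap.compr₂_apply, LinearMap.compl₁₂_apply, LinearMap.mul_apply', LinearMap.comp_apply,
      AlgHom.toLinearMap_apply, map_mul, coordT_stdB, coordT_stdB, wd_mul, bil, linExt_wd]
    simp only [List.cons_append, List.nil_append, letV_stdLetter]
  exact LinearMap.congr_fun₂ h v w

lemma Mhat_bil {g : Std n m →ₗ[ℂ] Std n' m'} (hM : hmap g (Mhat n m) = Mhat n' m')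
    {E : Type*} [AddCommGroup E] [Module ℂ E] (B : Std n' m' →ₗ[ℂ] Std n' m' →ₗ[ℂ] E) :
    ∑ a, B (g (stdB a)) (g (shp a)) = ∑ c, B (stdB c) (shp c) := by
  have h := congrArg (fun f => bil B (coordT n' m' (tc 2 f))) hM
  simp only [Mhat, map_sum, map_mul, hmap_tι, tc_tι_mul] at h
  simp only [tc_tι, if_true, ← map_mul, bil_coordT] at h
  exact h

lemma isometry_dual {g : Std n m →ₗ[ℂ] Std n' m'} (hi : Function.Injective g)
    (hM : hmap g (Mhat n m) = Mhat n' m') (hg : ∀ v, g (sinv v) = sinv (g v)) (v : Std n m) :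
    ∑ a, (sg (spar a) * prV (g (stdB a)) (g v)) • shp a = v := by
  apply hi
  have h := Mhat_bil hM ((prV.flip (g v) ∘ₗ sinv).smulRight (LinearMap.id : _ →ₗ[ℂ] Std n' m'))
  simp only [LinearMap.smulRight_apply, LinearMap.smul_apply, LinearMap.comp_apply,
    LinearMap.flip_apply, LinearMap.id_apply, sinv_stdB, ← hg, map_smul, smul_eq_mul] at h
  rw [shp_dual' (g v)] at h
  rw [map_sum]
  simp only [map_smul]
  exact h

end LinearSymplectic

section Rotation

variable {n m n' m' : ℕ}

/-- Translation of the index of a letter. -/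
def shiftLetter (K : ℕ) : Letter → Letter
  | .p i => .p (i + K)
  | .q i => .q (i + K)
  | .x i => .x (i + K)

lemma par_shiftLetter (K : ℕ) (a : Letter) : par (shiftLetter K a) = par a := by cases a <;> rfl

lemma pr_shiftLetter (K : ℕ) (a b : Letter) :
    pr (shiftLetter K a) (shiftLetter K b) = pr a b := by
  cases a <;> cases b <;> simp [shiftLetter, pr]

/-- Letters with index less than `K`. -/
def IsSmall (K : ℕ) : Letter → Prop
  | .p i => i < K
  | .q i => i < K
  | .x i => i < K

lemma isSmall_stdLetter {K : ℕ} (hn : n ≤ K) (hm : m ≤ K) (i : SI n m) :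
    IsSmall K (stdLetter n m i) := by
  rcases i with i | i | i
  · exact lt_of_lt_of_le i.2 hn
  · exact lt_of_lt_of_le i.2 hn
  · exact lt_of_lt_of_le i.2 hm

lemma pr_small_shift {K : ℕ} {a : Letter} (ha : IsSmall K a) (b : Letter) :
    pr a (shiftLetter K b) = 0 := by
  cases a <;> cases b <;> simp only [shiftLetter, pr] <;> simp only [IsSmall] at ha <;>
    rw [if_neg (by omega)]

lemma pr_shift_small {K : ℕ} {a : Letter} (ha : IsSmall K a) (b : Letter) :
    pr (shiftLetter K b) a = 0 := by
  rw [pr_swap, pr_small_shift ha]; simp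

/-- Translation of the indices of the letters of words. -/
def shiftW (K : ℕ) : FA Letter →ₐ[ℂ] FA Letter :=
  MonoidAlgebra.lift ℂ _ _ (FreeMonoid.lift fun a => wd [shiftLetter K a])

lemma shiftW_single (K : ℕ) (a : Letter) : shiftW K (wd [a]) = wd [shiftLetter K a] := by
  rw [shiftW, wd, MonoidAlgebra.lift_single, one_smul, FreeMonoid.lift_apply]; simp

/-- The homomorphisms `a ↦ cos t a + sin t Y(a)`. -/
def rotHom (Y : Letter → FA Letter) (t : ℝ) : FA Letter →ₐ[ℂ] FA Letter :=
  MonoidAlgebra.lift ℂ _ _ (FreeMonoid.lift fun a =>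
    (Real.cos t : ℂ) • wd [a] + (Real.sin t : ℂ) • Y a)

lemma rotHom_single (Y : Letter → FA Letter) (t : ℝ) (a : Letter) :
    rotHom Y t (wd [a]) = (Real.cos t : ℂ) • wd [a] + (Real.sin t : ℂ) • Y a := by
  rw [rotHom]
  conv_lhs => rw [wd]
  rw [MonoidAlgebra.lift_single, one_smul, FreeMonoid.lift_apply]; simp

variable (g : Std n m →ₗ[ℂ] Std n' m') (K : ℕ)

/-- The coefficients of the rotation generator. -/
def rotCoeff (c : SI n' m') (b : SI n m) : ℂ := -∑ a, g (stdB a) c * (shp a : Std n m) b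

/-- The translate of the image of a letter under a linear map. -/
def imShift (a : Letter) : FA Letter := shiftW K (coordT n' m' (ι ℂ (g (letV n m a))))

lemma imShift_stdLetter (i : SI n m) :
    imShift g K (stdLetter n m i) =
      ∑ c, g (stdB i) c • wd [shiftLetter K (stdLetter n' m' c)] := by
  rw [imShift, letV_stdLetter, coordT_ι, map_sum]
  simp only [map_smul, shiftW_single]

/-- The generator of the rotation, on words. -/
def rotT : FA Letter →ₗ[ℂ] FA Letter :=
  ∑ c, ∑ b, rotCoeff g c b • ospT (shiftLetter K (stdLetter n' m' c)) (stdLetter n m b)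

/-- The generator of the rotation, on chains. -/
def rotC : FA Word →ₗ[ℂ] FA Word :=
  ∑ c, ∑ b, rotCoeff g c b • ospC (shiftLetter K (stdLetter n' m' c)) (stdLetter n m b)

lemma rotC_mem (x : FA Word) : rotC g K x ∈ ceR := by
  have key : ∀ s t (y : FA Word), ospC s t y ∈ ceR := by
    intro s t y
    refine Submodule.mem_sup_right ?_
    exact fa_induction (P := fun y => ospC s t y ∈ _) y (by simp)
      (fun l => Submodule.subset_span ⟨s, t, l, rfl⟩)
      (fun x y hx hy => by rw [map_add]; exact add_mem hx hy)
      (fun c x hx => by rw [map_smul]; exact Submodule.smul_mem _ _ hx)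
  rw [rotC, LinearMap.sum_apply]
  refine Submodule.sum_mem _ fun c _ => ?_
  rw [LinearMap.sum_apply]
  exact Submodule.sum_mem _ fun b _ => Submodule.smul_mem _ _ (key _ _ _)

lemma rotC_emb (x : FA Letter) : rotC g K (emb x) = emb (rotT g K x) := by
  have key : ∀ s t (y : FA Letter), ospC s t (emb y) = emb (ospT s t y) := by
    intro s t y
    refine fa_induction (P := fun y => ospC s t (emb y) = emb (ospT s t y)) y (by simp)
      (fun l => ?_) (fun x y hx hy => by simp only [map_add, hx, hy])
      (fun c x hx => by simp only [map_smul, hx])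
    rw [emb_wd, ospC, sderL_single]
  simp only [rotC, rotT, LinearMap.sum_apply, LinearMap.smul_apply, map_sum, map_smul, key]

variable {g} (hg : ∀ v, g (sinv v) = sinv (g v))

include hg in
lemma apply_eq_zero_of_par {a : SI n m} {c : SI n' m'} (h : spar c ≠ spar a) :
    g (stdB a) c = 0 := by
  have h1 : sinv (g (stdB a)) = sg (spar a) • g (stdB a) := by rw [← hg, sinv_stdB, map_smul]
  have h2 : sg (spar c) * g (stdB a) c = sg (spar a) * g (stdB a) c := congrFun h1 c
  have h3 : sg (spar c) ≠ sg (spar a) := by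
    rcases zmod2_cases (spar c) with e | e <;> rcases zmod2_cases (spar a) with e' | e' <;>
      rw [e, e'] at h ⊢ <;> simp_all [sg_zero, sg_one] <;> norm_num
  rw [← sub_eq_zero, ← sub_mul] at h2
  exact (mul_eq_zero.1 h2).resolve_left (sub_ne_zero.2 h3)

lemma shp_apply_eq_zero {a b : SI n m} (h : spar b ≠ spar a) : (shp a : Std n m) b = 0 := by
  rcases a with a | a | a <;> rcases b with b | b | b <;>
    first
    | exact absurd rfl h
    | (change (stdB _ : Std n m) _ = 0; rw [stdB_apply, if_neg (by simp)])
    | (change -(stdB _ : Std n m) _ = 0; rw [stdB_apply, if_neg (by simp), neg_zero])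

include hg in
lemma rotCoeff_eq_zero {c : SI n' m'} {b : SI n m} (h : spar c ≠ spar b) : rotCoeff g c b = 0 := by
  rw [rotCoeff, Finset.sum_eq_zero fun a _ => ?_, neg_zero]
  by_cases h1 : spar c = spar a
  · rw [shp_apply_eq_zero (by rw [← h1]; exact h.symm), mul_zero]
  · rw [apply_eq_zero_of_par hg h1, zero_mul]

lemma even_sderL_mul {α : Type} (par : α → ZMod 2) (δ : α → FA α) (x y : FA α) :
    sderL par 0 δ (x * y) = sderL par 0 δ x * y + x * sderL par 0 δ y := by
  refine fa_induction (P := fun x => sderL par 0 δ (x * y) = sderL par 0 δ x * y + x * sderL par 0 δ y)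
    x (by simp) (fun l => ?_) (fun x y hx hy => ?_) (fun c x hx => ?_)
  · rw [sderL_mul _ _ (wd_mem_hom par l), zero_mul, sg_zero, one_smul]
  · simp only [add_mul, map_add, hx, hy]; abel
  · simp only [smul_mul_assoc, map_smul, hx, smul_add]

include hg in
lemma rotT_mul (x y : FA Letter) : rotT g K (x * y) = rotT g K x * y + x * rotT g K y := by
  simp only [rotT, LinearMap.sum_apply, LinearMap.smul_apply, Finset.sum_mul, Finset.mul_sum,
    ← Finset.sum_add_distrib]
  refine Finset.sum_congr rfl fun c _ => Finset.sum_congr rfl fun b _ => ?_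
  by_cases h : spar c = spar b
  · have e : par (shiftLetter K (stdLetter n' m' c)) + par (stdLetter n m b) = 0 := by
      rw [par_shiftLetter]
      change spar c + spar b = 0
      rw [h, CharTwo.add_self_eq_zero]
    simp only [ospT, e, even_sderL_mul, smul_add, smul_mul_assoc, mul_smul_comm]
  · simp [rotCoeff_eq_zero hg h]

include hg in
lemma rotC_mul (x y : FA Word) : rotC g K (x * y) = rotC g K x * y + x * rotC g K y := by
  simp only [rotC, LinearMap.sum_apply, LinearMap.smul_apply, Finset.sum_mul, Finset.mul_sum,
    ← Finset.sum_add_distrib]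
  refine Finset.sum_congr rfl fun c _ => Finset.sum_congr rfl fun b _ => ?_
  by_cases h : spar c = spar b
  · have e : par (shiftLetter K (stdLetter n' m' c)) + par (stdLetter n m b) = 0 := by
      rw [par_shiftLetter]
      change spar c + spar b = 0
      rw [h, CharTwo.add_self_eq_zero]
    simp only [ospC, e, even_sderL_mul, smul_add, smul_mul_assoc, mul_smul_comm]
  · simp [rotCoeff_eq_zero hg h]

lemma ospT_single (s t v : Letter) : ospT s t (wd [v]) = ospV s t v := sderL_single _ _ _ _

variable {K} in
lemma rotT_stdLetter (hn : n ≤ K) (hm : m ≤ K) (i : SI n m) :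
    rotT g K (wd [stdLetter n m i]) = imShift g K (stdLetter n m i) := by
  have h : ∀ (c : SI n' m') (b : SI n m),
      ospV (shiftLetter K (stdLetter n' m' c)) (stdLetter n m b) (stdLetter n m i) =
      pr (stdLetter n m b) (stdLetter n m i) • wd [shiftLetter K (stdLetter n' m' c)] := fun c b => by
    rw [ospV, pr_shift_small (isSmall_stdLetter hn hm i), mul_zero, zero_smul, add_zero]
  rw [imShift_stdLetter]
  simp only [rotT, LinearMap.sum_apply, LinearMap.smul_apply, ospT_single, h, smul_smul,
    ← Finset.sum_smul]
  refine Finset.sum_congr rfl fun c _ => ?_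
  congr 1
  have h2 : ∀ b, rotCoeff g c b * pr (stdLetter n m b) (stdLetter n m i) =
      ∑ a, -(g (stdB a) c) * ((shp a : Std n m) b * pr (stdLetter n m b) (stdLetter n m i)) := fun b => by
    rw [rotCoeff, neg_mul, Finset.sum_mul, ← Finset.sum_neg_distrib]
    exact Finset.sum_congr rfl fun a _ => by ring
  simp only [h2]
  rw [Finset.sum_comm]
  simp only [← Finset.mul_sum]
  have h3 : ∀ a : SI n m, ∑ b, (shp a : Std n m) b * pr (stdLetter n m b) (stdLetter n m i) =
      if a = i then -1 else 0 := fun a => by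
    rw [← prV_shp]
    conv_rhs => rw [std_sum (shp a)]
    simp only [map_sum, LinearMap.sum_apply, map_smul, LinearMap.smul_apply, prV_stdB, smul_eq_mul]
  simp only [h3]
  rw [Finset.sum_eq_single i]
  · simp
  · intro a _ ha; rw [if_neg ha, mul_zero]
  · simp

variable {K} in
include hg in
lemma rotT_imShift (hi : Function.Injective g) (hM : hmap g (Mhat n m) = Mhat n' m') (hn : n ≤ K)
    (hm : m ≤ K) (i : SI n m) :
    rotT g K (imShift g K (stdLetter n m i)) = -wd [stdLetter n m i] := by
  have h : ∀ (c j : SI n' m') (b : SI n m),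
      ospV (shiftLetter K (stdLetter n' m' c)) (stdLetter n m b)
        (shiftLetter K (stdLetter n' m' j)) =
      (sg (spar c * spar b) * pr (stdLetter n' m' c) (stdLetter n' m' j)) •
        wd [stdLetter n m b] := fun c j b => by
    rw [ospV, pr_small_shift (isSmall_stdLetter hn hm b), zero_smul, zero_add, pr_shiftLetter,
      par_shiftLetter]
  have h1 := isometry_dual hi hM hg (stdB i)
  have h1' := congrArg (fun v => coordT n m (ι ℂ v)) h1
  simp only [map_sum, map_smul, coordT_stdB] at h1'
  rw [imShift_stdLetter, ← h1', map_sum]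
  simp only [map_smul, rotT, LinearMap.sum_apply, LinearMap.smul_apply, ospT_single, h, smul_smul,
    Finset.smul_sum]
  have h2 : ∀ a : SI n m, coordT n m (ι ℂ (shp a)) = ∑ b, (shp a : Std n m) b • wd [stdLetter n m b] :=
    fun a => coordT_ι _
  simp only [h2, Finset.smul_sum, smul_smul]
  rw [← Finset.sum_neg_distrib]
  simp only [← Finset.sum_neg_distrib, ← neg_smul]
  have e1 : ∀ j : SI n' m', ∑ c : SI n' m', ∑ b : SI n m, (g (stdB i) j * (rotCoeff g c b *
      (sg (spar c * spar b) * pr (stdLetter n' m' c) (stdLetter n' m' j)))) • (wd [stdLetter n m b] : FA Letter) =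
      ∑ b : SI n m, ∑ c : SI n' m', (g (stdB i) j * (rotCoeff g c b *
      (sg (spar c * spar b) * pr (stdLetter n' m' c) (stdLetter n' m' j)))) • wd [stdLetter n m b] :=
    fun j => Finset.sum_comm
  simp only [e1]
  rw [Finset.sum_comm]
  conv_rhs => rw [Finset.sum_comm]
  refine Finset.sum_congr rfl fun b _ => ?_
  simp only [← Finset.sum_smul]
  congr 1
  have e2 : ∀ (c j : SI n' m'), g (stdB i) j * (rotCoeff g c b *
      (sg (spar c * spar b) * pr (stdLetter n' m' c) (stdLetter n' m' j))) =
      ∑ a, -(sg (spar a) * (g (stdB a) c * g (stdB i) j * pr (stdLetter n' m' c) (stdLetter n' m' j)) *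
        (shp a : Std n m) b) := fun c j => by
    rw [rotCoeff, neg_mul, Finset.sum_mul, mul_neg, Finset.mul_sum, ← Finset.sum_neg_distrib]
    refine Finset.sum_congr rfl fun a _ => ?_
    by_cases hc : spar c = spar a
    · by_cases hb : spar b = spar a
      · have : ∀ x : ZMod 2, x * x = x := by decide
        rw [hc, hb, this]; ring
      · rw [shp_apply_eq_zero hb]; ring
    · rw [apply_eq_zero_of_par hg hc]; ring
  simp only [e2]
  have e3 : ∀ j : SI n' m', ∑ c : SI n' m', ∑ a : SI n m, -(sg (spar a) * (g (stdB a) c * g (stdB i) j *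
      pr (stdLetter n' m' c) (stdLetter n' m' j)) * (shp a : Std n m) b) =
      ∑ a : SI n m, ∑ c : SI n' m', -(sg (spar a) * (g (stdB a) c * g (stdB i) j *
      pr (stdLetter n' m' c) (stdLetter n' m' j)) * (shp a : Std n m) b) := fun j => Finset.sum_comm
  simp only [e3]
  rw [Finset.sum_comm]
  refine Finset.sum_congr rfl fun a _ => ?_
  rw [Finset.sum_comm, prV_apply]
  simp only [Finset.sum_neg_distrib, ← Finset.sum_mul, ← Finset.mul_sum]

lemma rotHom_zero (l : Word) (Y : Letter → FA Letter) : rotHom Y 0 (wd l) = wd l := by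
  induction l with
  | nil => rw [wd_nil, map_one]
  | cons a l ih => rw [wd_cons, map_mul, ih, rotHom_single]; simp

lemma rotHom_pi_div_two (l : List (SI n m)) :
    rotHom (imShift g K) (Real.pi / 2) (wd (l.map (stdLetter n m))) =
      shiftW K (coordT n' m' (tmap g (tw l))) := by
  induction l with
  | nil => simp [tw, wd_nil]
  | cons a l ih =>
    rw [List.map_cons, wd_cons, map_mul, ih, rotHom_single, tw_cons, map_mul, map_mul, map_mul,
      Real.cos_pi_div_two, Real.sin_pi_div_two]
    congr 1
    rw [imShift, letV_stdLetter]
    simp [tmap]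

variable {K} in
include hg in
lemma isDer_rotHom (hi : Function.Injective g) (hM : hmap g (Mhat n m) = Mhat n' m') (hn : n ≤ K)
    (hm : m ≤ K) {k : ℕ} {x : FA Letter} (hx : x ∈ imW (stdLetter n m) k) :
    IsDer (fun t => rotHom (imShift g K) t x) fun t => rotT g K (rotHom (imShift g K) t x) := by
  have h1 : rotT g K 1 = 0 := by
    have := rotT_mul K hg 1 1
    simpa using this
  refine imW_induction (P := fun x => IsDer (fun t => rotHom (imShift g K) t x)
    fun t => rotT g K (rotHom (imShift g K) t x)) hx (by simpa using IsDer.const (0 : FA Letter))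
    (fun l hl => ?_) (fun x y hx hy => by simpa only [map_add] using hx.add hy)
    (fun c x hx => by
      simp only [map_smul]
      exact hx.map (c • LinearMap.id))
  clear hl
  induction l with
  | nil =>
    rw [List.map_nil, wd_nil]
    simpa [h1] using IsDer.const (1 : FA Letter)
  | cons a l ih =>
    rw [List.map_cons, wd_cons]
    simp only [map_mul, rotT_mul K hg]
    refine IsDer.mul ?_ ih
    simp only [rotHom_single, map_add, map_smul, rotT_stdLetter hn hm,
      rotT_imShift hg hi hM hn hm]
    have c1 : ∀ t : ℝ, HasDerivAt (fun t : ℝ => (Real.cos t : ℂ)) (-(Real.sin t : ℂ)) t := fun t => by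
      simpa using (Real.hasDerivAt_cos t).ofReal_comp
    have c2 : ∀ t : ℝ, HasDerivAt (fun t : ℝ => (Real.sin t : ℂ)) (Real.cos t : ℂ) t := fun t =>
      (Real.hasDerivAt_sin t).ofReal_comp
    have := (IsDer.smul_const c1 (wd [stdLetter n m a])).add
      (IsDer.smul_const c2 (imShift g K (stdLetter n m a)))
    have e : (fun t : ℝ => (Real.cos t : ℂ) • imShift g K (stdLetter n m a) +
        (Real.sin t : ℂ) • -wd [stdLetter n m a]) = fun t : ℝ => -(Real.sin t : ℂ) • wd [stdLetter n m a] +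
        (Real.cos t : ℂ) • imShift g K (stdLetter n m a) := by
      funext t
      rw [smul_neg, neg_smul, add_comm]
    rw [e]
    exact this

open Finset.HasAntidiagonal in
include hg in
lemma coeff_powDer_genSer (H : ℕ → FA Letter) (i k : ℕ) :
    PowerSeries.coeff k (powDer (genSer H) (genSer fun k => rotT g K (H k)) i) =
      rotC g K (PowerSeries.coeff k (genSer H ^ i)) := by
  have h1 : rotC g K 1 = 0 := by
    have := rotC_mul K hg 1 1
    simpa using this
  have h2 : ∀ k, rotC g K (PowerSeries.coeff k (genSer H)) =
      PowerSeries.coeff k (genSer fun k => rotT g K (H k)) := fun k => by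
    rw [genSer, genSer, PowerSeries.coeff_mk, PowerSeries.coeff_mk]
    split_ifs
    · exact rotC_emb g K _
    · exact map_zero _
  induction i generalizing k with
  | zero =>
    rw [pow_zero, powDer, PowerSeries.coeff_one, map_zero]
    split_ifs
    · exact h1.symm
    · exact (map_zero _).symm
  | succ i ih =>
    rw [powDer, pow_succ, map_add, PowerSeries.coeff_mul, PowerSeries.coeff_mul, PowerSeries.coeff_mul,
      map_sum, ← Finset.sum_add_distrib]
    refine Finset.sum_congr rfl fun x _ => ?_
    rw [rotC_mul K hg, ih, h2]

variable {K} in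
include hg in
lemma genSer_shift_mem (hi : Function.Injective g) (hM : hmap g (Mhat n m) = Mhat n' m') (hn : n ≤ K)
    (hm : m ≤ K) (f : That (Std n m)) (i N : ℕ) :
    PowerSeries.coeff N (genSer (fun k => shiftW K (coordT n' m' (tc k (hmap g f)))) ^ i) -
      PowerSeries.coeff N (genSer (fun k => coordT n m (tc k f)) ^ i) ∈ ceR := by
  set H : ℝ → ℕ → FA Letter := fun t k => rotHom (imShift g K) t (coordT n m (tc k f)) with hH
  have hd : ∀ k, IsDer (fun t => PowerSeries.coeff k (genSer (H t)))
      fun t => PowerSeries.coeff k (genSer fun k => rotT g K (H t k)) := fun k => by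
    simp only [genSer, PowerSeries.coeff_mk]
    split_ifs
    · exact (isDer_rotHom hg hi hM hn hm (coordT_imW (tc_mem k f))).map emb
    · exact IsDer.const 0
  have := (IsDer.coeff_pow hd i N).sub_mem ceR (T := Real.pi / 2) (by positivity) fun t _ _ => by
    rw [coeff_powDer_genSer K hg]; exact rotC_mem g K _
  have e0 : H 0 = fun k => coordT n m (tc k f) := funext fun k =>
    imW_induction (P := fun x => rotHom (imShift g K) 0 x = x) (coordT_imW (tc_mem k f)) (map_zero _)
      (fun l _ => rotHom_zero _ _) (fun x y hx hy => by rw [map_add, hx, hy])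
      (fun c x hx => by rw [map_smul, hx])
  have e1 : H (Real.pi / 2) = fun k => shiftW K (coordT n' m' (tc k (hmap g f))) := funext fun k => by
    have h := mem_span_tw (tc_mem k f)
    rw [tc_hmap]
    change rotHom (imShift g K) (Real.pi / 2) (coordT n m (tc k f)) = _
    generalize tc k f = x at h ⊢
    induction h using Submodule.span_induction with
    | mem x hx => obtain ⟨l, -, rfl⟩ := hx; rw [coordT_tw, rotHom_pi_div_two]
    | zero => simp
    | add x y _ _ hx hy => simp only [map_add, hx, hy]
    | smul c x _ hx => simp only [map_smul, hx]
  rwa [e0, e1] at this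

end Rotation

section Invariance

variable {n m n' m' : ℕ}

/-- The class of `exp(f)` in the stable relative complex is invariant under linear symplectic
isomorphisms. -/
theorem expHam_hmap {g : Std n m →ₗ[ℂ] Std n' m'} (hg : ∀ v, g (sinv v) = sinv (g v))
    (hi : Function.Injective g) (hM : hmap g (Mhat n m) = Mhat n' m') (f : That (Std n m)) :
    expHam (hmap g f) = expHam f := by
  refine Subtype.ext (funext fun i => funext fun j => ?_)
  change ceR.mkQ _ = ceR.mkQ _
  rw [Submodule.mkQ_apply, Submodule.mkQ_apply, Submodule.Quotient.eq, ← smul_sub]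
  refine Submodule.smul_mem _ _ ?_
  have h1 := genSer_shift_mem (K := n + m + n' + m') hg hi hM (by omega) (by omega) f i (2 * j)
  have h2 := genSer_shift_mem (K := n + m + n' + m') (g := (LinearMap.id : Std n' m' →ₗ[ℂ] Std n' m'))
    (fun _ => rfl) Function.injective_id (hmap_id _) (by omega) (by omega) (hmap g f) i (2 * j)
  rw [hmap_id] at h2
  have := sub_mem h1 h2
  rwa [sub_sub_sub_cancel_left] at this

end Invariance

section LeadingTerms

variable {V W X : Type*} [AddCommGroup V] [Module ℂ V] [SuperSpace V]
  [AddCommGroup W] [Module ℂ W] [SuperSpace W] [AddCommGroup X] [Module ℂ X] [SuperSpace X]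
  {p : ZMod 2}

lemma tc_mul_ord {j k : ℕ} {f g : That V} (hf : f ∈ ordSub V j) (hg : g ∈ ordSub V k) :
    tc (j + k) (f * g) = tc j f * tc k g := by
  rw [tc_mul, Finset.sum_eq_single (j, k)]
  · intro x hx hne
    have hx := Finset.HasAntidiagonal.mem_antidiagonal.1 hx
    rcases lt_or_ge x.1 j with h | h
    · rw [mem_ordSub.1 hf _ h, zero_mul]
    · rw [mem_ordSub.1 hg x.2, mul_zero]
      by_contra h2
      exact hne (Prod.ext (by omega) (by omega))
  · exact fun h => (h (Finset.HasAntidiagonal.mem_antidiagonal.2 rfl)).elim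

/-- The linear part of a formal morphism. -/
def FMorph.lin (φ : FMorph V W) : V →ₗ[ℂ] W :=
  ιInv ∘ₗ tc 1 ∘ₗ φ.toAlgHom.toLinearMap ∘ₗ tι

lemma FMorph.ι_lin (φ : FMorph V W) (v : V) : ι ℂ (φ.lin v) = tc 1 (φ.toAlgHom (tι v)) := by
  obtain ⟨w, hw⟩ := gr_one_eq (tc_mem 1 (φ.toAlgHom (tι v)))
  change ι ℂ (ιInv (tc 1 (φ.toAlgHom (tι v)))) = _
  rw [hw, ι_leftInverse w]

lemma ι_inj {v w : V} (h : ι ℂ v = ι ℂ w) : v = w := ι_leftInverse.injective h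

lemma FMorph.tι_sub_lin (φ : FMorph V W) (v : V) :
    φ.toAlgHom (tι v) - tι (φ.lin v) ∈ ordSub W 2 := mem_ordSub.2 fun i hi => by
  interval_cases i
  · rw [map_sub, φ.tc_zero, tc_tι, if_neg (by simp), sub_zero]
  · rw [map_sub, tc_tι, if_pos rfl, φ.ι_lin, sub_self]

lemma sub_temb_mem {k : ℕ} {f : That V} (hf : f ∈ ordSub V k) :
    f - temb (tc k f) ∈ ordSub V (k + 1) := mem_ordSub.2 fun i hi => by
  rw [map_sub, tc_temb (tc_mem k f)]
  split_ifs with h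
  · rw [h, sub_self]
  · rw [mem_ordSub.1 hf i (by omega), sub_zero]

lemma FMorph.tc_temb (φ : FMorph V W) {k : ℕ} {x : TensorAlgebra ℂ V} (hx : x ∈ gr V k) :
    tc k (φ.toAlgHom (temb x)) = tmap φ.lin x := by
  refine gr_induct (P := fun k x => tc k (φ.toAlgHom (temb x)) = tmap φ.lin x) (fun r => ?_)
    (fun n x y hx hy => by simp only [map_add, hx, hy]) (fun n v x hx ih => ?_) hx
  · rw [AlgHom.commutes, AlgHom.commutes, AlgHom.commutes, tc_algebraMap, if_pos rfl]
  · rw [map_mul, map_mul, temb_ι, add_comm n 1,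
      tc_mul_ord (φ.ord (tι_ord v)) (φ.ord (temb_ord hx)), ih, map_mul, ← φ.ι_lin]
    simp [tmap]

lemma FMorph.tc_lowest (φ : FMorph V W) {k : ℕ} {f : That V} (hf : f ∈ ordSub V k) :
    tc k (φ.toAlgHom f) = tmap φ.lin (tc k f) := by
  have h := mem_ordSub.1 (φ.ord (sub_temb_mem hf)) k (Nat.lt_succ_self k)
  rw [map_sub, map_sub, sub_eq_zero] at h
  rw [h, φ.tc_temb (tc_mem k f)]

lemma FMorph.lin_sinv (φ : FMorph V W) (v : V) : φ.lin (sinv v) = sinv (φ.lin v) := by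
  apply ι_inj
  rw [φ.ι_lin]
  have h : hsgn (tι v) = tι (sinv v) := hmap_tι _ v
  rw [← h, ← φ.even, tc_hmap, ← φ.ι_lin]
  simp [tmap]

lemma FMorph.lin_comp (ψ : FMorph W X) (φ : FMorph V W) : (ψ.comp φ).lin = ψ.lin ∘ₗ φ.lin := by
  refine LinearMap.ext fun v => ι_inj ?_
  rw [FMorph.ι_lin, FMorph.comp_apply, ψ.tc_lowest (φ.ord (tι_ord v)), ← φ.ι_lin]
  simp [tmap]

lemma FMorph.lin_id : (FMorph.id V).lin = LinearMap.id := by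
  refine LinearMap.ext fun v => ι_inj ?_
  rw [FMorph.ι_lin]
  change tc 1 (tι v) = _
  rw [tc_tι, if_pos rfl]; rfl

lemma FMorph.ofLinear_apply (φ : V →ₗ[ℂ] W) (hφ : ∀ v, φ (sinv v) = sinv (φ v)) (f : That V) :
    (FMorph.ofLinear φ hφ).toAlgHom f = hmap φ f := rfl

lemma FMorph.lin_ofLinear (φ : V →ₗ[ℂ] W) (hφ : ∀ v, φ (sinv v) = sinv (φ v)) :
    (FMorph.ofLinear φ hφ).lin = φ := by
  refine LinearMap.ext fun v => ι_inj ?_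
  rw [FMorph.ι_lin, FMorph.ofLinear_apply, hmap_tι, tc_tι, if_pos rfl]

variable (V W) in
/-- Invertible formal morphisms. -/
structure FIso where
  hom : FMorph V W
  inv : FMorph W V
  inv_hom : ∀ f, inv.toAlgHom (hom.toAlgHom f) = f
  hom_inv : ∀ f, hom.toAlgHom (inv.toAlgHom f) = f

/-- The inverse. -/
def FIso.symm (e : FIso V W) : FIso W V := ⟨e.inv, e.hom, e.hom_inv, e.inv_hom⟩

/-- Composition. -/
def FIso.trans (e : FIso V W) (e' : FIso W X) : FIso V X where
  hom := e'.hom.comp e.hom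
  inv := e.inv.comp e'.inv
  inv_hom f := by simp only [FMorph.comp_apply, e'.inv_hom, e.inv_hom]
  hom_inv f := by simp only [FMorph.comp_apply, e'.hom_inv, e.hom_inv]

/-- The invertible formal morphism given by an even linear isomorphism. -/
def FIso.ofLinear (φ : V ≃ₗ[ℂ] W) (hφ : ∀ v, φ (sinv v) = sinv (φ v)) : FIso V W where
  hom := FMorph.ofLinear φ.toLinearMap hφ
  inv := FMorph.ofLinear φ.symm.toLinearMap fun w => by
    apply φ.injective
    change φ (φ.symm _) = φ _
    rw [hφ, φ.apply_symm_apply]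
    exact congrArg _ (φ.apply_symm_apply w).symm
  inv_hom f := by
    rw [FMorph.ofLinear_apply, FMorph.ofLinear_apply, hmap_comp]
    convert hmap_id f
    exact LinearMap.ext φ.symm_apply_apply
  hom_inv f := by
    rw [FMorph.ofLinear_apply, FMorph.ofLinear_apply, hmap_comp]
    convert hmap_id f
    exact LinearMap.ext φ.apply_symm_apply

lemma FIso.inv_comp_hom (e : FIso V W) : e.inv.comp e.hom = FMorph.id V :=
  FMorph.ext_fun e.inv_hom

lemma FIso.hom_comp_inv (e : FIso V W) : e.hom.comp e.inv = FMorph.id W :=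
  FMorph.ext_fun e.hom_inv

lemma FIso.pull_inv_hom (e : FIso V W) (a : DR V) : e.inv.pull (e.hom.pull a) = a := by
  rw [← FMorph.pull_comp, e.inv_comp_hom, FMorph.pull_id]

lemma FIso.pull_hom_inv (e : FIso V W) (a : DR W) : e.hom.pull (e.inv.pull a) = a :=
  e.symm.pull_inv_hom a

/-- The linear part of an invertible formal morphism. -/
def FIso.linEquiv (e : FIso V W) : V ≃ₗ[ℂ] W :=
  LinearEquiv.ofLinearMap e.hom.lin e.inv.lin
    (by rw [← FMorph.lin_comp, e.hom_comp_inv, FMorph.lin_id])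
    (by rw [← FMorph.lin_comp, e.inv_comp_hom, FMorph.lin_id])

/-- Transport of a vector field along an isomorphism. -/
def VField.conj (e : FIso V W) (ξ : VField V p) : VField W p where
  toFun := e.hom.toAlgHom.toLinearMap ∘ₗ ξ.toFun ∘ₗ e.inv.toAlgHom.toLinearMap
  leibniz f g := by
    simp only [LinearMap.comp_apply, AlgHom.toLinearMap_apply, map_mul, ξ.leibniz, map_add, e.hom_inv]
    rw [← e.hom.hsgnPow, e.hom_inv]
  parity f := by
    simp only [LinearMap.comp_apply, AlgHom.toLinearMap_apply, e.hom.even, ξ.parity, map_smul,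
      e.inv.even]
  cont := e.hom.cont.comp (ξ.cont.comp e.inv.cont)

lemma VField.conj_apply (e : FIso V W) (ξ : VField V p) (f : That W) :
    (ξ.conj e).toFun f = e.hom.toAlgHom (ξ.toFun (e.inv.toAlgHom f)) := rfl

lemma VField.conj_hom (e : FIso V W) (ξ : VField V p) (f : That V) :
    e.hom.toAlgHom (ξ.toFun f) = (ξ.conj e).toFun (e.hom.toAlgHom f) := by
  rw [VField.conj_apply, e.inv_hom]

/-- Difference of vector fields. -/
instance : Sub (VField V p) where
  sub ξ η :=
    { toFun := ξ.toFun - η.toFun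
      leibniz := fun f g => by
        simp only [LinearMap.sub_apply, ξ.leibniz, η.leibniz, sub_mul, mul_sub]; abel
      parity := fun f => by
        simp only [LinearMap.sub_apply, map_sub, ξ.parity, η.parity, smul_sub]
      cont := ξ.cont.sub η.cont }

lemma VField.sub_apply (ξ η : VField V p) (f : That V) :
    (ξ - η).toFun f = ξ.toFun f - η.toFun f := rfl

end LeadingTerms

section Hamiltonians

variable {n m n' m' : ℕ} {μ : VField (Std n m) 1}

/-- The defining property `dh = i_μ ω` of a Hamiltonian of an odd vector field. -/
def IsHam (μ : VField (Std n m) 1) (f : That (Std n m)) : Prop :=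
  drD (drFn ((hComm (Std n m)).mkQ f)) = μ.contract (stdOmega n m)

lemma isHam_iff_mem {f : That (Std n m)} : IsHam μ f ↔
    omD (fn f) - μ.iV.toFun (omD (stdAlpha n m)) ∈ hComm (FormGen (Std n m)) := by
  rw [IsHam, drFn_mkQ, drD_mkQ, ← mkQ_omD_stdAlpha, VField.contract_mkQ, Submodule.mkQ_apply,
    Submodule.mkQ_apply, Submodule.Quotient.eq]

lemma contract_mem {p : ZMod 2} (ξ : VField (Std n m) p) :
    ξ.iV.toFun (omD (stdAlpha n m)) ∈ omForm (Std n m) 1 :=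
  ξ.iV_mem_omForm (omD_mem_omForm stdAlpha_mem)

lemma isHam_iff {f : That (Std n m)} :
    IsHam μ f ↔ ∀ N, cycNL par (coordT n m (tc (N + 1) f)) = FH μ N := by
  have h1 : ∀ N, kap (N + 1) (omD (fn f) - μ.iV.toFun (omD (stdAlpha n m))) =
      cycNL par (coordT n m (tc (N + 1) f)) - FH μ N := fun N => by
    rw [LinearMap.map_sub, kap_omD_fn, kap_contract μ, sg_one, neg_neg, one_smul]
  have h2 : omD (fn f) - μ.iV.toFun (omD (stdAlpha n m)) ∈ omForm (Std n m) 1 :=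
    sub_mem (omD_mem_omForm (fn_mem_omForm f)) (contract_mem μ)
  rw [isHam_iff_mem]
  refine ⟨fun h N => ?_, fun h => mem_hComm_of_kap h2 fun k => ?_⟩
  · rw [← sub_eq_zero, ← h1, kap_hComm h]
  · cases k with
    | zero => rw [kap_apply, tc_zero_of_mem_omForm one_ne_zero h2, map_zero, map_zero]
    | succ N => rw [h1, h, sub_self]

lemma IsHam.isSymp {f : That (Std n m)} (h : IsHam μ f) : IsSymp μ := fun N => by
  rw [← isHam_iff.1 h N, rotL_cycNL]

lemma IsHam.sub_ham_mem {f : That (Std n m)} (h : IsHam μ f) {k : ℕ} (hk : k ≠ 0) :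
    coordT n m (tc k f) - ham μ k ∈ cyc := by
  obtain ⟨N, rfl⟩ := Nat.exists_eq_succ_of_ne_zero hk
  refine mem_cyc_of_cycNL hk (sub_mem (coordT_len n m (tc_mem _ f)) (ham_len μ _)) ?_
  rw [map_sub, isHam_iff.1 h N, h.isSymp.cycNL_ham]
  exact sub_self _

lemma IsHam.map {f : That (Std n m)} (h : IsHam μ f) {μ' : VField (Std n' m') 1}
    (θ : FMorph (Std n m) (Std n' m')) (hθ : θ.toAlgHom (Mhat n m) = Mhat n' m')
    (hμ : ∀ f, θ.toAlgHom (μ.toFun f) = μ'.toFun (θ.toAlgHom f)) :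
    IsHam μ' (θ.toAlgHom f) := by
  have h1 := congrArg θ.pull h
  rw [θ.pull_contract μ μ' hμ, (pull_stdOmega_eq_iff θ).2 hθ, θ.pull_drD, drFn_mkQ, θ.pull_mkQ,
    θ.pO_fn] at h1
  exact h1

lemma exists_isHam (h : μ.lie (stdOmega n m) = 0) (hd : drD (stdOmega n m) = 0) :
    ∃ f, tc 0 f = 0 ∧ IsHam μ f := by
  rw [VField.lie_eq, hd, map_zero, zero_add, sg_one, neg_smul, one_smul, neg_eq_zero,
    ← mkQ_omD_stdAlpha, VField.contract_mkQ, drD_mkQ] at h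
  obtain ⟨g, h0, hg⟩ := exact_of_closed (contract_mem μ) ((Submodule.Quotient.mk_eq_zero _).1 h)
  refine ⟨g, h0, isHam_iff_mem.2 ?_⟩
  rw [← neg_sub]
  exact neg_mem hg

lemma FH_imW {p : ZMod 2} (ξ : VField (Std n m) p) (N : ℕ) :
    FH ξ N ∈ imW (stdLetter n m) (N + 1) := by
  rw [FH]
  refine Submodule.sum_mem _ fun a _ => ?_
  rw [add_comm]
  exact Submodule.smul_mem _ _ (imW_mul (wd_mem_imW (stdLetter n m) [a]) (coordT_imW (tc_mem _ _)))

lemma ham_imW {p : ZMod 2} (ξ : VField (Std n m) p) (k : ℕ) : ham ξ k ∈ imW (stdLetter n m) k := by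
  refine Submodule.smul_mem _ _ ?_
  cases k with
  | zero => exact zero_mem _
  | succ k => exact FH_imW ξ k

lemma FH_eq_zero {p : ZMod 2} {ξ : VField (Std n m) p} {N : ℕ}
    (h : ∀ v, tc N (ξ.toFun (tι v)) = 0) : FH ξ N = 0 := by
  have h1 : ∀ v, vfC ξ N v = 0 := fun v => by rw [vfC_apply, h, map_zero]
  simp [FH, h1]

lemma ham_eq_zero {p : ZMod 2} {ξ : VField (Std n m) p}
    (h : ∀ v, ξ.toFun (tι v) ∈ ordSub (Std n m) 2) {k : ℕ} (hk : k < 3) : ham ξ k = 0 := by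
  have h1 : FF ξ k = 0 := by
    interval_cases k
    · rfl
    · exact FH_eq_zero fun v => mem_ordSub.1 (h v) 0 (by norm_num)
    · exact FH_eq_zero fun v => mem_ordSub.1 (h v) 1 (by norm_num)
  rw [ham, h1, smul_zero]

lemma br_sub_mem {x y x' y' : FA Letter} (hx : x - x' ∈ cyc) (hy : y - y' ∈ cyc) :
    br x y = br x' y' := by
  have h1 := br_cyc_left hx y
  have h2 := br_cyc_right x' hy
  rw [map_sub, LinearMap.sub_apply, sub_eq_zero] at h1
  rw [map_sub, sub_eq_zero] at h2
  rw [h1, h2]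

lemma IsHam.isMC {f : That (Std n m)} (h : IsHam μ f) (hsq : ∀ v, μ.toFun (μ.toFun (tι v)) = 0)
    (h0 : ∀ v, tc 0 (μ.toFun (tι v)) = 0) (hodd : hsgn f = sg 1 • f)
    (hord : f ∈ ordSub (Std n m) 3) : IsMC fun k => coordT n m (tc k f) where
  odd := coordT_tc_hom hodd
  ord k hk := by rw [mem_ordSub.1 hord k hk, map_zero]
  mc N := by
    have hm : ∀ k, coordT n m (tc k f) - ham μ k ∈ cyc := fun k => by
      rcases eq_or_ne k 0 with rfl | hk
      · rw [mem_ordSub.1 hord 0 (by norm_num), map_zero, ham]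
        simp [FF]
      · exact h.sub_ham_mem hk
    simp only [br_sub_mem (hm _) (hm _)]
    exact maurerCartan h.isSymp hsq h0 N

/-- An odd Hamiltonian without terms of order less than three. -/
lemma IsHam.exists_odd {f : That (Std n m)} (h : IsHam μ f)
    (hμ : ∀ v, μ.toFun (tι v) ∈ ordSub (Std n m) 2) :
    ∃ f', IsHam μ f' ∧ hsgn f' = sg 1 • f' ∧ f' ∈ ordSub (Std n m) 3 := by
  refine ⟨ofCoord (ham μ) (ham_imW μ), isHam_iff.2 fun N => ?_, That.ext_coord fun k => ?_,
    mem_ordSub.2 fun k hk => coordT_injective ?_⟩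
  · rw [coordT_ofCoord, h.isSymp.cycNL_ham]; rfl
  · rw [tc_hmap, coordT_tsgn, map_smul, map_smul, coordT_ofCoord, sgnW_of_hom (ham_hom μ k)]
  · rw [coordT_ofCoord, ham_eq_zero hμ hk, map_zero]

lemma expHam_congr {f f' : That (Std n m)}
    (h : ∀ k, 3 ≤ k → coordT n m (tc k f) - coordT n m (tc k f') ∈ cyc) : expHam f = expHam f' := by
  have e : ∀ H : ℕ → FA Letter, genSer H = genSer fun k => if 3 ≤ k then H k else 0 := fun H => by
    ext1 k
    simp only [genSer, PowerSeries.coeff_mk]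
    split_ifs <;> rfl
  refine Subtype.ext (funext fun i => funext fun j => ?_)
  change ceR.mkQ _ = ceR.mkQ _
  rw [Submodule.mkQ_apply, Submodule.mkQ_apply, Submodule.Quotient.eq, ← smul_sub]
  refine Submodule.smul_mem _ _ (Submodule.mem_sup_left ?_)
  rw [e fun k => coordT n m (tc k f), e fun k => coordT n m (tc k f')]
  refine genSer_pow_congr (fun k hk => if_neg (by omega)) (fun k hk => if_neg (by omega))
    (fun k => ?_) i _
  split_ifs with hk
  · exact h k hk
  · rw [sub_zero]; exact zero_mem _

lemma IsHam.expHam_eq {f f' : That (Std n m)} (h : IsHam μ f) (h' : IsHam μ f') :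
    expHam f = expHam f' :=
  expHam_congr fun k hk => by
    have := sub_mem (h.sub_ham_mem (k := k) (by omega)) (h'.sub_ham_mem (k := k) (by omega))
    rwa [sub_sub_sub_cancel_right] at this

/-- The exponential of the Hamiltonian is a cycle. -/
theorem IsHam.dHat_expHam {f : That (Std n m)} (h : IsHam μ f)
    (hsq : ∀ v, μ.toFun (μ.toFun (tι v)) = 0) (hμ : ∀ v, μ.toFun (tι v) ∈ ordSub (Std n m) 2) :
    dHat (expHam f) = 0 := by
  obtain ⟨f', h', hodd, hord⟩ := h.exists_odd hμ
  rw [h.expHam_eq h']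
  have hmc := h'.isMC hsq (fun v => mem_ordSub.1 (hμ v) 0 (by norm_num)) hodd hord
  refine Subtype.ext (funext fun i => funext fun j => ?_)
  change relD (ceR.mkQ _) = 0
  rw [map_smul, map_smul]
  refine smul_eq_zero_of_right _ ?_
  change ceR.mkQ (dCE _) = 0
  rw [Submodule.mkQ_apply, Submodule.Quotient.mk_eq_zero]
  exact Submodule.mem_sup_left (hmc.dCE_mem _ _)

end Hamiltonians

section Scaling

variable {V W : Type*} [AddCommGroup V] [Module ℂ V] [SuperSpace V]
  [AddCommGroup W] [Module ℂ W] [SuperSpace W]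

lemma tmap_smul_gr (c : ℂ) {k : ℕ} {x : TensorAlgebra ℂ V} (hx : x ∈ gr V k) :
    tmap (c • LinearMap.id : V →ₗ[ℂ] V) x = c ^ k • x := by
  refine gr_induct (P := fun k x => tmap (c • LinearMap.id : V →ₗ[ℂ] V) x = c ^ k • x) (fun r => ?_)
    (fun n x y hx hy => by simp only [map_add, hx, hy, smul_add]) (fun n v x hx ih => ?_) hx
  · rw [AlgHom.commutes, pow_zero, one_smul]
  · rw [map_mul, ih, pow_succ, mul_smul, mul_smul_comm]
    simp [tmap]

lemma tc_hmap_smul (c : ℂ) (k : ℕ) (f : That V) :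
    tc k (hmap (c • LinearMap.id : V →ₗ[ℂ] V) f) = c ^ k • tc k f := by
  rw [tc_hmap, tmap_smul_gr c (tc_mem k f)]

variable (V) in
/-- The dilation by a nonzero scalar. -/
def dilation (c : ℂ) (hc : c ≠ 0) : FIso V V :=
  FIso.ofLinear (LinearEquiv.smulOfNeZero ℂ V c hc) fun v => ((sinv : V →ₗ[ℂ] V).map_smul c v).symm

lemma tc_dilation_hom {c : ℂ} (hc : c ≠ 0) (k : ℕ) (f : That V) :
    tc k ((dilation V c hc).hom.toAlgHom f) = c ^ k • tc k f := tc_hmap_smul c k f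

lemma tc_dilation_inv {c : ℂ} (hc : c ≠ 0) (k : ℕ) (f : That V) :
    tc k ((dilation V c hc).inv.toAlgHom f) = (c ^ k)⁻¹ • tc k f := by
  have h := tc_dilation_hom hc k ((dilation V c hc).inv.toAlgHom f)
  rw [FIso.hom_inv] at h
  rw [h, smul_smul, inv_mul_cancel₀ (pow_ne_zero k hc), one_smul]

/-- The conjugate of an automorphism by a dilation. -/
def FIso.rescale (θ : FIso V V) (c : ℂ) (hc : c ≠ 0) : FIso V V :=
  ((dilation V c hc).symm.trans θ).trans (dilation V c hc)

lemma FIso.rescale_hom (θ : FIso V V) {c : ℂ} (hc : c ≠ 0) (f : That V) :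
    (θ.rescale c hc).hom.toAlgHom f = (dilation V c hc).hom.toAlgHom
      (θ.hom.toAlgHom ((dilation V c hc).inv.toAlgHom f)) := rfl

lemma FMorph.tc_eq_sum (φ : FMorph V W) (N : ℕ) (f : That V) :
    tc N (φ.toAlgHom f) = ∑ k ∈ Finset.range (N + 1), tc N (φ.toAlgHom (temb (tc k f))) := by
  have h := mem_ordSub.1 (φ.ord (sub_trunc_mem (N + 1) f)) N (Nat.lt_succ_self N)
  rw [map_sub, map_sub, sub_eq_zero] at h
  rw [h, trunc, map_sum, map_sum, map_sum]

lemma FIso.tc_rescale_hom (θ : FIso V V) {c : ℂ} (hc : c ≠ 0) (N : ℕ) (f : That V) :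
    tc N ((θ.rescale c hc).hom.toAlgHom f) =
      ∑ k ∈ Finset.range (N + 1), c ^ (N - k) • tc N (θ.hom.toAlgHom (temb (tc k f))) := by
  rw [θ.rescale_hom, tc_dilation_hom, FMorph.tc_eq_sum, Finset.smul_sum]
  refine Finset.sum_congr rfl fun k hk => ?_
  rw [tc_dilation_inv, map_smul, map_smul, map_smul, smul_smul]
  congr 1
  have hk : k ≤ N := by have := Finset.mem_range.1 hk; omega
  rw [← div_eq_mul_inv, div_eq_iff (pow_ne_zero _ hc), ← pow_add, Nat.sub_add_cancel hk]

lemma FIso.rescale_lin (θ : FIso V V) {c : ℂ} (hc : c ≠ 0) (h : θ.hom.lin = LinearMap.id) :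
    (θ.rescale c hc).hom.lin = LinearMap.id := by
  refine LinearMap.ext fun v => ι_inj ?_
  have h0 : tc 0 (tι v) = 0 := by rw [tc_tι, if_neg (by simp)]
  have h1 : tc 1 (tι v) = ι ℂ v := by rw [tc_tι, if_pos rfl]
  rw [FMorph.ι_lin, θ.tc_rescale_hom, Finset.sum_range_succ, Finset.sum_range_one, h0, h1, map_zero,
    map_zero, map_zero, smul_zero, zero_add, temb_ι, ← FMorph.ι_lin, h]
  simp

end Scaling

section Gauge

variable {n m n' m' : ℕ} {μ : VField (Std n m) 1}

lemma Mhat_homogeneous {k : ℕ} (hk : k ≠ 2) : tc k (Mhat n m) = 0 := by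
  rw [Mhat, map_sum]
  refine Finset.sum_eq_zero fun a _ => ?_
  rcases k with _ | k
  · exact tc_zero_tι_mul _ _
  · rw [tc_tι_mul, tc_tι, if_neg (by omega), mul_zero]

lemma eul_Mhat : eul (Mhat n m) = (2 : ℂ) • Mhat n m := by
  simp only [Mhat, map_sum, eul_mul, eul_tι, Finset.smul_sum, two_smul]

lemma rescale_Mhat (θ : FIso (Std n m) (Std n m)) (hθ : θ.hom.toAlgHom (Mhat n m) = Mhat n m) {c : ℂ}
    (hc : c ≠ 0) : (θ.rescale c hc).hom.toAlgHom (Mhat n m) = Mhat n m := by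
  have h1 : (dilation _ c hc).hom.toAlgHom (Mhat n m) = c ^ 2 • Mhat n m := That.ext' fun k => by
    rw [tc_dilation_hom, map_smul]
    rcases eq_or_ne k 2 with rfl | hk
    · rfl
    · rw [Mhat_homogeneous hk, smul_zero, smul_zero]
  have h2 : (dilation _ c hc).inv.toAlgHom (Mhat n m) = (c ^ 2)⁻¹ • Mhat n m := by
    rw [eq_inv_smul_iff₀ (pow_ne_zero 2 hc), ← map_smul, ← h1, FIso.inv_hom]
  rw [θ.rescale_hom, h2, map_smul, hθ, map_smul, h1, smul_smul, inv_mul_cancel₀ (pow_ne_zero 2 hc),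
    one_smul]

/-- The vector field generating the family of rescalings of an automorphism. -/
def gaugeField (θ : FIso (Std n m) (Std n m)) : VField (Std n m) 0 := eulV _ - (eulV _).conj θ

lemma gaugeField_apply (θ : FIso (Std n m) (Std n m)) (f : That (Std n m)) :
    (gaugeField θ).toFun (θ.hom.toAlgHom f) = eul (θ.hom.toAlgHom f) - θ.hom.toAlgHom (eul f) := by
  rw [gaugeField, VField.sub_apply, VField.conj_apply, θ.inv_hom]
  rfl

lemma isSymp_gaugeField (θ : FIso (Std n m) (Std n m)) (hθ : θ.hom.toAlgHom (Mhat n m) = Mhat n m) :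
    IsSymp (gaugeField θ) := by
  refine isSymp_of_Mhat ?_
  conv_lhs => rw [← hθ]
  rw [gaugeField_apply, eul_Mhat, map_smul, hθ, eul_Mhat, sub_self]

lemma eul_ord {V : Type*} [AddCommGroup V] [Module ℂ V] {k : ℕ} {f : That V} (hf : f ∈ ordSub V k) :
    eul f ∈ ordSub V k := mem_ordSub.2 fun i hi => by rw [tc_eul, mem_ordSub.1 hf i hi, smul_zero]

lemma gaugeField_ord (θ : FIso (Std n m) (Std n m)) (hl : θ.hom.lin = LinearMap.id) (v : Std n m) :
    (gaugeField θ).toFun (tι v) ∈ ordSub (Std n m) 2 := by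
  have h1 : θ.hom.toAlgHom (tι v) - tι v ∈ ordSub (Std n m) 2 := by
    simpa [hl] using θ.hom.tι_sub_lin v
  have h2 : (gaugeField θ).toFun (θ.hom.toAlgHom (tι v)) ∈ ordSub (Std n m) 2 := by
    rw [gaugeField_apply, eul_tι]
    have e : eul (θ.hom.toAlgHom (tι v)) - θ.hom.toAlgHom (tι v) =
        eul (θ.hom.toAlgHom (tι v) - tι v) - (θ.hom.toAlgHom (tι v) - tι v) := by
      rw [map_sub, eul_tι]; abel
    rw [e]
    exact sub_mem (eul_ord h1) h1
  have h3 : (gaugeField θ).toFun (θ.hom.toAlgHom (tι v) - tι v) ∈ ordSub (Std n m) 2 := by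
    obtain ⟨g, hg⟩ : ∃ g, θ.hom.toAlgHom g = θ.hom.toAlgHom (tι v) - tι v := ⟨_, θ.hom_inv _⟩
    rw [← hg, gaugeField_apply]
    have hg2 : g ∈ ordSub (Std n m) 2 := by
      rw [← θ.inv_hom g, hg]
      exact θ.inv.ord h1
    exact sub_mem (eul_ord (θ.hom.ord hg2)) (θ.hom.ord (eul_ord hg2))
  rw [map_sub] at h3
  have := sub_mem h2 h3
  rwa [sub_sub_cancel] at this

lemma exists_boundary {f f' : That (Std n m)} (h : ∀ i N,
    PowerSeries.coeff N (genSer (fun k => coordT n m (tc k f')) ^ i) -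
      PowerSeries.coeff N (genSer (fun k => coordT n m (tc k f)) ^ i) ∈
      ceI ⊔ (bigr (i + 1) (N + 2)).map dCE) : ∃ b : CHat, expHam f' - expHam f = dHat b := by
  have h2 : ∀ i N, ∃ y ∈ bigr (i + 1) (N + 2),
      PowerSeries.coeff N (genSer (fun k => coordT n m (tc k f')) ^ i) -
      PowerSeries.coeff N (genSer (fun k => coordT n m (tc k f)) ^ i) - dCE y ∈ ceI := fun i N => by
    obtain ⟨a, ha, _, ⟨y, hy, rfl⟩, e⟩ := Submodule.mem_sup.1 (h i N)
    exact ⟨y, hy, by rw [← e, add_sub_cancel_right]; exact ha⟩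
  choose y hy he using h2
  let b : ℕ → ℕ → RelCE
    | i + 1, j + 1 => ceR.mkQ ((i.factorial : ℂ)⁻¹ • y i (2 * j))
    | _, _ => 0
  have hb : ∀ i j, b i j ∈ relC i j := by
    rintro (_ | i) (_ | j)
    · exact zero_mem _
    · exact zero_mem _
    · exact zero_mem _
    · exact ⟨_, Submodule.smul_mem _ _ (hy i (2 * j)), rfl⟩
  refine ⟨⟨b, hb⟩, Subtype.ext (funext fun i => funext fun j => ?_)⟩
  change ceR.mkQ _ - ceR.mkQ _ = relD (ceR.mkQ ((i.factorial : ℂ)⁻¹ • y i (2 * j)))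
  rw [← map_sub, ← smul_sub, map_smul, map_smul, map_smul]
  congr 1
  change _ = ceR.mkQ (dCE _)
  rw [← sub_eq_zero, ← map_sub, Submodule.mkQ_apply, Submodule.Quotient.mk_eq_zero]
  exact Submodule.mem_sup_left (he i (2 * j))

/-- Isotopy invariance: an automorphism tangent to the identity changes the exponential of a Hamiltonian
by a boundary. -/
theorem IsHam.gauge {f : That (Std n m)} (h : IsHam μ f) (hsq : ∀ f, μ.toFun (μ.toFun f) = 0)
    (hμ : ∀ v, μ.toFun (tι v) ∈ ordSub (Std n m) 2) (hodd : hsgn f = sg 1 • f)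
    (hord : f ∈ ordSub (Std n m) 3) (θ : FIso (Std n m) (Std n m))
    (hθ : θ.hom.toAlgHom (Mhat n m) = Mhat n m) (hl : θ.hom.lin = LinearMap.id) :
    ∃ b : CHat, expHam (θ.hom.toAlgHom f) - expHam f = dHat b := by
  set A : ℕ → ℕ → FA Letter := fun N k => coordT n m (tc N (θ.hom.toAlgHom (temb (tc k f)))) with hA
  set H : ℝ → ℕ → FA Letter := fun t N => ∑ k ∈ Finset.range (N + 1), ((t : ℂ) ^ (N - k)) • A N k with hH
  set H' : ℝ → ℕ → FA Letter := fun t N => ∑ k ∈ Finset.range (N + 1),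
    (((N - k : ℕ) : ℂ) * (t : ℂ) ^ (N - k - 1)) • A N k with hH'
  have hpos : ∀ (t : ℝ) (ht : 0 < t), H t = fun N => coordT n m (tc N
      ((θ.rescale (t : ℂ) (by exact_mod_cast ht.ne')).hom.toAlgHom f)) := fun t ht => funext fun N => by
    rw [θ.tc_rescale_hom, map_sum]
    simp only [map_smul, hH, hA]
  have hA0 : ∀ N k, k < 3 → A N k = 0 := fun N k hk => by
    simp only [hA, mem_ordSub.1 hord k hk, map_zero]
  have h1 : H 1 = fun N => coordT n m (tc N (θ.hom.toAlgHom f)) := funext fun N => by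
    rw [FMorph.tc_eq_sum, map_sum]
    simp [hH, hA]
  have h0 : H 0 = fun N => coordT n m (tc N f) := funext fun N => by
    simp only [hH]
    rw [Finset.sum_range_succ, Finset.sum_eq_zero fun k hk => ?_, zero_add, Nat.sub_self, pow_zero,
      one_smul]
    · simp only [hA]
      rw [FMorph.tc_temb _ (tc_mem N f), hl]
      congr 1
      have : (tmap (LinearMap.id : Std n m →ₗ[ℂ] Std n m)) = AlgHom.id ℂ _ := by ext; simp [tmap]
      rw [this]; rfl
    · rw [Complex.ofReal_zero, zero_pow (by have := Finset.mem_range.1 hk; omega), zero_smul]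
  refine exists_boundary fun i N => ?_
  rw [← h1, ← h0]
  refine genSer_pow_sub_mem (H := H) (H' := H') (fun N => ?_) (fun t N hN => ?_) (fun t N => ?_)
    (fun t ht _ => ?_) (fun t ht _ => ?_) i N
  · refine IsDer.sum _ fun k _ => IsDer.smul_const (fun t => ?_) _
    exact (hasDerivAt_pow (N - k) (t : ℂ)).comp_ofReal
  · refine Finset.sum_eq_zero fun k hk => ?_
    rw [hA0 N k (by have := Finset.mem_range.1 hk; omega), smul_zero]
  · exact Submodule.sum_mem _ fun k _ => Submodule.smul_mem _ _ (coordT_len n m (tc_mem _ _))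
  · have hc : (t : ℂ) ≠ 0 := by exact_mod_cast ht.ne'
    rw [hpos t ht]
    set θt := θ.rescale (t : ℂ) hc with hθt
    have hm : θt.hom.toAlgHom (Mhat n m) = Mhat n m := rescale_Mhat θ hθ hc
    refine (h.map θt.hom hm (μ.conj_hom θt)).isMC (fun v => ?_) (fun v => ?_) ?_ (θt.hom.ord hord)
    · rw [VField.conj_apply, VField.conj_apply, θt.inv_hom, hsq, map_zero]
    · rw [VField.conj_apply]
      refine mem_ordSub.1 (θt.hom.ord (k := 1) ?_) 0 (by norm_num)
      have : ∀ g ∈ ordSub (Std n m) 1, μ.toFun g ∈ ordSub (Std n m) 1 := fun g hg => by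
        have e := μ.ord (sub_temb_mem hg)
        obtain ⟨w, hw⟩ := gr_one_eq (tc_mem 1 g)
        rw [hw, temb_ι, map_sub] at e
        have := add_mem e (ordSub_anti (by norm_num) (hμ w) : _ ∈ ordSub (Std n m) 1)
        rwa [sub_add_cancel] at this
      exact this _ (θt.inv.ord (tι_ord v))
    · rw [θt.hom.even, hodd, map_smul]
  · have hc : (t : ℂ) ≠ 0 := by exact_mod_cast ht.ne'
    set θt := θ.rescale (t : ℂ) hc with hθt
    have hm : θt.hom.toAlgHom (Mhat n m) = Mhat n m := rescale_Mhat θ hθ hc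
    have hlt : θt.hom.lin = LinearMap.id := θ.rescale_lin hc hl
    refine ⟨fun k => (t : ℂ)⁻¹ • ham (gaugeField θt) k, fun k => Submodule.smul_mem _ _ (ham_hom _ k),
      fun k => Submodule.smul_mem _ _ (ham_len _ k),
      fun k hk => by beta_reduce; rw [ham_eq_zero (gaugeField_ord θt hlt) hk, smul_zero], fun N => ?_⟩
    have e1 : H' t N = (t : ℂ)⁻¹ • coordT n m (tc N ((gaugeField θt).toFun (θt.hom.toAlgHom f))) := by
      rw [gaugeField_apply, map_sub, tc_eul, θ.tc_rescale_hom, θ.tc_rescale_hom, Finset.smul_sum,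
        ← Finset.sum_sub_distrib, map_sum, Finset.smul_sum]
      refine Finset.sum_congr rfl fun k hk => ?_
      have hk : k ≤ N := by have := Finset.mem_range.1 hk; omega
      rw [tc_eul, map_smul, map_smul, map_smul, smul_comm _ (k : ℂ), ← sub_smul, map_smul, map_smul,
        smul_smul, smul_smul]
      congr 1
      rcases eq_or_lt_of_le hk with rfl | hk
      · simp
      · obtain ⟨d, rfl⟩ : ∃ d, N = k + (d + 1) := ⟨N - k - 1, by omega⟩
        rw [show k + (d + 1) - k = d + 1 by omega, Nat.add_sub_cancel, pow_succ]
        push_cast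
        field_simp
        ring
    have e2 := (isSymp_gaugeField θt hm).coordT_sub_br_mem (θt.hom.toAlgHom f) N
    have e3 := Submodule.smul_mem _ (t : ℂ)⁻¹ e2
    rw [smul_sub, ← e1, Finset.smul_sum] at e3
    rw [hpos t ht]
    simpa only [map_smul, LinearMap.smul_apply] using e3

/-- Symplectic invariance of the exponential of a Hamiltonian, up to boundaries. -/
theorem IsHam.iso {f : That (Std n m)} (h : IsHam μ f) (hsq : ∀ f, μ.toFun (μ.toFun f) = 0)
    (hμ : ∀ v, μ.toFun (tι v) ∈ ordSub (Std n m) 2) (θ : FIso (Std n m) (Std n' m'))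
    (hθ : θ.hom.toAlgHom (Mhat n m) = Mhat n' m') {μ' : VField (Std n' m') 1} (hμ' : μ' = μ.conj θ)
    {f' : That (Std n' m')} (h' : IsHam μ' f') :
    ∃ b : CHat, expHam f - expHam f' = dHat b := by
  obtain ⟨f₀, h₀, hodd, hord⟩ := h.exists_odd hμ
  have hlin : hmap θ.hom.lin (Mhat n m) = Mhat n' m' := That.ext' fun k => by
    rcases eq_or_ne k 2 with rfl | hk
    · rw [tc_hmap, ← hθ, FMorph.tc_lowest]
      exact mem_ordSub.2 fun i hi => Mhat_homogeneous (by omega)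
    · rw [tc_hmap, Mhat_homogeneous hk, map_zero, Mhat_homogeneous hk]
  let G := FIso.ofLinear θ.linEquiv θ.hom.lin_sinv
  have hG : ∀ x, G.hom.toAlgHom x = hmap θ.hom.lin x := fun _ => rfl
  let θ₁ := θ.trans G.symm
  have e1 : ∀ x, θ.hom.toAlgHom x = hmap θ.hom.lin (θ₁.hom.toAlgHom x) := fun x => by
    rw [← hG]; exact (G.hom_inv _).symm
  have hm : θ₁.hom.toAlgHom (Mhat n m) = Mhat n m := by
    change G.inv.toAlgHom (θ.hom.toAlgHom _) = _
    rw [hθ, ← hlin, ← hG, G.inv_hom]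
  have hl : θ₁.hom.lin = LinearMap.id := by
    change (G.inv.comp θ.hom).lin = _
    have hGl : G.inv.lin = θ.linEquiv.symm.toLinearMap :=
      FMorph.lin_ofLinear θ.inv.lin θ.inv.lin_sinv
    rw [FMorph.lin_comp, hGl]
    exact LinearMap.ext θ.linEquiv.symm_apply_apply
  obtain ⟨b, hb⟩ := h₀.gauge hsq hμ hodd hord θ₁ hm hl
  refine ⟨-b, ?_⟩
  have h2 : IsHam μ' (θ.hom.toAlgHom f₀) := h₀.map θ.hom hθ (by rw [hμ']; exact μ.conj_hom θ)
  rw [h.expHam_eq h₀, h'.expHam_eq h2, e1, expHam_hmap θ.hom.lin_sinv θ.linEquiv.injective hlin, map_neg,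
    ← hb, neg_sub]

end Gauge

section Inverse

variable {V : Type*} [AddCommGroup V] [Module ℂ V] [SuperSpace V]

lemma FMorph.sub_mem_of_lin {θ : FMorph V V} (h : θ.lin = LinearMap.id) {k : ℕ} {f : That V}
    (hf : f ∈ ordSub V k) : f - θ.toAlgHom f ∈ ordSub V (k + 1) := mem_ordSub.2 fun i hi => by
  rcases Nat.lt_succ_iff_lt_or_eq.1 hi with hi | rfl
  · rw [map_sub, mem_ordSub.1 hf i hi, mem_ordSub.1 (θ.ord hf) i hi, sub_self]
  · have : (tmap (LinearMap.id : V →ₗ[ℂ] V)) = AlgHom.id ℂ _ := by ext; simp [tmap]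
    rw [map_sub, θ.tc_lowest hf, h, this, AlgHom.id_apply, sub_self]

/-- The difference between the identity and a formal morphism. -/
def FMorph.nil (θ : FMorph V V) : That V →ₗ[ℂ] That V := LinearMap.id - θ.toAlgHom.toLinearMap

lemma FMorph.nil_apply (θ : FMorph V V) (f : That V) : θ.nil f = f - θ.toAlgHom f := rfl

lemma FMorph.nil_pow_ord {θ : FMorph V V} (h : θ.lin = LinearMap.id) (j : ℕ) {k : ℕ} {f : That V}
    (hf : f ∈ ordSub V k) : (θ.nil ^ j) f ∈ ordSub V (k + j) := by
  induction j with
  | zero => exact hf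
  | succ j ih =>
    rw [pow_succ', Module.End.mul_apply, FMorph.nil_apply]
    exact FMorph.sub_mem_of_lin h ih

/-- The Neumann series `∑ (1 - θ)^j`. -/
def FMorph.neumann (θ : FMorph V V) : That V →ₗ[ℂ] That V :=
  tmk (fun N => ∑ j ∈ Finset.range (N + 1), tc N ∘ₗ (θ.nil ^ j)) fun N f => by
    rw [LinearMap.sum_apply]
    exact Submodule.sum_mem _ fun j _ => tc_mem N _

lemma FMorph.tc_neumann (θ : FMorph V V) (N : ℕ) (f : That V) :
    tc N (θ.neumann f) = ∑ j ∈ Finset.range (N + 1), tc N ((θ.nil ^ j) f) := by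
  rw [FMorph.neumann, tc_tmk, LinearMap.sum_apply]; rfl

lemma FMorph.nil_pow_sub (θ : FMorph V V) (j : ℕ) (f : That V) :
    θ.toAlgHom ((θ.nil ^ j) f) = (θ.nil ^ j) f - (θ.nil ^ (j + 1)) f := by
  rw [pow_succ', Module.End.mul_apply, FMorph.nil_apply]; abel

lemma FMorph.nil_pow_comm (θ : FMorph V V) (j : ℕ) (f : That V) :
    (θ.nil ^ j) (θ.toAlgHom f) = (θ.nil ^ j) f - (θ.nil ^ (j + 1)) f := by
  rw [pow_succ, Module.End.mul_apply, FMorph.nil_apply, map_sub]; abel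

lemma FMorph.neumann_left {θ : FMorph V V} (h : θ.lin = LinearMap.id) (f : That V) :
    θ.neumann (θ.toAlgHom f) = f := That.ext' fun N => by
  rw [θ.tc_neumann]
  simp only [θ.nil_pow_comm, map_sub]
  rw [Finset.sum_range_sub', pow_zero, Module.End.one_apply,
    mem_ordSub.1 (FMorph.nil_pow_ord h (N + 1) (mem_ordSub_zero f)) N (by omega), sub_zero]

lemma FMorph.neumann_sub_mem {θ : FMorph V V} (h : θ.lin = LinearMap.id) (N : ℕ) (f : That V) :
    θ.neumann f - ∑ j ∈ Finset.range (N + 1), (θ.nil ^ j) f ∈ ordSub V (N + 1) :=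
  mem_ordSub.2 fun i hi => by
    rw [map_sub, θ.tc_neumann, map_sum, sub_eq_zero]
    refine Finset.sum_subset (Finset.range_mono (by omega)) fun j _ hj => ?_
    have hj : i < j := by rw [Finset.mem_range] at hj; omega
    exact mem_ordSub.1 (FMorph.nil_pow_ord h j (mem_ordSub_zero f)) i (by omega)

lemma FMorph.neumann_right {θ : FMorph V V} (h : θ.lin = LinearMap.id) (f : That V) :
    θ.toAlgHom (θ.neumann f) = f := That.ext' fun N => by
  have h1 := mem_ordSub.1 (θ.ord (FMorph.neumann_sub_mem h N f)) N (Nat.lt_succ_self N)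
  rw [map_sub, map_sub, sub_eq_zero] at h1
  rw [h1, map_sum, map_sum]
  simp only [θ.nil_pow_sub, map_sub]
  rw [Finset.sum_range_sub', pow_zero, Module.End.one_apply,
    mem_ordSub.1 (FMorph.nil_pow_ord h (N + 1) (mem_ordSub_zero f)) N (by omega), sub_zero]

/-- A formal morphism tangent to the identity is invertible. -/
lemma FMorph.exists_iso {θ : FMorph V V} (h : θ.lin = LinearMap.id) : ∃ e : FIso V V, e.hom = θ := by
  have hb : Function.Bijective θ.toAlgHom :=
    ⟨Function.LeftInverse.injective (FMorph.neumann_left h),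
      Function.RightInverse.surjective (FMorph.neumann_right h)⟩
  have hi : ∀ f, (AlgEquiv.ofBijective θ.toAlgHom hb).symm f = θ.neumann f := fun f => by
    rw [AlgEquiv.symm_apply_eq]
    exact (FMorph.neumann_right h f).symm
  refine ⟨⟨θ, ⟨(AlgEquiv.ofBijective θ.toAlgHom hb).symm, fun f => ?_, ?_⟩, fun f => ?_, fun f => ?_⟩, rfl⟩
  · apply hb.1
    change θ.toAlgHom (hsgn ((AlgEquiv.ofBijective θ.toAlgHom hb).symm f)) =
      θ.toAlgHom ((AlgEquiv.ofBijective θ.toAlgHom hb).symm (hsgn f))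
    rw [← θ.even, hi, hi, FMorph.neumann_right h, FMorph.neumann_right h]
  · refine IAdicCont.iff.2 fun k => ⟨k, fun f hf => mem_ordSub.2 fun i hi' => ?_⟩
    change tc i ((AlgEquiv.ofBijective θ.toAlgHom hb).symm f) = 0
    rw [hi, θ.tc_neumann]
    exact Finset.sum_eq_zero fun j _ => mem_ordSub.1 (FMorph.nil_pow_ord h j hf) i (by omega)
  · exact (hi _).trans (FMorph.neumann_left h f)
  · change θ.toAlgHom ((AlgEquiv.ofBijective θ.toAlgHom hb).symm f) = f
    rw [hi, FMorph.neumann_right h]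

end Inverse

section Correction

variable {n m : ℕ}

lemma prV_shp_right (i a : SI n m) :
    prV (stdB i) (shp a) = if a = i then sg (spar i) else 0 := by
  rcases a with a | a | a <;> rcases i with i | i | i <;>
    simp only [shp, map_neg, prV_stdB, stdLetter, pr] <;>
    simp [Fin.val_inj, spar, par, stdLetter, sg_zero, sg_one, eq_comm]
  all_goals split_ifs <;> simp

lemma ctrL_word (i : SI n m) (l : Word) (v : Std n m) :
    ctrL (wd (stdLetter n m i :: l)) (coordT n m (ι ℂ v)) =
      (sg (spar i * lpar par l) * prV (stdB i) v) • wd l := by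
  conv_lhs => rw [std_sum v]
  conv_rhs => rw [std_sum v]
  simp only [map_sum, map_smul, Finset.mul_sum, Finset.sum_smul, coordT_stdB, smul_eq_mul, prV_stdB]
  refine Finset.sum_congr rfl fun j _ => ?_
  rw [wd_cons, ctrL_cons_single _ _ (wd_mem_hom par l), smul_smul]
  congr 1
  ring

lemma ctrL_imW {N : ℕ} {r : FA Letter} (hr : r ∈ imW (stdLetter n m) (N + 1)) (v : Std n m) :
    ctrL r (coordT n m (ι ℂ v)) ∈ imW (stdLetter n m) N := by
  refine imW_induction (P := fun r => ctrL r (coordT n m (ι ℂ v)) ∈ imW (stdLetter n m) N) hr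
    (by simp) (fun l hl => ?_) (fun x y hx hy => by rw [map_add]; exact add_mem hx hy)
    (fun c x hx => by rw [map_smul]; exact Submodule.smul_mem _ _ hx)
  cases l with
  | nil => simp at hl
  | cons i l =>
    rw [List.map_cons, ctrL_word]
    refine Submodule.smul_mem _ _ ?_
    obtain rfl : l.length = N := by simpa using hl
    exact wd_mem_imW _ l

lemma sum_ctrL_shp {N : ℕ} {r : FA Letter} (hr : r ∈ imW (stdLetter n m) (N + 1))
    (hr0 : r ∈ hom par 0) :
    ∑ a, wd [stdLetter n m a] * ctrL r (coordT n m (ι ℂ (shp a))) = r := by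
  have key : ∑ a, wd [stdLetter n m a] * ctrL (r + sgnW par r) (coordT n m (ι ℂ (shp a))) =
      r + sgnW par r := by
    clear hr0
    refine imW_induction (P := fun r => ∑ a, wd [stdLetter n m a] *
      ctrL (r + sgnW par r) (coordT n m (ι ℂ (shp a))) = r + sgnW par r) hr (by simp)
      (fun l hl => ?_) (fun x y hx hy => ?_) (fun c x hx => ?_)
    · cases l with
      | nil => simp at hl
      | cons i l =>
        rw [List.map_cons, sgnW_wd, lpar_cons]
        generalize hq : lpar par (l.map (stdLetter n m)) = q
        rcases eq_or_ne (spar i) q with h | h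
        · have e : par (stdLetter n m i) + q = 0 := by
            change spar i + q = 0
            rw [h, CharTwo.add_self_eq_zero]
          rw [e, sg_zero, one_smul, ← two_smul ℂ]
          simp only [map_smul, LinearMap.smul_apply, ctrL_word, prV_shp_right, mul_smul_comm]
          rw [Finset.sum_eq_single i]
          · rw [if_pos rfl, hq, ← h, ← sg_add, wd_mul, List.singleton_append]
            have : ∀ x : ZMod 2, x * x + x = 0 := by decide
            rw [this, sg_zero, one_smul]
          · intro a _ ha; rw [if_neg ha, mul_zero, zero_smul, smul_zero]
          · simp
        · have e : par (stdLetter n m i) + q = 1 := by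
            have : ∀ x y : ZMod 2, x ≠ y → x + y = 1 := by decide
            exact this _ _ h
          rw [e, sg_one, neg_smul, one_smul, add_neg_cancel]
          simp
    · have e : x + y + sgnW par (x + y) = (x + sgnW par x) + (y + sgnW par y) := by
        rw [map_add]; abel
      rw [e]
      generalize x + sgnW par x = X at hx ⊢
      generalize y + sgnW par y = Y at hy ⊢
      simp only [map_add, LinearMap.add_apply, mul_add, Finset.sum_add_distrib, hx, hy]
    · rw [map_smul, ← smul_add, map_smul]
      simp only [LinearMap.smul_apply, mul_smul_comm, ← Finset.smul_sum, hx]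
  rw [sgnW_of_hom hr0, sg_zero, one_smul, ← two_smul ℂ] at key
  simp only [map_smul, LinearMap.smul_apply, mul_smul_comm, ← Finset.smul_sum] at key
  exact smul_right_injective _ (two_ne_zero (α := ℂ)) key

/-- The values on generators of the vector field whose contraction with the symplectic form is `r`. -/
def corr (r : FA Letter) : Std n m →ₗ[ℂ] That (Std n m) :=
  temb.toLinearMap ∘ₗ (ev n m).toLinearMap ∘ₗ ctrL r ∘ₗ (coordT n m).toLinearMap ∘ₗ ι ℂ

lemma corr_gr {N : ℕ} {r : FA Letter} (hr : r ∈ imW (stdLetter n m) (N + 1)) (v : Std n m) :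
    ev n m (ctrL r (coordT n m (ι ℂ v))) ∈ gr (Std n m) N := ev_gr (ctrL_imW hr v)

lemma tc_corr {N : ℕ} {r : FA Letter} (hr : r ∈ imW (stdLetter n m) (N + 1)) (v : Std n m) (k : ℕ) :
    tc k (corr r v) = if k = N then ev n m (ctrL r (coordT n m (ι ℂ v))) else 0 :=
  tc_temb (corr_gr hr v) k

lemma corr_ord {N : ℕ} {r : FA Letter} (hr : r ∈ imW (stdLetter n m) (N + 1)) (v : Std n m) :
    corr r v ∈ ordSub (Std n m) N := temb_ord (corr_gr hr v)

lemma corr_par {N : ℕ} {r : FA Letter} (hr : r ∈ imW (stdLetter n m) (N + 1)) (hr0 : r ∈ hom par 0)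
    (v : Std n m) : hsgn (corr r v) = corr r (sinv v) := by
  have h : (hsgn : That (Std n m) →ₐ[ℂ] _).toLinearMap ∘ₗ corr r = corr r ∘ₗ sinv := by
    refine LinearMap.ext fun v => ?_
    rw [std_sum v, map_sum, map_sum]
    refine Finset.sum_congr rfl fun i _ => ?_
    rw [map_smul, map_smul]
    congr 1
    refine That.ext_coord fun k => ?_
    rw [LinearMap.comp_apply, LinearMap.comp_apply, AlgHom.toLinearMap_apply, tc_hmap, coordT_tsgn,
      sinv_stdB, map_smul, map_smul, map_smul, tc_corr hr]
    split_ifs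
    · have h1 : ctrL r (wd [stdLetter n m i]) ∈ hom par (spar i) := by
        have := ctrL_hom hr0 (wd_mem_hom par [stdLetter n m i])
        simpa using this
      rw [coordT_ev (ctrL_imW hr _), coordT_stdB, sgnW_of_hom h1]
    · simp
  exact LinearMap.congr_fun h v

lemma corr_Mhat {N : ℕ} {r : FA Letter} (hr : r ∈ imW (stdLetter n m) (N + 1)) (hr0 : r ∈ hom par 0) :
    coordT n m (tc (N + 1) (∑ a, (corr r (stdB a) * tι (shp a) + tι (stdB a) * corr r (shp a)))) =
      r - rotL par r := by
  let ξ : VField (Std n m) 0 := VField.mk' (corr r) fun v => by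
    rw [sg_zero, one_smul]; exact corr_par hr hr0 v
  have hξ : ∀ v, ξ.toFun (tι v) = corr r v := derHat_tι 0 (corr r)
  have h1 : FH ξ N = r := by
    rw [FH]
    conv_rhs => rw [← sum_ctrL_shp hr hr0]
    refine Finset.sum_congr rfl fun a _ => ?_
    rw [zero_mul, sg_zero, one_smul, vfC_apply, hξ, tc_corr hr, if_pos rfl, coordT_ev (ctrL_imW hr _)]
  have h2 := FH_sub_rotL ξ N
  rw [h1] at h2
  rw [h2]
  congr 2
  rw [Mhat, map_sum]
  refine Finset.sum_congr rfl fun a _ => ?_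
  rw [ξ.leibniz, hξ, hξ, hsgnPow_zero_apply]

/-- Cyclic sums vanish precisely on the image of `1 - rot`. -/
lemma exists_sub_rotL {N : ℕ} (hN : N ≠ 0) {R : FA Letter} (hR : R ∈ imW (stdLetter n m) N)
    (hR0 : R ∈ hom par 0) (h : cycNL par R = 0) :
    ∃ r ∈ imW (stdLetter n m) N, r ∈ hom par 0 ∧ r - rotL par r = R := by
  have hh : ∀ i, (rotL par ^ i) R ∈ hom par 0 := fun i => by
    induction i with
    | zero => exact hR0
    | succ i ih => rw [pow_succ', Module.End.mul_apply]; exact rotL_hom ih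
  refine ⟨-((N : ℂ)⁻¹ • ∑ i ∈ Finset.range N, (i : ℂ) • (rotL par ^ i) R),
    neg_mem (Submodule.smul_mem _ _ (Submodule.sum_mem _ fun i _ => Submodule.smul_mem _ _
      (rotL_pow_imW par i hR))),
    neg_mem (Submodule.smul_mem _ _ (Submodule.sum_mem _ fun i _ => Submodule.smul_mem _ _ (hh i))), ?_⟩
  have hlen := imW_le_lenSub (stdLetter n m) N hR
  have key : ∀ K : ℕ, ∑ i ∈ Finset.range K, (i : ℂ) • (rotL par ^ i) R -
      ∑ i ∈ Finset.range K, (i : ℂ) • (rotL par ^ (i + 1)) R =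
      ∑ i ∈ Finset.range K, (rotL par ^ i) R - (K : ℂ) • (rotL par ^ K) R +
        ((rotL par ^ K) R - R) := fun K => by
    induction K with
    | zero => simp
    | succ K ih =>
      rw [Finset.sum_range_succ, Finset.sum_range_succ, Finset.sum_range_succ, add_sub_add_comm, ih]
      push_cast
      module
  have h1 := key N
  rw [rotL_pow_len par hlen, sub_self, add_zero, ← cycNL_of_len par hlen, h, zero_sub] at h1
  have h2 : rotL par (∑ i ∈ Finset.range N, (i : ℂ) • (rotL par ^ i) R) =
      ∑ i ∈ Finset.range N, (i : ℂ) • (rotL par ^ (i + 1)) R := by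
    rw [map_sum]
    refine Finset.sum_congr rfl fun i _ => ?_
    rw [map_smul, pow_succ', Module.End.mul_apply]
  rw [map_neg, map_smul, h2, ← neg_sub', ← smul_sub, h1, smul_neg, neg_neg, smul_smul,
    inv_mul_cancel₀ (Nat.cast_ne_zero.2 hN), one_smul]

end Correction

section Darboux

variable {n m : ℕ}

lemma cycNL_pO_Mhat (θ : FMorph (Std n m) (Std n m)) (k : ℕ) :
    cycNL par (coordT n m (tc k (θ.toAlgHom (Mhat n m)))) = 0 := by
  have h := lam_pO_stdAlpha θ k
  rw [eq_neg_iff_add_eq_zero, add_eq_zero_iff_eq_neg'] at h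
  rw [h, lam_apply, neg_sub, map_sub, cycNL_rotL, sub_self]

lemma hsgn_Mhat : hsgn (Mhat n m) = Mhat n m := by
  rw [Mhat, map_sum]
  refine Finset.sum_congr rfl fun a _ => ?_
  have h : ∀ v : Std n m, hsgn (tι v) = tι (sinv v) := hmap_tι _
  rw [map_mul, h, h, sinv_stdB, sinv_shp, map_smul, map_smul, smul_mul_smul_comm, sg_sq, one_smul]

/-- One step of the recursive solution of `θ(∑ a a♯) = M`. -/
lemma darboux_step {M : That (Std n m)} (hM : hsgn M = M)
    (hc : ∀ k, cycNL par (coordT n m (tc k M)) = 0) {N : ℕ} (hN : 2 ≤ N)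
    (θ : FMorph (Std n m) (Std n m)) (hl : θ.lin = LinearMap.id)
    (hθ : M - θ.toAlgHom (Mhat n m) ∈ ordSub (Std n m) (N + 1)) :
    ∃ θ' : FMorph (Std n m) (Std n m), θ'.lin = LinearMap.id ∧
      M - θ'.toAlgHom (Mhat n m) ∈ ordSub (Std n m) (N + 2) ∧
      ∀ v, θ'.toAlgHom (tι v) - θ.toAlgHom (tι v) ∈ ordSub (Std n m) N := by
  set D := M - θ.toAlgHom (Mhat n m) with hD
  have hDpar : hsgn D = sg 0 • D := by
    rw [sg_zero, one_smul, hD, map_sub, hM, θ.even, hsgn_Mhat]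
  obtain ⟨r, hr, hr0, hrR⟩ := exists_sub_rotL (Nat.succ_ne_zero N) (coordT_imW (tc_mem (N + 1) D))
    (coordT_tc_hom hDpar (N + 1)) (by rw [hD, map_sub, map_sub, map_sub, hc, cycNL_pO_Mhat, sub_zero])
  let η : Std n m →ₗ[ℂ] That (Std n m) := θ.toAlgHom.toLinearMap ∘ₗ tι + corr r
  have hη : ∀ v, η v = θ.toAlgHom (tι v) + corr r v := fun v => rfl
  have h0 : ∀ v, tc 0 (η v) = 0 := fun v => by
    rw [hη, map_add, θ.tc_zero, mem_ordSub.1 (corr_ord hr v) 0 (by omega), add_zero]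
  have hp : ∀ v, hsgn (η v) = η (sinv v) := fun v => by
    rw [hη, hη, map_add, corr_par hr hr0, θ.even]
    congr 2
    exact hmap_tι _ _
  have hθ' : ∀ v, (FMorph.mk' η h0 hp).toAlgHom (tι v) = θ.toAlgHom (tι v) + corr r v :=
    FMorph.mk'_tι η h0 hp
  refine ⟨FMorph.mk' η h0 hp, ?_, ?_, fun v => ?_⟩
  · refine LinearMap.ext fun v => ι_inj ?_
    rw [FMorph.ι_lin, hθ', map_add, mem_ordSub.1 (corr_ord hr v) 1 (by omega), add_zero, ← θ.ι_lin, hl]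
  · set S := ∑ a, (corr r (stdB a) * tι (shp a) + tι (stdB a) * corr r (shp a)) with hS
    have e1 : (FMorph.mk' η h0 hp).toAlgHom (Mhat n m) - θ.toAlgHom (Mhat n m) - S ∈
        ordSub (Std n m) (N + 2) := by
      rw [Mhat, map_sum, map_sum, hS, ← Finset.sum_sub_distrib, ← Finset.sum_sub_distrib]
      refine Submodule.sum_mem _ fun a _ => ?_
      rw [map_mul, map_mul, hθ', hθ']
      have t : ∀ v, θ.toAlgHom (tι v) - tι v ∈ ordSub (Std n m) 2 := fun v => by
        simpa [hl] using θ.tι_sub_lin v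
      have a1 := mul_mem_ordSub (t (stdB a)) (corr_ord hr (shp a))
      have a2 := mul_mem_ordSub (corr_ord hr (stdB a)) (t (shp a))
      have a3 := ordSub_anti (show N + 2 ≤ N + N by omega)
        (mul_mem_ordSub (corr_ord hr (stdB a)) (corr_ord hr (shp a)))
      rw [add_comm 2 N] at a1
      convert add_mem (add_mem a1 a2) a3 using 1
      simp only [add_mul, mul_add, sub_mul, mul_sub]
      abel
    have e2 : D - S ∈ ordSub (Std n m) (N + 2) := mem_ordSub.2 fun i hi => by
      rcases Nat.lt_succ_iff_lt_or_eq.1 hi with hi | rfl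
      · have hSo : S ∈ ordSub (Std n m) (N + 1) := Submodule.sum_mem _ fun a _ => by
          refine add_mem (mul_mem_ordSub (corr_ord hr _) (tι_ord _)) ?_
          rw [add_comm]
          exact mul_mem_ordSub (tι_ord _) (corr_ord hr _)
        rw [map_sub, mem_ordSub.1 hθ i hi, mem_ordSub.1 hSo i hi, sub_self]
      · refine coordT_injective ?_
        rw [map_sub, map_sub, hS, corr_Mhat hr hr0, hrR, sub_self, map_zero]
    have := sub_mem e2 e1
    convert this using 1
    rw [hD]; abel
  · rw [hθ', add_sub_cancel_left]; exact corr_ord hr v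

/-- Every even cyclic-commutator-like element with the right leading term is the image of `∑ a a♯` under
a formal automorphism. -/
theorem exists_darboux {M : That (Std n m)} (hM : hsgn M = M)
    (hc : ∀ k, cycNL par (coordT n m (tc k M)) = 0) (h2 : M - Mhat n m ∈ ordSub (Std n m) 3) :
    ∃ e : FIso (Std n m) (Std n m), e.hom.toAlgHom (Mhat n m) = M := by
  let T (k : ℕ) : Type := {θ : FMorph (Std n m) (Std n m) // θ.lin = LinearMap.id ∧
    M - θ.toAlgHom (Mhat n m) ∈ ordSub (Std n m) (k + 3)}
  have step : ∀ k (θ : T k), ∃ θ' : T (k + 1),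
      ∀ v, θ'.1.toAlgHom (tι v) - θ.1.toAlgHom (tι v) ∈ ordSub (Std n m) (k + 2) := fun k θ => by
    obtain ⟨θ', h, h', h''⟩ := darboux_step hM hc (N := k + 2) (by omega) θ.1 θ.2.1 θ.2.2
    exact ⟨⟨θ', h, h'⟩, h''⟩
  choose nxt hnxt using step
  let s : (k : ℕ) → T k := fun k => Nat.rec ⟨FMorph.id _, FMorph.lin_id, h2⟩ nxt k
  have hs : ∀ k v, (s (k + 1)).1.toAlgHom (tι v) - (s k).1.toAlgHom (tι v) ∈
      ordSub (Std n m) (k + 2) := fun k => hnxt k (s k)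
  have hs2 : ∀ j k v, (s (k + j)).1.toAlgHom (tι v) - (s k).1.toAlgHom (tι v) ∈
      ordSub (Std n m) (k + 2) := fun j k v => by
    induction j with
    | zero => rw [add_zero, sub_self]; exact zero_mem _
    | succ j ih =>
      have := add_mem (ordSub_anti (by omega) (hs (k + j) v)) ih
      rwa [sub_add_sub_cancel] at this
  let η : Std n m →ₗ[ℂ] That (Std n m) :=
    tmk (fun N => tc N ∘ₗ (s N).1.toAlgHom.toLinearMap ∘ₗ tι) fun N v => tc_mem N _
  have hη : ∀ N v, tc N (η v) = tc N ((s N).1.toAlgHom (tι v)) := fun N v => tc_tmk _ _ _ _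
  have h0 : ∀ v, tc 0 (η v) = 0 := fun v => by rw [hη, FMorph.tc_zero]
  have hp : ∀ v, hsgn (η v) = η (sinv v) := fun v => That.ext' fun N => by
    rw [tc_hmap, hη, hη, ← tc_hmap, FMorph.even]
    congr 2
    exact hmap_tι _ _
  set θ := FMorph.mk' η h0 hp with hθ
  have hθη : ∀ v, θ.toAlgHom (tι v) = η v := FMorph.mk'_tι η h0 hp
  have hd : ∀ N v, θ.toAlgHom (tι v) - (s N).1.toAlgHom (tι v) ∈ ordSub (Std n m) (N + 1) :=
    fun N v => mem_ordSub.2 fun i hi => by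
      have := mem_ordSub.1 (hs2 (N - i) i v) i (by omega)
      rw [show i + (N - i) = N by omega, map_sub, sub_eq_zero] at this
      rw [map_sub, hθη, hη, this, sub_self]
  have hlin : θ.lin = LinearMap.id := by
    refine LinearMap.ext fun v => ι_inj ?_
    rw [θ.ι_lin, hθη, hη, ← FMorph.ι_lin, (s 1).2.1]
  obtain ⟨e, he⟩ := FMorph.exists_iso hlin
  refine ⟨e, ?_⟩
  rw [he]
  refine eq_of_sub_mem_ordSub fun N => ?_
  have h1 : θ.toAlgHom (Mhat n m) - (s N).1.toAlgHom (Mhat n m) ∈ ordSub (Std n m) N := by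
    have key : ∀ φ : FMorph (Std n m) (Std n m), φ.toAlgHom (Mhat n m) =
        ∑ a, φ.toAlgHom (tι (stdB a)) * φ.toAlgHom (tι (shp a)) := fun φ => by
      rw [Mhat, map_sum]
      simp only [map_mul]
    rw [key, key, ← Finset.sum_sub_distrib]
    refine Submodule.sum_mem _ fun a _ => ?_
    have a1 := mul_mem_ordSub (hd N (stdB a)) (mem_ordSub_zero (θ.toAlgHom (tι (shp a))))
    have a2 := mul_mem_ordSub (mem_ordSub_zero ((s N).1.toAlgHom (tι (stdB a)))) (hd N (shp a))
    rw [zero_add] at a2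
    have := ordSub_anti (Nat.le_succ N) (add_mem a1 a2)
    convert this using 1
    simp only [sub_mul, mul_sub]
    abel
  have := sub_mem h1 (ordSub_anti (show N ≤ N + 3 by omega) (s N).2.2)
  convert this using 1
  abel

end Darboux

section SuperBilinear

variable {E : Type*} [AddCommGroup E] [Module ℂ E] {n m : ℕ}

instance : FiniteDimensional ℂ (Std n m) := inferInstanceAs (FiniteDimensional ℂ (SI n m → ℂ))

lemma finrank_Std : Module.finrank ℂ (Std n m) = n + (n + m) := by
  have : Module.finrank ℂ (SI n m → ℂ) = n + (n + m) := by simp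
  exact this

/-- The linear map from `ℂ^{2n|m}` with given values on the basis. -/
def comb (F : SI n m → E) : Std n m →ₗ[ℂ] E where
  toFun v := ∑ i, v i • F i
  map_add' v w := by simp only [std_add_apply, add_smul, Finset.sum_add_distrib]
  map_smul' c v := by simp only [std_smul_apply, mul_smul, Finset.smul_sum, RingHom.id_apply]

lemma comb_apply (F : SI n m → E) (v : Std n m) : comb F v = ∑ i, v i • F i := rfl

/-- Families of homogeneous vectors whose pairings are those of the canonical basis. -/
structure IsFrame (s : E →ₗ[ℂ] E) (b : E →ₗ[ℂ] E →ₗ[ℂ] ℂ) (F : SI n m → E) : Prop where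
  par : ∀ i, s (F i) = sg (spar i) • F i
  pair : ∀ i j, b (F i) (F j) = pr (stdLetter n m i) (stdLetter n m j)

variable {s : E →ₗ[ℂ] E} {b : E →ₗ[ℂ] E →ₗ[ℂ] ℂ}

lemma IsFrame.pair_comb {F : SI n m → E} (h : IsFrame s b F) (i : SI n m) (v : Std n m) :
    b (F i) (comb F v) = prV (stdB i) v := by
  conv_rhs => rw [std_sum v]
  simp only [comb_apply, map_sum, map_smul, h.pair, prV_stdB]

lemma IsFrame.injective {F : SI n m → E} (h : IsFrame s b F) : Function.Injective (comb F) := by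
  rw [← LinearMap.ker_eq_bot, LinearMap.ker_eq_bot']
  intro v hv
  rw [← shp_dual' v]
  refine Finset.sum_eq_zero fun a _ => ?_
  rw [← h.pair_comb, hv, map_zero, mul_zero, zero_smul]

lemma IsFrame.exists_residual {F : SI n m → E} (h : IsFrame s b F) (y : E) :
    ∃ v, ∀ i, b (F i) (y - comb F v) = 0 := by
  refine ⟨∑ a, (sg (spar a) * b (F a) y) • shp a, fun i => ?_⟩
  rw [map_sub, h.pair_comb, map_sum, Finset.sum_eq_single i]
  · rw [map_smul, prV_shp_right, if_pos rfl, smul_eq_mul, mul_right_comm, sg_sq, one_mul, sub_self]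
  · intro a _ ha; rw [map_smul, prV_shp_right, if_neg ha, smul_zero]
  · simp

/-- Even bilinear forms that are antisymmetric on the even part and symmetric on the odd part, and
nondegenerate. -/
structure IsSuperSymp (s : E →ₗ[ℂ] E) (b : E →ₗ[ℂ] E →ₗ[ℂ] ℂ) : Prop where
  inv : ∀ x, s (s x) = x
  even : ∀ x y, b (s x) (s y) = b x y
  symm : ∀ x y, b y x = -b x (s y)
  nondeg : ∀ y, (∀ x, b x y = 0) → y = 0

lemma IsSuperSymp.orth_symm (hb : IsSuperSymp s b) {F : SI n m → E} (h : IsFrame s b F) {y : E}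
    (hy : ∀ i, b (F i) y = 0) (i : SI n m) : b y (F i) = 0 := by
  rw [hb.symm (F i) y, ← hb.even, hb.inv, h.par, map_smul, LinearMap.smul_apply, hy, smul_zero, neg_zero]

lemma IsSuperSymp.extend_even (hb : IsSuperSymp s b) {F : SI n m → E} (h : IsFrame s b F) {p q : E}
    (hp : s p = p) (hq : s q = q) (hFp : ∀ i, b (F i) p = 0) (hFq : ∀ i, b (F i) q = 0)
    (hpq : b p q = 1) : ∃ F' : SI (n + 1) m → E, IsFrame s b F' := by
  have hqp : b q p = -1 := by rw [hb.symm p q, hq, hpq]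
  have hself : ∀ x, s x = x → b x x = 0 := fun x hx => by
    have := hb.symm x x
    rw [hx] at this
    exact self_eq_neg.1 this
  have e1 := hself p hp
  have e2 := hself q hq
  have hpF := hb.orth_symm h hFp
  have hqF := hb.orth_symm h hFq
  have hF := h.pair
  refine ⟨Sum.elim (Fin.cons p fun i => F (.inl i))
    (Sum.elim (Fin.cons q fun i => F (.inr (.inl i))) fun i => F (.inr (.inr i))), ⟨?_, ?_⟩⟩
  · rintro (i | i | i)
    · refine Fin.cases ?_ (fun i => ?_) i
      · simpa [spar, stdLetter, Letter.par, sg_zero] using hp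
      · exact h.par (.inl i)
    · refine Fin.cases ?_ (fun i => ?_) i
      · simpa [spar, stdLetter, Letter.par, sg_zero] using hq
      · exact h.par (.inr (.inl i))
    · exact h.par (.inr (.inr i))
  · rintro (i | i | i) (j | j | j)
    · refine Fin.cases ?_ (fun i => ?_) i <;> refine Fin.cases ?_ (fun j => ?_) j <;>
        simp [hpF, hFp, hF, e1, stdLetter, pr]
    · refine Fin.cases ?_ (fun i => ?_) i <;> refine Fin.cases ?_ (fun j => ?_) j <;>
        simp [hpF, hFq, hF, hpq, stdLetter, pr]
    · refine Fin.cases ?_ (fun i => ?_) i <;> simp [hpF, hF, stdLetter, pr]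
    · refine Fin.cases ?_ (fun i => ?_) i <;> refine Fin.cases ?_ (fun j => ?_) j <;>
        simp [hFp, hqF, hF, hqp, stdLetter, pr]
    · refine Fin.cases ?_ (fun i => ?_) i <;> refine Fin.cases ?_ (fun j => ?_) j <;>
        simp [hqF, hFq, hF, e2, stdLetter, pr]
    · refine Fin.cases ?_ (fun i => ?_) i <;> simp [hqF, hF, stdLetter, pr]
    · refine Fin.cases ?_ (fun j => ?_) j <;> simp [hFp, hF, stdLetter, pr]
    · refine Fin.cases ?_ (fun j => ?_) j <;> simp [hFq, hF, stdLetter, pr]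
    · simp [hF, stdLetter, pr]

lemma IsSuperSymp.extend_odd (hb : IsSuperSymp s b) {F : SI n m → E} (h : IsFrame s b F) {x : E}
    (hx : s x = -x) (hFx : ∀ i, b (F i) x = 0) (hxx : b x x = 1) :
    ∃ F' : SI n (m + 1) → E, IsFrame s b F' := by
  have hxF := hb.orth_symm h hFx
  have hF := h.pair
  refine ⟨Sum.elim (fun i => F (.inl i))
    (Sum.elim (fun i => F (.inr (.inl i))) (Fin.cons x fun i => F (.inr (.inr i)))), ⟨?_, ?_⟩⟩
  · rintro (i | i | i)
    · exact h.par (.inl i)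
    · exact h.par (.inr (.inl i))
    · refine Fin.cases ?_ (fun i => ?_) i
      · simpa [spar, stdLetter, Letter.par, sg_one] using hx
      · exact h.par (.inr (.inr i))
  · rintro (i | i | i) (j | j | j)
    · simp [hF, stdLetter, pr]
    · simp [hF, stdLetter, pr]
    · refine Fin.cases ?_ (fun j => ?_) j <;> simp [hFx, hF, stdLetter, pr]
    · simp [hF, stdLetter, pr]
    · simp [hF, stdLetter, pr]
    · refine Fin.cases ?_ (fun j => ?_) j <;> simp [hFx, hF, stdLetter, pr]
    · refine Fin.cases ?_ (fun i => ?_) i <;> simp [hxF, hF, stdLetter, pr]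
    · refine Fin.cases ?_ (fun i => ?_) i <;> simp [hxF, hF, stdLetter, pr]
    · refine Fin.cases ?_ (fun i => ?_) i <;> refine Fin.cases ?_ (fun j => ?_) j <;>
        simp [hxF, hFx, hF, hxx, stdLetter, pr]

lemma IsSuperSymp.exists_larger (hb : IsSuperSymp s b) {F : SI n m → E} (h : IsFrame s b F) {r : E}
    (hr : ∀ i, b (F i) r = 0) (hr0 : r ≠ 0) :
    ∃ (n' m' : ℕ) (F' : SI n' m' → E), IsFrame s b F' ∧ n' + m' = n + m + 1 := by
  have hs : ∀ y, (∀ i, b (F i) y = 0) → ∀ i, b (F i) (s y) = 0 := fun y hy i => by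
    rw [← hb.even, hb.inv, h.par, map_smul, LinearMap.smul_apply, hy, smul_zero]
  -- a homogeneous nonzero vector in the orthogonal complement
  obtain ⟨ε, hε, r, hrs, hr, hr0⟩ : ∃ ε : ℂ, (ε = 1 ∨ ε = -1) ∧ ∃ r, s r = ε • r ∧
      (∀ i, b (F i) r = 0) ∧ r ≠ 0 := by
    by_cases h1 : r + s r = 0
    · exact ⟨-1, Or.inr rfl, r, by rw [neg_smul, one_smul]; exact (neg_eq_of_add_eq_zero_right h1).symm,
        hr, hr0⟩
    · exact ⟨1, Or.inl rfl, r + s r, by rw [map_add, hb.inv, one_smul, add_comm],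
        fun i => by rw [map_add, hr, hs r hr, add_zero], h1⟩
  have hεε : ε * ε = 1 := by rcases hε with rfl | rfl <;> norm_num
  obtain ⟨x, hx⟩ : ∃ x, b x r ≠ 0 := by
    by_contra hc
    push Not at hc
    exact hr0 (hb.nondeg r hc)
  obtain ⟨v, hv⟩ := h.exists_residual x
  have hrF := hb.orth_symm h hr
  have hrv : ∀ v, b (comb F v) r = 0 := fun v => by
    simp only [comb_apply, map_sum, map_smul, LinearMap.sum_apply, LinearMap.smul_apply, hr, smul_zero,
      Finset.sum_const_zero]
  set y := x - comb F v with hy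
  have hyr : b y r ≠ 0 := by rwa [hy, map_sub, LinearMap.sub_apply, hrv, sub_zero]
  -- a homogeneous vector in the orthogonal complement pairing to one
  obtain ⟨w, hws, hw, hwr⟩ : ∃ w, s w = ε • w ∧ (∀ i, b (F i) w = 0) ∧ b w r = 1 := by
    refine ⟨(2 * b y r)⁻¹ • (y + ε • s y), ?_, fun i => ?_, ?_⟩
    · rw [map_smul, map_add, map_smul, hb.inv, smul_comm ε, smul_add, smul_add, smul_add, smul_smul ε ε, hεε,
        one_smul, add_comm]
    · rw [map_smul, map_add, map_smul, hv, hs y hv, smul_zero, add_zero, smul_zero]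
    · have e : b (s y) r = ε * b y r := by
        rw [← hb.even, hb.inv, hrs, map_smul, smul_eq_mul]
      rw [map_smul, map_add, map_smul, LinearMap.smul_apply, LinearMap.add_apply, LinearMap.smul_apply, e,
        smul_eq_mul, smul_eq_mul, ← mul_assoc ε, hεε, one_mul, ← two_mul]
      exact inv_mul_cancel₀ (mul_ne_zero two_ne_zero hyr)
  rcases hε with rfl | rfl
  · rw [one_smul] at hrs hws
    obtain ⟨F', hF'⟩ := hb.extend_even h hws hrs hw hr hwr
    exact ⟨n + 1, m, F', hF', by omega⟩
  · rw [neg_smul, one_smul] at hrs hws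
    have hrw : b r w = 1 := by rw [hb.symm w r, hrs, map_neg, neg_neg, hwr]
    obtain ⟨u, hus, hu, huu⟩ : ∃ u, s u = -u ∧ (∀ i, b (F i) u = 0) ∧ b u u ≠ 0 := by
      by_cases h1 : b r r = 0
      · by_cases h2 : b w w = 0
        · refine ⟨r + w, by rw [map_add, hrs, hws, neg_add], fun i => by rw [map_add, hr, hw, add_zero], ?_⟩
          simp only [map_add, LinearMap.add_apply, h1, h2, hrw, hwr]
          norm_num
        · exact ⟨w, hws, hw, h2⟩
      · exact ⟨r, hrs, hr, h1⟩
    obtain ⟨c, hc⟩ := IsAlgClosed.exists_pow_nat_eq (b u u)⁻¹ (n := 2) (by norm_num)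
    obtain ⟨F', hF'⟩ := hb.extend_odd h (x := c • u) (by rw [map_smul, hus, smul_neg])
      (fun i => by rw [map_smul, hu, smul_zero]) (by
        rw [map_smul, map_smul, LinearMap.smul_apply, smul_eq_mul, smul_eq_mul, ← mul_assoc, ← sq, hc,
          inv_mul_cancel₀ huu])
    exact ⟨n, m + 1, F', hF', by omega⟩

/-- Existence of canonical bases. -/
theorem IsSuperSymp.exists_frame [FiniteDimensional ℂ E] (hb : IsSuperSymp s b) :
    ∃ (n m : ℕ) (F : SI n m → E), IsFrame s b F ∧ Function.Bijective (comb F) := by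
  by_contra hc
  have hP : ∀ k : ℕ, ∃ (n m : ℕ) (F : SI n m → E), IsFrame s b F ∧ n + m = k := fun k => by
    induction k with
    | zero =>
      refine ⟨0, 0, fun i => 0, ⟨fun i => ?_, fun i => ?_⟩, rfl⟩ <;>
        rcases i with i | i | i <;> exact i.elim0
    | succ k ih =>
      obtain ⟨n, m, F, hF, rfl⟩ := ih
      have hsurj : ¬ Function.Surjective (comb F) := fun hs => hc ⟨n, m, F, hF, hF.injective, hs⟩
      obtain ⟨y, hy⟩ := not_forall.1 hsurj
      obtain ⟨v, hv⟩ := hF.exists_residual y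
      exact hb.exists_larger hF hv (sub_ne_zero.2 fun e => hy ⟨v, e.symm⟩)
  obtain ⟨n, m, F, hF, hk⟩ := hP (Module.finrank ℂ E + 1)
  have := LinearMap.finrank_le_finrank_of_injective hF.injective
  rw [finrank_Std] at this
  omega

end SuperBilinear

section TwoForms

variable {V W : Type*} [AddCommGroup V] [Module ℂ V] [SuperSpace V]
  [AddCommGroup W] [Module ℂ W] [SuperSpace W]

lemma ι_mem_sComm {u : V} (h : ι ℂ u ∈ sComm V) : u = 0 := by
  refine (Module.forall_dual_apply_eq_zero_iff ℂ u).1 fun f => ?_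
  let D : TensorAlgebra ℂ V →ₐ[ℂ] TrivSqZeroExt ℂ ℂ := lift ℂ (TrivSqZeroExt.inrHom ℂ ℂ ∘ₗ f)
  have hD : ∀ v, D (ι ℂ v) = TrivSqZeroExt.inr (f v) := fun v => lift_ι_apply _ _
  have hodd : ∀ x, tsgn x = sg 1 • x → (D x).fst = 0 := fun x hx => by
    have e : ((TrivSqZeroExt.fstHom ℂ ℂ ℂ).comp D).comp tsgn = (TrivSqZeroExt.fstHom ℂ ℂ ℂ).comp D := by
      ext v
      simp [tmap, hD]
    have e1 := DFunLike.congr_fun e x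
    simp only [AlgHom.comp_apply] at e1
    rw [hx, sg_one, neg_smul, one_smul, map_neg, map_neg] at e1
    exact self_eq_neg.1 e1.symm
  have key : ∀ z ∈ sComm V, D z = 0 := fun z hz => by
    induction hz using Submodule.span_induction with
    | mem z hz =>
      obtain ⟨p, q, x, y, hx, hy, rfl⟩ := hz
      rw [map_sub, map_smul, map_mul, map_mul, mul_comm (D y)]
      by_cases hpq : p * q = 0
      · rw [hpq, sg_zero, one_smul, sub_self]
      · have h1 : ∀ p q : ZMod 2, p * q ≠ 0 → p = 1 ∧ q = 1 := by decide
        obtain ⟨rfl, rfl⟩ := h1 p q hpq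
        have e : D x * D y = 0 := by
          ext
          · rw [TrivSqZeroExt.fst_mul, hodd x hx, zero_mul]; rfl
          · rw [TrivSqZeroExt.snd_mul, hodd x hx, hodd y hy]; simp
        rw [e, smul_zero, sub_zero]
    | zero => exact map_zero _
    | add x y _ _ hx hy => rw [map_add, hx, hy, add_zero]
    | smul c x _ hx => rw [map_smul, hx, smul_zero]
  have := key _ h
  rw [hD] at this
  exact TrivSqZeroExt.inr_injective (this.trans (TrivSqZeroExt.inr_zero ℂ).symm)

/-- The form `dv dw` as a function of `v ⊗ w`. -/
def nu : V ⊗[ℂ] V →ₗ[ℂ] TensorAlgebra ℂ (FormGen V) :=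
  LinearMap.mul' ℂ _ ∘ₗ TensorProduct.map (ι ℂ ∘ₗ dgen) (ι ℂ ∘ₗ dgen)

lemma nu_tmul (a c : V) : nu (a ⊗ₜ[ℂ] c) = ι ℂ (dgen a) * ι ℂ (dgen c) := by
  simp [nu]

lemma nu_gr (t : V ⊗[ℂ] V) : nu t ∈ gr (FormGen V) 2 := by
  induction t with
  | zero => rw [map_zero]; exact zero_mem _
  | tmul a c => rw [nu_tmul]; exact gr_mul (ι_mem_gr _) (ι_mem_gr _)
  | add x y hx hy => rw [map_add]; exact add_mem hx hy

lemma exists_nu {z : TensorAlgebra ℂ (FormGen V)} (hz : z ∈ gr (FormGen V) 2) (h : z ∈ tForm V 2) :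
    ∃ t, nu t = z := by
  have key : ∃ t, tmap (dilL V) (tmap (dilL V) z) - (3 : ℂ) • tmap (dilL V) z + (2 : ℂ) • z =
      (6 : ℂ) • nu t := by
    clear h
    rw [gr, pow_two] at hz
    induction hz using Submodule.mul_induction_on' with
    | mem_mul_mem a ha c hc =>
      obtain ⟨a, rfl⟩ := ha
      obtain ⟨c, rfl⟩ := hc
      refine ⟨sndL a ⊗ₜ sndL c, ?_⟩
      have e : ∀ x : FormGen V, tmap (dilL V) (ι ℂ x) =
          ι ℂ (gen (fstL x)) + (2 : ℂ) • ι ℂ (dgen (sndL x)) := fun x => by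
        simp [tmap, dilL_apply]
      have e1 : ∀ v : V, tmap (dilL V) (ι ℂ (gen v)) = ι ℂ (gen v) := fun v => by
        rw [e]
        change ι ℂ (gen v) + (2 : ℂ) • ι ℂ (dgen (0 : V)) = _
        simp
      have e2 : ∀ v : V, tmap (dilL V) (ι ℂ (dgen v)) = (2 : ℂ) • ι ℂ (dgen v) := fun v => by
        rw [e]
        change ι ℂ (gen (0 : V)) + (2 : ℂ) • ι ℂ (dgen v) = _
        simp
      have e3 : ∀ x : FormGen V, ι ℂ x = ι ℂ (gen (fstL x)) + ι ℂ (dgen (sndL x)) := fun x => by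
        conv_lhs => rw [formGen_eq x, map_add]
      rw [nu_tmul, map_mul, map_mul, e, e, map_add, map_add, map_smul, map_smul, e1, e1, e2, e2, e3 a, e3 c]
      simp only [add_mul, mul_add, smul_add, smul_mul_assoc, mul_smul_comm]
      module
    | add a ha c hc iha ihc =>
      obtain ⟨t, ht⟩ := iha
      obtain ⟨t', ht'⟩ := ihc
      refine ⟨t + t', ?_⟩
      rw [map_add nu, smul_add (6 : ℂ), ← ht, ← ht']
      simp only [map_add, smul_add]
      abel
  obtain ⟨t, ht⟩ := key
  refine ⟨t, ?_⟩
  rw [mem_tForm_iff.1 h, map_smul, mem_tForm_iff.1 h] at ht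
  refine smul_right_injective _ (show (6 : ℂ) ≠ 0 by norm_num) ?_
  dsimp only
  rw [← ht]
  module

lemma tsgn_nu (t : V ⊗[ℂ] V) : tsgn (nu t) = nu (TensorProduct.map sinv sinv t) := by
  induction t with
  | zero => simp
  | tmul a c =>
    have e : ∀ v : V, tsgn (ι ℂ (dgen v)) = -ι ℂ (dgen (sinv v)) := fun v => by
      rw [← map_neg, ← sinv_dgen]; simp [tmap]
    rw [TensorProduct.map_tmul, nu_tmul, nu_tmul, map_mul, e, e, neg_mul_neg]
  | add x y hx hy => simp only [map_add, hx, hy]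

lemma exists_nu_even {z : TensorAlgebra ℂ (FormGen V)} (hz : z ∈ gr (FormGen V) 2) (h : z ∈ tForm V 2)
    (he : tsgn z = z) : ∃ t, nu t = z ∧ TensorProduct.map sinv sinv t = t := by
  obtain ⟨t, ht⟩ := exists_nu hz h
  refine ⟨(1 / 2 : ℂ) • (t + TensorProduct.map sinv sinv t), ?_, ?_⟩
  · rw [map_smul, map_add, ← tsgn_nu, ht, he]
    module
  · have e : TensorProduct.map sinv sinv (TensorProduct.map sinv sinv t) = t := by
      rw [← LinearMap.comp_apply, ← TensorProduct.map_comp]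
      have : (sinv : V →ₗ[ℂ] V) ∘ₗ sinv = LinearMap.id := LinearMap.ext SuperSpace.inv_inv
      rw [this, TensorProduct.map_id, LinearMap.id_apply]
    rw [map_smul, map_add, e, add_comm]

/-- Even representatives of even forms. -/
lemma exists_rep {r : ℕ} {ω : DR V} (hf : ω ∈ drForm V r) (he : ω ∈ drPar V 0) :
    ∃ w ∈ omForm V r, hsgn w = w ∧ (hComm (FormGen V)).mkQ w = ω := by
  obtain ⟨w, hw, rfl⟩ := hf
  obtain ⟨w', hw', h⟩ := mem_drPar.1 he
  have h1 : w' - w ∈ hComm (FormGen V) := (Submodule.Quotient.eq _).1 h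
  have h2 := hsgn_mem_hComm h1
  rw [map_sub, hw', sg_zero, one_smul] at h2
  refine ⟨(1 / 2 : ℂ) • (w + hsgn w), ?_, ?_, ?_⟩
  · refine Submodule.smul_mem _ _ (add_mem hw (mem_omForm_iff.2 ?_))
    have := hsgnPow_dil 1 w
    rw [hsgnPow_one_apply, hsgnPow_one_apply] at this
    rw [← this, mem_omForm_iff.1 hw, map_smul]
  · rw [map_smul, map_add, hsgn_hsgn, add_comm]
  · refine (Submodule.Quotient.eq _).2 ?_
    have e : (1 / 2 : ℂ) • (w + hsgn w) - w = (1 / 2 : ℂ) • ((w' - w) - (w' - hsgn w)) := by module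
    rw [e]
    exact Submodule.smul_mem _ _ (sub_mem h1 h2)

lemma tc_one_of_mem_omForm {f : OmegaHat V} (hf : f ∈ omForm V 2) : tc 1 f = 0 := by
  obtain ⟨u, hu⟩ := gr_one_eq (tc_mem 1 f)
  have h := congrArg (tc 1) (mem_omForm_iff.1 hf)
  rw [tc_hmap, map_smul, hu] at h
  have h1 : ι ℂ (dilL V u) = ι ℂ ((2 : ℂ) ^ 2 • u) := by
    rw [map_smul, ← h]; simp [tmap]
  have h2 := ι_inj h1
  have a1 : fstL u = (2 : ℂ) ^ 2 • fstL u := by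
    have := congrArg fstL h2
    rw [map_smul, dilL_apply, map_add, map_smul] at this
    change fstL u + (2 : ℂ) • (0 : V) = _ at this
    rwa [smul_zero, add_zero] at this
  have a2 : (2 : ℂ) • sndL u = (2 : ℂ) ^ 2 • sndL u := by
    have := congrArg sndL h2
    rw [map_smul, dilL_apply, map_add, map_smul] at this
    change (0 : V) + (2 : ℂ) • sndL u = _ at this
    rwa [zero_add] at this
  have b1 : fstL u = 0 := by
    have : (3 : ℂ) • fstL u = 0 := by
      have := sub_eq_zero.2 a1.symm
      rw [← this]; module
    exact (smul_eq_zero.1 this).resolve_left (by norm_num)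
  have b2 : sndL u = 0 := by
    have : (2 : ℂ) • sndL u = 0 := by
      have := sub_eq_zero.2 a2.symm
      rw [← this]; module
    exact (smul_eq_zero.1 this).resolve_left (by norm_num)
  rw [hu, formGen_eq u, b1, b2, map_zero, map_zero, add_zero, map_zero]

lemma mem_ordSub_of_mem_omForm {f : OmegaHat V} (hf : f ∈ omForm V 2) : f ∈ ordSub (FormGen V) 2 :=
  mem_ordSub.2 fun i hi => by
    interval_cases i
    · exact tc_zero_of_mem_omForm two_ne_zero hf
    · exact tc_one_of_mem_omForm hf

/-- The pairing of `x ⊗ y` with a tensor, as a bilinear form in `x` and `y`. -/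
def pairL (t : V ⊗[ℂ] V) : Module.Dual ℂ V →ₗ[ℂ] Module.Dual ℂ V →ₗ[ℂ] ℂ :=
  (TensorProduct.mk ℂ _ _).compr₂ (LinearMap.applyₗ t ∘ₗ TensorProduct.dualDistrib ℂ V V)

lemma pairL_apply (t : V ⊗[ℂ] V) (x y : Module.Dual ℂ V) :
    pairL t x y = TensorProduct.dualDistrib ℂ V V (x ⊗ₜ y) t := rfl

lemma pairL_tmul (a c : V) (x y : Module.Dual ℂ V) : pairL (a ⊗ₜ[ℂ] c) x y = x a * y c := by
  rw [pairL_apply, TensorProduct.dualDistrib_apply]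

lemma pairL_add (t t' : V ⊗[ℂ] V) (x y : Module.Dual ℂ V) :
    pairL (t + t') x y = pairL t x y + pairL t' x y := by simp only [pairL_apply, map_add]

lemma pairL_map (f g : V →ₗ[ℂ] V) (t : V ⊗[ℂ] V) (x y : Module.Dual ℂ V) :
    pairL (TensorProduct.map f g t) x y = pairL t (x ∘ₗ f) (y ∘ₗ g) := by
  induction t with
  | zero => simp [pairL_apply]
  | tmul a c => rw [TensorProduct.map_tmul, pairL_tmul, pairL_tmul]; rfl
  | add s t hs ht => rw [map_add, pairL_add, pairL_add, hs, ht]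

variable (V) in
/-- The parity involution of the dual space. -/
def dualInv : Module.Dual ℂ V →ₗ[ℂ] Module.Dual ℂ V := (sinv : V →ₗ[ℂ] V).dualMap

lemma dualInv_apply (x : Module.Dual ℂ V) (v : V) : dualInv V x v = x (sinv v) := rfl

lemma dualInv_dualInv (x : Module.Dual ℂ V) : dualInv V (dualInv V x) = x :=
  LinearMap.ext fun v => by rw [dualInv_apply, dualInv_apply]; exact congrArg x (SuperSpace.inv_inv v)

/-- The bilinear form on the dual space of a form of order zero. -/
def symForm (t : V ⊗[ℂ] V) : Module.Dual ℂ V →ₗ[ℂ] Module.Dual ℂ V →ₗ[ℂ] ℂ :=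
  pairL t - (pairL t).flip ∘ₗ dualInv V

lemma symForm_apply (t : V ⊗[ℂ] V) (x y : Module.Dual ℂ V) :
    symForm t x y = pairL t x y - pairL t y (dualInv V x) := rfl

lemma tc_one_iV_nu {q : ZMod 2} (ξ : VField V q) (x : Module.Dual ℂ V)
    (hx : ∀ v, tc 0 (ξ.toFun (tι v)) = algebraMap ℂ _ (x v)) (t : V ⊗[ℂ] V) :
    ∃ u, tc 1 (ξ.iV.toFun (temb (nu t))) = ι ℂ (dgen u) ∧ ∀ y : Module.Dual ℂ V,
      y u = pairL t x y + pairL t (y ∘ₗ sndL ∘ₗ spow (q + 1) ∘ₗ dgen) x := by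
  induction t with
  | zero => exact ⟨0, by simp, by simp [pairL_apply]⟩
  | add s t hs ht =>
    obtain ⟨u, hu, hu'⟩ := hs
    obtain ⟨v, hv, hv'⟩ := ht
    refine ⟨u + v, by simp only [map_add, hu, hv], fun y => ?_⟩
    rw [map_add, hu', hv', pairL_add, pairL_add]; ring
  | tmul a c =>
    have e0 : ∀ v, tc 0 (fn (ξ.toFun (tι v))) = algebraMap ℂ _ (x v) := fun v => by
      rw [fn_apply, tc_hmap, hx, AlgHom.commutes]
    have e1 : ∀ v : V, ξ.iV.toFun (tι (dgen v)) = fn (ξ.toFun (tι v)) := fun v => ξ.iV_tι _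
    have e2 : ∀ v : V, spow (q + 1) (dgen v) = dgen (sndL (spow (q + 1) (dgen v))) := fun v => by
      rcases zmod2_cases (q + 1) with h | h
      · rw [h, spow_zero_eq]; rfl
      · rw [h, spow_one_eq, sinv_dgen, ← map_neg]; rfl
    refine ⟨x a • c + x c • sndL (spow (q + 1) (dgen a)), ?_, fun y => ?_⟩
    · rw [nu_tmul, map_mul, temb_ι, temb_ι, ξ.iV.leibniz, e1, e1, hsgnPow_tι, map_add, tc_mul_tι,
        tc_tι_mul, e0, e0, e2 a]
      simp only [map_add, map_smul, Algebra.algebraMap_eq_smul_one, smul_mul_assoc, mul_smul_comm, one_mul,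
        mul_one]
      rfl
    · rw [map_add, map_smul, map_smul, pairL_tmul, pairL_tmul, smul_eq_mul, smul_eq_mul,
        mul_comm (x c)]
      rfl

/-- The bilinear form of the order zero part of a symplectic form. -/
lemma IsEvenSymplectic.superSymp {ω : DR V} (hω : IsEvenSymplectic ω) {w : OmegaHat V}
    (hw : w ∈ omForm V 2) (hwω : (hComm (FormGen V)).mkQ w = ω) {t : V ⊗[ℂ] V} (ht : nu t = tc 2 w)
    (hte : TensorProduct.map sinv sinv t = t) : IsSuperSymp (dualInv V) (symForm t) := by
  have even : ∀ x y, pairL t (dualInv V x) (dualInv V y) = pairL t x y := fun x y => by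
    conv_rhs => rw [← hte, pairL_map]
    rfl
  refine ⟨dualInv_dualInv, fun x y => ?_, fun x y => ?_, fun y hy => LinearMap.ext fun v => ?_⟩
  · rw [symForm_apply, symForm_apply, even, even]
  · rw [symForm_apply, symForm_apply, even]; ring
  · have key : ∀ (q : ZMod 2) (v : V), sinv v = sg q • v → y v = 0 := fun q v hv => by
      have hα : (hComm (FormGen V)).mkQ (tι (dgen v)) ∈ drForm V 1 ⊓ drPar V (q + 1) := by
        refine ⟨⟨_, tι_dgen_mem v, rfl⟩, mem_drPar.2 ⟨_, ?_, rfl⟩⟩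
        have e : hsgn (tι (dgen v)) = tι (sinv (dgen v)) := hmap_tι _ _
        rw [e, sinv_dgen, hv, sg_add, sg_one, mul_neg, mul_one, neg_smul]
        simp only [map_neg, map_smul]
      obtain ⟨ξ, hξ, -⟩ := hω.nondeg q _ hα
      rw [← hwω, VField.contract_mkQ] at hξ
      have h1 : tc 1 (ξ.iV.toFun w - tι (dgen v)) ∈ sComm (FormGen V) :=
        mem_hComm.1 ((Submodule.Quotient.eq _).1 hξ) 1
      have h2 : tc 1 (ξ.iV.toFun w) = tc 1 (ξ.iV.toFun (temb (nu t))) := by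
        have := mem_ordSub.1 (ξ.iV.ord (sub_temb_mem (mem_ordSub_of_mem_omForm hw))) 1 (by norm_num)
        rw [map_sub, map_sub, sub_eq_zero] at this
        rw [this, ht]
      have hx0 : ∀ v, ∃ r : ℂ, tc 0 (ξ.toFun (tι v)) = algebraMap ℂ _ r :=
        fun v => gr_zero_eq (tc_mem 0 _)
      let x : Module.Dual ℂ V := (algebraMapInv (R := ℂ) (M := V)).toLinearMap ∘ₗ tc 0 ∘ₗ ξ.toFun ∘ₗ tι
      have hx : ∀ v, tc 0 (ξ.toFun (tι v)) = algebraMap ℂ _ (x v) := fun v => by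
        obtain ⟨r, hr⟩ := hx0 v
        have : x v = algebraMapInv (R := ℂ) (M := V) (tc 0 (ξ.toFun (tι v))) := rfl
        rw [this, hr, algebraMap_leftInverse]
      have hxs : dualInv V x = sg q • x := by
        refine LinearMap.ext fun v => ?_
        have e := congrArg (tc 0) (ξ.parity (tι v))
        have e' : hsgn (tι v) = tι (sinv v) := hmap_tι _ _
        rw [tc_hmap, e', map_smul, hx, hx, AlgHom.commutes, Algebra.smul_def, ← map_mul] at e
        have e2 := algebraMap_leftInverse (R := ℂ) V |>.injective e
        rw [dualInv_apply, LinearMap.smul_apply, e2, smul_eq_mul, ← mul_assoc, sg_sq, one_mul]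
      obtain ⟨u, hu, hu'⟩ := tc_one_iV_nu ξ x hx t
      rw [map_sub, h2, hu, tc_tι, if_pos rfl, ← map_sub, ← map_sub] at h1
      have h3 : u - v = 0 := congrArg sndL (ι_mem_sComm h1)
      rw [← sub_eq_zero.1 h3, hu']
      have h4 : pairL t (y ∘ₗ sndL ∘ₗ spow (q + 1) ∘ₗ dgen) x = -pairL t y (dualInv V x) := by
        rcases zmod2_cases q with rfl | rfl
        · have e : y ∘ₗ sndL ∘ₗ spow (0 + 1) ∘ₗ dgen = -dualInv V y := LinearMap.ext fun v => by
            rw [zero_add, spow_one_eq, LinearMap.comp_apply, LinearMap.comp_apply, LinearMap.comp_apply,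
              sinv_dgen, ← map_neg dgen]
            change y (-sinv v) = -y (sinv v)
            rw [map_neg]
          rw [e, map_neg, LinearMap.neg_apply, ← even y (dualInv V x), dualInv_dualInv]
        · have e : y ∘ₗ sndL ∘ₗ spow (1 + 1) ∘ₗ dgen = y := LinearMap.ext fun v => by
            rw [CharTwo.add_self_eq_zero, spow_zero_eq]; rfl
          rw [e, hxs, sg_one, map_smul, neg_one_smul, neg_neg]
      rw [h4, ← sub_eq_add_neg]
      exact hy x
    have hv : v = (1 / 2 : ℂ) • (v + sinv v) + (1 / 2 : ℂ) • (v - sinv v) := by module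
    have hi : sinv (sinv v) = v := SuperSpace.inv_inv v
    rw [hv, map_add, map_smul, map_smul, key 0 (v + sinv v), key 1 (v - sinv v)]
    · simp
    · rw [map_sub, hi, sg_one]; module
    · rw [map_add, hi, sg_zero]; module

end TwoForms

section LinearDarboux

variable {V W : Type*} [AddCommGroup V] [Module ℂ V] [SuperSpace V]
  [AddCommGroup W] [Module ℂ W] [SuperSpace W] {n m : ℕ}

/-- The signed exchange of the factors of an even tensor. -/
def twist : V ⊗[ℂ] V →ₗ[ℂ] V ⊗[ℂ] V :=
  TensorProduct.map LinearMap.id sinv ∘ₗ (TensorProduct.comm ℂ V V).toLinearMap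

lemma twist_tmul (a c : V) : twist (a ⊗ₜ[ℂ] c) = c ⊗ₜ sinv a := rfl

lemma nu_add_twist_hom {p q : ZMod 2} {a c : V} (ha : sinv a = sg p • a) (hc : sinv c = sg q • c) :
    nu (a ⊗ₜ[ℂ] c + sinv a ⊗ₜ sinv c) + nu (twist (a ⊗ₜ[ℂ] c + sinv a ⊗ₜ sinv c)) ∈
      sComm (FormGen V) := by
  have e : ∀ {p : ZMod 2} {a : V}, sinv a = sg p • a →
      tsgn (ι ℂ (dgen a)) = sg (p + 1) • ι ℂ (dgen a) := fun {p a} ha => by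
    rw [show tsgn (ι ℂ (dgen a)) = ι ℂ (sinv (dgen a)) by simp [tmap], sinv_dgen, ha, sg_add, sg_one]
    simp
  rw [map_add twist, twist_tmul, twist_tmul, ha, hc]
  simp only [TensorProduct.tmul_smul, map_smul, map_add, nu_tmul, smul_smul,
    ← TensorProduct.smul_tmul', ha, sg_sq]
  by_cases h : p = q
  · subst h
    have := Submodule.smul_mem (sComm (FormGen V)) 2
      (Submodule.subset_span ⟨p + 1, p + 1, _, _, e ha, e hc, rfl⟩)
    convert this using 1
    have s : sg ((p + 1) * (p + 1)) = -sg p := by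
      rcases zmod2_cases p with rfl | rfl <;> simp [sg_zero, sg_one, CharTwo.add_self_eq_zero]
    rw [s]
    simp only [sg_sq]
    module
  · have s : sg q = -sg p := by
      rcases zmod2_cases p with rfl | rfl <;> rcases zmod2_cases q with rfl | rfl <;>
        simp_all [sg_zero, sg_one]
    rw [s]
    simp only [mul_neg, neg_mul, sg_sq]
    convert zero_mem (sComm (FormGen V)) using 1
    module

lemma nu_add_twist_mem (t : V ⊗[ℂ] V) :
    nu (t + TensorProduct.map sinv sinv t) + nu (twist (t + TensorProduct.map sinv sinv t)) ∈
      sComm (FormGen V) := by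
  let L : V ⊗[ℂ] V →ₗ[ℂ] TensorAlgebra ℂ (FormGen V) :=
    (nu + nu ∘ₗ twist) ∘ₗ (LinearMap.id + TensorProduct.map sinv sinv)
  change L t ∈ sComm (FormGen V)
  induction t with
  | zero => rw [map_zero]; exact zero_mem _
  | add s t hs ht => rw [map_add]; exact add_mem hs ht
  | tmul a c =>
    have dec : ∀ v : V, ∃ v0 v1 : V, v = v0 + v1 ∧ sinv v0 = sg 0 • v0 ∧ sinv v1 = sg 1 • v1 := fun v => by
      have hi : sinv (sinv v) = v := SuperSpace.inv_inv v
      refine ⟨(1 / 2 : ℂ) • (v + sinv v), (1 / 2 : ℂ) • (v - sinv v), by module, ?_, ?_⟩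
      · rw [map_smul, map_add, hi, sg_zero]; module
      · rw [map_smul, map_sub, hi, sg_one]; module
    obtain ⟨a0, a1, rfl, ha0, ha1⟩ := dec a
    obtain ⟨c0, c1, rfl, hc0, hc1⟩ := dec c
    simp only [TensorProduct.add_tmul, TensorProduct.tmul_add, map_add L]
    exact add_mem (add_mem (nu_add_twist_hom ha0 hc0) (nu_add_twist_hom ha1 hc0))
      (add_mem (nu_add_twist_hom ha0 hc1) (nu_add_twist_hom ha1 hc1))

lemma pairL_twist (t : V ⊗[ℂ] V) (x y : Module.Dual ℂ V) :
    pairL (twist t) x y = pairL t (dualInv V y) x := by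
  induction t with
  | zero => simp [pairL_apply]
  | add s t hs ht => rw [map_add, pairL_add, pairL_add, hs, ht]
  | tmul a c => rw [twist_tmul, pairL_tmul, pairL_tmul, mul_comm]; rfl

lemma pairL_map_map (φ : V →ₗ[ℂ] W) (t : V ⊗[ℂ] V) (x y : Module.Dual ℂ W) :
    pairL (TensorProduct.map φ φ t) x y = pairL t (x ∘ₗ φ) (y ∘ₗ φ) := by
  induction t with
  | zero => simp [pairL_apply]
  | add s t hs ht => rw [map_add, pairL_add, pairL_add, hs, ht]
  | tmul a c => rfl

/-- The coordinates on the canonical superspace. -/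
def stdC (i : SI n m) : Module.Dual ℂ (Std n m) where
  toFun v := v i
  map_add' _ _ := rfl
  map_smul' _ _ := rfl

lemma tensor_eq_sum (t : Std n m ⊗[ℂ] Std n m) :
    t = ∑ i, ∑ j, pairL t (stdC i) (stdC j) • (stdB i ⊗ₜ[ℂ] stdB j) := by
  induction t with
  | zero => simp [pairL_apply]
  | add s t hs ht =>
    simp only [pairL_add, add_smul, Finset.sum_add_distrib, ← hs, ← ht]
  | tmul a c =>
    conv_lhs => rw [std_sum a, std_sum c]
    simp only [TensorProduct.sum_tmul, TensorProduct.tmul_sum, TensorProduct.smul_tmul_smul, pairL_tmul]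
    rw [Finset.sum_comm]
    rfl

lemma nu_mem_of_symForm {t : Std n m ⊗[ℂ] Std n m} (he : TensorProduct.map sinv sinv t = t)
    (h : symForm t = 0) : nu t ∈ sComm (FormGen (Std n m)) := by
  have e : twist t = t := by
    rw [tensor_eq_sum (twist t)]
    conv_rhs => rw [tensor_eq_sum t]
    refine Finset.sum_congr rfl fun i _ => Finset.sum_congr rfl fun j _ => ?_
    congr 1
    have h1 := LinearMap.congr_fun₂ h (stdC i) (stdC j)
    rw [symForm_apply, LinearMap.zero_apply, LinearMap.zero_apply, sub_eq_zero] at h1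
    rw [pairL_twist, h1]
    conv_lhs => rw [← he, pairL_map]
    change pairL t (dualInv _ (dualInv _ (stdC j))) _ = _
    rw [dualInv_dualInv]
    rfl
  have := Submodule.smul_mem _ (1 / 4 : ℂ) (nu_add_twist_mem t)
  rw [he, map_add twist, e] at this
  convert this using 1
  rw [map_add]
  module

variable (n m) in
/-- The canonical symplectic form as a tensor. -/
def stdTen : Std n m ⊗[ℂ] Std n m := (1 / 2 : ℂ) • ∑ a, sg (spar a) • (stdB a ⊗ₜ[ℂ] shp a)

lemma temb_nu_stdTen : temb (nu (stdTen n m)) = omD (stdAlpha n m) := by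
  rw [omD_stdAlpha, stdTen]
  simp only [map_smul, map_sum, nu_tmul, map_mul, temb_ι]

lemma stdTen_even : TensorProduct.map sinv sinv (stdTen n m) = stdTen n m := by
  rw [stdTen]
  simp only [map_smul, map_sum, TensorProduct.map_tmul, sinv_stdB, sinv_shp, TensorProduct.smul_tmul_smul,
    sg_sq, one_smul]

lemma sg_smul_shp (a : SI n m) :
    sg (spar a) • shp a = ∑ j, pr (stdLetter n m a) (stdLetter n m j) • (stdB j : Std n m) := by
  rcases a with a | a | a <;>
    simp [spar, shp, stdLetter, pr, par, sg_zero, sg_one, Fintype.sum_sum_type, ite_smul, ← Fin.ext_iff]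

/-- The values of a linear form on the canonical basis. -/
def stdVal (x : Module.Dual ℂ (Std n m)) : Std n m := fun i => x (stdB i)

lemma symForm_stdTen (x y : Module.Dual ℂ (Std n m)) :
    symForm (stdTen n m) x y =
      prV (stdVal x) (stdVal y) := by
  have e1 : ∀ x y : Module.Dual ℂ (Std n m), pairL (stdTen n m) x y =
      (1 / 2 : ℂ) * ∑ a, sg (spar a) * (x (stdB a) * y (shp a)) := fun x y => by
    rw [pairL_apply, stdTen]
    simp only [map_smul, map_sum, smul_eq_mul]
    rfl
  have e2 := swap_sum sg (LinearMap.mul ℂ ℂ |>.compl₁₂ x y)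
  simp only [LinearMap.compl₁₂_apply, LinearMap.mul_apply', smul_eq_mul, sg_sq, one_mul] at e2
  have e3 : ∑ a, sg (spar a) * (y (stdB a) * (dualInv _ x) (shp a)) =
      ∑ a, x (shp a) * y (stdB a) := Finset.sum_congr rfl fun a _ => by
    rw [dualInv_apply, sinv_shp, map_smul, smul_eq_mul, mul_left_comm (y _), ← mul_assoc, sg_sq, one_mul,
      mul_comm]
  rw [symForm_apply, e1, e1, e3, e2, prV_apply]
  have e4 : ∀ a : SI n m, sg (spar a) * (x (stdB a) * y (shp a)) =
      ∑ j, x (stdB a) * y (stdB j) * pr (stdLetter n m a) (stdLetter n m j) := fun a => by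
    rw [mul_left_comm, ← smul_eq_mul (sg _), ← map_smul, sg_smul_shp, map_sum, Finset.mul_sum]
    refine Finset.sum_congr rfl fun j _ => ?_
    rw [map_smul, smul_eq_mul]; ring
  simp only [e4, stdVal]
  ring

/-- The generators of forms under a linear map. -/
def formMap (φ : V →ₗ[ℂ] W) : FormGen V →ₗ[ℂ] FormGen W := gen ∘ₗ φ ∘ₗ fstL + dgen ∘ₗ φ ∘ₗ sndL

lemma pO_ofLinear (φ : V →ₗ[ℂ] W) (hφ : ∀ v, φ (sinv v) = sinv (φ v)) (f : OmegaHat V) :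
    (FMorph.ofLinear φ hφ).pO.toAlgHom f = hmap (formMap φ) f := by
  refine hom_unique (FMorph.cont _) (hmap_cont _) (fun x => ?_) f
  rw [FMorph.pO_tι, FMorph.ofLinear_apply, FMorph.ofLinear_apply, hmap_tι, hmap_tι, hmap_tι, fn_tι,
    omD_fn_tι, ← map_add]
  rfl

lemma tmap_formMap_nu (φ : V →ₗ[ℂ] W) (t : V ⊗[ℂ] V) :
    tmap (formMap φ) (nu t) = nu (TensorProduct.map φ φ t) := by
  have e : ∀ v : V, tmap (formMap φ) (ι ℂ (dgen v)) = ι ℂ (dgen (φ v)) := fun v => by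
    have : formMap φ (dgen v) = dgen (φ v) := by
      change gen (φ 0) + dgen (φ v) = _
      rw [map_zero, map_zero, zero_add]
    simp [tmap, this]
  induction t with
  | zero => simp
  | add s t hs ht => simp only [map_add, hs, ht]
  | tmul a c => rw [TensorProduct.map_tmul, nu_tmul, nu_tmul, map_mul, e, e]

/-- Linear Darboux theorem for the order zero part of a symplectic form. -/
lemma IsEvenSymplectic.exists_linear [FiniteDimensional ℂ V] {ω : DR V} (hω : IsEvenSymplectic ω)
    {w : OmegaHat V} (hw : w ∈ omForm V 2) (hs : hsgn w = w) (hwω : (hComm (FormGen V)).mkQ w = ω) :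
    ∃ (n m : ℕ) (φ : V ≃ₗ[ℂ] Std n m) (_ : ∀ v, φ (sinv v) = sinv (φ v)),
      tmap (formMap φ.toLinearMap) (tc 2 w) - tc 2 (omD (stdAlpha n m)) ∈
        sComm (FormGen (Std n m)) := by
  have hw2 : tc 2 w ∈ tForm V 2 := (Submodule.mem_iInf _).1 hw 2
  obtain ⟨t, ht, hte⟩ := exists_nu_even (tc_mem 2 w) hw2 (by rw [← tc_hmap, hs])
  obtain ⟨n, m, F, hF, hb⟩ := (hω.superSymp hw hwω ht hte).exists_frame
  let φ₀ : V →ₗ[ℂ] Std n m :=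
    { toFun := fun v i => F i v
      map_add' := fun v w => funext fun i => map_add _ _ _
      map_smul' := fun c v => funext fun i => map_smul _ _ _ }
  have hcomb : ∀ x : Module.Dual ℂ (Std n m), x ∘ₗ φ₀ = comb F (stdVal x) := fun x =>
    LinearMap.ext fun v => by
      rw [comb_apply, LinearMap.comp_apply, std_sum (φ₀ v), map_sum, LinearMap.sum_apply]
      refine Finset.sum_congr rfl fun i _ => ?_
      rw [map_smul, smul_eq_mul, mul_comm]; rfl
  have hinj : Function.Injective φ₀ := (injective_iff_map_eq_zero _).2 fun v hv => by
    refine (Module.forall_dual_apply_eq_zero_iff ℂ v).1 fun x => ?_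
    obtain ⟨u, rfl⟩ := hb.2 x
    rw [comb_apply, LinearMap.sum_apply]
    refine Finset.sum_eq_zero fun i _ => ?_
    rw [LinearMap.smul_apply, show F i v = 0 from congrFun hv i, smul_zero]
  have hdim : Module.finrank ℂ V = Module.finrank ℂ (Std n m) := by
    rw [← Subspace.dual_finrank_eq]
    exact (LinearEquiv.ofBijective _ hb).finrank_eq.symm
  have hφ : ∀ v, φ₀ (sinv v) = sinv (φ₀ v) := fun v => funext fun i =>
    LinearMap.congr_fun (hF.par i) v
  refine ⟨n, m, LinearEquiv.ofInjectiveOfFinrankEq φ₀ hinj hdim, hφ, ?_⟩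
  have e : (LinearEquiv.ofInjectiveOfFinrankEq φ₀ hinj hdim).toLinearMap = φ₀ := rfl
  rw [e, ← ht, tmap_formMap_nu, ← temb_nu_stdTen, tc_temb (nu_gr _), if_pos rfl, ← map_sub]
  refine nu_mem_of_symForm ?_ ?_
  · rw [map_sub, stdTen_even]
    congr 1
    conv_rhs => rw [← hte]
    rw [← LinearMap.comp_apply, ← LinearMap.comp_apply, ← TensorProduct.map_comp, ← TensorProduct.map_comp]
    congr 2 <;> exact LinearMap.ext fun v => (hφ v).symm
  · refine LinearMap.ext fun x => LinearMap.ext fun y => ?_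
    have e1 : symForm (TensorProduct.map φ₀ φ₀ t - stdTen n m) x y =
        symForm t (x ∘ₗ φ₀) (y ∘ₗ φ₀) - symForm (stdTen n m) x y := by
      have e2 : (dualInv _ x) ∘ₗ φ₀ = dualInv V (x ∘ₗ φ₀) := LinearMap.ext fun v =>
        congrArg x (hφ v).symm
      have e3 : ∀ x y, pairL (TensorProduct.map φ₀ φ₀ t - stdTen n m) x y =
          pairL (TensorProduct.map φ₀ φ₀ t) x y - pairL (stdTen n m) x y := fun x y => by
        simp only [pairL_apply, map_sub]
      rw [symForm_apply, symForm_apply, symForm_apply, e3, e3, pairL_map_map, pairL_map_map, e2]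
      ring
    rw [e1, symForm_stdTen, hcomb, hcomb]
    set X := stdVal x
    set Y := stdVal y
    have e5 : symForm t (comb F X) (comb F Y) = prV X Y := by
      rw [comb_apply F X, map_sum, LinearMap.sum_apply]
      conv_rhs => rw [std_sum X, map_sum, LinearMap.sum_apply]
      refine Finset.sum_congr rfl fun i _ => ?_
      rw [map_smul, map_smul, LinearMap.smul_apply, LinearMap.smul_apply, hF.pair_comb]
    rw [e5, sub_self]
    rfl

end LinearDarboux

section DarbouxForms

variable {V : Type*} [AddCommGroup V] [Module ℂ V] [SuperSpace V] {n m : ℕ}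

lemma tc_omD_stdAlpha {k : ℕ} (hk : k ≠ 2) : tc k (omD (stdAlpha n m)) = 0 := by
  rw [← temb_nu_stdTen, tc_temb (nu_gr _), if_neg hk]

/-- A symplectic form of order zero has a linear Darboux frame. -/
theorem IsEvenSymplectic.exists_frame [FiniteDimensional ℂ V] {ω : DR V} (hω : IsEvenSymplectic ω)
    (h0 : ω ∈ drOrd V 2 0) : ∃ (n m : ℕ) (φ : V ≃ₗ[ℂ] Std n m) (hφ : ∀ v, φ (sinv v) = sinv (φ v)),
      (FMorph.ofLinear φ.toLinearMap hφ).pull ω = stdOmega n m := by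
  obtain ⟨w, hw, hs, hwω⟩ := exists_rep hω.form hω.even
  obtain ⟨n, m, φ, hφ, h⟩ := hω.exists_linear hw hs hwω
  refine ⟨n, m, φ, hφ, ?_⟩
  obtain ⟨w0, ⟨-, hw0⟩, rfl⟩ := h0
  have hw0' : ∀ k, k ≠ 2 → tc k w0 = 0 := fun k hk => by
    have := (Submodule.mem_iInf _).1 ((Submodule.mem_iInf _).1 hw0 k) (by simpa using hk)
    exact this
  have e : (hComm (FormGen V)).mkQ (temb (tc 2 w)) = (hComm (FormGen V)).mkQ w0 := by
    refine (Submodule.Quotient.eq _).2 (mem_hComm.2 fun k => ?_)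
    rw [map_sub, tc_temb (tc_mem 2 w)]
    split_ifs with hk
    · subst hk
      rw [← map_sub]
      exact mem_hComm.1 ((Submodule.Quotient.eq _).1 hwω) 2
    · rw [hw0' k hk, sub_zero]; exact zero_mem _
  rw [← e, FMorph.pull_mkQ, pO_ofLinear, ← mkQ_omD_stdAlpha]
  refine (Submodule.Quotient.eq _).2 (mem_hComm.2 fun k => ?_)
  rw [map_sub, tc_hmap, tc_temb (tc_mem 2 w)]
  split_ifs with hk
  · subst hk; exact h
  · rw [tc_omD_stdAlpha hk, map_zero, sub_zero]; exact zero_mem _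

lemma strip_hom (l : List (Letter ⊕ Letter)) : strip l ∈ hom par (lpar parO l) := by
  induction l with
  | nil => exact wd_mem_hom par []
  | cons a l ih =>
    rcases a with a | a
    · rw [strip, lpar_cons]
      have := hom_mul (wd_mem_hom par [a]) ih
      rwa [lpar_cons, lpar_nil, add_zero] at this
    · exact zero_mem _

lemma pick_hom (l : List (Letter ⊕ Letter)) : pick l ∈ hom par (lpar parO l + 1) := by
  rcases l with _ | ⟨a | a, l⟩
  · exact zero_mem _
  · exact zero_mem _
  · rw [pick, lpar_cons]
    have := hom_mul (wd_mem_hom par [a]) (strip_hom l)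
    rw [lpar_cons, lpar_nil, add_zero] at this
    have h : par a + 1 + lpar parO l + 1 = par a + lpar parO l := by
      linear_combination CharTwo.add_self_eq_zero (1 : ZMod 2)
    rwa [show parO (Sum.inr a) = par a + 1 from rfl, h]

lemma cycNL_mem_hom {α : Type} (par : α → ZMod 2) {p : ZMod 2} {x : FA α} (hx : x ∈ hom par p) :
    cycNL par x ∈ hom par p := by
  refine hom_induction (P := fun x => cycNL par x ∈ hom par p) hx ?_ (fun l hl => ?_) (fun x y hx hy => ?_)
    fun c x hx => ?_
  · rw [map_zero]; exact zero_mem _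
  · rw [cycNL_word, ← hl]; exact cycN_hom _ _
  · rw [map_add]; exact add_mem hx hy
  · rw [map_smul]; exact Submodule.smul_mem _ _ hx

lemma kapW_hom {p : ZMod 2} {x : FA (Letter ⊕ Letter)} (hx : x ∈ hom parO p) :
    kapW x ∈ hom par (p + 1) := by
  refine hom_induction (P := fun x => linExt pick x ∈ hom par (p + 1)) (cycNL_mem_hom parO hx) ?_ (fun l hl => ?_)
    (fun x y hx hy => ?_) fun c x hx => ?_
  · rw [map_zero]; exact zero_mem _
  · rw [linExt_wd, ← hl]; exact pick_hom _
  · rw [map_add]; exact add_mem hx hy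
  · rw [map_smul]; exact Submodule.smul_mem _ _ hx

lemma kap_hom {p : ZMod 2} {f : OmegaHat (Std n m)} (hf : hsgn f = sg p • f) (k : ℕ) :
    kap k f ∈ hom par (p + 1) := by
  rw [kap_apply]
  exact kapW_hom (coordO_hom (tc_hsgn hf k))

lemma hsgn_ideg (f : That V) : hsgn (ideg f) = ideg (hsgn f) := That.ext' fun k => by
  rw [tc_hmap, tc_ideg, tc_ideg, tc_hmap, map_smul]

lemma lam_one (f : OmegaHat (Std n m)) : lam 1 f = 0 := by
  have := rotL_pow_len par (imW_le_lenSub _ _ (kap_imW 1 f))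
  rw [pow_one] at this
  rw [lam_apply, this, sub_self]

lemma lam_imW (k : ℕ) (f : OmegaHat (Std n m)) : lam k f ∈ imW (stdLetter n m) k := by
  rw [lam_apply]
  exact sub_mem (kap_imW k f) (rotL_imW _ (kap_imW k f))

/-- Darboux theorem: a closed even `2`-form with canonical constant part is the image of the canonical
symplectic form under an automorphism. -/
theorem exists_darboux_form {w : OmegaHat (Std n m)} (hw : w ∈ omForm (Std n m) 2) (hs : hsgn w = w)
    (hd : omD w ∈ hComm (FormGen (Std n m)))
    (h2 : tc 2 w - tc 2 (omD (stdAlpha n m)) ∈ sComm (FormGen (Std n m))) :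
    ∃ e : FIso (Std n m) (Std n m),
      e.hom.pull (stdOmega n m) = (hComm (FormGen (Std n m))).mkQ w := by
  have hp := poincare hd (tc_zero_of_mem_omForm two_ne_zero hw)
  set α : OmegaHat (Std n m) := ideg ((eulV (Std n m)).iV.toFun w) with hα
  have hα1 : α ∈ omForm (Std n m) 1 := ideg_mem_omForm (VField.iV_mem_omForm _ hw)
  have hαs : hsgn α = sg 1 • α := by
    rw [hα, hsgn_ideg, VField.parity, hs, map_smul]; rfl
  have hlh : ∀ k, lam k α ∈ hom par 0 := fun k => by
    have h1 := kap_hom hαs k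
    rw [CharTwo.add_self_eq_zero] at h1
    rw [lam_apply]
    exact sub_mem h1 (rotL_hom h1)
  have hl2 : lam 2 α = lam 2 (stdAlpha n m) := by
    have hf : temb (tc 2 α) ∈ omForm (Std n m) 1 := (Submodule.mem_iInf _).2 fun k => by
      rw [Submodule.mem_comap, tc_temb (tc_mem 2 α)]
      split_ifs with hk
      · exact (Submodule.mem_iInf _).1 hα1 2
      · exact zero_mem _
    have h3 := lam_of_omD hf stdAlpha_mem (mem_hComm.2 fun k => ?_) 2
    · rw [← h3, lam_apply, lam_apply, kap_apply, kap_apply, tc_temb (tc_mem 2 α), if_pos rfl]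
    · rw [map_sub, tc_omD, tc_temb (tc_mem 2 α)]
      split_ifs with hk
      · subst hk
        rw [← tc_omD]
        have := mem_hComm.1 hp 2
        rw [map_sub] at this
        have h4 := sub_mem h2 this
        rwa [sub_sub_sub_cancel_left] at h4
      · rw [map_zero, map_zero, map_zero, tc_omD_stdAlpha hk, sub_zero]; exact zero_mem _
  let M := ofCoord (fun k => -lam k α) fun k => neg_mem (lam_imW k α)
  have hM : ∀ k, coordT n m (tc k M) = -lam k α := fun k => coordT_ofCoord _ _ k
  obtain ⟨e, he⟩ := exists_darboux (M := M) (That.ext_coord fun k => by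
      rw [tc_hmap, coordT_tsgn, hM, sgnW_of_hom (neg_mem (hlh k)), sg_zero, one_smul]) (fun k => by
      rw [hM, map_neg, lam_apply, map_sub, cycNL_rotL, sub_self, neg_zero]) (mem_ordSub.2 fun k hk => by
      refine coordT_injective ?_
      rw [map_sub, map_sub, hM, map_zero]
      rcases (by omega : k = 0 ∨ k = 1 ∨ k = 2) with rfl | rfl | rfl
      · rw [Mhat_homogeneous (by norm_num), map_zero, lam_apply, kap_apply,
          tc_zero_of_mem_omForm one_ne_zero hα1]
        simp
      · rw [Mhat_homogeneous (by norm_num), map_zero, lam_one]; simp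
      · rw [hl2, lam_stdAlpha, neg_neg, sub_self])
  refine ⟨e, ?_⟩
  rw [(pull_stdOmega_iff e.hom hα1).2 fun k => by rw [he, hM]]
  exact ((Submodule.Quotient.eq _).2 hp).symm

/-- Darboux theorem for even symplectic forms. -/
theorem IsEvenSymplectic.exists_coordinates [FiniteDimensional ℂ V] {ω : DR V}
    (hω : IsEvenSymplectic ω) :
    ∃ (n m : ℕ) (e : FIso V (Std n m)), e.hom.pull ω = stdOmega n m := by
  obtain ⟨w, hw, hs, hwω⟩ := exists_rep hω.form hω.even
  obtain ⟨n, m, φ, hφ, h⟩ := hω.exists_linear hw hs hwω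
  set ψ := FIso.ofLinear φ hφ with hψ
  have hψw : ψ.hom.pO.toAlgHom w = hmap (formMap φ.toLinearMap) w := pO_ofLinear _ hφ w
  obtain ⟨e, he⟩ := exists_darboux_form (ψ.hom.pO_mem_omForm hw) (by rw [ψ.hom.pO.even, hs])
    (by
      rw [← FMorph.pO_omD]
      have hd : (hComm (FormGen V)).mkQ (omD w) = 0 := by
        rw [← drD_mkQ, hwω, hω.closed]
      have := congrArg ψ.hom.pull hd
      rw [map_zero, FMorph.pull_mkQ] at this
      exact (Submodule.Quotient.mk_eq_zero _).1 this)
    (by rw [hψw, tc_hmap]; exact h)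
  refine ⟨n, m, ψ.trans e.symm, ?_⟩
  change (e.inv.comp ψ.hom).pull ω = _
  rw [FMorph.pull_comp, ← hwω, FMorph.pull_mkQ, ← he, FIso.pull_inv_hom]

end DarbouxForms

section Transport

variable {V W : Type*} [AddCommGroup V] [Module ℂ V] [SuperSpace V]
  [AddCommGroup W] [Module ℂ W] [SuperSpace W] {p : ZMod 2}

lemma VField.ord_two {ξ : VField V p} (h : ∀ v, ξ.toFun (tι v) ∈ ordSub V 2) (f : That V) :
    ξ.toFun f ∈ ordSub V 2 := by
  have key : ∀ x : TensorAlgebra ℂ V, ξ.toFun (temb x) ∈ ordSub V 2 := fun x => by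
    induction x using TensorAlgebra.induction with
    | algebraMap r =>
      rw [VField.eq_derHat, derHat_temb, derT_algebraMap]
      exact zero_mem _
    | ι v => rw [temb_ι]; exact h v
    | mul a b ha hb =>
      rw [map_mul, ξ.leibniz]
      have h1 := mul_mem_ordSub ha (mem_ordSub_zero (temb b))
      have h2 := mul_mem_ordSub (mem_ordSub_zero (SympAInf.hsgnPow p (temb a))) hb
      rw [add_zero] at h1
      rw [zero_add] at h2
      exact add_mem h1 h2
    | add a b ha hb => rw [map_add, map_add]; exact add_mem ha hb
  have h2 := add_mem (ξ.ord (sub_trunc_mem 3 f)) (key (trunc 3 f))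
  rwa [← map_add, sub_add_cancel] at h2

lemma VField.conj_ord (e : FIso V W) {ξ : VField V p} (h : ∀ v, ξ.toFun (tι v) ∈ ordSub V 2) (w : W) :
    (ξ.conj e).toFun (tι w) ∈ ordSub W 2 :=
  e.hom.ord (ξ.ord_two h _)

lemma VField.eq_conj (e : FIso V W) {ξ : VField V p} {η : VField W p}
    (h : ∀ f, e.hom.toAlgHom (ξ.toFun f) = η.toFun (e.hom.toAlgHom f)) : η = ξ.conj e :=
  VField.ext (LinearMap.ext fun f => by rw [VField.conj_apply, h, e.hom_inv])

lemma VField.inv_conj (e : FIso V W) (ξ : VField V p) (f : That W) :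
    e.inv.toAlgHom ((ξ.conj e).toFun f) = ξ.toFun (e.inv.toAlgHom f) := e.inv_hom _

lemma VField.conj_symm_conj (e : FIso V W) (η : VField W p) : (η.conj e.symm).conj e = η :=
  (VField.eq_conj e fun f => by
    rw [VField.conj_apply]
    exact (e.hom_inv _)).symm

lemma IsEvenSymplectic.pull {ω : DR V} (h : IsEvenSymplectic ω) (e : FIso V W) :
    IsEvenSymplectic (e.hom.pull ω) where
  form := e.hom.pull_mem_drForm h.form
  even := e.hom.pull_mem_drPar h.even
  closed := by rw [← FMorph.pull_drD, h.closed, map_zero]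
  nondeg p α hα := by
    obtain ⟨ξ, hξ, hu⟩ := h.nondeg p (e.inv.pull α)
      ⟨e.inv.pull_mem_drForm hα.1, e.inv.pull_mem_drPar hα.2⟩
    refine ⟨ξ.conj e, ?_, fun η hη => ?_⟩
    · change (ξ.conj e).contract _ = α
      rw [← FMorph.pull_contract e.hom ξ _ (ξ.conj_hom e)]
      exact (congrArg e.hom.pull hξ).trans (e.pull_hom_inv α)
    · rw [← hu (η.conj e.symm), VField.conj_symm_conj]
      change (η.conj e.symm).contract ω = _
      rw [← hη, FMorph.pull_contract e.inv η _ (η.conj_hom e.symm), e.pull_inv_hom]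

lemma symm_sinv (φ : V ≃ₗ[ℂ] W) (hφ : ∀ v, φ (sinv v) = sinv (φ v)) (w : W) :
    φ.symm (sinv w) = sinv (φ.symm w) :=
  φ.injective (by rw [hφ, φ.apply_symm_apply, φ.apply_symm_apply])

lemma pull_drFn (φ : FMorph V W) (f : That V) :
    φ.pull (drFn ((hComm V).mkQ f)) = drFn ((hComm W).mkQ (φ.toAlgHom f)) := by
  rw [drFn_mkQ, FMorph.pull_mkQ, FMorph.pO_fn, drFn_mkQ]

lemma pull_stdOmega_mem_drOrd {n m : ℕ} (φ : Std n m →ₗ[ℂ] V) (hφ : ∀ v, φ (sinv v) = sinv (φ v)) :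
    (FMorph.ofLinear φ hφ).pull (stdOmega n m) ∈ drOrd V 2 0 := by
  rw [← mkQ_omD_stdAlpha, FMorph.pull_mkQ]
  refine ⟨_, ⟨FMorph.pO_mem_omForm _ (omD_mem_omForm stdAlpha_mem), ?_⟩, rfl⟩
  refine (Submodule.mem_iInf _).2 fun k => (Submodule.mem_iInf _).2 fun hk => ?_
  rw [LinearMap.mem_ker, pO_ofLinear, tc_hmap, tc_omD_stdAlpha hk, map_zero]

end Transport

section AInf

instance (U : Type u) [AddCommGroup U] [Module ℂ U] [FiniteDimensional ℂ U] :
    FiniteDimensional ℂ (PiDual U) := inferInstanceAs (FiniteDimensional ℂ (Module.Dual ℂ U))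

namespace MinSympAInf

variable {A B C : MinSympAInf.{u}} {n m n' m' : ℕ}

lemma m_ord (A : MinSympAInf.{u}) (v : A.V) : A.m.toFun (tι v) ∈ ordSub A.V 2 :=
  mem_ordSub.2 fun i hi => by
    rcases (by omega : i = 0 ∨ i = 1) with rfl | rfl
    · exact A.m_zero v
    · exact A.m_min v

lemma conj_sq (A : MinSympAInf.{u}) {W : Type*} [AddCommGroup W] [Module ℂ W] [SuperSpace W]
    (e : FIso A.V W) (f : That W) : (A.m.conj e).toFun ((A.m.conj e).toFun f) = 0 := by
  rw [VField.conj_apply, VField.inv_conj, A.m_sq, map_zero]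

lemma conj_lie (A : MinSympAInf.{u}) {W : Type*} [AddCommGroup W] [Module ℂ W] [SuperSpace W]
    (e : FIso A.V W) : (A.m.conj e).lie (e.hom.pull A.ω) = 0 := by
  rw [← FMorph.pull_lie e.hom A.m _ (A.m.conj_hom e), A.m_symp, map_zero]

/-- The invertible morphism given by a frame. -/
def Frame.iso (F : Frame A n m) : FIso A.V (Std n m) := FIso.ofLinear F.φ F.even

lemma Frame.pull_iso (F : Frame A n m) : F.iso.hom.pull A.ω = stdOmega n m := F.symp

lemma IsHamiltonian.isHam {f : That A.V} (h : A.IsHamiltonian ((hComm A.V).mkQ f)) (F : Frame A n m)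
    {f' : That (Std n m)}
    (hf : (hComm (Std n m)).mkQ f' = pull0 F.φ.toLinearMap F.even ((hComm A.V).mkQ f)) :
    IsHam (A.m.conj F.iso) f' := by
  have e : F.iso.hom.pull (drFn ((hComm A.V).mkQ f)) = drFn ((hComm (Std n m)).mkQ f') := by
    rw [pull_drFn, hf, pull0_mkQ]
    rfl
  rw [IsHam, ← e, ← FMorph.pull_drD, h.1, FMorph.pull_contract F.iso.hom A.m _ (A.m.conj_hom _),
    F.pull_iso]

lemma IsCharClass.exists_isHam {c : CHat} (h : IsCharClass A c) :
    ∃ (n m : ℕ) (F : Frame A n m) (f : That (Std n m)), IsHam (A.m.conj F.iso) f ∧ c = expHam f := by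
  obtain ⟨h, n, m, F, f, hh, hf, rfl⟩ := h
  obtain ⟨g, rfl⟩ := (hComm A.V).mkQ_surjective h
  exact ⟨n, m, F, f, hh.isHam F hf, rfl⟩

lemma exists_isCharClass (hA : A.OrderZero) : ∃ c, IsCharClass A c := by
  obtain ⟨n, m, φ, hφ, hω⟩ := A.symp.exists_frame hA
  let F : Frame A n m := ⟨φ, hφ, hω⟩
  have hl := A.conj_lie F.iso
  rw [F.pull_iso] at hl
  obtain ⟨f, h0, hf⟩ := SympAInf.exists_isHam hl (by
    rw [← F.pull_iso, ← FMorph.pull_drD, A.symp.closed, map_zero])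
  refine ⟨_, (hComm A.V).mkQ (F.iso.inv.toAlgHom f), n, m, F, f, ⟨?_, _, ?_, rfl⟩, ?_, rfl⟩
  · rw [← pull_drFn, ← FMorph.pull_drD, show drD (drFn ((hComm _).mkQ f)) = _ from hf,
      FMorph.pull_contract F.iso.inv _ A.m (A.m.inv_conj F.iso), ← F.pull_iso, F.iso.pull_inv_hom]
  · refine mem_ordSub.1 (F.iso.inv.ord (k := 1) (mem_ordSub.2 fun i hi => ?_)) 0 one_pos
    rwa [Nat.lt_one_iff.1 hi]
  · rw [pull0_mkQ]
    exact congrArg _ (F.iso.hom_inv f).symm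

lemma IsCharClass.unique {c c' : CHat} (h : IsCharClass A c) (h' : IsCharClass A c') : c = c' := by
  obtain ⟨n, m, F, f, hf, rfl⟩ := h.exists_isHam
  obtain ⟨n', m', F', f', hf', rfl⟩ := h'.exists_isHam
  let g : Std n m ≃ₗ[ℂ] Std n' m' := F.φ.symm.trans F'.φ
  let θ := F.iso.symm.trans F'.iso
  have hθ : ∀ f, θ.hom.toAlgHom f = hmap g.toLinearMap f := fun f => hmap_comp _ _ _
  have hg : ∀ v, g (sinv v) = sinv (g v) := fun v => by
    change F'.φ (F.φ.symm (sinv v)) = _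
    rw [symm_sinv _ F.even, F'.even]
    rfl
  have hM : θ.hom.toAlgHom (Mhat n m) = Mhat n' m' := by
    rw [← pull_stdOmega_eq_iff]
    change (F'.iso.hom.comp F.iso.inv).pull _ = _
    rw [FMorph.pull_comp, ← F.pull_iso, F.iso.pull_inv_hom, F'.pull_iso]
  have h1 := hf.map (μ' := A.m.conj F'.iso) θ.hom hM fun f => by
    change F'.iso.hom.toAlgHom (F.iso.inv.toAlgHom _) = _
    rw [VField.inv_conj, VField.conj_hom]
    rfl
  rw [hf'.expHam_eq h1, hθ, expHam_hmap hg g.injective (by rw [← hθ, hM])]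

lemma IsCharClass.dHat_eq {c : CHat} (h : IsCharClass A c) : dHat c = 0 := by
  obtain ⟨n, m, F, f, hf, rfl⟩ := h.exists_isHam
  exact hf.dHat_expHam (fun v => A.conj_sq _ _) (VField.conj_ord _ A.m_ord)

lemma Iso.exists_fIso (h : Iso A B) : ∃ e : FIso A.V B.V, e.hom.pull A.ω = B.ω ∧ B.m = A.m.conj e := by
  obtain ⟨f, g, hfg, hgf⟩ := h
  let e : FIso A.V B.V := ⟨g.φ, f.φ, hfg, hgf⟩
  exact ⟨e, g.symp, VField.eq_conj e g.comm⟩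

lemma Iso.of_fIso (e : FIso A.V B.V) (hω : e.hom.pull A.ω = B.ω) (hm : B.m = A.m.conj e) :
    Iso A B :=
  ⟨⟨e.inv, fun f => by rw [hm, VField.inv_conj], by rw [← hω, e.pull_inv_hom]⟩,
    ⟨e.hom, fun f => by rw [hm, VField.conj_hom], hω⟩, e.inv_hom, e.hom_inv⟩

lemma Iso.refl (A : MinSympAInf.{u}) : Iso A A :=
  ⟨⟨FMorph.id A.V, fun _ => rfl, FMorph.pull_id _⟩, ⟨FMorph.id A.V, fun _ => rfl, FMorph.pull_id _⟩,
    fun _ => rfl, fun _ => rfl⟩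

lemma Iso.symm (h : Iso A B) : Iso B A := by
  obtain ⟨f, g, hfg, hgf⟩ := h
  exact ⟨g, f, hgf, hfg⟩

lemma Iso.trans (h : Iso A B) (h' : Iso B C) : Iso A C := by
  obtain ⟨e, hω, hm⟩ := h.exists_fIso
  obtain ⟨e', hω', hm'⟩ := h'.exists_fIso
  refine .of_fIso (e.trans e') ?_ ?_
  · change (e'.hom.comp e.hom).pull _ = _
    rw [FMorph.pull_comp, hω, hω']
  · rw [hm', hm]; rfl

lemma IsCharClass.homologous {c c' : CHat} (h : Iso A B) (hc : IsCharClass A c)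
    (hc' : IsCharClass B c') : ∃ b : CHat, c - c' = dHat b := by
  obtain ⟨n, m, F, f, hf, rfl⟩ := hc.exists_isHam
  obtain ⟨n', m', F', f', hf', rfl⟩ := hc'.exists_isHam
  obtain ⟨e, hω, hm⟩ := h.exists_fIso
  let θ := (F.iso.symm.trans e).trans F'.iso
  refine hf.iso (A.conj_sq _) (VField.conj_ord _ A.m_ord) θ ?_ ?_ hf'
  · rw [← pull_stdOmega_eq_iff]
    change (F'.iso.hom.comp (e.hom.comp F.iso.inv)).pull _ = _
    rw [FMorph.pull_comp, FMorph.pull_comp, ← F.pull_iso, F.iso.pull_inv_hom, hω, F'.pull_iso]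
  · refine VField.eq_conj θ fun f => ?_
    change F'.iso.hom.toAlgHom (e.hom.toAlgHom (F.iso.inv.toAlgHom _)) = _
    rw [VField.inv_conj, hm, VField.conj_hom, VField.conj_hom]
    rfl

/-- The transport of the structure along an automorphism. -/
def transport (A : MinSympAInf.{u}) (e : FIso A.V A.V) : MinSympAInf.{u} where
  U := A.U
  ω := e.hom.pull A.ω
  symp := A.symp.pull e
  m := A.m.conj e
  m_zero v := mem_ordSub.1 (VField.conj_ord e A.m_ord v) 0 two_pos
  m_min v := mem_ordSub.1 (VField.conj_ord e A.m_ord v) 1 one_lt_two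
  m_sq := A.conj_sq e
  m_symp := A.conj_lie e

/-- Every object is isomorphic to one with a symplectic form of order zero. -/
lemma exists_orderZero (A : MinSympAInf.{u}) : ∃ B : MinSympAInf.{u}, B.OrderZero ∧ Iso A B := by
  obtain ⟨n, m, e, he⟩ := A.symp.exists_coordinates
  let ρ := FIso.ofLinear e.linEquiv e.hom.lin_sinv
  refine ⟨A.transport (e.trans ρ.symm), ?_, .of_fIso (e.trans ρ.symm) rfl rfl⟩
  change (ρ.inv.comp e.hom).pull A.ω ∈ _
  rw [FMorph.pull_comp, he]
  exact pull_stdOmega_mem_drOrd _ (symm_sinv e.linEquiv e.hom.lin_sinv)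

/-- Homologous cycles have the same class. -/
lemma mk_eq_mk {c c' : CHat} (hc : c ∈ LinearMap.ker dHat) (hc' : c' ∈ LinearMap.ker dHat)
    (h : ∃ b, c - c' = dHat b) :
    (Submodule.Quotient.mk ⟨c, hc⟩ : HHat) = Submodule.Quotient.mk ⟨c', hc'⟩ := by
  obtain ⟨b, hb⟩ := h
  exact (Submodule.Quotient.eq _).2 ⟨b, hb.symm⟩

lemma exists_class (A : MinSympAInf.{u}) : ∃ x : HHat, ∀ B : MinSympAInf.{u}, B.OrderZero → Iso A B →
    ∀ c : CHat, IsCharClass B c → ∃ hc : c ∈ LinearMap.ker dHat, x = Submodule.Quotient.mk ⟨c, hc⟩ := by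
  obtain ⟨A', hA', h⟩ := A.exists_orderZero
  obtain ⟨c', hc'⟩ := exists_isCharClass hA'
  exact ⟨Submodule.Quotient.mk ⟨c', hc'.dHat_eq⟩, fun B hB hAB c hc => ⟨hc.dHat_eq,
    mk_eq_mk _ _ (hc'.homologous (h.symm.trans hAB) hc)⟩⟩

end MinSympAInf

end AInf

end SympAInf
end

theorem theorem6p8 :
    -- the characteristic class of an object of order zero is well defined
    (∀ A : MinSympAInf.{u}, A.OrderZero → ∃! c : CHat, IsCharClass A c) ∧
    -- it is a cycle
    (∀ A : MinSympAInf.{u}, A.OrderZero → ∀ c : CHat, IsCharClass A c → dHat c = 0) ∧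
    -- isomorphic objects give homologous cycles
    (∀ A B : MinSympAInf.{u}, A.OrderZero → B.OrderZero → Iso A B →
      ∀ c c' : CHat, IsCharClass A c → IsCharClass B c' → ∃ b : CHat, c - c' = dHat b) ∧
    -- the class extends uniquely to isomorphism classes of all objects, of any order
    ∃! F : Quot (Iso : MinSympAInf.{u} → MinSympAInf.{u} → Prop) → HHat,
      ∀ A : MinSympAInf.{u}, A.OrderZero → ∀ c : CHat, IsCharClass A c →
        ∃ hc : c ∈ LinearMap.ker dHat, F (Quot.mk _ A) = Submodule.Quotient.mk ⟨c, hc⟩ := by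
  have hrange : ∀ A : MinSympAInf.{u}, A.OrderZero → ∀ c : CHat, IsCharClass A c → dHat c = 0 :=
    fun A _ c hc => hc.dHat_eq
  refine ⟨fun A hA => ?_, hrange, fun A B _ _ h c c' hc hc' => hc.homologous h hc', ?_⟩
  · obtain ⟨c, hc⟩ := exists_isCharClass hA
    exact ⟨c, hc, fun c' hc' => hc'.unique hc⟩
  choose x hx using exists_class
  refine ⟨Quot.lift x fun A B h => ?_, fun A hA c hc => hx A A hA (.refl A) c hc, fun F hF => ?_⟩
  · obtain ⟨C, hC, hBC⟩ := B.exists_orderZero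
    obtain ⟨c, hc⟩ := exists_isCharClass hC
    obtain ⟨_, h1⟩ := hx A C hC (h.trans hBC) c hc
    obtain ⟨_, h2⟩ := hx B C hC hBC c hc
    rw [h1, h2]
  · funext q
    induction q using Quot.ind with | _ A
    obtain ⟨C, hC, hAC⟩ := A.exists_orderZero
    obtain ⟨c, hc⟩ := exists_isCharClass hC
    obtain ⟨_, h1⟩ := hF C hC c hc
    obtain ⟨_, h2⟩ := hx C C hC (.refl C) c hc
    rw [Quot.sound hAC, h1]
    exact h2.symm
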